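/- **Setting.** A signature $\mathbf R=\{R_1,\dots,R_k\}$ is a finite set of relation names of positive arity with $R_k$ the binary symbol $<$. $\mathrm{OrdStruct}[\mathbf R]$ is the class of finite $\mathbf R$-structures with nonempty domain in which $<$ is interpreted by a (strict) linear order. A structure $\mathfrak A$ with elements $a_1<\dots<a_n$ is encoded by the binary string $\mathrm{enc}(\mathfrak A)=0^n\,1\,\mathrm{enc}(R_1^{\mathfrak A})\cdots\mathrm{enc}(R_{k-1}^{\mathfrak A})$, where $\mathrm{enc}(R_i^{\mathfrak A})$ lists, in lexicographic order of the $\mathrm{arity}(R_i)$-tuples over the domain, a bit that tells whether the tuple belongs to $R_i^{\mathfrak A}$. **The logic.** $\Sigma_1[\mathrm{FO}]$ over $\mathbf R$ is the set of formulae $\exists x_1\cdots\exists x_m\,\psi$, $m\ge 0$, with $\psi$ a Boolean combination of atoms of the form $u=v$, $X(\bar u)$ with $X$ a second-order variable, or $\varphi(\bar u)$ with $\varphi$ an arbitrary first-order formula over $\mathbf R$ (in which no second-order variable occurs). The formulae of $\Sigma\mathrm{QSO}(\Sigma_1[\mathrm{FO}])$ over $\mathbf R$ are given by $$\alpha ::=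 \varphi \mid s \mid (\alpha+\alpha)\mid \Sigma x.\,\alpha\mid \Sigma X.\,\alpha ,$$ with $\varphi$ in $\Sigma_1[\mathrm{FO}]$, $s\in\mathbb N$, $x$ a first-order variable and $X$ a second-order variable. The value $[\![\alpha]\!](\mathfrak A,v,V)\in\mathbb N$ under a first-order assignment $v$ and a second-order assignment $V$ is $1$ or $0$ for a formula $\varphi$ according to whether $(\mathfrak A,v,V)\models\varphi$, is $s$ for a constant $s$, is additive for $+$, and is $\sum_{a\in A}[\![\alpha]\!](\mathfrak A,v[a/x],V)$ for $\Sigma x.\,\alpha$ and $\sum_{B\subseteq A^{\mathrm{arity}(X)}}[\![\alpha]\!](\mathfrak A,v,V[B/X])$ for $\Sigma X.\,\alpha$, where $A$ is the domain of $\mathfrak A$. A function $f:\mathrm{OrdStruct}[\mathbf R]\to\mathbb N$ belongs to $\Sigma\mathrm{QSO}(\Sigma_1[\mathrm{FO}])$ over $\mathbf R$ if it is $\mathfrak A\mapsto[\![\alpha]\!](\mathfrak A)$ for a sentence $\alpha$ (a formula without free variables). **Complexity.** $\mathrm{TotP}$ is the class of functions $F:\{0,1\}^*\to\mathbb N$ for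 which there is a polynomial-time nondeterministic Turing machine $M$ such that, for every $w$, $F(w)$ is the total number of runs of $M$ on $w$ minus one. A fully polynomial randomized approximation scheme (FPRAS) for $F:\{0,1\}^*\to\mathbb N$ is a randomized algorithm $\mathcal A$ with values in $\mathbb N$ such that, for all $w\in\{0,1\}^*$ and all real $\varepsilon\in(0,1)$, $\Pr\big(|F(w)-\mathcal A(w,\varepsilon)|\le\varepsilon F(w)\big)\ge \tfrac34$, and the running time of $\mathcal A$ on $(w,\varepsilon)$ is polynomial in $|w|$ and $1/\varepsilon$; here the algorithm receives $\varepsilon$ as the number $\lceil 1/\varepsilon\rceil$ in unary. **Theorem.** Let $\mathbf R$ be such a signature. 1. If $f$ and $g$ are in $\Sigma\mathrm{QSO}(\Sigma_1[\mathrm{FO}])$ over $\mathbf R$, then so is $f+g$. 2. If $f$ and $g$ are in $\Sigma\mathrm{QSO}(\Sigma_1[\mathrm{FO}])$ over $\mathbf R$, then so is $f\cdot g$. 3. If $f$ is in $\Sigma\mathrm{QSO}(\Sigma_1[\mathrm{FO}])$ over $\mathbf R$, then so is $\mathfrak A\mapsto\max(f(\mathfrak A)-1,0)$. 4. For every $f$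 in $\Sigma\mathrm{QSO}(\Sigma_1[\mathrm{FO}])$ over $\mathbf R$ there is $F\in\mathrm{TotP}$ with $F(\mathrm{enc}(\mathfrak A))=f(\mathfrak A)$ for every $\mathfrak A\in\mathrm{OrdStruct}[\mathbf R]$. 5. For every $f$ in $\Sigma\mathrm{QSO}(\Sigma_1[\mathrm{FO}])$ over $\mathbf R$ there is $F:\{0,1\}^*\to\mathbb N$ that has an FPRAS and satisfies $F(\mathrm{enc}(\mathfrak A))=f(\mathfrak A)$ for every $\mathfrak A\in\mathrm{OrdStruct}[\mathbf R]$. -/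

import Mathlib

namespace QuantLogic

/-! ### Ordered signatures and finite ordered structures -/

/-- A finite relational signature that contains the binary symbol `<`. The symbol `<` is kept
implicit (it is the last symbol `R_k`); `numRel` counts the other symbols `R_1, ..., R_{k-1}`. -/
structure Signature where
  numRel : ℕ
  arity : Fin numRel → ℕ
  arity_pos : ∀ i, 0 < arity i

/-- A finite ordered structure over `R`: a nonempty finite domain, a linear order on it (the
interpretation of `<`), and an interpretation of every other relation symbol. -/
structure OrdStruct (R : Signature) where
  Dom : Type
  [fintypeDom : Fintype Dom]
  [nonemptyDom : Nonempty Dom]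
  [linearOrderDom : LinearOrder Dom]
  rel : ∀ i : Fin R.numRel, Set (Fin (R.arity i) → Dom)

attribute [instance] OrdStruct.fintypeDom OrdStruct.nonemptyDom OrdStruct.linearOrderDom

/-- The tuples of length `r` over the entries of the list `l`, in the lexicographic order that is
induced by the order of the entries in `l`. -/
def lexTuples {D : Type} (l : List D) : (r : ℕ) → List (Fin r → D)
  | 0 => [Fin.elim0]
  | r + 1 => l.flatMap fun a => (lexTuples l r).map fun t => Fin.cons a t

/-- The domain of a structure, listed increasingly. -/
def OrdStruct.domList {R : Signature} (S : OrdStruct R) : List S.Dom :=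
  Finset.univ.sort (· ≤ ·)

open Classical in
/-- The bit string of length `n ^ arity` that describes the `i`-th relation. -/
noncomputable def OrdStruct.encRel {R : Signature} (S : OrdStruct R) (i : Fin R.numRel) :
    List Bool :=
  (lexTuples S.domList (R.arity i)).map fun t => decide (t ∈ S.rel i)

/-- The encoding `0^n 1 enc(R_1) ... enc(R_{k-1})` of a structure with `n` elements. -/
noncomputable def OrdStruct.enc {R : Signature} (S : OrdStruct R) : List Bool :=
  List.replicate (Fintype.card S.Dom) false ++
    true :: (List.finRange R.numRel).flatMap fun i => S.encRel i

/-! ### Variables and assignments -/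

/-- First-order variables. -/
abbrev FOVar : Type := ℕ

/-- Second-order variables, each with an arity; there are infinitely many of every arity. -/
structure SOVar where
  name : ℕ
  arity : ℕ
deriving DecidableEq

/-- First-order assignments. -/
abbrev FOAssign {R : Signature} (S : OrdStruct R) : Type := FOVar → S.Dom

/-- Second-order assignments. -/
abbrev SOAssign {R : Signature} (S : OrdStruct R) : Type :=
  (X : SOVar) → Set (Fin X.arity → S.Dom)

/-! ### First-order formulae over a signature -/

/-- First-order formulae over `R`; no second-order variable occurs in them. -/
inductive FOFormula (R : Signature) : Type where
  | eq (x y : FOVar)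
  | lt (x y : FOVar)
  | rel (i : Fin R.numRel) (u : Fin (R.arity i) → FOVar)
  | top
  | neg (φ : FOFormula R)
  | or (φ ψ : FOFormula R)
  | ex (x : FOVar) (φ : FOFormula R)

namespace FOFormula

variable {R : Signature}

def Sat (S : OrdStruct R) : FOFormula R → FOAssign S → Prop
  | eq x y, v => v x = v y
  | lt x y, v => v x < v y
  | rel i u, v => (fun j => v (u j)) ∈ S.rel i
  | top, _ => True
  | neg φ, v => ¬ φ.Sat S v
  | or φ ψ, v => φ.Sat S v ∨ ψ.Sat S v
  | ex x φ, v => ∃ a : S.Dom, φ.Sat S (Function.update v x a)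

/-- The free variables of a formula. -/
def free : FOFormula R → Finset FOVar
  | eq x y => {x, y}
  | lt x y => {x, y}
  | rel _ u => Finset.univ.image u
  | top => ∅
  | neg φ => φ.free
  | or φ ψ => φ.free ∪ ψ.free
  | ex x φ => φ.free.erase x

end FOFormula

/-! ### The fragment `Σ₁[FO]` -/

/-- The quantifier-free part: Boolean combinations of atoms `u = v`, `X(ū)` with a second-order
variable `X`, and `φ(ū)` with an arbitrary first-order formula `φ` over the signature. -/
inductive QFExt (R : Signature) : Type where
  | eq (x y : FOVar)
  | so (X : SOVar) (u : Fin X.arity → FOVar)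
  | fo (φ : FOFormula R)
  | neg (ψ : QFExt R)
  | or (ψ₁ ψ₂ : QFExt R)

namespace QFExt

variable {R : Signature}

def Sat (S : OrdStruct R) (v : FOAssign S) (V : SOAssign S) : QFExt R → Prop
  | eq x y => v x = v y
  | so X u => (fun j => v (u j)) ∈ V X
  | fo φ => φ.Sat S v
  | neg ψ => ¬ ψ.Sat S v V
  | or ψ₁ ψ₂ => ψ₁.Sat S v V ∨ ψ₂.Sat S v V

/-- The free first-order variables. -/
def freeFO : QFExt R → Finset FOVar
  | eq x y => {x, y}
  | so _ u => Finset.univ.image u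
  | fo φ => φ.free
  | neg ψ => ψ.freeFO
  | or ψ₁ ψ₂ => ψ₁.freeFO ∪ ψ₂.freeFO

/-- The free second-order variables. -/
def freeSO : QFExt R → Finset SOVar
  | eq _ _ => ∅
  | so X _ => {X}
  | fo _ => ∅
  | neg ψ => ψ.freeSO
  | or ψ₁ ψ₂ => ψ₁.freeSO ∪ ψ₂.freeSO

end QFExt

/-- `Σ₁` over the extended atoms: formulae `∃ x₁ ⋯ ∃ xₘ ψ` with `ψ` in `QFExt R`. -/
inductive Sigma1Ext (R : Signature) : Type where
  | qf (ψ : QFExt R)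
  | ex (x : FOVar) (φ : Sigma1Ext R)

namespace Sigma1Ext

variable {R : Signature}

def Sat (S : OrdStruct R) : Sigma1Ext R → FOAssign S → SOAssign S → Prop
  | qf ψ, v, V => ψ.Sat S v V
  | ex x φ, v, V => ∃ a : S.Dom, φ.Sat S (Function.update v x a) V

/-- The free first-order variables. -/
def freeFO : Sigma1Ext R → Finset FOVar
  | qf ψ => ψ.freeFO
  | ex x φ => φ.freeFO.erase x

/-- The free second-order variables. -/
def freeSO : Sigma1Ext R → Finset SOVar
  | qf ψ => ψ.freeSO
  | ex _ φ => φ.freeSO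

end Sigma1Ext

/-! ### The quantitative logic `ΣQSO(Σ₁[FO])` -/

/-- The formulae of `ΣQSO(Σ₁[FO])` over `R`:
`α := φ | s | (α + α) | Σx. α | ΣX. α` with `φ` in `Sigma1Ext R` and `s` a natural number. -/
inductive SigmaQSO (R : Signature) : Type where
  | bool (φ : Sigma1Ext R)
  | const (s : ℕ)
  | add (α β : SigmaQSO R)
  | sumFO (x : FOVar) (α : SigmaQSO R)
  | sumSO (X : SOVar) (α : SigmaQSO R)

namespace SigmaQSO

variable {R : Signature}

open Classical in
/-- The evaluation of a quantitative formula. -/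
noncomputable def eval (S : OrdStruct R) : SigmaQSO R → FOAssign S → SOAssign S → ℕ
  | bool φ, v, V => if φ.Sat S v V then 1 else 0
  | const s, _, _ => s
  | add α β, v, V => α.eval S v V + β.eval S v V
  | sumFO x α, v, V => ∑ a : S.Dom, α.eval S (Function.update v x a) V
  | sumSO X α, v, V => ∑ B : Set (Fin X.arity → S.Dom), α.eval S v (Function.update V X B)

/-- The free first-order variables. -/
def freeFO : SigmaQSO R → Finset FOVar
  | bool φ => φ.freeFO
  | const _ => ∅
  | add α β => α.freeFO ∪ β.freeFO
  | sumFO x α => α.freeFO.erase x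
  | sumSO _ α => α.freeFO

/-- The free second-order variables. -/
def freeSO : SigmaQSO R → Finset SOVar
  | bool φ => φ.freeSO
  | const _ => ∅
  | add α β => α.freeSO ∪ β.freeSO
  | sumFO _ α => α.freeSO
  | sumSO X α => α.freeSO.erase X

/-- A sentence is a formula without free variables. -/
def IsSentence (α : SigmaQSO R) : Prop := α.freeFO = ∅ ∧ α.freeSO = ∅

end SigmaQSO

/-- The class of functions on ordered `R`-structures that are defined by a sentence of
`ΣQSO(Σ₁[FO])` over `R` (the value of a sentence does not depend on the assignments). -/
def SigmaQSOClass (R : Signature) : Set (OrdStruct R → ℕ) :=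
  {f | ∃ α : SigmaQSO R, α.IsSentence ∧
    ∀ (S : OrdStruct R) (v : FOAssign S) (V : SOAssign S), α.eval S v V = f S}

/-! ### Turing machines -/

/-- Head movements. -/
inductive Move : Type where
  | left
  | stay
  | right

def Move.toInt : Move → ℤ
  | left => -1
  | stay => 0
  | right => 1

/-- Multi-tape Turing machines with choice, used both as nondeterministic and as probabilistic
machines. `K` indexes the tapes, `inp` is the input tape, `out` the output tape, `Q` is the set of
states; a tape cell holds `none` (blank), a bit, or an auxiliary symbol from `Aux`. In a state,
and on reading one symbol on every tape, the machine either halts (`none`) or has a transition for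
each of the two values of a choice bit. The two transitions may coincide, in which case the step is
deterministic. -/
structure TM where
  K : Type
  [fintypeK : Fintype K]
  [decidableEqK : DecidableEq K]
  inp : K
  out : K
  Aux : Type
  [fintypeAux : Fintype Aux]
  Q : Type
  [fintypeQ : Fintype Q]
  start : Q
  trans : Q → (K → Option (Bool ⊕ Aux)) →
    Option (Bool → Q × (K → Option (Bool ⊕ Aux) × Move))

attribute [instance] TM.fintypeK TM.decidableEqK TM.fintypeAux TM.fintypeQ

namespace TM

/-- Tape symbols. -/
abbrev Sym (M : TM) : Type := Option (Bool ⊕ M.Aux)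

/-- Configurations: a state, the contents of the two-way infinite tapes, and head positions. -/
@[ext]
structure Cfg (M : TM) where
  state : M.Q
  tape : M.K → ℤ → M.Sym
  head : M.K → ℤ

variable (M : TM)

/-- The tape that holds `w` in the cells `0, 1, ..., |w| - 1` and is blank elsewhere. -/
def wordTape (w : List Bool) : ℤ → M.Sym := fun i =>
  if 0 ≤ i then (w[i.toNat]?).map Sum.inl else none

/-- The initial configuration on input `w`. -/
def init (w : List Bool) : M.Cfg where
  state := M.start
  tape k := if k = M.inp then M.wordTape w else fun _ => none
  head _ := 0

/-- The effect of an action: new state, and on every tape a written symbol and a head movement. -/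
def act (c : M.Cfg) (a : M.Q × (M.K → M.Sym × Move)) : M.Cfg where
  state := a.1
  tape k := Function.update (c.tape k) (c.head k) (a.2 k).1
  head k := c.head k + (a.2 k).2.toInt

/-- The next configuration for the choice bit `b`; `none` if the machine has halted. -/
def next (b : Bool) (c : M.Cfg) : Option M.Cfg :=
  (M.trans c.state fun k => c.tape k (c.head k)).map fun f => M.act c (f b)

/-- The one-step relation of the nondeterministic machine. -/
def Step (c c' : M.Cfg) : Prop := ∃ b : Bool, M.next b c = some c'

/-- Halting configurations: no transition applies. -/
def Halted (c : M.Cfg) : Prop := ∀ b : Bool, M.next b c = none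

/-- Finite computations on input `w` that need not be complete. -/
def IsPartialRun (w : List Bool) (l : List M.Cfg) : Prop :=
  l.head? = some (M.init w) ∧ l.IsChain M.Step

/-- The runs on input `w`: computations that end in a halting configuration. -/
def IsRun (w : List Bool) (l : List M.Cfg) : Prop :=
  M.IsPartialRun w l ∧ ∃ c, l.getLast? = some c ∧ M.Halted c

/-- Some polynomial in the input length bounds the number of steps of every computation. -/
def PolyTime : Prop :=
  ∃ p : Polynomial ℕ, ∀ (w : List Bool) (l : List M.Cfg),
    M.IsPartialRun w l → l.length ≤ p.eval w.length + 1

/-- The total number of runs on input `w`. -/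
noncomputable def totalRuns (w : List Bool) : ℕ := {l : List M.Cfg | M.IsRun w l}.ncard

/-- Run the machine with the given coin tosses, one for each step, until it halts or the coin
tosses are used up. -/
def runCoins : List Bool → M.Cfg → M.Cfg
  | [], c => c
  | b :: bs, c =>
    match M.next b c with
    | none => c
    | some c' => runCoins bs c'

/-- The output tape holds, from cell `0` on, the binary digits of `n` (least significant first),
followed by blanks only. -/
def Outputs (c : M.Cfg) (n : ℕ) : Prop :=
  ∀ i : ℕ, c.tape M.out (i : ℤ) = (n.bits[i]?).map Sum.inl

end TM

/-! ### Counting complexity -/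

/-- `TotP`: the functions `f` such that `f x + 1` is the total number of runs on input `x` of
some polynomial-time nondeterministic Turing machine. -/
def TotP : Set (List Bool → ℕ) :=
  {f | ∃ M : TM, M.PolyTime ∧ ∀ x : List Bool, M.totalRuns x = f x + 1}

/-- `f` has a fully polynomial randomized approximation scheme. The accuracy `ε` is presented to
the machine as `m = ⌈1/ε⌉` in unary: the input for `(x, ε)` is the string `1^m 0 x`. With a time
bound `T` that is polynomial in `|x|` and `1/ε`, the machine halts and outputs a number within `T`
steps for all coin tosses, and for at least three quarters of the `2 ^ T` sequences of `T` coin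
tosses the output has relative error at most `ε`. -/
def HasFPRAS (f : List Bool → ℕ) : Prop :=
  ∃ (M : TM) (p : Polynomial ℕ), ∀ (x : List Bool) (ε : ℝ), 0 < ε → ε < 1 →
    let m : ℕ := ⌈1 / ε⌉₊
    let T : ℕ := p.eval (x.length + m)
    let final : (Fin T → Bool) → M.Cfg := fun ω =>
      M.runCoins (List.ofFn ω) (M.init (List.replicate m true ++ false :: x))
    (∀ ω : Fin T → Bool, M.Halted (final ω) ∧ ∃ n : ℕ, M.Outputs (final ω) n) ∧
    (3 / 4 : ℝ) ≤
      (Nat.card {ω : Fin T → Bool // ∃ n : ℕ, M.Outputs (final ω) n ∧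
        |(f x : ℝ) - (n : ℝ)| ≤ ε * (f x : ℝ)} : ℝ) / 2 ^ T

end QuantLogic

/-!
The proof rests on a normal form. Pulling sums and existential quantifiers outwards shows that the
functions of the class are exactly the finite sums of counting terms: numbers of pairs `(x̄, X̄)` that
satisfy `∃ȳ. ψ`, where `ψ` is a Boolean combination of first-order formulae and of atoms `X(ū)`
(`mem_sigmaQSOClass_iff`).

*Closure.* Sums are immediate, and a product of counting terms is a counting term in disjoint
variables. For the subtraction of one, note that the truth of `ψ` depends only on the truth values
of its boundedly many second-order atoms. Therefore a term that has a solution has one in which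
the relations hold only at values of first-order variables. Such a solution is described by
first-order data, and the linear order allows to single one out by a first-order formula; to differ
from it is a property in `Σ₁[FO]` (`CTerm.exists_pred`). Since it is first-order definable whether
a term is nonzero, `(a + b) - 1` can be written as a sum of such terms
(`pred_mem_sigmaQSOClass`).

*Machines.* Algorithms are written in a small language of loop programs on tapes with a left end,
whose meaning is a tree of coin tosses. A program is compiled to a Turing machine that unfolds into
the same tree (`comp_runs`); programs whose loops run over unchanged registers take polynomial
time (`Cmd.WF.bound`). The number of runs of the machine is the number of leaves of the tree, and
expectations over coin sequences are weighted sums over the leaves. A word that need not be the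
encoding of a structure is read as a structure whose domain has as many elements as the word has
leading zeros (`wordVal`).

*TotP.* For all terms and all `x̄`, the program fills the relations `X̄` cell by cell. Whether the
cells filled so far extend to a solution can be tested in polynomial time, by trying all `ȳ` and all
truth values of the undetermined atoms of `ψ` (`NTerm.den_satK`). So the program branches only
where both values of a cell extend to a solution, and every run that takes part in the search ends
in a solution of its own; one more run declines to search (`leaves_runProg`).

*FPRAS.* If a term has a solution for some `x̄`, then all relations that agree with it on the atoms
of `ψ` are solutions as well, so at least a fraction `2 ^ (-c)` of all choices of relations are
solutions, for a constant `c` (`NTerm.two_pow_numCells_le`). Hence naive sampling has a relative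
variance of at most `2 ^ c`, and by Chebyshev's inequality the mean of `O(2 ^ c / ε ^ 2)` samples is
a good approximation (`approxProg_spec`). The samples are added up in a binary counter; the number
of samples is a power of two, so that the division by it is a shift.
-/


set_option linter.unusedSectionVars false

namespace QuantLogic

/-! ### Trees of coin tosses -/

/-- Finite binary trees: the outcomes of a computation that tosses coins, at the leaves. -/
inductive Tree (α : Type*) where
  | leaf (a : α)
  | coin (t₀ t₁ : Tree α)

namespace Tree

variable {α β γ : Type*}

/-- Continue at every leaf. -/
def bind : Tree α → (α → Tree β) → Tree β
  | leaf a, u => u a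
  | coin t₀ t₁, u => coin (t₀.bind u) (t₁.bind u)

/-- Relabel the leaves. -/
def map (f : α → β) (t : Tree α) : Tree β := t.bind fun a => leaf (f a)

/-- The number of leaves. -/
def leaves : Tree α → ℕ
  | leaf _ => 1
  | coin t₀ t₁ => t₀.leaves + t₁.leaves

/-- All leaves satisfy `p`. -/
def All (p : α → Prop) : Tree α → Prop
  | leaf a => p a
  | coin t₀ t₁ => t₀.All p ∧ t₁.All p

/-- The maximum of `f` over the leaves. -/
def sup (f : α → ℕ) : Tree α → ℕ
  | leaf a => f a
  | coin t₀ t₁ => max (t₀.sup f) (t₁.sup f)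

/-- The expected value of `f` at the leaf that is reached by fair coin tosses. -/
noncomputable def mean (f : α → ℝ) : Tree α → ℝ
  | leaf a => f a
  | coin t₀ t₁ => (t₀.mean f + t₁.mean f) / 2

@[simp] theorem leaf_bind (a : α) (u : α → Tree β) : (leaf a).bind u = u a := rfl

@[simp] theorem coin_bind (t₀ t₁ : Tree α) (u : α → Tree β) :
    (coin t₀ t₁).bind u = coin (t₀.bind u) (t₁.bind u) := rfl

@[simp] theorem map_leaf (f : α → β) (a : α) : (leaf a).map f = leaf (f a) := rfl

@[simp] theorem map_coin (f : α → β) (t₀ t₁ : Tree α) :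
    (coin t₀ t₁).map f = coin (t₀.map f) (t₁.map f) := rfl

theorem bind_assoc (t : Tree α) (u : α → Tree β) (w : β → Tree γ) :
    (t.bind u).bind w = t.bind fun a => (u a).bind w := by
  induction t with
  | leaf a => rfl
  | coin t₀ t₁ h₀ h₁ => simp [h₀, h₁]

theorem map_bind (t : Tree α) (u : α → Tree β) (f : β → γ) :
    (t.bind u).map f = t.bind fun a => (u a).map f := bind_assoc _ _ _

theorem bind_map (t : Tree α) (f : α → β) (u : β → Tree γ) :
    (t.map f).bind u = t.bind fun a => u (f a) := bind_assoc _ _ _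

theorem map_map (t : Tree α) (f : α → β) (g : β → γ) :
    (t.map f).map g = t.map fun a => g (f a) := bind_assoc _ _ _

theorem All.mono {p q : α → Prop} (h : ∀ a, p a → q a) {t : Tree α} (ht : t.All p) : t.All q := by
  induction t with
  | leaf a => exact h a ht
  | coin t₀ t₁ h₀ h₁ => exact ⟨h₀ ht.1, h₁ ht.2⟩

theorem All.and {p q : α → Prop} {t : Tree α} (hp : t.All p) (hq : t.All q) :
    t.All fun a => p a ∧ q a := by
  induction t with
  | leaf a => exact ⟨hp, hq⟩
  | coin t₀ t₁ h₀ h₁ => exact ⟨h₀ hp.1 hq.1, h₁ hp.2 hq.2⟩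

theorem all_of_forall {p : α → Prop} (h : ∀ a, p a) (t : Tree α) : t.All p := by
  induction t with
  | leaf a => exact h a
  | coin t₀ t₁ h₀ h₁ => exact ⟨h₀, h₁⟩

theorem all_forall {ι : Sort*} {p : ι → α → Prop} {t : Tree α} (h : ∀ i, t.All (p i)) :
    t.All fun a => ∀ i, p i a := by
  induction t with
  | leaf a => exact h
  | coin t₀ t₁ h₀ h₁ => exact ⟨h₀ fun i => (h i).1, h₁ fun i => (h i).2⟩

theorem all_bind {t : Tree α} {u : α → Tree β} {p : β → Prop} :
    (t.bind u).All p ↔ t.All fun a => (u a).All p := by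
  induction t with
  | leaf a => rfl
  | coin t₀ t₁ h₀ h₁ => simp [All, h₀, h₁]

theorem all_map {t : Tree α} {f : α → β} {p : β → Prop} :
    (t.map f).All p ↔ t.All fun a => p (f a) := all_bind

theorem all_le_sup (f : α → ℕ) (t : Tree α) : t.All fun a => f a ≤ t.sup f := by
  induction t with
  | leaf a => exact le_rfl
  | coin t₀ t₁ h₀ h₁ =>
    exact ⟨h₀.mono fun _ h => h.trans (le_max_left _ _),
      h₁.mono fun _ h => h.trans (le_max_right _ _)⟩

theorem sup_le {f : α → ℕ} {n : ℕ} {t : Tree α} (h : t.All fun a => f a ≤ n) : t.sup f ≤ n := by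
  induction t with
  | leaf a => exact h
  | coin t₀ t₁ h₀ h₁ => exact max_le (h₀ h.1) (h₁ h.2)

theorem leaves_map (t : Tree α) (f : α → β) : (t.map f).leaves = t.leaves := by
  induction t with
  | leaf a => rfl
  | coin t₀ t₁ h₀ h₁ => simp [leaves, h₀, h₁]

theorem bind_congr {t : Tree α} {u w : α → Tree β} (h : t.All fun a => u a = w a) :
    t.bind u = t.bind w := by
  induction t with
  | leaf a => exact h
  | coin t₀ t₁ h₀ h₁ => simp [h₀ h.1, h₁ h.2]

theorem mean_bind (t : Tree α) (u : α → Tree β) (f : β → ℝ) :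
    (t.bind u).mean f = t.mean fun a => (u a).mean f := by
  induction t with
  | leaf a => rfl
  | coin t₀ t₁ h₀ h₁ => simp [mean, h₀, h₁]

theorem mean_map (t : Tree α) (g : α → β) (f : β → ℝ) :
    (t.map g).mean f = t.mean fun a => f (g a) := mean_bind _ _ _

theorem mean_mono {t : Tree α} {f g : α → ℝ} (h : t.All fun a => f a ≤ g a) :
    t.mean f ≤ t.mean g := by
  induction t with
  | leaf a => exact h
  | coin t₀ t₁ h₀ h₁ => simp only [mean]; linarith [h₀ h.1, h₁ h.2]

end Tree

/-! ### Unfolding a transition system into a tree -/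

/-- `Reach nx k c t`: within `k` steps, the system with the transition function `nx` (one
successor for each value of the coin) unfolds from `c` into the tree `t`. Steps that do not depend
on the coin leave no trace in the tree. -/
inductive Reach {C : Type*} (nx : Bool → C → Option C) : ℕ → C → Tree C → Prop
  | refl (k : ℕ) (c : C) : Reach nx k c (.leaf c)
  | det {k : ℕ} {c c' : C} {t : Tree C} : (∀ b, nx b c = some c') → Reach nx k c' t →
      Reach nx (k + 1) c t
  | coin {k : ℕ} {c c₀ c₁ : C} {t₀ t₁ : Tree C} : nx false c = some c₀ → nx true c = some c₁ →
      c₀ ≠ c₁ → Reach nx k c₀ t₀ → Reach nx k c₁ t₁ → Reach nx (k + 1) c (.coin t₀ t₁)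

namespace Reach

variable {C C' : Type*} {nx : Bool → C → Option C} {nx' : Bool → C' → Option C'}

theorem mono {k j : ℕ} {c : C} {t : Tree C} (h : Reach nx k c t) (hkj : k ≤ j) :
    Reach nx j c t := by
  induction h generalizing j with
  | refl k c => exact refl _ _
  | det hn _ ih =>
    obtain ⟨j, rfl⟩ : ∃ i, j = i + 1 := ⟨j - 1, by omega⟩
    exact det hn (ih (by omega))
  | coin h₀ h₁ hne _ _ ih₀ ih₁ =>
    obtain ⟨j, rfl⟩ : ∃ i, j = i + 1 := ⟨j - 1, by omega⟩
    exact coin h₀ h₁ hne (ih₀ (by omega)) (ih₁ (by omega))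

theorem trans {α : Type*} {r : α → C} {k j : ℕ} {c : C} {t : Tree α} {u : α → Tree C}
    (h : Reach nx k c (t.map r)) (hu : t.All fun a => Reach nx j (r a) (u a)) :
    Reach nx (k + j) c (t.bind u) := by
  generalize ht : t.map r = t' at h
  induction h generalizing t with
  | refl k c =>
    cases t with
    | leaf a =>
      cases ht
      exact mono hu (by omega)
    | coin t₀ t₁ => cases ht
  | det hn _ ih => exact (det hn (ih hu ht)).mono (by omega)
  | coin h₀ h₁ hne _ _ ih₀ ih₁ =>
    cases t with
    | leaf a => cases ht
    | coin t₀ t₁ =>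
      cases ht
      exact (coin h₀ h₁ hne (ih₀ hu.1 rfl) (ih₁ hu.2 rfl)).mono (by omega)

/-- Transport along an injective map that commutes with the transitions. -/
theorem map {φ : C → C'} (hφ : Function.Injective φ)
    (hs : ∀ b c d, nx b c = some d → nx' b (φ c) = some (φ d)) {k : ℕ} {c : C} {t : Tree C}
    (h : Reach nx k c t) : Reach nx' k (φ c) (t.map φ) := by
  induction h with
  | refl k c => exact refl _ _
  | det hn _ ih => exact det (fun b => hs _ _ _ (hn b)) ih
  | coin h₀ h₁ hne _ _ ih₀ ih₁ =>
    exact coin (hs _ _ _ h₀) (hs _ _ _ h₁) (hφ.ne hne) ih₀ ih₁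

theorem one {c d : C} (h : ∀ b, nx b c = some d) : Reach nx 1 c (.leaf d) := det h (refl 0 d)

end Reach

/-! ### Runs and coin sequences of a machine that unfolds into a tree -/

namespace TM

variable {M : TM}

/-- The runs that start in a given configuration. -/
def runsFrom (M : TM) (c : M.Cfg) : Set (List M.Cfg) :=
  {l | (l.head? = some c ∧ l.IsChain M.Step) ∧ ∃ d, l.getLast? = some d ∧ M.Halted d}

theorem length_le_of_reach {k : ℕ} {c : M.Cfg} {t : Tree M.Cfg} (h : Reach M.next k c t)
    (ht : t.All M.Halted) (l : List M.Cfg) (hl : l.head? = some c) (hc : l.IsChain M.Step) :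
    l.length ≤ k + 1 := by
  induction h generalizing l with
  | refl k c =>
    match l, hl, hc with
    | [a], _, _ => simp
    | a :: b :: l, hl, hc =>
      simp only [List.head?_cons, Option.some.injEq] at hl
      subst hl
      rw [List.isChain_cons_cons] at hc
      obtain ⟨⟨x, hx⟩, -⟩ := hc
      rw [ht x] at hx
      cases hx
  | det hn _ ih =>
    match l, hl, hc with
    | [a], _, _ => simp
    | a :: b :: l, hl, hc =>
      simp only [List.head?_cons, Option.some.injEq] at hl
      subst hl
      rw [List.isChain_cons_cons] at hc
      obtain ⟨⟨x, hx⟩, hc⟩ := hc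
      rw [hn x] at hx
      cases hx
      have := ih ht (_ :: l) rfl hc
      simp only [List.length_cons] at this ⊢
      omega
  | @coin k c c₀ c₁ t₀ t₁ h₀ h₁ hne _ _ ih₀ ih₁ =>
    match l, hl, hc with
    | [a], _, _ => simp
    | a :: b :: l, hl, hc =>
      simp only [List.head?_cons, Option.some.injEq] at hl
      subst hl
      rw [List.isChain_cons_cons] at hc
      obtain ⟨⟨x, hx⟩, hc⟩ := hc
      have : (b :: l).length ≤ k + 1 := by
        cases x with
        | false => rw [h₀] at hx; cases hx; exact ih₀ ht.1 (_ :: l) rfl hc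
        | true => rw [h₁] at hx; cases hx; exact ih₁ ht.2 (_ :: l) rfl hc
      simp only [List.length_cons] at this ⊢
      omega

theorem runsFrom_halted {c : M.Cfg} (h : M.Halted c) : M.runsFrom c = {[c]} := by
  ext l
  simp only [runsFrom, Set.mem_ofPred_eq, Set.mem_singleton_iff]
  constructor
  · rintro ⟨⟨hl, hc⟩, -⟩
    match l, hl, hc with
    | [a], hl, _ => simpa using hl
    | a :: b :: l, hl, hc =>
      simp only [List.head?_cons, Option.some.injEq] at hl
      subst hl
      rw [List.isChain_cons_cons] at hc
      obtain ⟨⟨x, hx⟩, -⟩ := hc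
      rw [h x] at hx
      cases hx
  · rintro rfl
    exact ⟨⟨rfl, List.isChain_singleton _⟩, c, rfl, h⟩

theorem runsFrom_step {c : M.Cfg} {b₀ : Bool} {c₀ : M.Cfg} (h : M.next b₀ c = some c₀) :
    M.runsFrom c = List.cons c '' {l | ∃ d, M.Step c d ∧ l ∈ M.runsFrom d} := by
  ext l
  simp only [Set.mem_image, Set.mem_ofPred_eq]
  constructor
  · rintro ⟨⟨hl, hc⟩, d, hd, hh⟩
    match l, hl, hc with
    | [a], hl, _ =>
      simp only [List.head?_cons, Option.some.injEq, List.getLast?_singleton] at hl hd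
      subst hl hd
      rw [hh b₀] at h
      cases h
    | a :: b :: l, hl, hc =>
      simp only [List.head?_cons, Option.some.injEq] at hl
      subst hl
      rw [List.isChain_cons_cons] at hc
      exact ⟨b :: l, ⟨b, hc.1, ⟨rfl, hc.2⟩, d, by simpa using hd, hh⟩, rfl⟩
  · rintro ⟨l, ⟨d, hs, ⟨hl, hc⟩, e, he, hh⟩, rfl⟩
    match l, hl, hc with
    | b :: l, hl, hc =>
      simp only [List.head?_cons, Option.some.injEq] at hl
      subst hl
      exact ⟨⟨rfl, List.isChain_cons_cons.2 ⟨hs, hc⟩⟩, e, by simpa using he, hh⟩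

/-- Runs are sequences of configurations; they correspond to the leaves of the tree because the two
successors at a coin are distinct. -/
theorem runsFrom_of_reach {k : ℕ} {c : M.Cfg} {t : Tree M.Cfg} (h : Reach M.next k c t)
    (ht : t.All M.Halted) : (M.runsFrom c).Finite ∧ (M.runsFrom c).ncard = t.leaves := by
  induction h with
  | refl k c => rw [runsFrom_halted ht]; simp [Tree.leaves]
  | @det k c c' t hn _ ih =>
    have e : {l | ∃ d, M.Step c d ∧ l ∈ M.runsFrom d} = M.runsFrom c' := by
      ext l
      constructor
      · rintro ⟨d, ⟨b, hb⟩, hl⟩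
        rw [hn b] at hb; cases hb; exact hl
      · exact fun hl => ⟨c', ⟨true, hn _⟩, hl⟩
    rw [runsFrom_step (hn true), e]
    exact ⟨(ih ht).1.image _, by
      rw [Set.ncard_image_of_injective _ (List.cons_injective), (ih ht).2]⟩
  | @coin k c c₀ c₁ t₀ t₁ h₀ h₁ hne _ _ ih₀ ih₁ =>
    have e : {l | ∃ d, M.Step c d ∧ l ∈ M.runsFrom d} = M.runsFrom c₀ ∪ M.runsFrom c₁ := by
      ext l
      constructor
      · rintro ⟨d, ⟨b, hb⟩, hl⟩
        cases b with
        | false => rw [h₀] at hb; cases hb; exact Or.inl hl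
        | true => rw [h₁] at hb; cases hb; exact Or.inr hl
      · rintro (hl | hl)
        · exact ⟨c₀, ⟨false, h₀⟩, hl⟩
        · exact ⟨c₁, ⟨true, h₁⟩, hl⟩
    have hd : Disjoint (M.runsFrom c₀) (M.runsFrom c₁) := by
      rw [Set.disjoint_left]
      rintro l ⟨⟨hl, -⟩, -⟩ ⟨⟨hl', -⟩, -⟩
      rw [hl] at hl'
      exact hne (Option.some.inj hl')
    obtain ⟨f₀, n₀⟩ := ih₀ ht.1
    obtain ⟨f₁, n₁⟩ := ih₁ ht.2
    rw [runsFrom_step h₀, e]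
    exact ⟨(f₀.union f₁).image _, by
      rw [Set.ncard_image_of_injective _ (List.cons_injective),
        Set.ncard_union_eq hd f₀ f₁, n₀, n₁, Tree.leaves]⟩

theorem polyTime_of_reach {p : Polynomial ℕ} {t : List Bool → Tree M.Cfg}
    (h : ∀ w, Reach M.next (p.eval w.length) (M.init w) (t w)) (ht : ∀ w, (t w).All M.Halted) :
    M.PolyTime :=
  ⟨p, fun w l hl => length_le_of_reach (h w) (ht w) l hl.1 hl.2⟩

theorem totalRuns_of_reach {k : ℕ} {w : List Bool} {t : Tree M.Cfg}
    (h : Reach M.next k (M.init w) t) (ht : t.All M.Halted) : M.totalRuns w = t.leaves :=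
  (runsFrom_of_reach h ht).2

theorem runCoins_halted {c : M.Cfg} (h : M.Halted c) (l : List Bool) : M.runCoins l c = c := by
  cases l with
  | nil => rfl
  | cons b l => simp [runCoins, h b]

theorem sum_coins_succ (T : ℕ) (f : (Fin (T + 1) → Bool) → ℝ) :
    ∑ ω, f ω = ∑ ω : Fin T → Bool, f (Fin.cons false ω) +
      ∑ ω : Fin T → Bool, f (Fin.cons true ω) := by
  rw [← (Fin.consEquiv fun _ => Bool).sum_comp, Fintype.sum_prod_type]
  simp [Fin.consEquiv, add_comm]

/-- The fair coin sequences of a sufficient length sample a leaf of the tree. -/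
theorem sum_runCoins_of_reach {k : ℕ} {c : M.Cfg} {t : Tree M.Cfg} (h : Reach M.next k c t)
    (ht : t.All M.Halted) (f : M.Cfg → ℝ) {T : ℕ} (hT : k ≤ T) :
    ∑ ω : Fin T → Bool, f (M.runCoins (List.ofFn ω) c) = 2 ^ T * t.mean f := by
  induction h generalizing T with
  | refl k c => simp [runCoins_halted ht, Tree.mean]
  | det hn _ ih =>
    obtain ⟨T, rfl⟩ : ∃ i, T = i + 1 := ⟨T - 1, by omega⟩
    rw [sum_coins_succ]
    simp only [List.ofFn_succ, Fin.cons_zero, Fin.cons_succ, runCoins, hn]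
    rw [ih ht (by omega)]
    ring
  | coin h₀ h₁ hne _ _ ih₀ ih₁ =>
    obtain ⟨T, rfl⟩ : ∃ i, T = i + 1 := ⟨T - 1, by omega⟩
    rw [sum_coins_succ]
    simp only [List.ofFn_succ, Fin.cons_zero, Fin.cons_succ, runCoins, h₀, h₁]
    rw [ih₀ ht.1 (by omega), ih₁ ht.2 (by omega), Tree.mean]
    ring

theorem runCoins_of_reach {k : ℕ} {c : M.Cfg} {t : Tree M.Cfg} (h : Reach M.next k c t)
    {p : M.Cfg → Prop} (hp : t.All p) (ht : t.All M.Halted) (l : List Bool) (hl : k ≤ l.length) :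
    p (M.runCoins l c) := by
  induction h generalizing l with
  | refl k c => rw [runCoins_halted ht]; exact hp
  | det hn _ ih =>
    match l, hl with
    | b :: l, hl => simp only [runCoins, hn b]; exact ih hp ht l (by simpa using hl)
  | coin h₀ h₁ hne _ _ ih₀ ih₁ =>
    match l, hl with
    | false :: l, hl => simp only [runCoins, h₀]; exact ih₀ hp.1 ht.1 l (by simpa using hl)
    | true :: l, hl => simp only [runCoins, h₁]; exact ih₁ hp.2 ht.2 l (by simpa using hl)

end TM
end QuantLogic

namespace QuantLogic

/-! ### A loop language on tapes -/

/-- The states of a loop program: the contents of one-way infinite tapes, the positions of their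
heads, and Boolean flags. A head position also serves as a number register. -/
@[ext]
structure State (K Fl : Type) where
  cont : K → ℕ → Option Bool
  head : K → ℕ
  flag : Fl → Bool

namespace State

variable {K Fl : Type} [DecidableEq K] [DecidableEq Fl]

/-- Move the head of `k` to cell `i`. -/
def setHead (k : K) (i : ℕ) (s : State K Fl) : State K Fl :=
  { s with head := Function.update s.head k i }

/-- Write `o` into cell `i` of the tape `k`. -/
def setCell (k : K) (i : ℕ) (o : Option Bool) (s : State K Fl) : State K Fl :=
  { s with cont := Function.update s.cont k (Function.update (s.cont k) i o) }

/-- Set the flag `f` to `b`. -/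
def setFlag (f : Fl) (b : Bool) (s : State K Fl) : State K Fl :=
  { s with flag := Function.update s.flag f b }

@[simp] theorem setHead_cont (k : K) (i : ℕ) (s : State K Fl) : (s.setHead k i).cont = s.cont := rfl
@[simp] theorem setHead_flag (k : K) (i : ℕ) (s : State K Fl) : (s.setHead k i).flag = s.flag := rfl
@[simp] theorem setHead_head (k : K) (i : ℕ) (s : State K Fl) :
    (s.setHead k i).head = Function.update s.head k i := rfl
@[simp] theorem setCell_head (k : K) (i : ℕ) (o : Option Bool) (s : State K Fl) :
    (s.setCell k i o).head = s.head := rfl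
@[simp] theorem setCell_flag (k : K) (i : ℕ) (o : Option Bool) (s : State K Fl) :
    (s.setCell k i o).flag = s.flag := rfl
@[simp] theorem setCell_cont (k : K) (i : ℕ) (o : Option Bool) (s : State K Fl) :
    (s.setCell k i o).cont = Function.update s.cont k (Function.update (s.cont k) i o) := rfl
@[simp] theorem setFlag_head (f : Fl) (b : Bool) (s : State K Fl) :
    (s.setFlag f b).head = s.head := rfl
@[simp] theorem setFlag_cont (f : Fl) (b : Bool) (s : State K Fl) :
    (s.setFlag f b).cont = s.cont := rfl
@[simp] theorem setFlag_flag (f : Fl) (b : Bool) (s : State K Fl) :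
    (s.setFlag f b).flag = Function.update s.flag f b := rfl

@[simp] theorem setHead_setHead (k : K) (i j : ℕ) (s : State K Fl) :
    (s.setHead k i).setHead k j = s.setHead k j := by
  simp [setHead]

theorem setHead_self {k : K} {i : ℕ} {s : State K Fl} (h : s.head k = i) : s.setHead k i = s := by
  subst h; simp [setHead]

theorem setFlag_self {f : Fl} {b : Bool} {s : State K Fl} (h : s.flag f = b) :
    s.setFlag f b = s := by
  subst h; simp [setFlag]

theorem setCell_self {k : K} {i : ℕ} {o : Option Bool} {s : State K Fl} (h : s.cont k i = o) :
    s.setCell k i o = s := by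
  subst h; simp [setCell]

theorem setHead_comm {k k' : K} (h : k ≠ k') (i j : ℕ) (s : State K Fl) :
    (s.setHead k i).setHead k' j = (s.setHead k' j).setHead k i := by
  simp [setHead, Function.update_comm h]

@[simp] theorem setFlag_setFlag (f : Fl) (a b : Bool) (s : State K Fl) :
    (s.setFlag f a).setFlag f b = s.setFlag f b := by
  simp [setFlag]

@[simp] theorem setCell_setCell (k : K) (i : ℕ) (a b : Option Bool) (s : State K Fl) :
    (s.setCell k i a).setCell k i b = s.setCell k i b := by
  simp [setCell]

theorem setFlag_setHead (f : Fl) (b : Bool) (k : K) (i : ℕ) (s : State K Fl) :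
    (s.setHead k i).setFlag f b = (s.setFlag f b).setHead k i := rfl

theorem setCell_setHead (k' : K) (j : ℕ) (o : Option Bool) (k : K) (i : ℕ) (s : State K Fl) :
    (s.setHead k i).setCell k' j o = (s.setCell k' j o).setHead k i := rfl

end State

/-- Loop programs: head movements, single-cell updates, tests, coin tosses into a flag, and
`loop k c`, which repeats `c` as often as the head position of `k` says at its start. -/
inductive Cmd (K Fl : Type) where
  | skip
  | right (k : K)
  | reset (k : K)
  | write (k : K) (o : Option Bool)
  | iteSym (k : K) (o : Option Bool) (c₁ c₂ : Cmd K Fl)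
  | setF (f : Fl) (b : Bool)
  | iteF (f : Fl) (c₁ c₂ : Cmd K Fl)
  | toss (f : Fl)
  | seq (c₁ c₂ : Cmd K Fl)
  | loop (k : K) (c : Cmd K Fl)

infixr:65 " ;; " => Cmd.seq

/-- Run `f 0`, ..., `f (n - 1)` one after the other. -/
def loopM {α : Type*} (f : ℕ → α → Tree α) : ℕ → α → Tree α
  | 0, s => .leaf s
  | n + 1, s => (loopM f n s).bind (f n)

namespace Cmd

variable {K Fl : Type} [DecidableEq K] [DecidableEq Fl]

/-- The tree of outcomes of a program. In the `i`-th round of `loop k c` the head of `k` is at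
`i`; afterwards it is back at its original position. -/
def den : Cmd K Fl → State K Fl → Tree (State K Fl)
  | skip, s => .leaf s
  | right k, s => .leaf (s.setHead k (s.head k + 1))
  | reset k, s => .leaf (s.setHead k 0)
  | write k o, s => .leaf (s.setCell k (s.head k) o)
  | iteSym k o c₁ c₂, s => if s.cont k (s.head k) = o then c₁.den s else c₂.den s
  | setF f b, s => .leaf (s.setFlag f b)
  | iteF f c₁ c₂, s => if s.flag f = true then c₁.den s else c₂.den s
  | toss f, s => .coin (.leaf (s.setFlag f false)) (.leaf (s.setFlag f true))
  | seq c₁ c₂, s => (c₁.den s).bind c₂.den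
  | loop k c, s => loopM (fun i s' => (c.den (s'.setHead k i)).map (State.setHead k (s.head k)))
      (s.head k) s

/-- A bound on the number of machine steps. -/
def cost : Cmd K Fl → State K Fl → ℕ
  | skip, _ => 1
  | right _, _ => 1
  | reset k, s => s.head k + 2
  | write _ _, _ => 1
  | iteSym _ _ c₁ c₂, s => 1 + max (c₁.cost s) (c₂.cost s)
  | setF _ _, _ => 1
  | iteF _ c₁ c₂, s => 1 + max (c₁.cost s) (c₂.cost s)
  | toss _, _ => 1
  | seq c₁ c₂, s => c₁.cost s + (c₁.den s).sup c₂.cost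
  | loop k c, s => (s.head k + 2) + ((∑ j ∈ Finset.range (s.head k),
      ((loopM (fun i s' => (c.den (s'.setHead k i)).map (State.setHead k (s.head k))) j s).sup
        (fun s' => c.cost (s'.setHead k j)) + 2)) + 1)

/-- The program does not move the head of `k`, except by loops over `k`. -/
def Keeps (k : K) : Cmd K Fl → Prop
  | right k' => k' ≠ k
  | reset k' => k' ≠ k
  | iteSym _ _ c₁ c₂ => c₁.Keeps k ∧ c₂.Keeps k
  | iteF _ c₁ c₂ => c₁.Keeps k ∧ c₂.Keeps k
  | seq c₁ c₂ => c₁.Keeps k ∧ c₂.Keeps k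
  | loop _ c => c.Keeps k
  | _ => True

/-- No loop moves the head of its own register. -/
def Safe : Cmd K Fl → Prop
  | iteSym _ _ c₁ c₂ => c₁.Safe ∧ c₂.Safe
  | iteF _ c₁ c₂ => c₁.Safe ∧ c₂.Safe
  | seq c₁ c₂ => c₁.Safe ∧ c₂.Safe
  | loop k c => c.Keeps k ∧ c.Safe
  | _ => True

/-- The tapes that occur in a program. -/
def tapes : Cmd K Fl → Finset K
  | skip => ∅
  | right k => {k}
  | reset k => {k}
  | write k _ => {k}
  | iteSym k _ c₁ c₂ => {k} ∪ (c₁.tapes ∪ c₂.tapes)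
  | setF _ _ => ∅
  | iteF _ c₁ c₂ => c₁.tapes ∪ c₂.tapes
  | toss _ => ∅
  | seq c₁ c₂ => c₁.tapes ∪ c₂.tapes
  | loop k c => {k} ∪ c.tapes

/-- The flags that occur in a program. -/
def flags : Cmd K Fl → Finset Fl
  | iteSym _ _ c₁ c₂ => c₁.flags ∪ c₂.flags
  | setF f _ => {f}
  | iteF f c₁ c₂ => {f} ∪ (c₁.flags ∪ c₂.flags)
  | toss f => {f}
  | seq c₁ c₂ => c₁.flags ∪ c₂.flags
  | loop _ c => c.flags
  | _ => ∅

/-- The nesting depth of loops. -/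
def depth : Cmd K Fl → ℕ
  | iteSym _ _ c₁ c₂ => max c₁.depth c₂.depth
  | iteF _ c₁ c₂ => max c₁.depth c₂.depth
  | seq c₁ c₂ => max c₁.depth c₂.depth
  | loop _ c => c.depth + 1
  | _ => 0

theorem all_loopM {α : Type*} {f : ℕ → α → Tree α} {p : ℕ → α → Prop} {n : ℕ} {s : α} (h0 : p 0 s)
    (hs : ∀ i < n, ∀ a, p i a → (f i a).All (p (i + 1))) : (loopM f n s).All (p n) := by
  induction n with
  | zero => exact h0
  | succ n ih =>
    rw [loopM, Tree.all_bind]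
    exact (ih fun i hi => hs i (by omega)).mono fun a ha => hs n (by omega) a ha

theorem Keeps.all_head {k : K} {c : Cmd K Fl} (h : c.Keeps k) (s : State K Fl) :
    (c.den s).All fun s' : State K Fl => s'.head k = s.head k := by
  induction c generalizing s with
  | skip => exact rfl
  | right k' => exact Function.update_of_ne (Ne.symm h) _ _
  | reset k' => exact Function.update_of_ne (Ne.symm h) _ _
  | write k' o => exact rfl
  | iteSym k' o c₁ c₂ h₁ h₂ =>
    rw [den]; split
    · exact h₁ h.1 s
    · exact h₂ h.2 s
  | setF f b => exact rfl
  | iteF f c₁ c₂ h₁ h₂ =>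
    rw [den]; split
    · exact h₁ h.1 s
    · exact h₂ h.2 s
  | toss f => exact ⟨rfl, rfl⟩
  | seq c₁ c₂ h₁ h₂ =>
    rw [den, Tree.all_bind]
    exact (h₁ h.1 s).mono fun a ha => (h₂ h.2 a).mono fun b hb => hb.trans ha
  | loop k' c ih =>
    rw [den]
    refine all_loopM (p := fun _ (s' : State K Fl) => s'.head k = s.head k) rfl fun i _ a ha => ?_
    rw [Tree.all_map]
    by_cases hk : k = k'
    · subst hk
      exact Tree.all_of_forall (fun b => by simp) _
    · exact (ih h (a.setHead k' i)).mono fun b hb => by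
        simp only [State.setHead_head, Function.update_of_ne hk] at hb ⊢
        exact hb.trans ha

end Cmd

/-! ### Machine fragments -/

/-- Tape symbols: blank, a bit, or the mark of the left end. -/
abbrev Cell : Type := Option (Bool ⊕ Unit)

/-- The memory of a machine: flags, tapes and head positions. -/
@[ext]
structure Mem (T Φ : Type) where
  flag : Φ → Bool
  tape : T → ℤ → Cell
  head : T → ℤ

namespace Mem

variable {T Φ : Type}

/-- The scanned symbols. -/
def scan (m : Mem T Φ) : T → Cell := fun k => m.tape k (m.head k)

/-- Set the flags, write symbols and move the heads. -/
def act (m : Mem T Φ) (a : (Φ → Bool) × (T → Cell × Move)) : Mem T Φ where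
  flag := a.1
  tape k := Function.update (m.tape k) (m.head k) (a.2 k).1
  head k := m.head k + (a.2 k).2.toInt

end Mem

/-- Machines with one exit: the successor state `none` leaves the fragment. -/
structure Frag (T Φ : Type) where
  Q : Type
  [fintypeQ : Fintype Q]
  start : Q
  trans : Q → (Φ → Bool) → (T → Cell) → Bool → Option Q × (Φ → Bool) × (T → Cell × Move)

attribute [instance] Frag.fintypeQ

namespace Frag

variable {T Φ : Type}

/-- The transition function on control states with memory. -/
def nx (F : Frag T Φ) (b : Bool) : Option F.Q × Mem T Φ → Option (Option F.Q × Mem T Φ)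
  | (none, _) => none
  | (some q, m) =>
    some ((F.trans q m.flag m.scan b).1, m.act (F.trans q m.flag m.scan b).2)

/-- Started on `m`, the fragment is left within `k` steps, with the outcomes `t`. -/
def Runs (F : Frag T Φ) (k : ℕ) (m : Mem T Φ) (t : Tree (Mem T Φ)) : Prop :=
  Reach F.nx k (some F.start, m) (t.map (Prod.mk none))

/-- The action that only moves heads. -/
def mv (sy : T → Cell) (d : T → Move) : T → Cell × Move := fun t => (sy t, d t)

theorem act_mv (m : Mem T Φ) (fl : Φ → Bool) (d : T → Move) :
    m.act (fl, mv m.scan d) = ⟨fl, m.tape, fun k => m.head k + (d k).toInt⟩ := by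
  ext <;> simp [Mem.act, mv, Mem.scan]

/-- A single step. -/
def prim (g : (Φ → Bool) → (T → Cell) → Bool → (Φ → Bool) × (T → Cell × Move)) : Frag T Φ where
  Q := Unit
  start := ()
  trans _ fl sy b := (none, g fl sy b)

theorem prim_runs {g : (Φ → Bool) → (T → Cell) → Bool → (Φ → Bool) × (T → Cell × Move)}
    {m m' : Mem T Φ} (h : ∀ b, m.act (g m.flag m.scan b) = m') : (prim g).Runs 1 m (.leaf m') :=
  Reach.one fun b => by simp [nx, prim, h]

/-- Repeat the action `a` as long as the test succeeds, then do `a'`. -/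
def spin (test : (T → Cell) → Bool) (a a' : (T → Cell) → T → Cell × Move) : Frag T Φ where
  Q := Unit
  start := ()
  trans _ fl sy _ := if test sy then (some (), fl, a sy) else (none, fl, a' sy)

theorem spin_stop {test : (T → Cell) → Bool} {a a' : (T → Cell) → T → Cell × Move}
    {m : Mem T Φ} (h : test m.scan = false) :
    (spin test a a').Runs 1 m (.leaf (m.act (m.flag, a' m.scan))) :=
  Reach.one fun b => by simp [nx, spin, h]

theorem spin_go {test : (T → Cell) → Bool} {a a' : (T → Cell) → T → Cell × Move}
    {m : Mem T Φ} {t : Tree (Mem T Φ)} {k : ℕ} (h : test m.scan = true)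
    (hr : (spin test a a').Runs k (m.act (m.flag, a m.scan)) t) :
    (spin test a a').Runs (k + 1) m t :=
  Reach.det (fun b => by simp [nx, spin, h]) hr

/-- Sequential composition. -/
def seq (F G : Frag T Φ) : Frag T Φ where
  Q := F.Q ⊕ G.Q
  start := .inl F.start
  trans
    | .inl q, fl, sy, b =>
      ((some (((F.trans q fl sy b).1.map Sum.inl).getD (.inr G.start))), (F.trans q fl sy b).2)
    | .inr q, fl, sy, b => ((G.trans q fl sy b).1.map .inr, (G.trans q fl sy b).2)

theorem seq_runs {F G : Frag T Φ} {α : Type*} {r : α → Mem T Φ} {k j : ℕ} {m : Mem T Φ}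
    {t : Tree α} {u : α → Tree (Mem T Φ)} (hF : F.Runs k m (t.map r))
    (hG : t.All fun a => G.Runs j (r a) (u a)) : (seq F G).Runs (k + j) m (t.bind u) := by
  let φ : Option F.Q × Mem T Φ → Option (seq F G).Q × Mem T Φ :=
    fun p => (some ((p.1.map Sum.inl).getD (.inr G.start)), p.2)
  let χ : Option G.Q × Mem T Φ → Option (seq F G).Q × Mem T Φ := fun p => (p.1.map Sum.inr, p.2)
  have hφ : Function.Injective φ := by
    have hf : Function.Injective
        (fun o : Option F.Q => some ((o.map (Sum.inl (β := G.Q))).getD (.inr G.start))) := by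
      rintro (_ | q) (_ | q') h <;> simp at h ⊢; exact h
    exact hf.prodMap Function.injective_id
  have hχ : Function.Injective χ :=
    (Option.map_injective (Sum.inr_injective (α := F.Q))).prodMap Function.injective_id
  have h₁ := Reach.map (nx' := (seq F G).nx) hφ (by
    rintro b ⟨_ | q, m⟩ d h
    · cases h
    · simp only [nx, Option.some.injEq] at h
      subst h
      simp [nx, φ, seq]) hF
  have h₂ : ∀ m' t', G.Runs j m' t' → Reach (seq F G).nx j (φ (none, m'))
      ((t'.map (Prod.mk none)).map χ) := fun m' t' hm => Reach.map (nx' := (seq F G).nx) hχ (by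
    rintro b ⟨_ | q, m⟩ d h
    · cases h
    · simp only [nx, Option.some.injEq] at h
      subst h
      simp [nx, χ, seq]) hm
  rw [Tree.map_map, Tree.map_map] at h₁
  have h₃ := h₁.trans (j := j) (u := fun a => ((u a).map (Prod.mk none)).map χ)
    (hG.mono fun a ha => h₂ _ _ ha)
  simp only [Tree.map_map] at h₃
  rw [Runs, Tree.map_bind]
  exact h₃

/-- Branching. -/
def ite (test : (Φ → Bool) → (T → Cell) → Bool) (F G : Frag T Φ) : Frag T Φ where
  Q := Option (F.Q ⊕ G.Q)
  start := none
  trans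
    | none, fl, sy, _ =>
      (some (some (if test fl sy then .inl F.start else .inr G.start)), fl, mv sy fun _ => .stay)
    | some (.inl q), fl, sy, b =>
      ((F.trans q fl sy b).1.map fun q' => some (.inl q'), (F.trans q fl sy b).2)
    | some (.inr q), fl, sy, b =>
      ((G.trans q fl sy b).1.map fun q' => some (.inr q'), (G.trans q fl sy b).2)

theorem act_stay (m : Mem T Φ) : m.act (m.flag, mv m.scan fun _ => .stay) = m := by
  rw [act_mv]; simp [Move.toInt]

theorem ite_runs_true {test : (Φ → Bool) → (T → Cell) → Bool} {F G : Frag T Φ} {k : ℕ}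
    {m : Mem T Φ} {t : Tree (Mem T Φ)} (h : test m.flag m.scan = true) (hF : F.Runs k m t) :
    (ite test F G).Runs (1 + k) m t := by
  let φ : Option F.Q × Mem T Φ → Option (ite test F G).Q × Mem T Φ :=
    fun p => (p.1.map fun q => some (.inl q), p.2)
  have hφ : Function.Injective φ :=
    (Option.map_injective ((Option.some_injective _).comp
      (Sum.inl_injective (β := G.Q)))).prodMap Function.injective_id
  have h₁ := Reach.map (nx' := (ite test F G).nx) hφ (by
    rintro b ⟨_ | q, m⟩ d h
    · cases h
    · simp only [nx, Option.some.injEq] at h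
      subst h
      simp [nx, φ, ite]) hF
  rw [add_comm]
  refine Reach.det (c' := φ (some F.start, m)) (fun b => ?_) (by rw [Tree.map_map] at h₁; exact h₁)
  simp [nx, ite, h, φ, act_stay]

theorem ite_runs_false {test : (Φ → Bool) → (T → Cell) → Bool} {F G : Frag T Φ} {k : ℕ}
    {m : Mem T Φ} {t : Tree (Mem T Φ)} (h : test m.flag m.scan = false) (hG : G.Runs k m t) :
    (ite test F G).Runs (1 + k) m t := by
  let φ : Option G.Q × Mem T Φ → Option (ite test F G).Q × Mem T Φ :=
    fun p => (p.1.map fun q => some (.inr q), p.2)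
  have hφ : Function.Injective φ :=
    (Option.map_injective ((Option.some_injective _).comp
      (Sum.inr_injective (α := F.Q)))).prodMap Function.injective_id
  have h₁ := Reach.map (nx' := (ite test F G).nx) hφ (by
    rintro b ⟨_ | q, m⟩ d h
    · cases h
    · simp only [nx, Option.some.injEq] at h
      subst h
      simp [nx, φ, ite]) hG
  rw [add_comm]
  refine Reach.det (c' := φ (some G.start, m)) (fun b => ?_) (by rw [Tree.map_map] at h₁; exact h₁)
  simp [nx, ite, h, φ, act_stay]

/-- As long as the test succeeds, do `a` and then run `F`. -/
def whil (test : (T → Cell) → Bool) (a : (T → Cell) → T → Cell × Move) (F : Frag T Φ) :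
    Frag T Φ where
  Q := Option F.Q
  start := none
  trans
    | none, fl, sy, _ =>
      if test sy then (some (some F.start), fl, a sy) else (none, fl, mv sy fun _ => .stay)
    | some q, fl, sy, b => (some (F.trans q fl sy b).1, (F.trans q fl sy b).2)

theorem whil_stop {test : (T → Cell) → Bool} {a : (T → Cell) → T → Cell × Move} {F : Frag T Φ}
    {m : Mem T Φ} (h : test m.scan = false) : (whil test a F).Runs 1 m (.leaf m) :=
  Reach.one fun b => by simp [nx, whil, h, act_stay]

theorem whil_round {test : (T → Cell) → Bool} {a : (T → Cell) → T → Cell × Move} {F : Frag T Φ}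
    {m : Mem T Φ} {k : ℕ} {t : Tree (Mem T Φ)} (h : test m.scan = true)
    (hF : F.Runs k (m.act (m.flag, a m.scan)) t) :
    Reach (whil test a F).nx (k + 1) (some none, m) (t.map (Prod.mk (some none))) := by
  let φ : Option F.Q × Mem T Φ → Option (whil test a F).Q × Mem T Φ := fun p => (some p.1, p.2)
  have hφ : Function.Injective φ :=
    (Option.some_injective _).prodMap Function.injective_id
  have h₁ := Reach.map (nx' := (whil test a F).nx) hφ (by
    rintro b ⟨_ | q, m⟩ d h
    · cases h
    · simp only [nx, Option.some.injEq] at h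
      subst h
      simp [nx, φ, whil]) hF
  refine Reach.det (c' := φ (some F.start, m.act (m.flag, a m.scan))) (fun b => ?_)
    (by rw [Tree.map_map] at h₁; exact h₁)
  simp [nx, whil, h, φ]

end Frag
end QuantLogic

namespace QuantLogic

/-! ### Compiling loop programs -/

section Compile

variable {K Fl : Type} [DecidableEq K] [DecidableEq Fl]

/-- The tape that holds `c` in the cells `0, 1, ...` and the mark of the left end in cell `-1`. -/
def tapeOf (c : ℕ → Option Bool) (z : ℤ) : Cell :=
  if 0 ≤ z then (c z.toNat).map Sum.inl else if z = -1 then some (.inr ()) else none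

/-- The tape that holds the mark of the left end in cell `0`. -/
def backTape (z : ℤ) : Cell := if z = 0 then some (.inr ()) else none

/-- The tapes of the compiled machine: those of the program, and one for each nesting depth of
loops, which holds the number of remaining rounds. -/
abbrev TapeIx (A : Finset K) (H : ℕ) : Type := {k // k ∈ A} ⊕ Fin H

variable (A : Finset K) (G : Finset Fl) (H : ℕ)

/-- The machine memory for given contents, flags and head positions. -/
def rep (cont : K → ℕ → Option Bool) (fl : Fl → Bool) (hd : K → ℤ) (bk : ℕ → ℤ) :
    Mem (TapeIx A H) {f // f ∈ G} where
  flag f := fl f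
  tape
    | .inl k => tapeOf (cont k)
    | .inr _ => backTape
  head
    | .inl k => hd k
    | .inr j => bk j

/-- The machine memory for a program state. -/
def repS (bk : ℕ → ℤ) (s : State K Fl) : Mem (TapeIx A H) {f // f ∈ G} :=
  rep A G H s.cont s.flag (fun k => s.head k) bk

/-- The symbol scanned on a tape of the program. -/
def symAt (sy : TapeIx A H → Cell) (k : K) : Cell :=
  if h : k ∈ A then sy (.inl ⟨k, h⟩) else none

/-- The symbol scanned on the tape of a nesting depth. -/
def backAt (sy : TapeIx A H → Cell) (j : ℕ) : Cell :=
  if h : j < H then sy (.inr ⟨j, h⟩) else none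

/-- Move the head of `k` and that of nesting depth `j`. -/
def mvs (k : K) (d : Move) (j : ℕ) (e : Move) : TapeIx A H → Move
  | .inl k' => if k'.1 = k then d else .stay
  | .inr j' => if j'.1 = j then e else .stay

variable {A G H}

theorem act_mvs (cont : K → ℕ → Option Bool) (fl : Fl → Bool) (hd : K → ℤ) (bk : ℕ → ℤ) (k : K)
    (d : Move) (j : ℕ) (e : Move) :
    (rep A G H cont fl hd bk).act ((rep A G H cont fl hd bk).flag,
        Frag.mv (rep A G H cont fl hd bk).scan (mvs A H k d j e)) =
      rep A G H cont fl (Function.update hd k (hd k + d.toInt))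
        (Function.update bk j (bk j + e.toInt)) := by
  rw [Frag.act_mv]
  ext x z
  · rfl
  · cases x <;> rfl
  · cases x with
    | inl k' =>
      simp only [rep, mvs, Function.update_apply]
      split_ifs with h
      · rw [h]
      · simp [Move.toInt]
    | inr j' =>
      simp only [rep, mvs, Function.update_apply]
      split_ifs with h
      · rw [h]
      · simp [Move.toInt]

theorem rep_update_ge (cont : K → ℕ → Option Bool) (fl : Fl → Bool) (hd : K → ℤ) (bk : ℕ → ℤ)
    {j : ℕ} (h : H ≤ j) (x : ℤ) :
    rep A G H cont fl hd (Function.update bk j x) = rep A G H cont fl hd bk := by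
  have : ∀ i : Fin H, (i : ℕ) ≠ j := fun i => by have := i.2; omega
  ext y z
  · rfl
  · cases y <;> rfl
  · cases y with
    | inl k => rfl
    | inr i => simp [rep, Function.update_of_ne (this i)]

theorem symAt_scan {k : K} (hk : k ∈ A) (cont : K → ℕ → Option Bool) (fl : Fl → Bool)
    (hd : K → ℤ) (bk : ℕ → ℤ) :
    symAt A H (rep A G H cont fl hd bk).scan k = tapeOf (cont k) (hd k) := by
  simp [symAt, hk, Mem.scan, rep]

theorem backAt_scan {j : ℕ} (hj : j < H) (cont : K → ℕ → Option Bool) (fl : Fl → Bool)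
    (hd : K → ℤ) (bk : ℕ → ℤ) :
    backAt A H (rep A G H cont fl hd bk).scan j = backTape (bk j) := by
  simp [backAt, hj, Mem.scan, rep]

theorem tapeOf_nat (c : ℕ → Option Bool) (i : ℕ) : tapeOf c i = (c i).map Sum.inl := by
  simp [tapeOf]

theorem repS_setHead (bk : ℕ → ℤ) (s : State K Fl) (k : K) (i : ℕ) :
    repS A G H bk (s.setHead k i) =
      rep A G H s.cont s.flag (Function.update (fun k => (s.head k : ℤ)) k i) bk := by
  unfold repS
  congr 1
  funext k'
  by_cases h : k' = k
  · subst h; simp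
  · simp [h]

variable (A G H)

/-- Move the head of `k` to its position `0`; the head of nesting depth `j` moves to the right as
many times. -/
def transfer (k : K) (j : ℕ) : Frag (TapeIx A H) {f // f ∈ G} :=
  Frag.spin (fun sy => decide (symAt A H sy k ≠ some (.inr ())))
    (fun sy => Frag.mv sy (mvs A H k .left j .right))
    (fun sy => Frag.mv sy (mvs A H k .right j .left))

/-- The machine of a program inside `h` nested loops. -/
def comp : ℕ → Cmd K Fl → Frag (TapeIx A H) {f // f ∈ G}
  | _, .skip => .prim fun fl sy _ => (fl, Frag.mv sy fun _ => .stay)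
  | _, .right k => .prim fun fl sy _ => (fl, Frag.mv sy (mvs A H k .right H .stay))
  | _, .reset k => transfer A G H k H
  | _, .write k o => .prim fun fl sy _ => (fl, fun
      | .inl k' => (if k'.1 = k then o.map Sum.inl else sy (.inl k'), .stay)
      | .inr j => (sy (.inr j), .stay))
  | h, .iteSym k o c₁ c₂ =>
    .ite (fun _ sy => decide (symAt A H sy k = o.map Sum.inl)) (comp h c₁) (comp h c₂)
  | _, .setF f b => .prim fun fl sy _ =>
      ((fun f' => if f'.1 = f then b else fl f'), Frag.mv sy fun _ => .stay)
  | h, .iteF f c₁ c₂ =>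
    .ite (fun fl _ => if hf : f ∈ G then fl ⟨f, hf⟩ else false) (comp h c₁) (comp h c₂)
  | _, .toss f => .prim fun fl sy b =>
      ((fun f' => if f'.1 = f then b else fl f'), Frag.mv sy fun _ => .stay)
  | h, .seq c₁ c₂ => .seq (comp h c₁) (comp h c₂)
  | h, .loop k c => .seq (transfer A G H k h)
      (.whil (fun sy => decide (backAt A H sy h ≠ some (.inr ())))
        (fun sy => Frag.mv sy (mvs A H k .stay h .left))
        (.seq (comp (h + 1) c)
          (.prim fun fl sy _ => (fl, Frag.mv sy (mvs A H k .right H .stay)))))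

variable {A G H}

/-- The loop ends on the mark in cell `-1`, and the last step undoes one move of both heads. The
case that the head starts there is what the induction needs. -/
theorem transfer_runs {k : K} (hk : k ∈ A) (j : ℕ) (cont : K → ℕ → Option Bool) (fl : Fl → Bool)
    (n : ℕ) (hd : K → ℤ) (bk : ℕ → ℤ) (hn : hd k = (n : ℤ) - 1) :
    (transfer A G H k j).Runs (n + 1) (rep A G H cont fl hd bk)
      (.leaf (rep A G H cont fl (Function.update hd k 0)
        (Function.update bk j (bk j + n - 1)))) := by
  induction n generalizing hd bk with
  | zero =>
    have h := Frag.spin_stop (test := fun sy => decide (symAt A H sy k ≠ some (.inr ())))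
      (a := fun sy => Frag.mv sy (mvs A H k .left j .right))
      (a' := fun sy => Frag.mv sy (mvs A H k .right j .left))
      (m := rep A G H cont fl hd bk) (by
        rw [symAt_scan hk, hn]; simp [tapeOf])
    rw [act_mvs] at h
    simpa [transfer, hn, Move.toInt, sub_eq_add_neg] using h
  | succ n ih =>
    refine Frag.spin_go ?_ ?_
    · rw [symAt_scan hk, hn]
      simp only [Nat.cast_add, Nat.cast_one, add_sub_cancel_right, tapeOf_nat]
      cases cont k n <;> simp
    · rw [act_mvs]
      have := ih (Function.update hd k (hd k + Move.left.toInt))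
        (Function.update bk j (bk j + Move.right.toInt)) (by simp [hn, Move.toInt]; ring)
      rw [Function.update_idem, Function.update_idem, Function.update_self] at this
      convert this using 4
      · rfl
      · simp only [Move.toInt]; push_cast; ring

theorem right_runs {k : K} (bk : ℕ → ℤ) (s : State K Fl) :
    (Frag.prim fun fl sy _ => (fl, Frag.mv sy (mvs A H k .right H .stay)) :
      Frag _ {f // f ∈ G}).Runs 1 (repS A G H bk s)
        (.leaf (repS A G H bk (s.setHead k (s.head k + 1)))) := by
  refine Frag.prim_runs fun _ => ?_
  have := act_mvs (A := A) (G := G) (H := H) s.cont s.flag (fun k => (s.head k : ℤ)) bk k .right H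
    .stay
  rw [rep_update_ge _ _ _ _ le_rfl] at this
  rw [repS_setHead]
  exact this.trans (by simp [Move.toInt])

theorem setFlag_act (bk : ℕ → ℤ) (s : State K Fl) (f : Fl) (b : Bool) :
    (repS A G H bk s).act ((fun f' => if f'.1 = f then b else (repS A G H bk s).flag f'),
        Frag.mv (repS A G H bk s).scan fun _ => .stay) = repS A G H bk (s.setFlag f b) := by
  rw [Frag.act_mv]
  ext x z
  · simp [repS, rep, Function.update_apply]
  · rfl
  · simp [Move.toInt]; rfl

/-- The compiled machine simulates the program within `cost` steps, with the same coins. The tapes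
of the loops that are not running are at their marks. -/
theorem comp_runs {c : Cmd K Fl} {h : ℕ} (hA : c.tapes ⊆ A) (hG : c.flags ⊆ G)
    (hH : h + c.depth ≤ H) (hs : c.Safe) {bk : ℕ → ℤ} (hbk : ∀ j, h ≤ j → bk j = 0)
    (s : State K Fl) :
    (comp A G H h c).Runs (c.cost s) (repS A G H bk s) ((c.den s).map (repS A G H bk)) := by
  induction c generalizing h bk s with
  | skip => exact Frag.prim_runs fun _ => Frag.act_stay _
  | right k => exact right_runs bk s
  | reset k =>
    have hk : k ∈ A := hA (by simp [Cmd.tapes])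
    have := transfer_runs (G := G) (H := H) hk H s.cont s.flag (s.head k + 1)
      (fun k => s.head k) bk (by push_cast; ring)
    rw [rep_update_ge _ _ _ _ le_rfl] at this
    rw [Cmd.den, Tree.map_leaf, repS_setHead]
    exact this
  | write k o =>
    refine Frag.prim_runs fun _ => ?_
    ext x z
    · rfl
    · cases x with
      | inl k' =>
        simp only [Mem.act, repS, rep, State.setCell_cont]
        by_cases hk : k'.1 = k
        · subst hk
          simp only [if_true, Function.update_self]
          by_cases hz : z = (s.head k'.1 : ℤ)
          · subst hz; simp [tapeOf_nat]
          · rw [Function.update_of_ne hz]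
            simp only [tapeOf]
            split_ifs with h0
            · rw [Function.update_of_ne]
              intro e; apply hz; omega
            all_goals rfl
        · simp only [hk, if_false, Mem.scan, ne_eq, not_false_eq_true, Function.update_of_ne]
          rw [Function.update_eq_self]
      | inr j =>
        simp only [Mem.act, Mem.scan, Function.update_eq_self]
        rfl
    · cases x <;> simp [Mem.act, repS, rep, Move.toInt]
  | iteSym k o c₁ c₂ h₁ h₂ =>
    simp only [Cmd.tapes, Cmd.flags, Cmd.depth, Cmd.Safe, Finset.union_subset_iff,
      Finset.singleton_subset_iff] at hA hG hH hs
    have ht : (decide (symAt A H (repS A G H bk s).scan k = o.map Sum.inl) = true) ↔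
        s.cont k (s.head k) = o := by
      rw [repS, symAt_scan hA.1, tapeOf_nat, decide_eq_true_eq]
      exact (Option.map_injective Sum.inl_injective).eq_iff
    rw [Cmd.den, Cmd.cost]
    split_ifs with hc
    · exact (Frag.ite_runs_true (ht.2 hc) (h₁ hA.2.1 hG.1 (by omega) hs.1 hbk s)).mono (by omega)
    · exact (Frag.ite_runs_false (by rw [← ht] at hc; simpa using hc)
        (h₂ hA.2.2 hG.2 (by omega) hs.2 hbk s)).mono (by omega)
  | setF f b => exact Frag.prim_runs fun _ => setFlag_act bk s f b
  | iteF f c₁ c₂ h₁ h₂ =>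
    simp only [Cmd.tapes, Cmd.flags, Cmd.depth, Cmd.Safe, Finset.union_subset_iff,
      Finset.singleton_subset_iff] at hA hG hH hs
    have ht : (if hf : f ∈ G then (repS A G H bk s).flag ⟨f, hf⟩ else false) = s.flag f := by
      simp [hG.1, repS, rep]
    rw [Cmd.den, Cmd.cost]
    split_ifs with hc
    · exact (Frag.ite_runs_true (ht.trans hc)
        (h₁ hA.1 hG.2.1 (by omega) hs.1 hbk s)).mono (by omega)
    · exact (Frag.ite_runs_false (ht.trans (by simpa using hc))
        (h₂ hA.2 hG.2.2 (by omega) hs.2 hbk s)).mono (by omega)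
  | toss f =>
    have hf : f ∈ G := hG (by simp [Cmd.flags])
    refine Reach.coin (c₀ := (none, repS A G H bk (s.setFlag f false)))
      (c₁ := (none, repS A G H bk (s.setFlag f true))) ?_ ?_ ?_ (.refl _ _) (.refl _ _)
    · simp [Frag.nx, comp, Frag.prim, ← setFlag_act]
    · simp [Frag.nx, comp, Frag.prim, ← setFlag_act]
    · intro e
      have := congrFun (congrArg Mem.flag (congrArg Prod.snd e)) ⟨f, hf⟩
      simp [repS, rep] at this
  | seq c₁ c₂ h₁ h₂ =>
    simp only [Cmd.tapes, Cmd.flags, Cmd.depth, Cmd.Safe, Finset.union_subset_iff] at hA hG hH hs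
    have := Frag.seq_runs (h₁ hA.1 hG.1 (by omega) hs.1 hbk s)
      (G := comp A G H h c₂) (j := (c₁.den s).sup c₂.cost)
      (u := fun s' => (c₂.den s').map (repS A G H bk))
      ((Tree.all_le_sup c₂.cost (c₁.den s)).mono fun s' hs' =>
        (h₂ hA.2 hG.2 (by omega) hs.2 hbk s').mono hs')
    rw [Cmd.den, Tree.map_bind]
    exact this
  | loop k c ih =>
    simp only [Cmd.tapes, Cmd.flags, Cmd.depth, Cmd.Safe, Finset.union_subset_iff,
      Finset.singleton_subset_iff] at hA hG hH hs
    set n := s.head k with hn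
    have h₁ := transfer_runs (G := G) (H := H) hA.1 h s.cont s.flag (n + 1)
      (fun k => s.head k) bk (by push_cast; ring)
    have e₁ : rep A G H s.cont s.flag (Function.update (fun k => (s.head k : ℤ)) k 0)
        (Function.update bk h (bk h + (n + 1 : ℕ) - 1)) =
        repS A G H (Function.update bk h n) (s.setHead k 0) := by
      rw [repS_setHead, hbk h le_rfl]; congr 2; push_cast; ring
    rw [e₁] at h₁
    set f : ℕ → State K Fl → Tree (State K Fl) :=
      fun i s' => (c.den (s'.setHead k i)).map (State.setHead k n) with hf
    -- the machine of the loop body, and the state of the machine after `j` rounds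
    set B : Frag (TapeIx A H) {f // f ∈ G} := .seq (comp A G H (h + 1) c)
      (.prim fun fl sy _ => (fl, Frag.mv sy (mvs A H k .right H .stay))) with hB
    set W : Frag (TapeIx A H) {f // f ∈ G} := .whil
      (fun sy => decide (backAt A H sy h ≠ some (.inr ())))
      (fun sy => Frag.mv sy (mvs A H k .stay h .left)) B with hW
    let r : ℕ → State K Fl → Option W.Q × Mem (TapeIx A H) {f // f ∈ G} := fun j s' =>
      (some none, repS A G H (Function.update bk h ((n : ℤ) - j)) (s'.setHead k j))
    have hround : ∀ j < n, ∀ s', Reach W.nx (c.cost (s'.setHead k j) + 2) (r j s')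
        ((f j s').map (r (j + 1))) := by
      intro j hj s'
      have hbody := Frag.seq_runs (ih (h := h + 1) hA.2 hG (by omega) hs.2
          (bk := Function.update bk h ((n : ℤ) - (j + 1 : ℕ)))
          (fun i hi => by rw [Function.update_of_ne (by omega)]; exact hbk i (by omega))
          (s'.setHead k j)) (j := 1)
        (G := .prim fun fl sy _ => (fl, Frag.mv sy (mvs A H k .right H .stay)))
        (u := fun s'' => .leaf (repS A G H (Function.update bk h ((n : ℤ) - (j + 1 : ℕ)))
          (s''.setHead k (j + 1))))
        ((hs.1.all_head _).mono fun s'' hs'' => by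
          have := right_runs (A := A) (G := G) (H := H) (k := k)
            (Function.update bk h ((n : ℤ) - (j + 1 : ℕ))) s''
          rw [hs''] at this
          simpa using this)
      have := Frag.whil_round (test := fun sy => decide (backAt A H sy h ≠ some (.inr ())))
        (a := fun sy => Frag.mv sy (mvs A H k .stay h .left)) (F := B)
        (m := repS A G H (Function.update bk h ((n : ℤ) - j)) (s'.setHead k j)) (by
          rw [repS, backAt_scan (by omega)]
          have : (n : ℤ) - j ≠ 0 := by omega
          simp [backTape, this]) (k := c.cost (s'.setHead k j) + 1)
        (t := (c.den (s'.setHead k j)).bind fun s'' =>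
          .leaf (repS A G H (Function.update bk h ((n : ℤ) - (j + 1 : ℕ)))
          (s''.setHead k (j + 1)))) (by
          rw [repS, act_mvs]
          convert hbody using 1
          rw [repS]
          simp only [Move.toInt, add_zero, Function.update_idem, Function.update_eq_self,
            Function.update_self]
          congr 2
          push_cast; ring)
      simp only [hf, Tree.map_map, State.setHead_setHead, r]
      rw [Tree.map_bind] at this
      exact this
    have hloop : ∀ j ≤ n, Reach W.nx (∑ i ∈ Finset.range j,
        ((loopM f i s).sup (fun s' => c.cost (s'.setHead k i)) + 2)) (r 0 s)
        ((loopM f j s).map (r j)) := by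
      intro j
      induction j with
      | zero => exact fun _ => Reach.refl _ _
      | succ j ihj =>
        intro hj
        rw [Finset.sum_range_succ, loopM, Tree.map_bind]
        refine (ihj (by omega)).trans ?_
        exact (Tree.all_le_sup _ _).mono fun s' hs' =>
          (hround j (by omega) s').mono (Nat.add_le_add_right hs' 2)
    have hend : (loopM f n s).All fun s' => Reach W.nx 1 (r n s')
        (.leaf (none, repS A G H bk s')) := by
      have hhead : (loopM f n s).All fun s' : State K Fl => s'.head k = n := by
        refine Cmd.all_loopM (p := fun _ (s' : State K Fl) => s'.head k = n) hn.symm ?_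
        intro i _ a _
        rw [hf, Tree.all_map]
        exact Tree.all_of_forall (fun b => by simp) _
      refine hhead.mono fun s' hs' => ?_
      have e : Function.update bk h 0 = bk := by
        rw [← hbk h le_rfl]; exact Function.update_eq_self _ _
      have := Frag.whil_stop (test := fun sy => decide (backAt A H sy h ≠ some (.inr ())))
        (a := fun sy => Frag.mv sy (mvs A H k .stay h .left)) (F := B)
        (m := repS A G H bk s') (by
          rw [repS, backAt_scan (by omega), hbk h le_rfl]
          simp [backTape])
      have e₂ : r n s' = (some none, repS A G H bk s') := by
        simp only [r, sub_self, e, State.setHead_self hs']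
        rfl
      rw [e₂]
      exact this
    have hwhil : W.Runs (∑ i ∈ Finset.range n,
        ((loopM f i s).sup (fun s' => c.cost (s'.setHead k i)) + 2) + 1)
        (repS A G H (Function.update bk h n) (s.setHead k 0))
        ((loopM f n s).map (repS A G H bk)) := by
      have := (hloop n le_rfl).trans hend
      rw [Frag.Runs, Tree.map_map]
      convert this using 1
      · simp [r]; rfl
      · rfl
    have := Frag.seq_runs (α := State K Fl) (t := .leaf (s.setHead k 0))
      (r := repS A G H (Function.update bk h n))
      (u := fun _ => (loopM f n s).map (repS A G H bk)) h₁ hwhil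
    rw [Cmd.den, Cmd.cost]
    exact this

variable (A G H)

/-- Before the program starts: put down the marks, count the length of the input on `len`. -/
def prologue (inp len : K) (F : Frag (TapeIx A H) {f // f ∈ G}) : Frag (TapeIx A H) {f // f ∈ G} :=
  .seq (.prim fun fl sy _ => (fl, fun
      | .inl k => (sy (.inl k), .left)
      | .inr _ => (some (.inr ()), .stay)))
  (.seq (.prim fun fl sy _ => (fl, fun
      | .inl _ => (some (.inr ()), .right)
      | .inr j => (sy (.inr j), .stay)))
  (.seq (.spin (fun sy => decide (symAt A H sy inp ≠ none))
      (fun sy => Frag.mv sy fun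
        | .inl k => if k.1 = inp ∨ k.1 = len then .right else .stay
        | .inr _ => .stay)
      (fun sy => Frag.mv sy fun _ => .stay))
  (.seq (transfer A G H inp H) F)))

variable {A G H}

/-- The state in which a program is started on the input `w`. -/
def State.start (inp len : K) (w : List Bool) : State K Fl where
  cont k i := if k = inp then w[i]? else none
  head k := if k = len then w.length else 0
  flag _ := false

theorem scan_runs {inp len : K} (hi : inp ∈ A) (w : List Bool) (fl : Fl → Bool) (bk : ℕ → ℤ)
    (n i : ℕ) (hn : i + n = w.length) :
    (Frag.spin (fun sy => decide (symAt A H sy inp ≠ none))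
      (fun sy => Frag.mv sy fun
        | .inl k => if k.1 = inp ∨ k.1 = len then .right else .stay
        | .inr _ => .stay)
      (fun sy => Frag.mv sy fun _ => .stay) : Frag _ {f // f ∈ G}).Runs (n + 1)
      (rep A G H (State.start (Fl := Fl) inp len w).cont fl
        (fun k => if k = inp ∨ k = len then (i : ℤ) else 0) bk)
      (.leaf (rep A G H (State.start (Fl := Fl) inp len w).cont fl
        (fun k => if k = inp ∨ k = len then (w.length : ℤ) else 0) bk)) := by
  induction n generalizing i with
  | zero =>
    obtain rfl : i = w.length := by omega
    refine Reach.mono (k := 1) ?_ (by omega)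
    have := Frag.spin_stop (T := TapeIx A H) (Φ := {f // f ∈ G})
      (test := fun sy => decide (symAt A H sy inp ≠ none))
      (a := fun sy => Frag.mv sy fun
        | .inl k => if k.1 = inp ∨ k.1 = len then .right else .stay
        | .inr _ => .stay)
      (a' := fun sy => Frag.mv sy fun _ => .stay)
      (m := rep A G H (State.start (Fl := Fl) inp len w).cont fl
        (fun k => if k = inp ∨ k = len then (w.length : ℤ) else 0) bk) (by
        rw [symAt_scan hi]
        simp [State.start, tapeOf_nat])
    rw [Frag.act_stay] at this
    exact this
  | succ n ih =>
    refine Frag.spin_go ?_ ?_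
    · rw [symAt_scan hi]
      have : i < w.length := by omega
      simp [State.start, tapeOf_nat, this]
    · rw [Frag.act_mv]
      convert ih (i + 1) (by omega) using 1
      ext x z
      · rfl
      · rfl
      · cases x with
        | inl k =>
          simp only [rep]
          by_cases h : k.1 = inp ∨ k.1 = len
          · simp [h, Move.toInt]
          · simp [h, Move.toInt]
        | inr j => simp [rep, Move.toInt]

theorem prologue_runs {inp len : K} (hi : inp ∈ A) (hne : inp ≠ len) (w : List Bool)
    {F : Frag (TapeIx A H) {f // f ∈ G}} {k : ℕ} {t : Tree (Mem (TapeIx A H) {f // f ∈ G})}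
    (hF : F.Runs k (repS A G H (fun _ => 0) (State.start inp len w)) t) :
    (prologue A G H inp len F).Runs (2 * w.length + 5 + k)
      ⟨fun _ => false,
        fun x z => if x = .inl ⟨inp, hi⟩ then
          (if 0 ≤ z then (w[z.toNat]?).map Sum.inl else none) else none, fun _ => 0⟩ t := by
  have h₄ : Frag.Runs (.seq (transfer A G H inp H) F) (w.length + 2 + k)
      (rep A G H (State.start (Fl := Fl) inp len w).cont (fun _ => false)
        (fun k => if k = inp ∨ k = len then (w.length : ℤ) else 0) fun _ => 0) t := by
    have h := transfer_runs (G := G) (H := H) hi H (State.start (Fl := Fl) inp len w).cont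
      (fun _ => false) (w.length + 1)
      (fun k => if k = inp ∨ k = len then (w.length : ℤ) else 0) (fun _ => 0) (by simp)
    rw [rep_update_ge _ _ _ _ le_rfl] at h
    refine Frag.seq_runs (α := Unit) (t := .leaf ())
      (r := fun _ => repS A G H (fun _ => 0) (State.start inp len w)) (u := fun _ => t) ?_ hF
    convert h using 2
    simp only [repS, Tree.map_leaf]
    congr 2
    funext k
    by_cases h1 : k = inp
    · subst h1; simp [State.start, hne]
    · simp [State.start, h1]
  have h₃ := Frag.seq_runs (α := Unit) (t := .leaf ()) (u := fun _ => t)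
    (r := fun _ => rep A G H (State.start (Fl := Fl) inp len w).cont (fun _ => false)
        (fun k => if k = inp ∨ k = len then (w.length : ℤ) else 0) fun _ => 0)
    (scan_runs (len := len) hi w (fun _ => false) (fun _ => 0) w.length 0 (by omega)) h₄
  have h₂ := Frag.seq_runs (α := Unit) (t := .leaf ()) (u := fun _ => t) (k := 1)
    (F := .prim fun fl sy _ => (fl, fun
      | .inl _ => (some (.inr ()), .right)
      | .inr j => (sy (.inr j), .stay)))
    (m := ⟨fun _ => false, fun x z => match x with
        | .inl k => if k.1 = inp then (if 0 ≤ z then (w[z.toNat]?).map Sum.inl else none) else none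
        | .inr _ => backTape z, fun x => match x with
        | .inl _ => -1
        | .inr _ => 0⟩) (r := fun _ => _) (Frag.prim_runs fun b => by
      ext x z
      · rfl
      · cases x with
        | inl k =>
          by_cases hz : z = -1
          · subst hz; simp [Mem.act, rep, tapeOf]
          · simp only [Mem.act, rep, Function.update_of_ne hz, tapeOf, hz, if_false, State.start]
            split_ifs <;> simp
        | inr j => simp only [Mem.act, rep, Mem.scan, Function.update_eq_self]
      · cases x with
        | inl k => simp [Mem.act, rep, Move.toInt]
        | inr j => simp [Mem.act, rep, Move.toInt]) h₃
  have h₁ := Frag.seq_runs (α := Unit) (t := .leaf ()) (u := fun _ => t) (k := 1)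
    (F := .prim fun fl sy _ => (fl, fun
      | .inl k => (sy (.inl k), .left)
      | .inr _ => (some (.inr ()), .stay)))
    (m := ⟨fun _ => false,
        fun x z => if x = .inl ⟨inp, hi⟩ then
          (if 0 ≤ z then (w[z.toNat]?).map Sum.inl else none) else none, fun _ => 0⟩)
    (r := fun _ => _) (Frag.prim_runs fun b => by
      ext x z
      · rfl
      · cases x with
        | inl k =>
          simp only [Mem.act, Mem.scan, Function.update_eq_self]
          simp [Subtype.ext_iff]
        | inr j =>
          by_cases hz : z = 0
          · subst hz; simp [Mem.act, backTape]
          · simp [Mem.act, backTape, hz]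
      · cases x with
        | inl k => simp [Mem.act, Move.toInt]
        | inr j => simp [Mem.act, Move.toInt]) h₂
  exact h₁.mono (by omega)

end Compile

namespace Frag

variable {T Φ : Type} [Fintype T] [DecidableEq T] [Fintype Φ] [DecidableEq Φ]

/-- A fragment as a machine; the exit is the only halting state. -/
def toTM (F : Frag T Φ) (inp out : T) : TM where
  K := T
  inp := inp
  out := out
  Aux := Unit
  Q := Option F.Q × (Φ → Bool)
  start := (some F.start, fun _ => false)
  trans q sy := q.1.map fun q' b =>
    (((F.trans q' q.2 sy b).1, (F.trans q' q.2 sy b).2.1), (F.trans q' q.2 sy b).2.2)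

/-- The configuration of the machine for a control state and a memory. -/
def cfg (F : Frag T Φ) (inp out : T) (p : Option F.Q × Mem T Φ) : (F.toTM inp out).Cfg where
  state := (p.1, p.2.flag)
  tape := p.2.tape
  head := p.2.head

theorem next_cfg (F : Frag T Φ) (inp out : T) (b : Bool) (p : Option F.Q × Mem T Φ) :
    (F.toTM inp out).next b (F.cfg inp out p) = (F.nx b p).map (F.cfg inp out) := by
  rcases p with ⟨_ | q, m⟩ <;> rfl

theorem reach_toTM {F : Frag T Φ} {inp out : T} {k : ℕ} {m : Mem T Φ} {t : Tree (Mem T Φ)}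
    (h : F.Runs k m t) : Reach (F.toTM inp out).next k (F.cfg inp out (some F.start, m))
      (t.map fun m' => F.cfg inp out (none, m')) := by
  have hi : Function.Injective (F.cfg inp out) := by
    rintro ⟨q, m⟩ ⟨q', m'⟩ e
    have e₁ := congrArg TM.Cfg.state e
    have e₂ := congrArg TM.Cfg.tape e
    have e₃ := congrArg TM.Cfg.head e
    exact Prod.ext (Prod.mk.inj e₁).1 (Mem.ext (Prod.mk.inj e₁).2 e₂ e₃)
  have := Reach.map (nx' := (F.toTM inp out).next) hi
    (fun b p d hd => by rw [next_cfg, hd]; rfl) h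
  rwa [Tree.map_map] at this

end Frag

/-- Every safe loop program is executed by a machine, with the same tree of coin tosses. -/
theorem Cmd.exists_machine {K Fl : Type} [DecidableEq K] [DecidableEq Fl] {c : Cmd K Fl}
    (hs : c.Safe) {inp len : K} (out : K) (hne : inp ≠ len) :
    ∃ (M : TM) (g : State K Fl → M.Cfg), (∀ s, M.Halted (g s)) ∧
      (∀ s (i : ℕ), (g s).tape M.out i = (s.cont out i).map Sum.inl) ∧
      ∀ w, Reach M.next (2 * w.length + 5 + c.cost (State.start inp len w)) (M.init w)
        ((c.den (State.start inp len w)).map g) := by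
  let A : Finset K := {inp, out} ∪ c.tapes
  have hi : inp ∈ A := by simp [A]
  have ho : out ∈ A := by simp [A]
  let F := prologue A c.flags c.depth inp len (comp A c.flags c.depth 0 c)
  refine ⟨F.toTM (.inl ⟨inp, hi⟩) (.inl ⟨out, ho⟩),
    fun s => F.cfg _ _ (none, repS A c.flags c.depth (fun _ => 0) s), fun s b => ?_, fun s i => ?_,
    fun w => ?_⟩
  · rw [Frag.next_cfg]; rfl
  · exact tapeOf_nat _ _
  · have h₁ := comp_runs (A := A) (G := c.flags) (H := c.depth) (h := 0) (c := c)
      Finset.subset_union_right subset_rfl (by omega) hs (bk := fun _ => 0) (fun _ _ => rfl)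
      (State.start inp len w)
    have h₂ := Frag.reach_toTM (inp := .inl ⟨inp, hi⟩) (out := .inl ⟨out, ho⟩)
      (prologue_runs hi hne w h₁)
    rw [Tree.map_map] at h₂
    convert h₂ using 1
    refine TM.Cfg.ext rfl (funext fun (x : TapeIx A c.depth) => funext fun z => ?_) rfl
    show (if x = Sum.inl ⟨inp, hi⟩ then TM.wordTape (F.toTM _ _) w else fun _ => none) z =
      if x = Sum.inl ⟨inp, hi⟩ then (if 0 ≤ z then (w[z.toNat]?).map Sum.inl else none) else none
    by_cases hx : x = Sum.inl ⟨inp, hi⟩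
    · rw [if_pos hx, if_pos hx]; rfl
    · rw [if_neg hx, if_neg hx]

end QuantLogic

namespace QuantLogic

/-! ### Polynomial time -/

namespace Cmd

variable {K Fl : Type} [DecidableEq K] [DecidableEq Fl]

/-- All loops are over registers in `L`, and only loops move the heads of these. -/
def WF (L : K → Prop) : Cmd K Fl → Prop
  | right k => ¬ L k
  | reset k => ¬ L k
  | iteSym _ _ c₁ c₂ => c₁.WF L ∧ c₂.WF L
  | iteF _ c₁ c₂ => c₁.WF L ∧ c₂.WF L
  | seq c₁ c₂ => c₁.WF L ∧ c₂.WF L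
  | loop k c => L k ∧ c.WF L
  | _ => True

variable {L : K → Prop}

theorem WF.keeps {c : Cmd K Fl} (h : c.WF L) {k : K} (hk : L k) : c.Keeps k := by
  induction c with
  | right k' => exact fun e => h (e ▸ hk)
  | reset k' => exact fun e => h (e ▸ hk)
  | iteSym _ _ c₁ c₂ h₁ h₂ => exact ⟨h₁ h.1, h₂ h.2⟩
  | iteF _ c₁ c₂ h₁ h₂ => exact ⟨h₁ h.1, h₂ h.2⟩
  | seq c₁ c₂ h₁ h₂ => exact ⟨h₁ h.1, h₂ h.2⟩
  | loop k' c ih => exact ih h.2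
  | _ => trivial

theorem WF.safe {c : Cmd K Fl} (h : c.WF L) : c.Safe := by
  induction c with
  | iteSym _ _ c₁ c₂ h₁ h₂ => exact ⟨h₁ h.1, h₂ h.2⟩
  | iteF _ c₁ c₂ h₁ h₂ => exact ⟨h₁ h.1, h₂ h.2⟩
  | seq c₁ c₂ h₁ h₂ => exact ⟨h₁ h.1, h₂ h.2⟩
  | loop k' c ih => exact ⟨h.2.keeps h.1, ih h.2⟩
  | _ => trivial

/-- Loops over registers that keep the bound `B` take time polynomial in `B`, up to a factor that
is linear in the head positions, and move every head polynomially far. -/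
theorem WF.bound {c : Cmd K Fl} (h : c.WF L) : ∃ p : Polynomial ℕ, ∀ (B H : ℕ) (s : State K Fl),
    (∀ k, L k → s.head k ≤ B) → (∀ k, s.head k ≤ H) →
    c.cost s ≤ p.eval B * (H + 1) ∧
      (c.den s).All fun s' : State K Fl => ∀ k, s'.head k ≤ H + p.eval B := by
  induction c with
  | skip => exact ⟨1, fun B H s hB hH => ⟨by simp [cost], fun k => (hH k).trans (by simp)⟩⟩
  | right k =>
    refine ⟨1, fun B H s hB hH => ⟨by simp [cost], fun k' => ?_⟩⟩
    by_cases hk : k' = k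
    · subst hk; simpa using hH k'
    · simpa [hk] using (hH k').trans (Nat.le_succ _)
  | reset k =>
    refine ⟨2, fun B H s hB hH => ⟨?_, fun k' => ?_⟩⟩
    · have := hH k
      simp only [cost, Polynomial.eval_ofNat]; omega
    · by_cases hk : k' = k
      · subst hk; simp
      · simpa [hk] using (hH k').trans (Nat.le_add_right _ _)
  | write k o => exact ⟨1, fun B H s hB hH => ⟨by simp [cost], fun k => (hH k).trans (by simp)⟩⟩
  | setF f b => exact ⟨1, fun B H s hB hH => ⟨by simp [cost], fun k => (hH k).trans (by simp)⟩⟩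
  | toss f =>
    exact ⟨1, fun B H s hB hH => ⟨by simp [cost],
      ⟨fun k => (hH k).trans (by simp), fun k => (hH k).trans (by simp)⟩⟩⟩
  | iteSym k o c₁ c₂ h₁ h₂ =>
    obtain ⟨p₁, h₁⟩ := h₁ h.1
    obtain ⟨p₂, h₂⟩ := h₂ h.2
    refine ⟨1 + p₁ + p₂, fun B H s hB hH => ?_⟩
    obtain ⟨a₁, b₁⟩ := h₁ B H s hB hH
    obtain ⟨a₂, b₂⟩ := h₂ B H s hB hH
    simp only [cost, den, Polynomial.eval_add, Polynomial.eval_one]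
    refine ⟨?_, ?_⟩
    · have : max (c₁.cost s) (c₂.cost s) ≤ p₁.eval B * (H + 1) + p₂.eval B * (H + 1) := by omega
      nlinarith
    · split_ifs
      · exact b₁.mono fun s' hs' k => (hs' k).trans (by omega)
      · exact b₂.mono fun s' hs' k => (hs' k).trans (by omega)
  | iteF f c₁ c₂ h₁ h₂ =>
    obtain ⟨p₁, h₁⟩ := h₁ h.1
    obtain ⟨p₂, h₂⟩ := h₂ h.2
    refine ⟨1 + p₁ + p₂, fun B H s hB hH => ?_⟩
    obtain ⟨a₁, b₁⟩ := h₁ B H s hB hH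
    obtain ⟨a₂, b₂⟩ := h₂ B H s hB hH
    simp only [cost, den, Polynomial.eval_add, Polynomial.eval_one]
    refine ⟨?_, ?_⟩
    · have : max (c₁.cost s) (c₂.cost s) ≤ p₁.eval B * (H + 1) + p₂.eval B * (H + 1) := by omega
      nlinarith
    · split_ifs
      · exact b₁.mono fun s' hs' k => (hs' k).trans (by omega)
      · exact b₂.mono fun s' hs' k => (hs' k).trans (by omega)
  | seq c₁ c₂ h₁ h₂ =>
    obtain ⟨p₁, h₁⟩ := h₁ h.1
    obtain ⟨p₂, h₂⟩ := h₂ h.2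
    refine ⟨p₁ + p₂ * (1 + p₁), fun B H s hB hH => ?_⟩
    obtain ⟨a₁, b₁⟩ := h₁ B H s hB hH
    have hk : (c₁.den s).All fun s' : State K Fl => ∀ k, L k → s'.head k ≤ B := by
      by_cases hL : ∃ k, L k
      · have : ∀ k, (c₁.den s).All fun s' : State K Fl => L k → s'.head k ≤ B := fun k => by
          by_cases hk : L k
          · exact ((h.1.keeps hk).all_head s).mono fun s' e _ => e.trans_le (hB k hk)
          · exact Tree.all_of_forall (fun s' h' => absurd h' hk) _
        exact Tree.all_forall this
      · exact Tree.all_of_forall (fun s' k hk => absurd ⟨k, hk⟩ hL) _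
    have h₃ := (hk.and b₁).mono fun s' hs' => h₂ B (H + p₁.eval B) s' hs'.1 hs'.2
    simp only [cost, den, Polynomial.eval_add, Polynomial.eval_one, Polynomial.eval_mul]
    refine ⟨?_, ?_⟩
    · have := Tree.sup_le (h₃.mono fun s' hs' => hs'.1)
      nlinarith [Nat.zero_le (p₂.eval B * p₁.eval B * H)]
    · rw [Tree.all_bind]
      refine h₃.mono fun s' hs' => hs'.2.mono fun s'' hs'' k => (hs'' k).trans ?_
      nlinarith [Nat.zero_le (p₂.eval B * p₁.eval B)]
  | loop k c ih =>
    obtain ⟨p, hp⟩ := ih h.2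
    refine ⟨Polynomial.X * (p + p * Polynomial.X * p + 2) + Polynomial.X + 3,
      fun B H s hB hH => ?_⟩
    set n := s.head k with hn
    have hnB : n ≤ B := hB k h.1
    have hnH : n ≤ H := hH k
    set f : ℕ → State K Fl → Tree (State K Fl) :=
      fun i s' => (c.den (s'.setHead k i)).map (State.setHead k n) with hf
    let I : ℕ → State K Fl → Prop := fun j s' =>
      (∀ k, L k → s'.head k = s.head k) ∧ ∀ k, s'.head k ≤ H + j * p.eval B
    have hround : ∀ j < n, ∀ s', I j s' →
        c.cost (s'.setHead k j) ≤ p.eval B * (H + j * p.eval B + 1) ∧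
        (c.den (s'.setHead k j)).All fun s'' : State K Fl =>
          ∀ k, s''.head k ≤ H + j * p.eval B + p.eval B := by
      intro j hj s' hs'
      refine hp B _ _ (fun k' hk' => ?_) fun k' => ?_
      · by_cases e : k' = k
        · subst e; simp only [State.setHead_head, Function.update_self]; omega
        · simpa [e, hs'.1 k' hk'] using hB k' hk'
      · by_cases e : k' = k
        · subst e; simp only [State.setHead_head, Function.update_self]
          have := Nat.zero_le (j * p.eval B)
          omega
        · simpa [e] using hs'.2 k'
    have hI : ∀ j ≤ n, (loopM f j s).All (I j) := by
      intro j hj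
      refine all_loopM (p := I) ⟨fun _ _ => rfl, fun k => by simpa using hH k⟩ ?_
      intro i hi s' hs'
      rw [hf, Tree.all_map]
      have h₁ : (c.den (s'.setHead k i)).All fun s'' : State K Fl => ∀ k', L k' →
          s''.head k' = (s'.setHead k i).head k' := by
        refine Tree.all_forall fun k' => ?_
        by_cases hk : L k'
        · exact ((h.2.keeps hk).all_head _).mono fun s' e _ => e
        · exact Tree.all_of_forall (fun s' h' => absurd h' hk) _
      refine (h₁.and (hround i (by omega) s' hs').2).mono fun s'' hs'' =>
        ⟨fun k' hk' => ?_, fun k' => ?_⟩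
      · by_cases e : k' = k
        · subst e; simp [hn]
        · have := hs''.1 k' hk'
          simp only [State.setHead_head, ne_eq, e, not_false_eq_true,
            Function.update_of_ne] at this ⊢
          rw [this, hs'.1 k' hk']
      · by_cases e : k' = k
        · subst e; simp only [State.setHead_head, Function.update_self]
          have := Nat.zero_le ((i + 1) * p.eval B)
          omega
        · have := hs''.2 k'
          simp only [State.setHead_head, ne_eq, e, not_false_eq_true, Function.update_of_ne]
          linarith
    have hcost : ∀ j ∈ Finset.range n, (loopM f j s).sup (fun s' => c.cost (s'.setHead k j)) + 2 ≤
        p.eval B * (H + B * p.eval B + 1) + 2 := by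
      intro j hj
      rw [Finset.mem_range] at hj
      refine Nat.add_le_add_right (Tree.sup_le ((hI j hj.le).mono fun s' hs' => ?_)) 2
      refine ((hround j hj s' hs').1).trans ?_
      have : j * p.eval B ≤ B * p.eval B := Nat.mul_le_mul_right _ (by omega)
      exact Nat.mul_le_mul_left _ (by omega)
    have hsum := (Finset.sum_le_card_nsmul _ _ _ hcost)
    rw [Finset.card_range, smul_eq_mul] at hsum
    simp only [cost, den, Polynomial.eval_add, Polynomial.eval_mul, Polynomial.eval_X,
      Polynomial.eval_ofNat]
    set q := p.eval B
    refine ⟨?_, ?_⟩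
    · have h1 : n * (q * (H + B * q + 1) + 2) ≤ B * (q * (H + B * q + 1) + 2) :=
        Nat.mul_le_mul_right _ hnB
      have h2 := hsum.trans h1
      have h3 : n + 2 + (B * (q * (H + B * q + 1) + 2) + 1) ≤
          (B * (q + q * B * q + 2) + B + 3) * (H + 1) := by
        have := Nat.zero_le (B * (q * B * q) * H)
        have := Nat.zero_le (B * H)
        nlinarith
      exact le_trans (Nat.add_le_add_left (Nat.add_le_add_right h2 1) _) h3
    · refine (hI n le_rfl).mono fun s' hs' k' => (hs'.2 k').trans ?_
      have h1 : n * q ≤ B * q := Nat.mul_le_mul_right _ hnB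
      have := Nat.zero_le (B * (q * B * q))
      nlinarith

/-- Polynomially bounded programs: safe, with running time and final head positions polynomial in
a bound on the initial head positions. -/
def PolyBdd (c : Cmd K Fl) : Prop := c.Safe ∧ ∃ p : Polynomial ℕ, ∀ (H : ℕ) (s : State K Fl),
  (∀ k, s.head k ≤ H) → c.cost s ≤ p.eval H ∧
    (c.den s).All fun s' : State K Fl => ∀ k, s'.head k ≤ p.eval H

theorem WF.polyBdd {c : Cmd K Fl} (h : c.WF L) : c.PolyBdd := by
  obtain ⟨p, hp⟩ := h.bound
  refine ⟨h.safe, p * (Polynomial.X + 1) + Polynomial.X, fun H s hH => ?_⟩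
  obtain ⟨h₁, h₂⟩ := hp H H s (fun k _ => hH k) hH
  simp only [Polynomial.eval_add, Polynomial.eval_mul, Polynomial.eval_X, Polynomial.eval_one]
  refine ⟨by omega, h₂.mono fun s' hs' k => (hs' k).trans ?_⟩
  nlinarith [Nat.zero_le (p.eval H * H)]

theorem PolyBdd.seq {c₁ c₂ : Cmd K Fl} (h₁ : c₁.PolyBdd) (h₂ : c₂.PolyBdd) :
    (c₁ ;; c₂).PolyBdd := by
  obtain ⟨s₁, p₁, h₁⟩ := h₁
  obtain ⟨s₂, p₂, h₂⟩ := h₂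
  refine ⟨⟨s₁, s₂⟩, p₁ + p₂.comp p₁, fun H s hH => ?_⟩
  obtain ⟨a₁, b₁⟩ := h₁ H s hH
  have b₂ := b₁.mono fun s' hs' => h₂ _ s' hs'
  simp only [cost, den, Polynomial.eval_add, Polynomial.eval_comp]
  refine ⟨Nat.add_le_add a₁ (Tree.sup_le (b₂.mono fun s' hs' => hs'.1)), ?_⟩
  rw [Tree.all_bind]
  exact b₂.mono fun s' hs' => hs'.2.mono fun s'' hs'' k => (hs'' k).trans (Nat.le_add_left _ _)

/-- Run the programs of a list one after the other. -/
def seqs (l : List (Cmd K Fl)) : Cmd K Fl := l.foldr Cmd.seq skip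

theorem WF.seqs {l : List (Cmd K Fl)} (h : ∀ c ∈ l, c.WF L) : (Cmd.seqs l).WF L := by
  induction l with
  | nil => trivial
  | cons c l ih => exact ⟨h c (by simp), ih fun c' hc' => h c' (by simp [hc'])⟩

/-- Polynomially bounded programs are executed by machines in polynomial time. -/
theorem PolyBdd.exists_machine {c : Cmd K Fl} (h : c.PolyBdd) {inp len : K} (out : K)
    (hne : inp ≠ len) :
    ∃ (M : TM) (g : State K Fl → M.Cfg) (p : Polynomial ℕ), (∀ s, M.Halted (g s)) ∧
      (∀ s (i : ℕ), (g s).tape M.out i = (s.cont out i).map Sum.inl) ∧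
      ∀ w, Reach M.next (p.eval w.length) (M.init w) ((c.den (State.start inp len w)).map g) := by
  obtain ⟨hs, p, hp⟩ := h
  obtain ⟨M, g, h₁, h₂, h₃⟩ := Cmd.exists_machine hs out hne
  refine ⟨M, g, 2 * Polynomial.X + 5 + p, h₁, h₂, fun w => (h₃ w).mono ?_⟩
  have := (hp w.length (State.start inp len w) fun k => by
    simp only [State.start]; split_ifs <;> simp).1
  simp only [Polynomial.eval_add, Polynomial.eval_mul, Polynomial.eval_X, Polynomial.eval_ofNat]
  omega

end Cmd
end QuantLogic

namespace QuantLogic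

/-! ### Well-scoped formulae and closed counting terms -/

/-- An interpretation of the relation symbols on a domain. -/
abbrev Interp (R : Signature) (D : Type) : Type := ∀ i : Fin R.numRel, Set (Fin (R.arity i) → D)

/-- First-order formulae over `R` whose free variables are in the type `A`; a quantifier adds the
variable `none`. -/
inductive FO (R : Signature) : Type → Type 1 where
  | eq {A : Type} (x y : A) : FO R A
  | lt {A : Type} (x y : A) : FO R A
  | rel {A : Type} (i : Fin R.numRel) (u : Fin (R.arity i) → A) : FO R A
  | top {A : Type} : FO R A
  | neg {A : Type} (φ : FO R A) : FO R A
  | or {A : Type} (φ ψ : FO R A) : FO R A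
  | ex {A : Type} (φ : FO R (Option A)) : FO R A

/-- Extend an assignment by the value of the variable `none`. -/
def optCons {A D : Type} (a : D) (e : A → D) : Option A → D
  | none => a
  | some x => e x

namespace FO

variable {R : Signature} {A B D : Type}

/-- Truth under an assignment to the free variables. -/
def Sat [LT D] (I : Interp R D) : {A : Type} → FO R A → (A → D) → Prop
  | _, eq x y, e => e x = e y
  | _, lt x y, e => e x < e y
  | _, rel i u, e => (fun j => e (u j)) ∈ I i
  | _, top, _ => True
  | _, neg φ, e => ¬ φ.Sat I e
  | _, or φ ψ, e => φ.Sat I e ∨ ψ.Sat I e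
  | _, ex φ, e => ∃ a, φ.Sat I (optCons a e)

/-- Renaming of the free variables. -/
def map : {A B : Type} → (A → B) → FO R A → FO R B
  | _, _, f, eq x y => eq (f x) (f y)
  | _, _, f, lt x y => lt (f x) (f y)
  | _, _, f, rel i u => rel i fun j => f (u j)
  | _, _, _, top => top
  | _, _, f, neg φ => neg (φ.map f)
  | _, _, f, or φ ψ => or (φ.map f) (ψ.map f)
  | _, _, f, ex φ => ex (φ.map (Option.map f))

theorem sat_map [LT D] (I : Interp R D) (φ : FO R A) (f : A → B) (e : B → D) :
    (φ.map f).Sat I e ↔ φ.Sat I (e ∘ f) := by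
  induction φ generalizing B with
  | eq x y => exact Iff.rfl
  | lt x y => exact Iff.rfl
  | rel i u => exact Iff.rfl
  | top => exact Iff.rfl
  | neg φ ih => exact not_congr (ih f e)
  | or φ ψ h₁ h₂ => exact or_congr (h₁ f e) (h₂ f e)
  | ex φ ih =>
    refine exists_congr fun a => (ih _ _).trans ?_
    have : optCons a e ∘ Option.map f = optCons a (e ∘ f) := by
      funext o; cases o <;> rfl
    rw [this]

theorem sat_iso {D' : Type} [LinearOrder D] [LinearOrder D'] {I : Interp R D} {I' : Interp R D'}
    (g : D ≃o D') (hI : ∀ i t, t ∈ I i ↔ (fun j => g (t j)) ∈ I' i) (φ : FO R A) (e : A → D) :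
    φ.Sat I e ↔ φ.Sat I' (fun x => g (e x)) := by
  induction φ with
  | eq x y => exact g.injective.eq_iff.symm
  | lt x y => exact g.lt_iff_lt.symm
  | rel i u => exact hI i _
  | top => exact Iff.rfl
  | neg φ ih => exact not_congr (ih e)
  | or φ ψ h₁ h₂ => exact or_congr (h₁ e) (h₂ e)
  | ex φ ih =>
    have h : ∀ a, (fun x => g (optCons a e x)) = optCons (g a) fun x => g (e x) := fun a => by
      funext o; cases o <;> rfl
    constructor
    · rintro ⟨a, ha⟩
      exact ⟨g a, by rw [← h]; exact (ih _).1 ha⟩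
    · rintro ⟨b, hb⟩
      refine ⟨g.symm b, (ih _).2 ?_⟩
      rw [h, g.apply_symm_apply]
      exact hb

end FO

/-- Second-order assignments for variables with the arities `ar`. -/
abbrev SOAsg {J : Type} (ar : J → ℕ) (D : Type) : Type := ∀ j, Set (Fin (ar j) → D)

/-- Boolean combinations of first-order formulae with free variables in `A` and of atoms with
second-order variables in `J`, of the arities `ar`. -/
inductive QF (R : Signature) (A : Type) {J : Type} (ar : J → ℕ) : Type 1 where
  | so (j : J) (u : Fin (ar j) → A)
  | fo (φ : FO R A)
  | neg (ψ : QF R A ar)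
  | or (ψ₁ ψ₂ : QF R A ar)

namespace QF

variable {R : Signature} {A B D : Type} {J J' : Type} {ar : J → ℕ} {ar' : J' → ℕ}

/-- Truth under assignments to the second-order and the first-order variables. -/
def Sat [LT D] (I : Interp R D) (X : SOAsg ar D) : QF R A ar → (A → D) → Prop
  | so j u, e => (fun i => e (u i)) ∈ X j
  | fo φ, e => φ.Sat I e
  | neg ψ, e => ¬ ψ.Sat I X e
  | or ψ₁ ψ₂, e => ψ₁.Sat I X e ∨ ψ₂.Sat I X e

/-- Conjunction, as an abbreviation. -/
def and (ψ₁ ψ₂ : QF R A ar) : QF R A ar := neg (or (neg ψ₁) (neg ψ₂))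

theorem sat_and [LT D] (I : Interp R D) (X : SOAsg ar D) (ψ₁ ψ₂ : QF R A ar) (e : A → D) :
    (ψ₁.and ψ₂).Sat I X e ↔ ψ₁.Sat I X e ∧ ψ₂.Sat I X e := by
  simp [and, Sat, not_or]

/-- Renaming of the first-order and of the second-order variables. -/
def map (f : A → B) (g : J → J') (h : ∀ j, ar' (g j) = ar j) : QF R A ar → QF R B ar'
  | so j u => so (g j) fun i => f (u (Fin.cast (h j) i))
  | fo φ => fo (φ.map f)
  | neg ψ => neg (ψ.map f g h)
  | or ψ₁ ψ₂ => or (ψ₁.map f g h) (ψ₂.map f g h)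

theorem sat_map [LT D] (I : Interp R D) (X : SOAsg ar D) (X' : SOAsg ar' D) (f : A → B)
    (g : J → J') (h : ∀ j, ar' (g j) = ar j)
    (hX : ∀ j t, (fun i => t (Fin.cast (h j) i)) ∈ X' (g j) ↔ t ∈ X j)
    (ψ : QF R A ar) (e : B → D) :
    (ψ.map f g h).Sat I X' e ↔ ψ.Sat I X (e ∘ f) := by
  induction ψ with
  | so j u => exact hX j fun i => e (f (u i))
  | fo φ => exact φ.sat_map I f e
  | neg ψ ih => exact not_congr ih
  | or ψ₁ ψ₂ h₁ h₂ => exact or_congr h₁ h₂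

/-- Renaming of the first-order variables. -/
def mapFO (f : A → B) (ψ : QF R A ar) : QF R B ar := ψ.map f id fun _ => rfl

theorem sat_mapFO [LT D] (I : Interp R D) (X : SOAsg ar D) (f : A → B) (ψ : QF R A ar)
    (e : B → D) : (ψ.mapFO f).Sat I X e ↔ ψ.Sat I X (e ∘ f) :=
  sat_map I X X f id (fun _ => rfl) (fun _ _ => Iff.rfl) ψ e

theorem sat_iso {D' : Type} [LinearOrder D] [LinearOrder D'] {I : Interp R D} {I' : Interp R D'}
    (g : D ≃o D') (hI : ∀ i t, t ∈ I i ↔ (fun j => g (t j)) ∈ I' i) {X : SOAsg ar D}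
    {X' : SOAsg ar D'} (hX : ∀ i t, t ∈ X i ↔ (fun j => g (t j)) ∈ X' i) (ψ : QF R A ar)
    (e : A → D) : ψ.Sat I X e ↔ ψ.Sat I' X' (fun x => g (e x)) := by
  induction ψ with
  | so j u => exact hX j _
  | fo φ => exact φ.sat_iso g hI e
  | neg ψ ih => exact not_congr ih
  | or ψ₁ ψ₂ h₁ h₂ => exact or_congr h₁ h₂

end QF

/-- A counting term `ΣX̄. Σx̄. ∃ȳ. ψ` without free variables: the variables `x̄`, `ȳ` and `X̄` are
indexed by `A`, `B` and `J`. -/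
structure CTerm (R : Signature) where
  A : Type
  B : Type
  J : Type
  [finA : Fintype A]
  [finB : Fintype B]
  [finJ : Fintype J]
  ar : J → ℕ
  ψ : QF R (A ⊕ B) ar

attribute [instance] CTerm.finA CTerm.finB CTerm.finJ

namespace CTerm

variable {R : Signature} {D : Type}

/-- The choices of `x̄` and `X̄`. -/
abbrev Choice (t : CTerm R) (D : Type) : Type := (t.A → D) × SOAsg t.ar D

/-- The choice satisfies `∃ȳ. ψ`. -/
def Holds [LT D] (I : Interp R D) (t : CTerm R) (p : t.Choice D) : Prop :=
  ∃ y : t.B → D, t.ψ.Sat I p.2 (Sum.elim p.1 y)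

/-- The number of choices of `x̄` and `X̄` that satisfy `∃ȳ. ψ`. -/
noncomputable def val [LT D] (I : Interp R D) (t : CTerm R) : ℕ :=
  Nat.card {p : t.Choice D // t.Holds I p}

theorem val_iso {D' : Type} [LinearOrder D] [LinearOrder D'] {I : Interp R D} {I' : Interp R D'}
    (g : D ≃o D') (hI : ∀ i t, t ∈ I i ↔ (fun j => g (t j)) ∈ I' i) (t : CTerm R) :
    t.val I = t.val I' := by
  have eSO : ∀ r : ℕ, Set (Fin r → D) ≃ Set (Fin r → D') := fun r =>
    Equiv.Set.congr ((Equiv.refl (Fin r)).arrowCongr g.toEquiv)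
  refine Nat.card_congr (Equiv.subtypeEquiv (((Equiv.refl t.A).arrowCongr g.toEquiv).prodCongr
    (Equiv.piCongrRight fun j =>
      Equiv.Set.congr ((Equiv.refl (Fin (t.ar j))).arrowCongr g.toEquiv))) ?_)
  rintro ⟨x, X⟩
  have key : ∀ y : t.B → D, t.ψ.Sat I X (Sum.elim x y) ↔ t.ψ.Sat I'
      (fun j => (fun u i => g (u i)) '' X j) (Sum.elim (fun a => g (x a)) fun b => g (y b)) := by
    intro y
    rw [t.ψ.sat_iso g hI (X' := fun j => (fun u i => g (u i)) '' X j) (fun j u => ?_)]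
    · have : (fun x_1 => g (Sum.elim x y x_1)) =
          Sum.elim (fun a => g (x a)) fun b => g (y b) := by
        funext z; cases z <;> rfl
      rw [this]
    · constructor
      · exact fun hu => ⟨u, hu, rfl⟩
      · rintro ⟨u', hu', e⟩
        have : u' = u := funext fun i => g.injective (congrFun e i)
        exact this ▸ hu'
  constructor
  · rintro ⟨y, hy⟩
    exact ⟨fun b => g (y b), (key y).1 hy⟩
  · rintro ⟨y, hy⟩
    refine ⟨fun b => g.symm (y b), (key _).2 ?_⟩
    simp only [g.apply_symm_apply]
    exact hy

end CTerm

/-- Counting terms with variables that are numbered. -/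
structure NTerm (R : Signature) where
  k : ℕ
  m : ℕ
  q : ℕ
  ar : Fin q → ℕ
  ψ : QF R (Fin k ⊕ Fin m) ar

/-- The underlying counting term. -/
def NTerm.toCTerm {R : Signature} (t : NTerm R) : CTerm R where
  A := Fin t.k
  B := Fin t.m
  J := Fin t.q
  ar := t.ar
  ψ := t.ψ

theorem CTerm.exists_nTerm {R : Signature} (t : CTerm R) : ∃ t' : NTerm R,
    ∀ (D : Type) [LT D] (I : Interp R D), t'.toCTerm.val I = t.val I := by
  let eA := Fintype.equivFin t.A
  let eB := Fintype.equivFin t.B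
  let eJ := Fintype.equivFin t.J
  have har : ∀ j, (fun i => t.ar (eJ.symm i)) (eJ j) = t.ar j := fun j => by simp
  refine ⟨⟨Fintype.card t.A, Fintype.card t.B, Fintype.card t.J, fun i => t.ar (eJ.symm i),
    t.ψ.map (Sum.map eA eB) eJ har⟩, fun D _ I => (Nat.card_congr ?_).symm⟩
  refine Equiv.subtypeEquiv ((eA.arrowCongr (Equiv.refl D)).prodCongr
    (Equiv.piCongrLeft' (fun j => Set (Fin (t.ar j) → D)) eJ)) ?_
  rintro ⟨x, X⟩
  have hX : ∀ j u, (fun i => u (Fin.cast (har j) i)) ∈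
      (Equiv.piCongrLeft' (fun j => Set (Fin (t.ar j) → D)) eJ) X (eJ j) ↔ u ∈ X j := by
    intro j u
    have : ∀ j' (e : j' = j) (h : t.ar j' = t.ar j),
        (fun i => u (Fin.cast h i)) ∈ X j' ↔ u ∈ X j := by
      rintro j' rfl h; rfl
    exact this _ (eJ.symm_apply_apply j) _
  have key : ∀ y : Fin (Fintype.card t.B) → D, t.ψ.Sat I X (Sum.elim x fun b => y (eB b)) ↔
      (t.ψ.map (Sum.map eA eB) eJ har).Sat I
        (Equiv.piCongrLeft' (fun j => Set (Fin (t.ar j) → D)) eJ X)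
        (Sum.elim (fun a => x (eA.symm a)) y) := by
    intro y
    rw [QF.sat_map I X _ _ _ _ hX]
    have : (Sum.elim (fun a => x (eA.symm a)) y) ∘ Sum.map eA eB =
        Sum.elim x fun b => y (eB b) := by
      funext z; cases z <;> simp
    rw [this]
  constructor
  · rintro ⟨y, hy⟩
    refine ⟨fun b => y (eB.symm b), (key _).1 ?_⟩
    simpa using hy
  · rintro ⟨y, hy⟩
    exact ⟨fun b => y (eB b), (key y).2 hy⟩

/-! ### From sentences to counting terms -/

namespace FOFormula

variable {R : Signature}

/-- A formula as a well-scoped formula in all first-order variables. -/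
def toFO : FOFormula R → FO R ℕ
  | eq x y => .eq x y
  | lt x y => .lt x y
  | rel i u => .rel i u
  | top => .top
  | neg φ => .neg φ.toFO
  | or φ ψ => .or φ.toFO ψ.toFO
  | ex x φ => .ex (φ.toFO.map fun z => if z = x then none else some z)

theorem sat_toFO (S : OrdStruct R) (φ : FOFormula R) (v : FOAssign S) :
    φ.toFO.Sat S.rel v ↔ φ.Sat S v := by
  induction φ generalizing v with
  | eq x y => exact Iff.rfl
  | lt x y => exact Iff.rfl
  | rel i u => exact Iff.rfl
  | top => exact Iff.rfl
  | neg φ ih => exact not_congr (ih v)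
  | or φ ψ h₁ h₂ => exact or_congr (h₁ v) (h₂ v)
  | ex x φ ih =>
    refine exists_congr fun a => ?_
    rw [FO.sat_map, ← ih]
    have : (optCons a v ∘ fun z => if z = x then none else some z) = Function.update v x a := by
      funext z
      by_cases h : z = x
      · subst h; simp [optCons]
      · simp [h, optCons]
    rw [this]

end FOFormula

namespace QFExt

variable {R : Signature}

/-- The same formula, with all variable names as free variables. -/
def toQF : QFExt R → QF R ℕ SOVar.arity
  | eq x y => .fo (.eq x y)
  | so X u => .so X u
  | fo φ => .fo φ.toFO
  | neg ψ => .neg ψ.toQF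
  | or ψ₁ ψ₂ => .or ψ₁.toQF ψ₂.toQF

theorem sat_toQF (S : OrdStruct R) (ψ : QFExt R) (v : FOAssign S) (V : SOAssign S) :
    ψ.toQF.Sat S.rel V v ↔ ψ.Sat S v V := by
  induction ψ with
  | eq x y => exact Iff.rfl
  | so X u => exact Iff.rfl
  | fo φ => exact φ.sat_toFO S v
  | neg ψ ih => exact not_congr ih
  | or ψ₁ ψ₂ h₁ h₂ => exact or_congr h₁ h₂

end QFExt

/-- A counting term `ΣX̄. Σx̄. ∃ȳ. ψ` in which all first-order and second-order variables may also
occur freely. -/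
structure OTerm (R : Signature) where
  A : Type
  B : Type
  J : Type
  [finA : Fintype A]
  [finB : Fintype B]
  [finJ : Fintype J]
  ar : J → ℕ
  ψ : QF R (ℕ ⊕ (A ⊕ B)) (Sum.elim SOVar.arity ar)

attribute [instance] OTerm.finA OTerm.finB OTerm.finJ

/-- Join assignments to two families of second-order variables. -/
def soElim {J J' D : Type} {ar : J → ℕ} {ar' : J' → ℕ} (V : SOAsg ar D) (X : SOAsg ar' D) :
    SOAsg (Sum.elim ar ar') D
  | .inl j => V j
  | .inr j => X j

/-- Extend a second-order assignment by the value of the variable `none`. -/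
def soCons {J D : Type} {ar : J → ℕ} {r : ℕ} (Y : Set (Fin r → D)) (X : SOAsg ar D) :
    SOAsg (fun o : Option J => o.elim r ar) D
  | none => Y
  | some j => X j

namespace OTerm

variable {R : Signature} {D : Type}

/-- The values `p` of `x̄` and `X̄` satisfy `∃ȳ. ψ`, when `v` and `V` interpret the free
variables. -/
def Holds [LT D] (I : Interp R D) (t : OTerm R) (v : ℕ → D) (V : SOAsg SOVar.arity D)
    (p : (t.A → D) × SOAsg t.ar D) : Prop :=
  ∃ y : t.B → D, t.ψ.Sat I (soElim V p.2) (Sum.elim v (Sum.elim p.1 y))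

/-- The number of choices of `x̄` and `X̄` that satisfy `∃ȳ. ψ`. -/
noncomputable def val [LT D] (I : Interp R D) (t : OTerm R) (v : ℕ → D)
    (V : SOAsg SOVar.arity D) : ℕ :=
  Nat.card {p : (t.A → D) × SOAsg t.ar D // t.Holds I v V p}

/-- The term for a formula of `Σ₁[FO]`. -/
theorem exists_of_sigma1 (φ : Sigma1Ext R) : ∃ (B : Type) (_ : Fintype B)
    (ψ : QF R (ℕ ⊕ B) SOVar.arity), ∀ (S : OrdStruct R) (v : FOAssign S) (V : SOAssign S),
      φ.Sat S v V ↔ ∃ y : B → S.Dom, ψ.Sat S.rel V (Sum.elim v y) := by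
  induction φ with
  | qf ψ =>
    refine ⟨Empty, inferInstance, ψ.toQF.mapFO Sum.inl, fun S v V => ?_⟩
    rw [Sigma1Ext.Sat, ← ψ.sat_toQF]
    constructor
    · intro h
      exact ⟨Empty.elim, (QF.sat_mapFO S.rel V _ _ _).2 h⟩
    · rintro ⟨y, hy⟩
      exact (QF.sat_mapFO S.rel V Sum.inl _ _).1 hy
  | ex x φ ih =>
    obtain ⟨B, _, ψ, h⟩ := ih
    refine ⟨Option B, inferInstance, ψ.mapFO (fun z => match z with
      | .inl z => if z = x then .inr none else .inl z
      | .inr b => .inr (some b)), fun S v V => ?_⟩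
    have key : ∀ (a : S.Dom) (y : B → S.Dom), Sum.elim v (optCons a y) ∘ (fun z => match z with
        | .inl z => if z = x then .inr none else .inl z
        | .inr b => .inr (some b) : ℕ ⊕ B → ℕ ⊕ Option B) =
        Sum.elim (Function.update v x a) y := by
      intro a y
      funext z
      rcases z with z | b
      · by_cases hz : z = x
        · subst hz; simp [optCons]
        · simp [hz]
      · rfl
    rw [Sigma1Ext.Sat]
    constructor
    · rintro ⟨a, ha⟩
      obtain ⟨y, hy⟩ := (h S _ V).1 ha
      refine ⟨optCons a y, (QF.sat_mapFO S.rel V _ _ _).2 ?_⟩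
      rw [key]; exact hy
    · rintro ⟨y, hy⟩
      have hy' := (QF.sat_mapFO S.rel V _ _ _).1 hy
      have e : y = optCons (y none) fun b => y (some b) := by
        funext o; cases o <;> rfl
      rw [e, key] at hy'
      exact ⟨y none, (h S _ V).2 ⟨_, hy'⟩⟩

/-- Bind a first-order variable by `Σ`. -/
def sumFO (x : ℕ) (t : OTerm R) : OTerm R where
  A := Option t.A
  B := t.B
  J := t.J
  ar := t.ar
  ψ := t.ψ.mapFO fun z => match z with
    | .inl z => if z = x then .inr (.inl none) else .inl z
    | .inr (.inl a) => .inr (.inl (some a))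
    | .inr (.inr b) => .inr (.inr b)

theorem val_sumFO [LT D] [Fintype D] (I : Interp R D) (x : ℕ) (t : OTerm R) (v : ℕ → D)
    (V : SOAsg SOVar.arity D) :
    (t.sumFO x).val I v V = ∑ a, t.val I (Function.update v x a) V := by
  have key : ∀ (a : D) (x' : t.A → D) (y : t.B → D),
      Sum.elim v (Sum.elim (optCons a x') y) ∘ (fun z => match z with
        | .inl z => if z = x then .inr (.inl none) else .inl z
        | .inr (.inl a) => .inr (.inl (some a))
        | .inr (.inr b) => .inr (.inr b) : ℕ ⊕ (t.A ⊕ t.B) → ℕ ⊕ (Option t.A ⊕ t.B)) =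
        Sum.elim (Function.update v x a) (Sum.elim x' y) := by
    intro a x' y
    funext z
    rcases z with z | a | b
    · by_cases hz : z = x
      · subst hz; simp [optCons]
      · simp [hz]
    · rfl
    · rfl
  have key' : ∀ (a : D) (x' : t.A → D) (X : SOAsg t.ar D) (y : t.B → D),
      (t.sumFO x).ψ.Sat I (soElim V X) (Sum.elim v (Sum.elim (optCons a x') y)) ↔
        t.ψ.Sat I (soElim V X) (Sum.elim (Function.update v x a) (Sum.elim x' y)) := by
    intro a x' X y
    rw [← key]
    exact QF.sat_mapFO I _ _ t.ψ _
  simp only [val]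
  rw [← Nat.card_sigma]
  symm
  refine Nat.card_congr
    { toFun := fun p => ⟨(optCons p.1 p.2.1.1, p.2.1.2), ?_⟩
      invFun := fun p => ⟨p.1.1 none, ⟨(fun a => p.1.1 (some a), p.1.2), ?_⟩⟩
      left_inv := fun p => rfl
      right_inv := fun p => ?_ }
  · obtain ⟨a, ⟨x', X⟩, y, hy⟩ := p
    exact ⟨y, (key' _ _ _ _).2 hy⟩
  · obtain ⟨⟨x', X⟩, y, hy⟩ := p
    have e : x' = optCons (x' none) fun b => x' (some b) := by
      funext o; cases o <;> rfl
    simp only at hy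
    rw [e] at hy
    exact ⟨y, (key' _ _ _ _).1 hy⟩
  · obtain ⟨⟨x', X⟩, hp⟩ := p
    have e : x' = optCons (x' none) fun b => x' (some b) := by
      funext o; cases o <;> rfl
    exact Subtype.ext (Prod.ext e.symm rfl)

/-- Bind a second-order variable by `Σ`. -/
def sumSO (X : SOVar) (t : OTerm R) : OTerm R where
  A := t.A
  B := t.B
  J := Option t.J
  ar := fun o => o.elim X.arity t.ar
  ψ := t.ψ.map id (fun z => match z with
    | .inl Y => if Y = X then .inr none else .inl Y
    | .inr j => .inr (some j)) (by
      rintro (Y | j)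
      · by_cases h : Y = X
        · subst h; simp
        · simp [h]
      · rfl)

theorem val_sumSO [LT D] [Fintype D] (I : Interp R D) (X : SOVar) (t : OTerm R) (v : ℕ → D)
    (V : SOAsg SOVar.arity D) :
    (t.sumSO X).val I v V =
      ∑ Y : Set (Fin X.arity → D), t.val I v (Function.update V X Y) := by
  simp only [val]
  rw [← Nat.card_sigma]
  symm
  have key : ∀ (Y : Set (Fin X.arity → D)) (X' : SOAsg t.ar D) (e : ℕ ⊕ (t.A ⊕ t.B) → D),
      (t.sumSO X).ψ.Sat I (soElim V (soCons Y X')) e ↔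
        t.ψ.Sat I (soElim (Function.update V X Y) X') e := by
    intro Y X' e
    refine QF.sat_map I _ _ _ _ _ ?_ t.ψ e
    rintro (Z | j) u
    · by_cases h : Z = X
      · subst h
        have : ∀ (z : SOVar ⊕ Option t.J) (hz : z = .inr none)
            (h : (Sum.elim SOVar.arity fun o : Option t.J => o.elim Z.arity t.ar) z = Z.arity),
            ((fun i => u (Fin.cast h i)) ∈ soElim V (soCons Y X') z ↔ u ∈ Y) := by
          rintro z rfl h; rfl
        refine (this _ (by simp) _).trans ?_
        simp only [soElim, Function.update_self]
        rfl
      · have : ∀ (z : SOVar ⊕ Option t.J) (hz : z = .inl Z)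
            (h : (Sum.elim SOVar.arity fun o : Option t.J => o.elim X.arity t.ar) z = Z.arity),
            ((fun i => u (Fin.cast h i)) ∈ soElim V (soCons Y X') z ↔ u ∈ V Z) := by
          rintro z rfl h; rfl
        refine (this _ (by simp [h]) _).trans ?_
        simp only [soElim, Function.update_of_ne h]
        rfl
    · rfl
  refine Nat.card_congr
    { toFun := fun p => ⟨(p.2.1.1, soCons p.1 p.2.1.2), ?_⟩
      invFun := fun p => ⟨p.1.2 none, ⟨(p.1.1, fun j => p.1.2 (some j)), ?_⟩⟩
      left_inv := fun p => rfl
      right_inv := fun p => ?_ }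
  · obtain ⟨Y, ⟨x', X'⟩, y, hy⟩ := p
    exact ⟨y, (key _ _ _).2 hy⟩
  · obtain ⟨⟨x', X'⟩, y, hy⟩ := p
    have e : X' = soCons (X' none) fun b => X' (some b) := by
      funext o; cases o <;> rfl
    simp only at hy
    rw [e] at hy
    exact ⟨y, (key _ _ _).1 hy⟩
  · obtain ⟨⟨x', X'⟩, hp⟩ := p
    have e : X' = soCons (X' none) fun b => X' (some b) := by
      funext o; cases o <;> rfl
    exact Subtype.ext (Prod.ext rfl e.symm)

theorem sum_sum_map {ι : Type*} {τ : Type*} (s : Finset ι) (l : List τ) (f : ι → τ → ℕ) :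
    ∑ a ∈ s, (l.map (f a)).sum = (l.map fun t => ∑ a ∈ s, f a t).sum := by
  induction l with
  | nil => simp
  | cons t l ih => simp [Finset.sum_add_distrib, ih]

/-- Every formula is a sum of open counting terms. -/
theorem exists_list (α : SigmaQSO R) : ∃ l : List (OTerm R),
    ∀ (S : OrdStruct R) (v : FOAssign S) (V : SOAssign S),
      α.eval S v V = (l.map fun t => t.val S.rel v V).sum := by
  have hsat : ∀ φ : Sigma1Ext R, ∃ t : OTerm R, ∀ (S : OrdStruct R) (v : FOAssign S)
      (V : SOAssign S), (SigmaQSO.bool φ).eval S v V = t.val S.rel v V := by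
    intro φ
    obtain ⟨B, _, ψ, h⟩ := exists_of_sigma1 φ
    let t : OTerm R := ⟨Empty, B, Empty, Empty.elim,
      ψ.map (Sum.map id Sum.inr) Sum.inl fun _ => rfl⟩
    refine ⟨t, fun S v V => ?_⟩
    have hh : ∀ p, t.Holds S.rel v V p ↔ φ.Sat S v V := by
      intro p
      rw [h]
      refine exists_congr fun y => ?_
      have h₁ := QF.sat_map (ar' := Sum.elim SOVar.arity Empty.elim) S.rel V (soElim V p.2)
        (Sum.map id Sum.inr) Sum.inl (fun _ => rfl) (fun _ _ => Iff.rfl) ψ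
        (Sum.elim v (Sum.elim p.1 y))
      have h₂ : Sum.elim v (Sum.elim p.1 y) ∘ Sum.map id Sum.inr = Sum.elim v y := by
        funext z; cases z <;> rfl
      rw [h₂] at h₁
      exact h₁
    rw [SigmaQSO.eval, OTerm.val]
    simp only [hh]
    have : Unique ((t.A → S.Dom) × SOAsg t.ar S.Dom) :=
      ⟨⟨(Empty.elim, fun j => j.elim)⟩, fun p => Prod.ext (funext fun j => j.elim)
        (funext fun j => j.elim)⟩
    split_ifs with hs
    · simp [hs]
    · simp [hs]
  induction α with
  | bool φ =>
    obtain ⟨t, ht⟩ := hsat φ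
    exact ⟨[t], fun S v V => by simp [ht]⟩
  | const s =>
    obtain ⟨t, ht⟩ := hsat (.qf (.fo .top))
    refine ⟨List.replicate s t, fun S v V => ?_⟩
    rw [List.map_replicate, List.sum_replicate, ← ht]
    simp [SigmaQSO.eval, Sigma1Ext.Sat, QFExt.Sat, FOFormula.Sat]
  | add α β hα hβ =>
    obtain ⟨l, hl⟩ := hα
    obtain ⟨l', hl'⟩ := hβ
    exact ⟨l ++ l', fun S v V => by simp [SigmaQSO.eval, hl, hl']⟩
  | sumFO x α ih =>
    obtain ⟨l, hl⟩ := ih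
    refine ⟨l.map (OTerm.sumFO x), fun S v V => ?_⟩
    simp only [SigmaQSO.eval, hl, List.map_map]
    rw [sum_sum_map]
    exact congrArg List.sum (List.map_congr_left fun t _ => (t.val_sumFO S.rel x v V).symm)
  | sumSO X α ih =>
    obtain ⟨l, hl⟩ := ih
    refine ⟨l.map (OTerm.sumSO X), fun S v V => ?_⟩
    simp only [SigmaQSO.eval, hl, List.map_map]
    rw [sum_sum_map]
    exact congrArg List.sum (List.map_congr_left fun t _ => (t.val_sumSO S.rel X v V).symm)

/-- Replace the free second-order variables by the empty relation. -/
def dropSO {J : Type} {ar : J → ℕ} {A : Type} : QF R A (Sum.elim SOVar.arity ar) → QF R A ar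
  | .so (.inl _) _ => .fo (.neg .top)
  | .so (.inr j) u => .so j u
  | .fo φ => .fo φ
  | .neg ψ => .neg (dropSO ψ)
  | .or ψ₁ ψ₂ => .or (dropSO ψ₁) (dropSO ψ₂)

theorem sat_dropSO [LT D] (I : Interp R D) {J : Type} {ar : J → ℕ} {A : Type} (X : SOAsg ar D)
    (ψ : QF R A (Sum.elim SOVar.arity ar)) (e : A → D) :
    (dropSO ψ).Sat I X e ↔ ψ.Sat I (soElim (fun _ => ∅) X) e := by
  induction ψ with
  | so j u =>
    cases j with
    | inl j => exact ⟨fun h => absurd trivial h, fun h => h.elim⟩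
    | inr j => exact Iff.rfl
  | fo φ => exact Iff.rfl
  | neg ψ ih => exact not_congr ih
  | or ψ₁ ψ₂ h₁ h₂ => exact or_congr h₁ h₂

/-- The term in which the free first-order variables denote the least element (the value of a new
existential variable), and the free second-order variables the empty relation. -/
def close (t : OTerm R) : CTerm R where
  A := t.A
  B := Option t.B
  J := t.J
  ar := t.ar
  ψ := (dropSO (t.ψ.mapFO fun z => match z with
      | .inl _ => .inr none
      | .inr (.inl a) => .inl a
      | .inr (.inr b) => .inr (some b))).and
    (.fo (.neg (.ex (.lt none (some (.inr none))))))

theorem val_close (S : OrdStruct R) {d : S.Dom} (hd : ∀ b, d ≤ b) (t : OTerm R) :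
    t.close.val S.rel = t.val S.rel (fun _ => d) fun _ => ∅ := by
  refine Nat.card_congr (Equiv.subtypeEquivRight ?_)
  rintro ⟨x, X⟩
  have key : ∀ (a : S.Dom) (y : t.B → S.Dom),
      Sum.elim x (optCons a y) ∘ (fun z => match z with
      | .inl _ => .inr none
      | .inr (.inl a) => .inl a
      | .inr (.inr b) => .inr (some b) : ℕ ⊕ (t.A ⊕ t.B) → t.A ⊕ Option t.B) =
        Sum.elim (fun _ => a) (Sum.elim x y) := by
    intro a y
    funext z
    rcases z with z | a | b <;> rfl
  have h₁ : ∀ (a : S.Dom) (y : t.B → S.Dom),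
      t.close.ψ.Sat S.rel X (Sum.elim x (optCons a y)) ↔
      t.ψ.Sat S.rel (soElim (fun _ => ∅) X) (Sum.elim (fun _ => a) (Sum.elim x y)) ∧
        ∀ b, ¬ b < a := by
    intro a y
    refine (QF.sat_and _ _ _ _ _).trans (and_congr ((sat_dropSO _ _ _ _).trans
      ((QF.sat_mapFO _ _ _ _ _).trans (iff_of_eq
        (congrArg (t.ψ.Sat S.rel (soElim (fun _ => ∅) X)) (key a y))))) ?_)
    simp [QF.Sat, FO.Sat, optCons]
    rfl
  constructor
  · rintro ⟨y, hy⟩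
    have e : y = optCons (y none) fun b => y (some b) := by
      funext o; cases o <;> rfl
    simp only at hy
    rw [e, h₁] at hy
    have : y none = d := le_antisymm (not_lt.1 (hy.2 d)) (hd _)
    rw [this] at hy
    exact ⟨_, hy.1⟩
  · rintro ⟨y, hy⟩
    exact ⟨optCons d y, (h₁ d y).2 ⟨hy, fun b => not_lt.2 (hd b)⟩⟩

end OTerm

/-- The functions of the class are sums of counting terms. -/
theorem exists_cTerms {R : Signature} {f : OrdStruct R → ℕ} (hf : f ∈ SigmaQSOClass R) :
    ∃ l : List (CTerm R), ∀ S, f S = (l.map fun t => t.val S.rel).sum := by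
  obtain ⟨α, -, hα⟩ := hf
  obtain ⟨l, hl⟩ := OTerm.exists_list α
  refine ⟨l.map OTerm.close, fun S => ?_⟩
  obtain ⟨d, hd⟩ := Finite.exists_min (id : S.Dom → S.Dom)
  rw [← hα S (fun _ => d) fun _ => ∅, hl, List.map_map]
  exact congrArg List.sum (List.map_congr_left fun t _ => (t.val_close S hd).symm)

end QuantLogic

namespace QuantLogic

/-! ### From counting terms to sentences -/

namespace FO

variable {R : Signature}

/-- The formula with named variables: the free variable `a` gets the name `ν a`, and a quantifier
below `i` others binds the name `d + i`. -/
def toRaw : {A : Type} → FO R A → (A → ℕ) → ℕ → FOFormula R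
  | _, eq x y, ν, _ => .eq (ν x) (ν y)
  | _, lt x y, ν, _ => .lt (ν x) (ν y)
  | _, rel i u, ν, _ => .rel i fun j => ν (u j)
  | _, top, _, _ => .top
  | _, neg φ, ν, d => .neg (φ.toRaw ν d)
  | _, or φ ψ, ν, d => .or (φ.toRaw ν d) (ψ.toRaw ν d)
  | _, ex φ, ν, d => .ex d (φ.toRaw (fun o => o.elim d ν) (d + 1))

theorem sat_toRaw (S : OrdStruct R) {A : Type} (φ : FO R A) (ν : A → ℕ) (d : ℕ)
    (hν : ∀ a, ν a < d) (v : FOAssign S) :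
    (φ.toRaw ν d).Sat S v ↔ φ.Sat S.rel fun a => v (ν a) := by
  induction φ generalizing d v with
  | eq x y => exact Iff.rfl
  | lt x y => exact Iff.rfl
  | rel i u => exact Iff.rfl
  | top => exact Iff.rfl
  | neg φ ih => exact not_congr (ih ν d hν v)
  | or φ ψ h₁ h₂ => exact or_congr (h₁ ν d hν v) (h₂ ν d hν v)
  | ex φ ih =>
    refine exists_congr fun a => (ih _ _ ?_ _).trans ?_
    · rintro (_ | a)
      · exact Nat.lt_succ_self d
      · exact (hν a).trans (Nat.lt_succ_self d)
    · have : (fun o : Option _ => Function.update v d a (o.elim d ν)) =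
          optCons a fun a => v (ν a) := by
        funext o
        rcases o with _ | b
        · simp [optCons]
        · simp [optCons, (hν b).ne]
      rw [this]

theorem free_toRaw {A : Type} (φ : FO R A) (ν : A → ℕ) (d : ℕ) {x : ℕ}
    (hx : x ∈ (φ.toRaw ν d).free) : ∃ a, ν a = x := by
  induction φ generalizing d with
  | eq x y =>
    simp only [toRaw, FOFormula.free, Finset.mem_insert, Finset.mem_singleton] at hx
    rcases hx with rfl | rfl <;> exact ⟨_, rfl⟩
  | lt x y =>
    simp only [toRaw, FOFormula.free, Finset.mem_insert, Finset.mem_singleton] at hx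
    rcases hx with rfl | rfl <;> exact ⟨_, rfl⟩
  | rel i u =>
    simp only [toRaw, FOFormula.free, Finset.mem_image, Finset.mem_univ, true_and] at hx
    obtain ⟨j, rfl⟩ := hx
    exact ⟨_, rfl⟩
  | top => simp [toRaw, FOFormula.free] at hx
  | neg φ ih => exact ih ν d hx
  | or φ ψ h₁ h₂ =>
    rcases Finset.mem_union.1 hx with h | h
    exacts [h₁ ν d h, h₂ ν d h]
  | ex φ ih =>
    obtain ⟨h, h'⟩ := Finset.mem_erase.1 hx
    obtain ⟨a | a, ha⟩ := ih _ _ h'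
    · exact absurd ha.symm h
    · exact ⟨_, ha⟩

end FO

namespace QF

variable {R : Signature} {A : Type} {q : ℕ} {ar : Fin q → ℕ}

/-- The formula with named variables; the second-order variable number `j` gets the name `j`. -/
def toRaw (ν : A → ℕ) (d : ℕ) : QF R A ar → QFExt R
  | so j u => .so ⟨j.val, ar j⟩ fun i => ν (u i)
  | fo φ => .fo (φ.toRaw ν d)
  | neg ψ => .neg (ψ.toRaw ν d)
  | or ψ₁ ψ₂ => .or (ψ₁.toRaw ν d) (ψ₂.toRaw ν d)

theorem sat_toRaw (S : OrdStruct R) (ψ : QF R A ar) (ν : A → ℕ) (d : ℕ)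
    (hν : ∀ a, ν a < d) (v : FOAssign S) (V : SOAssign S) :
    (ψ.toRaw ν d).Sat S v V ↔ ψ.Sat S.rel (fun j => V ⟨j.val, ar j⟩) fun a => v (ν a) := by
  induction ψ with
  | so j u => exact Iff.rfl
  | fo φ => exact φ.sat_toRaw S ν d hν v
  | neg ψ ih => exact not_congr ih
  | or ψ₁ ψ₂ h₁ h₂ => exact or_congr h₁ h₂

theorem freeFO_toRaw (ψ : QF R A ar) (ν : A → ℕ) (d : ℕ) {x : ℕ}
    (hx : x ∈ (ψ.toRaw ν d).freeFO) : ∃ a, ν a = x := by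
  induction ψ with
  | so j u =>
    simp only [toRaw, QFExt.freeFO, Finset.mem_image, Finset.mem_univ, true_and] at hx
    obtain ⟨j, rfl⟩ := hx
    exact ⟨_, rfl⟩
  | fo φ => exact φ.free_toRaw ν d hx
  | neg ψ ih => exact ih hx
  | or ψ₁ ψ₂ h₁ h₂ => exact (Finset.mem_union.1 hx).elim h₁ h₂

theorem freeSO_toRaw (ψ : QF R A ar) (ν : A → ℕ) (d : ℕ) {X : SOVar}
    (hX : X ∈ (ψ.toRaw ν d).freeSO) : ∃ j : Fin q, X = ⟨j.val, ar j⟩ := by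
  induction ψ with
  | so j u => exact ⟨j, Finset.mem_singleton.1 hX⟩
  | fo φ => simp [toRaw, QFExt.freeSO] at hX
  | neg ψ ih => exact ih hX
  | or ψ₁ ψ₂ h₁ h₂ => exact (Finset.mem_union.1 hX).elim h₁ h₂

end QF

namespace Sigma1Ext

variable {R : Signature}

/-- Bind the variables `k, …, k + m - 1`. -/
def exs (k : ℕ) : ℕ → Sigma1Ext R → Sigma1Ext R
  | 0, φ => φ
  | m + 1, φ => exs k m (.ex (k + m) φ)

theorem sat_exs (S : OrdStruct R) (V : SOAssign S) (k m : ℕ) (φ : Sigma1Ext R)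
    (G : (Fin k → S.Dom) → (Fin m → S.Dom) → Prop)
    (h : ∀ v, φ.Sat S v V ↔ G (fun i => v i) fun i => v (k + i)) (v : FOAssign S) :
    (exs k m φ).Sat S v V ↔ ∃ y, G (fun i => v i) y := by
  induction m generalizing φ with
  | zero =>
    rw [exs, h]
    exact ⟨fun h => ⟨_, h⟩, fun ⟨y, hy⟩ => by convert hy⟩
  | succ m ih =>
    rw [exs, ih _ fun x y => ∃ a, G x (Fin.snoc y a : Fin (m + 1) → S.Dom)]
    · constructor
      · rintro ⟨y, a, h⟩
        exact ⟨_, h⟩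
      · rintro ⟨y, h⟩
        exact ⟨Fin.init y, y (Fin.last m), by rwa [Fin.snoc_init_self]⟩
    · intro v
      refine exists_congr fun a => ?_
      rw [h]
      have h₁ : (fun i : Fin k => Function.update v (k + m) a i) = fun i : Fin k => v i := by
        funext i
        have := i.2
        exact Function.update_of_ne (show (i : ℕ) ≠ k + m by omega) _ _
      have h₂ : (fun i : Fin (m + 1) => Function.update v (k + m) a (k + i)) =
          Fin.snoc (fun i : Fin m => v (k + i)) a := by
        funext i
        refine Fin.lastCases ?_ (fun i => ?_) i
        · simp
        · have := i.2
          rw [Fin.snoc_castSucc, Fin.val_castSucc,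
            Function.update_of_ne (show k + (i : ℕ) ≠ k + m by omega)]
      rw [h₁, h₂]

theorem freeFO_exs (k m : ℕ) (φ : Sigma1Ext R) {x : ℕ} (hx : x ∈ (exs k m φ).freeFO) :
    x ∈ φ.freeFO ∧ (x < k ∨ k + m ≤ x) := by
  induction m generalizing φ with
  | zero => exact ⟨hx, by omega⟩
  | succ m ih =>
    obtain ⟨h, h'⟩ := ih _ hx
    obtain ⟨h₁, h₂⟩ := Finset.mem_erase.1 h
    exact ⟨h₂, by omega⟩

theorem freeSO_exs (k m : ℕ) (φ : Sigma1Ext R) : (exs k m φ).freeSO = φ.freeSO := by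
  induction m generalizing φ with
  | zero => rfl
  | succ m ih => exact ih _

end Sigma1Ext

namespace SigmaQSO

variable {R : Signature}

/-- Bind the variables `0, …, k - 1`. -/
def sumFOs : ℕ → SigmaQSO R → SigmaQSO R
  | 0, α => α
  | k + 1, α => sumFOs k (.sumFO k α)

theorem eval_sumFOs (S : OrdStruct R) (V : SOAssign S) (k : ℕ) (α : SigmaQSO R)
    (G : (Fin k → S.Dom) → ℕ) (h : ∀ v, α.eval S v V = G fun i => v i) (v : FOAssign S) :
    (sumFOs k α).eval S v V = ∑ x, G x := by
  induction k generalizing α with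
  | zero =>
    rw [sumFOs, h, Fintype.sum_unique]
    congr 1
    exact Subsingleton.elim _ _
  | succ k ih =>
    rw [sumFOs, ih _ fun x => ∑ a, G (Fin.snoc x a : Fin (k + 1) → S.Dom)]
    · rw [← Fintype.sum_equiv (Fin.snocEquiv fun _ : Fin (k + 1) => S.Dom)
        (fun p => G (Fin.snoc p.2 p.1 : Fin (k + 1) → S.Dom)) G fun p => rfl,
        Fintype.sum_prod_type_right]
    · intro v
      rw [eval]
      refine Finset.sum_congr rfl fun a _ => ?_
      rw [h]
      congr 1
      funext i
      refine Fin.lastCases ?_ (fun i => ?_) i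
      · simp
      · have := i.2
        rw [Fin.snoc_castSucc, Fin.val_castSucc, Function.update_of_ne (show (i : ℕ) ≠ k by omega)]

theorem freeFO_sumFOs (k : ℕ) (α : SigmaQSO R) {x : ℕ} (hx : x ∈ (sumFOs k α).freeFO) :
    x ∈ α.freeFO ∧ k ≤ x := by
  induction k generalizing α with
  | zero => exact ⟨hx, by omega⟩
  | succ k ih =>
    obtain ⟨h, h'⟩ := ih _ hx
    obtain ⟨h₁, h₂⟩ := Finset.mem_erase.1 h
    exact ⟨h₂, by omega⟩

theorem freeSO_sumFOs (k : ℕ) (α : SigmaQSO R) : (sumFOs k α).freeSO = α.freeSO := by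
  induction k generalizing α with
  | zero => rfl
  | succ k ih => exact ih _

/-- Bind the second-order variables number `0, …, q - 1`. -/
def sumSOs : (q : ℕ) → (Fin q → ℕ) → SigmaQSO R → SigmaQSO R
  | 0, _, α => α
  | q + 1, ar, α => sumSOs q (fun j => ar j.castSucc) (.sumSO ⟨q, ar (Fin.last q)⟩ α)

open Classical in
theorem eval_sumSOs (S : OrdStruct R) (v : FOAssign S) (q : ℕ) (ar : Fin q → ℕ) (α : SigmaQSO R)
    (G : SOAsg ar S.Dom → ℕ) (h : ∀ V, α.eval S v V = G fun j => V ⟨j, ar j⟩) (V : SOAssign S) :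
    (sumSOs q ar α).eval S v V = ∑ X, G X := by
  induction q generalizing α with
  | zero =>
    rw [sumSOs, h, Fintype.sum_unique]
    congr 1
    exact Subsingleton.elim _ _
  | succ q ih =>
    rw [sumSOs, ih _ _ fun X => ∑ Y : Set (Fin (ar (Fin.last q)) → S.Dom),
      G (Fin.snoc (α := fun j => Set (Fin (ar j) → S.Dom)) X Y)]
    · rw [← Fintype.sum_equiv (Fin.snocEquiv fun j : Fin (q + 1) => Set (Fin (ar j) → S.Dom))
        (fun p => G (Fin.snoc (α := fun j => Set (Fin (ar j) → S.Dom)) p.2 p.1)) G fun p => rfl,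
        Fintype.sum_prod_type_right]
    · intro V
      rw [eval]
      refine Finset.sum_congr (by ext; simp) fun Y _ => ?_
      rw [h]
      congr 1
      funext j
      refine Fin.lastCases ?_ (fun j => ?_) j
      · rw [Fin.snoc_last]
        exact Function.update_self (⟨q, ar (Fin.last q)⟩ : SOVar) Y V
      · have hj := j.2
        have hne : (⟨(j.castSucc : Fin (q + 1)), ar j.castSucc⟩ : SOVar) ≠
            ⟨q, ar (Fin.last q)⟩ := by
          intro e
          have := congrArg SOVar.name e
          simp only [Fin.val_castSucc] at this
          omega
        rw [Fin.snoc_castSucc, Function.update_of_ne hne]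
        rfl

theorem freeFO_sumSOs (q : ℕ) (ar : Fin q → ℕ) (α : SigmaQSO R) :
    (sumSOs q ar α).freeFO = α.freeFO := by
  induction q generalizing α with
  | zero => rfl
  | succ q ih => exact ih _ _

theorem freeSO_sumSOs (q : ℕ) (ar : Fin q → ℕ) (α : SigmaQSO R) {X : SOVar}
    (hX : X ∈ (sumSOs q ar α).freeSO) : X ∈ α.freeSO ∧ ∀ j : Fin q, X ≠ ⟨j, ar j⟩ := by
  induction q generalizing α with
  | zero => exact ⟨hX, fun j => j.elim0⟩
  | succ q ih =>
    obtain ⟨h, h'⟩ := ih _ _ hX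
    obtain ⟨h₁, h₂⟩ := Finset.mem_erase.1 h
    exact ⟨h₂, fun j => Fin.lastCases h₁ (fun j => h' j) j⟩

end SigmaQSO

namespace NTerm

variable {R : Signature}

/-- The names of the variables: `0, …, k - 1` for `x̄` and `k, …, k + m - 1` for `ȳ`. -/
def names (t : NTerm R) : Fin t.k ⊕ Fin t.m → ℕ
  | .inl i => i
  | .inr i => t.k + i

/-- The sentence for a counting term. -/
def toSentence (t : NTerm R) : SigmaQSO R :=
  .sumSOs t.q t.ar (.sumFOs t.k (.bool (.exs t.k t.m (.qf
    (t.ψ.toRaw t.names (t.k + t.m))))))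

theorem isSentence (t : NTerm R) : t.toSentence.IsSentence := by
  constructor
  · rw [Finset.eq_empty_iff_forall_notMem]
    intro x hx
    rw [toSentence, SigmaQSO.freeFO_sumSOs] at hx
    obtain ⟨h, h₁⟩ := SigmaQSO.freeFO_sumFOs _ _ hx
    obtain ⟨h', h₂⟩ := Sigma1Ext.freeFO_exs _ _ _ h
    obtain ⟨a | b, e⟩ := QF.freeFO_toRaw _ _ _ h'
    · have := a.2
      simp only [names] at e
      omega
    · have := b.2
      simp only [names] at e
      omega
  · rw [Finset.eq_empty_iff_forall_notMem]
    intro X hX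
    obtain ⟨h, h₁⟩ := SigmaQSO.freeSO_sumSOs t.q t.ar _ hX
    rw [SigmaQSO.freeSO_sumFOs, SigmaQSO.freeSO, Sigma1Ext.freeSO_exs] at h
    obtain ⟨j, e⟩ := QF.freeSO_toRaw _ _ _ h
    exact h₁ j e

theorem eval_toSentence (t : NTerm R) (S : OrdStruct R) (v : FOAssign S) (V : SOAssign S) :
    t.toSentence.eval S v V = t.toCTerm.val S.rel := by
  classical
  let H (p : (Fin t.k → S.Dom) × SOAsg t.ar S.Dom) : Prop :=
    ∃ y : Fin t.m → S.Dom, t.ψ.Sat S.rel p.2 (Sum.elim p.1 y)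
  have h₁ : ∀ v V, (Sigma1Ext.exs t.k t.m (.qf (t.ψ.toRaw t.names (t.k + t.m)))).Sat S v V ↔
      H (fun i => v i, fun j => V ⟨j.val, t.ar j⟩) := by
    intro v V
    rw [Sigma1Ext.sat_exs S V t.k t.m _ fun x y =>
      t.ψ.Sat S.rel (fun j : Fin t.q => V ⟨j.val, t.ar j⟩) (Sum.elim x y)]
    intro v
    rw [Sigma1Ext.Sat, QF.sat_toRaw]
    · have : (fun a => v (t.names a)) =
          Sum.elim (fun i : Fin t.k => v i) fun i : Fin t.m => v (t.k + i) := by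
        funext z; cases z <;> rfl
      rw [this]
    · rintro (a | b)
      · exact lt_of_lt_of_le a.2 (Nat.le_add_right _ _)
      · exact Nat.add_lt_add_left b.2 _
  have h₂ : t.toCTerm.val S.rel = Nat.card {p // H p} := rfl
  rw [h₂, toSentence, SigmaQSO.eval_sumSOs S v t.q t.ar _ fun X =>
    ∑ x : Fin t.k → S.Dom, if H (x, X) then 1 else 0]
  · rw [← Fintype.sum_prod_type_right (fun p : (Fin t.k → S.Dom) × SOAsg t.ar S.Dom =>
      if H p then 1 else 0)]
    rw [Finset.sum_boole, Nat.card_eq_fintype_card, Fintype.card_subtype]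
    rfl
  · intro V
    refine SigmaQSO.eval_sumFOs S V t.k _ _ (fun v => ?_) v
    rw [SigmaQSO.eval]
    simp only [h₁]

end NTerm

/-- The class consists of the sums of counting terms. -/
theorem mem_sigmaQSOClass_iff {R : Signature} {f : OrdStruct R → ℕ} : f ∈ SigmaQSOClass R ↔
    ∃ l : List (CTerm R), ∀ S, f S = (l.map fun t => t.val S.rel).sum := by
  refine ⟨exists_cTerms, ?_⟩
  rintro ⟨l, hl⟩
  suffices h : ∃ α : SigmaQSO R, α.IsSentence ∧ ∀ (S : OrdStruct R) v V,
      α.eval S v V = (l.map fun t => t.val S.rel).sum by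
    obtain ⟨α, h₁, h₂⟩ := h
    exact ⟨α, h₁, fun S v V => by rw [h₂, hl]⟩
  clear hl
  induction l with
  | nil => exact ⟨.const 0, ⟨rfl, rfl⟩, fun S v V => rfl⟩
  | cons t l ih =>
    obtain ⟨α, h₁, h₂⟩ := ih
    obtain ⟨t', ht'⟩ := t.exists_nTerm
    refine ⟨.add t'.toSentence α, ⟨?_, ?_⟩, fun S v V => ?_⟩
    · rw [SigmaQSO.freeFO, t'.isSentence.1, h₁.1, Finset.empty_union]
    · rw [SigmaQSO.freeSO, t'.isSentence.2, h₁.2, Finset.empty_union]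
    · rw [SigmaQSO.eval, t'.eval_toSentence, ht', h₂, List.map_cons, List.sum_cons]

end QuantLogic

namespace QuantLogic

/-! ### First-order definable predicates -/

/-- `P` is defined by a first-order formula, uniformly in all linear orders. -/
def FODef (R : Signature) {A : Type}
    (P : ∀ (D : Type) [LinearOrder D], Interp R D → (A → D) → Prop) : Prop :=
  ∃ φ : FO R A, ∀ (D : Type) [LinearOrder D] (I : Interp R D) (e : A → D), φ.Sat I e ↔ P D I e

namespace FODef

variable {R : Signature} {A B : Type}
  {P Q : ∀ (D : Type) [LinearOrder D], Interp R D → (A → D) → Prop}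

theorem congr (h : FODef R P) (hPQ : ∀ (D : Type) [LinearOrder D] (I : Interp R D) e,
    P D I e ↔ Q D I e) : FODef R Q := by
  obtain ⟨φ, hφ⟩ := h
  exact ⟨φ, fun D _ I e => (hφ D I e).trans (hPQ D I e)⟩

theorem not (h : FODef R P) : FODef R fun D _ I e => ¬ P D I e := by
  obtain ⟨φ, hφ⟩ := h
  exact ⟨.neg φ, fun D _ I e => not_congr (hφ D I e)⟩

theorem or (h : FODef R P) (h' : FODef R Q) : FODef R fun D _ I e => P D I e ∨ Q D I e := by
  obtain ⟨φ, hφ⟩ := h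
  obtain ⟨ψ, hψ⟩ := h'
  exact ⟨.or φ ψ, fun D _ I e => or_congr (hφ D I e) (hψ D I e)⟩

theorem and (h : FODef R P) (h' : FODef R Q) : FODef R fun D _ I e => P D I e ∧ Q D I e :=
  (h.not.or h'.not).not.congr fun D _ I e => by simp only [not_or, not_not]

theorem const (p : Prop) : FODef R (A := A) fun _ _ _ _ => p := by
  by_cases h : p
  · exact ⟨.top, fun D _ I e => ⟨fun _ => h, fun _ => trivial⟩⟩
  · exact ⟨.neg .top, fun D _ I e => ⟨fun h' => absurd trivial h', fun h' => absurd h' h⟩⟩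

theorem eq (x y : A) : FODef R fun _ _ _ e => e x = e y := ⟨.eq x y, fun _ _ _ _ => Iff.rfl⟩

theorem lt (x y : A) : FODef R fun _ _ _ e => e x < e y := ⟨.lt x y, fun _ _ _ _ => Iff.rfl⟩

theorem map (h : FODef R P) (f : A → B) : FODef R fun D _ I e => P D I (e ∘ f) := by
  obtain ⟨φ, hφ⟩ := h
  exact ⟨φ.map f, fun D _ I e => (φ.sat_map I f e).trans (hφ D I _)⟩

theorem exists_index {ι : Type} [Finite ι]
    {P : ι → ∀ (D : Type) [LinearOrder D], Interp R D → (A → D) → Prop}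
    (h : ∀ i, FODef R (P i)) : FODef R fun D _ I e => ∃ i, P i D I e := by
  have := Fintype.ofFinite ι
  suffices H : ∀ s : Finset ι, FODef R fun D _ I e => ∃ i ∈ s, P i D I e from
    (H Finset.univ).congr fun D _ I e => by simp
  intro s
  classical
  induction s using Finset.induction_on with
  | empty => exact (const False).congr fun D _ I e => by simp
  | insert i s _ ih => exact ((h i).or ih).congr fun D _ I e => by simp

theorem forall_index {ι : Type} [Finite ι]
    {P : ι → ∀ (D : Type) [LinearOrder D], Interp R D → (A → D) → Prop}
    (h : ∀ i, FODef R (P i)) : FODef R fun D _ I e => ∀ i, P i D I e :=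
  (exists_index fun i => (h i).not).not.congr fun D _ I e => by simp only [not_exists, not_not]

theorem exists_fin (m : ℕ) {P : ∀ (D : Type) [LinearOrder D], Interp R D → (A ⊕ Fin m → D) → Prop}
    (h : FODef R P) : FODef R fun D _ I e => ∃ y : Fin m → D, P D I (Sum.elim e y) := by
  induction m with
  | zero =>
    refine (h.map (Sum.elim id Fin.elim0)).congr fun D _ I e => ?_
    have : ∀ y : Fin 0 → D, e ∘ Sum.elim id Fin.elim0 = Sum.elim e y := by
      intro y
      funext z
      rcases z with z | z
      exacts [rfl, z.elim0]
    exact ⟨fun h => ⟨Fin.elim0, by rwa [← this]⟩, fun ⟨y, hy⟩ => by rwa [this y]⟩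
  | succ m ih =>
    obtain ⟨φ, hφ⟩ := h.map (Sum.elim (fun a => some (.inl a)) fun i : Fin (m + 1) =>
      Fin.lastCases (motive := fun _ => Option (A ⊕ Fin m)) none (fun j => some (.inr j)) i)
    refine (@ih (fun D _ I e => (FO.ex φ).Sat I e) ⟨.ex φ, fun _ _ _ _ => Iff.rfl⟩).congr
      fun D _ I e => ?_
    have key : ∀ a (y : Fin m → D), optCons a (Sum.elim e y) ∘
        (Sum.elim (fun a => some (.inl a)) fun i : Fin (m + 1) =>
          Fin.lastCases (motive := fun _ => Option (A ⊕ Fin m)) none (fun j => some (.inr j)) i) =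
        Sum.elim e (Fin.snoc y a : Fin (m + 1) → D) := by
      intro a y
      funext z
      rcases z with z | i
      · rfl
      · refine Fin.lastCases ?_ (fun i => ?_) i <;> simp [optCons]
    constructor
    · rintro ⟨y, a, ha⟩
      have := (hφ D I _).1 ha
      beta_reduce at this
      rw [key] at this
      exact ⟨_, this⟩
    · rintro ⟨y, hy⟩
      refine ⟨Fin.init y, y (Fin.last m), (hφ D I _).2 ?_⟩
      beta_reduce
      rw [key, Fin.snoc_init_self]
      exact hy

theorem exists_block [Finite B]
    {P : ∀ (D : Type) [LinearOrder D], Interp R D → (A ⊕ B → D) → Prop}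
    (h : FODef R P) : FODef R fun D _ I e => ∃ y : B → D, P D I (Sum.elim e y) := by
  obtain ⟨m, ⟨g⟩⟩ := Finite.exists_equiv_fin B
  refine (exists_fin m (h.map (Sum.map id g))).congr fun D _ I e => ?_
  have key : ∀ y : Fin m → D, Sum.elim e y ∘ Sum.map id g = Sum.elim e (y ∘ g) := by
    intro y
    funext z
    cases z <;> rfl
  constructor
  · rintro ⟨y, hy⟩
    exact ⟨_, by rwa [← key]⟩
  · rintro ⟨y, hy⟩
    refine ⟨y ∘ g.symm, ?_⟩
    rw [key, Function.comp_assoc, g.symm_comp_self]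
    exact hy

/-- Among the solutions of finitely many definable conditions one can be chosen in a definable
way: the first condition that has a solution, and its lexicographically least solution. -/
theorem exists_choice {ι : Type} [Finite ι] [Finite A]
    {P : ι → ∀ (D : Type) [LinearOrder D], Interp R D → (A → D) → Prop}
    (h : ∀ i, FODef R (P i)) :
    ∃ Q : ι → ∀ (D : Type) [LinearOrder D], Interp R D → (A → D) → Prop,
      (∀ i, FODef R (Q i)) ∧ ∀ (D : Type) [LinearOrder D] [Finite D] (I : Interp R D),
        (∀ i e, Q i D I e → P i D I e) ∧
        (∀ i i' e e', Q i D I e → Q i' D I e' → i = i' ∧ e = e') ∧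
        ((∃ i e, P i D I e) → ∃ i e, Q i D I e) := by
  obtain ⟨m, ⟨g⟩⟩ := Finite.exists_equiv_fin A
  obtain ⟨n, ⟨c⟩⟩ := Finite.exists_equiv_fin ι
  -- The assignments in lexicographic order, along an enumeration of the variables.
  let L (D : Type) [LinearOrder D] (e : A → D) : Lex (Fin m → D) := toLex (e ∘ g.symm)
  have hL : ∀ (D : Type) [LinearOrder D], Function.Injective (L D) := by
    intro D _ e e' h
    have := congrArg ofLex h
    have h' : e ∘ g.symm = e' ∘ g.symm := this
    exact g.symm.surjective.injective_comp_right h'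
  have hlt : FODef R fun (D : Type) _ I (e : A ⊕ A → D) => L D (e ∘ .inr) < L D (e ∘ .inl) := by
    have : ∀ (D : Type) [LinearOrder D] (e e' : A → D), L D e < L D e' ↔
        ∃ i : Fin m, (∀ j : Fin m, i ≤ j ∨ e (g.symm j) = e' (g.symm j)) ∧
          e (g.symm i) < e' (g.symm i) := by
      intro D _ e e'
      refine exists_congr fun i => and_congr (forall_congr' fun j => ?_) Iff.rfl
      rw [← not_lt, ← imp_iff_not_or]
      rfl
    refine (exists_index fun i : Fin m => (forall_index fun j : Fin m => (const (i ≤ j)).or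
      (eq (A := A ⊕ A) (.inr (g.symm j)) (.inl (g.symm j)))).and
      (lt (A := A ⊕ A) (.inr (g.symm i)) (.inl (g.symm i)))).congr
      fun D _ I e => (this D (e ∘ .inr) (e ∘ .inl)).symm
  refine ⟨fun i D _ I e => P i D I e ∧ (¬ ∃ i', c i' < c i ∧ ∃ e', P i' D I e') ∧
    ¬ ∃ e', P i D I e' ∧ L D e' < L D e, fun i => ?_, fun D _ _ I => ⟨?_, ?_, ?_⟩⟩
  · refine (h i).and ((exists_index fun i' => (const _).and ?_).not.and ?_)
    · exact exists_block (A := A) (B := A) (P := fun D _ I e => P i' D I (e ∘ .inr))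
        ((h i').map Sum.inr)
    · exact (exists_block (((h i).map Sum.inr).and hlt)).not
  · exact fun i e h => h.1
  · rintro i i' e e' ⟨h₁, h₂, h₃⟩ ⟨h₁', h₂', h₃'⟩
    have hi : i = i' := by
      refine c.injective (le_antisymm ?_ ?_)
      · exact not_lt.1 fun hlt => h₂ ⟨i', hlt, e', h₁'⟩
      · exact not_lt.1 fun hlt => h₂' ⟨i, hlt, e, h₁⟩
    subst hi
    refine ⟨rfl, hL D (le_antisymm ?_ ?_)⟩
    · exact not_lt.1 fun hlt => h₃ ⟨e', h₁', hlt⟩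
    · exact not_lt.1 fun hlt => h₃' ⟨e, h₁, hlt⟩
  · rintro ⟨i₀, e₀, h₀⟩
    obtain ⟨i, ⟨e₁, h₁⟩, hi⟩ := Set.exists_min_image {i | ∃ e, P i D I e} c (Set.toFinite _)
      ⟨i₀, e₀, h₀⟩
    obtain ⟨e, he, hm⟩ := Set.exists_min_image {e | P i D I e} (L D) (Set.toFinite _) ⟨e₁, h₁⟩
    refine ⟨i, e, he, ?_, ?_⟩
    · rintro ⟨i', hlt, he'⟩
      exact not_lt.2 (hi i' he') hlt
    · rintro ⟨e', he', hlt⟩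
      exact not_lt.2 (hm e' he') hlt

end FODef

/-- `P` is defined by a Boolean combination of first-order formulae and second-order atoms. -/
def QFDef (R : Signature) {A J : Type} (ar : J → ℕ)
    (P : ∀ (D : Type) [LinearOrder D], Interp R D → SOAsg ar D → (A → D) → Prop) : Prop :=
  ∃ ψ : QF R A ar, ∀ (D : Type) [LinearOrder D] (I : Interp R D) (X : SOAsg ar D) (e : A → D),
    ψ.Sat I X e ↔ P D I X e

namespace QFDef

variable {R : Signature} {A B J : Type} {ar : J → ℕ}
  {P Q : ∀ (D : Type) [LinearOrder D], Interp R D → SOAsg ar D → (A → D) → Prop}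

theorem congr (h : QFDef R ar P) (hPQ : ∀ (D : Type) [LinearOrder D] (I : Interp R D) X e,
    P D I X e ↔ Q D I X e) : QFDef R ar Q := by
  obtain ⟨φ, hφ⟩ := h
  exact ⟨φ, fun D _ I X e => (hφ D I X e).trans (hPQ D I X e)⟩

theorem not (h : QFDef R ar P) : QFDef R ar fun D _ I X e => ¬ P D I X e := by
  obtain ⟨φ, hφ⟩ := h
  exact ⟨.neg φ, fun D _ I X e => not_congr (hφ D I X e)⟩

theorem or (h : QFDef R ar P) (h' : QFDef R ar Q) :
    QFDef R ar fun D _ I X e => P D I X e ∨ Q D I X e := by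
  obtain ⟨φ, hφ⟩ := h
  obtain ⟨ψ, hψ⟩ := h'
  exact ⟨.or φ ψ, fun D _ I X e => or_congr (hφ D I X e) (hψ D I X e)⟩

theorem and (h : QFDef R ar P) (h' : QFDef R ar Q) :
    QFDef R ar fun D _ I X e => P D I X e ∧ Q D I X e :=
  (h.not.or h'.not).not.congr fun D _ I X e => by simp only [not_or, not_not]

theorem iff (h : QFDef R ar P) (h' : QFDef R ar Q) :
    QFDef R ar fun D _ I X e => P D I X e ↔ Q D I X e :=
  ((h.and h').or (h.not.and h'.not)).congr fun D _ I X e => by tauto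

theorem so (j : J) (u : Fin (ar j) → A) : QFDef R ar fun _ _ _ X e => (fun i => e (u i)) ∈ X j :=
  ⟨.so j u, fun _ _ _ _ _ => Iff.rfl⟩

theorem of_foDef {P : ∀ (D : Type) [LinearOrder D], Interp R D → (A → D) → Prop}
    (h : FODef R P) : QFDef R ar fun D _ I _ e => P D I e := by
  obtain ⟨φ, hφ⟩ := h
  exact ⟨.fo φ, fun D _ I _ e => hφ D I e⟩

theorem sat (ψ : QF R A ar) (f : A → B) : QFDef R ar fun _ _ I X e => ψ.Sat I X (e ∘ f) :=
  ⟨ψ.mapFO f, fun _ _ I X e => ψ.sat_mapFO I X f e⟩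

theorem exists_index {ι : Type} [Finite ι]
    {P : ι → ∀ (D : Type) [LinearOrder D], Interp R D → SOAsg ar D → (A → D) → Prop}
    (h : ∀ i, QFDef R ar (P i)) : QFDef R ar fun D _ I X e => ∃ i, P i D I X e := by
  have := Fintype.ofFinite ι
  suffices H : ∀ s : Finset ι, QFDef R ar fun D _ I X e => ∃ i ∈ s, P i D I X e from
    (H Finset.univ).congr fun D _ I X e => by simp
  intro s
  classical
  induction s using Finset.induction_on with
  | empty =>
    exact (of_foDef (FODef.const (R := R) (A := A) False)).congr fun D _ I X e => by simp
  | insert i s _ ih => exact ((h i).or ih).congr fun D _ I X e => by simp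

end QFDef

/-! ### Products and subtraction of one -/

/-- The relations that contain just the values under `e` of the tuples of variables in `T`. -/
def atomRel {J C D : Type} {ar : J → ℕ} (T : Set (Σ j, Fin (ar j) → C)) (e : C → D) : SOAsg ar D :=
  fun j => {z | ∃ u, (⟨j, u⟩ : Σ j, Fin (ar j) → C) ∈ T ∧ ∀ i, z i = e (u i)}

/-- The second-order atoms become first-order definable once the relations are given by an
assignment to finitely many first-order variables. -/
theorem QF.foDef_atomRel {R : Signature} {J C : Type} [Finite C] {ar : J → ℕ} (ψ : QF R C ar)
    (T : Set (Σ j, Fin (ar j) → C)) : FODef R fun _ _ I e => ψ.Sat I (atomRel T e) e := by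
  induction ψ with
  | so j u =>
    exact FODef.exists_index fun u' : Fin (ar j) → C => (FODef.const _).and
      (FODef.forall_index fun i => FODef.eq (u i) (u' i))
  | fo φ => exact ⟨φ, fun _ _ _ _ => Iff.rfl⟩
  | neg ψ ih => exact ih.not
  | or ψ₁ ψ₂ h₁ h₂ => exact h₁.or h₂

/-- Under an assignment `e` only the values of tuples of variables matter. -/
theorem QF.sat_atomRel {R : Signature} {J C D : Type} [LT D] {ar : J → ℕ} (I : Interp R D)
    (X : SOAsg ar D) (ψ : QF R C ar) (e : C → D) :
    ψ.Sat I (atomRel {a | (fun i => e (a.2 i)) ∈ X a.1} e) e ↔ ψ.Sat I X e := by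
  induction ψ with
  | so j u =>
    constructor
    · rintro ⟨u', hu', h⟩
      have h : (fun i => e (u i)) = fun i => e (u' i) := funext h
      rw [QF.Sat, h]
      exact hu'
    · exact fun h => ⟨u, h, fun _ => rfl⟩
  | fo φ => exact Iff.rfl
  | neg ψ ih => exact not_congr ih
  | or ψ₁ ψ₂ h₁ h₂ => exact or_congr h₁ h₂

namespace CTerm

variable {R : Signature}

/-- Whether a counting term is nonzero is first-order definable, and there is a counting term for
its value minus one: a solution in which the second-order variables hold only tuples of values of
first-order variables is chosen in a definable way and left out. -/
theorem exists_pred (t : CTerm R) : ∃ (φ : FO R Empty) (t' : CTerm R),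
    ∀ (D : Type) [LinearOrder D] [Finite D] [Nonempty D] (I : Interp R D),
      (φ.Sat I Empty.elim ↔ t.val I ≠ 0) ∧ t'.val I = t.val I - 1 := by
  obtain ⟨Q, hQ, hspec⟩ := FODef.exists_choice fun T : Set (Σ j, Fin (t.ar j) → t.A ⊕ t.B) =>
    t.ψ.foDef_atomRel T
  obtain ⟨φ, hφ⟩ : FODef R (A := Empty) fun D _ I _ => ∃ T, ∃ e, Q T D I e :=
    FODef.exists_index fun T => FODef.exists_block (A := Empty) (B := t.A ⊕ t.B)
      (P := fun D _ I e => Q T D I (e ∘ .inr)) ((hQ T).map Sum.inr)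
  -- The variables `z j` range over the tuples on which `X j` may differ from the solution left out.
  let z (j : t.J) (i : Fin (t.ar j)) : t.A ⊕ (t.B ⊕ Σ j, Fin (t.ar j)) := .inr (.inr ⟨j, i⟩)
  -- `ψ` says that `(x̄, X̄)` is a solution and differs from the one chosen by `Q`, in a variable of
  -- `x̄` or at a tuple `z j`. As the tuple is bound existentially, this is in `Σ₁[FO]`.
  obtain ⟨ψ, hψ⟩ : QFDef R t.ar (A := t.A ⊕ (t.B ⊕ Σ j, Fin (t.ar j))) fun D _ I X e =>
      t.ψ.Sat I X (e ∘ Sum.map id .inl) ∧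
      ((∃ i : t.A, ¬ ∃ T, ∃ e', Q T D I e' ∧ e (.inl i) = e' (.inl i)) ∨
        ∃ j : t.J, ¬ ((fun i => e (z j i)) ∈ X j ↔ ∃ T, ∃ e', Q T D I e' ∧ ∃ u,
          (⟨j, u⟩ : Σ j, Fin (t.ar j) → t.A ⊕ t.B) ∈ T ∧ ∀ i, e (z j i) = e' (u i))) := by
    refine (QFDef.sat t.ψ _).and ((QFDef.exists_index fun i => ?_).or
      (QFDef.exists_index fun j => (QFDef.iff (QFDef.so j (z j)) ?_).not))
    · refine (QFDef.of_foDef (FODef.exists_index fun T => ?_)).not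
      exact FODef.exists_block (((hQ T).map Sum.inr).and
        (FODef.eq (Sum.inl (Sum.inl i)) (Sum.inr (Sum.inl i))))
    · refine QFDef.of_foDef (FODef.exists_index fun T => ?_)
      exact FODef.exists_block (((hQ T).map Sum.inr).and (FODef.exists_index
        fun u : Fin (t.ar j) → t.A ⊕ t.B => (FODef.const _).and
          (FODef.forall_index fun i => FODef.eq (.inl (z j i)) (.inr (u i)))))
  refine ⟨φ, ⟨t.A, t.B ⊕ Σ j, Fin (t.ar j), t.J, t.ar, ψ⟩, fun D _ _ _ I => ?_⟩
  obtain ⟨h₁, h₂, h₃⟩ := hspec D I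
  have hval : t.val I ≠ 0 ↔ ∃ p, t.Holds I p := by
    rw [val, Nat.card_ne_zero, nonempty_subtype]
    exact and_iff_left inferInstance
  have hex : (∃ T e, Q T D I e) ↔ ∃ p, t.Holds I p := by
    constructor
    · rintro ⟨T, e, he⟩
      refine ⟨(e ∘ .inl, atomRel T e), e ∘ .inr, ?_⟩
      rw [Sum.elim_comp_inl_inr]
      exact h₁ _ _ he
    · rintro ⟨⟨x, X⟩, y, hy⟩
      exact h₃ ⟨_, _, (QF.sat_atomRel I X t.ψ _).2 hy⟩
  refine ⟨(hφ D I _).trans (hex.trans hval.symm), ?_⟩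
  by_cases hT : ∃ T e, Q T D I e
  · obtain ⟨T, e, he⟩ := hT
    let p₀ : t.Choice D := (e ∘ .inl, atomRel T e)
    have hp₀ : t.Holds I p₀ := by
      refine ⟨e ∘ .inr, ?_⟩
      rw [Sum.elim_comp_inl_inr]
      exact h₁ _ _ he
    -- As the choice is unique, "some choice with `F`" is the same as "`F` for the choice".
    have huniq : ∀ F : (t.A ⊕ t.B → D) → Set (Σ j, Fin (t.ar j) → t.A ⊕ t.B) → Prop,
        (∃ T, ∃ e', Q T D I e' ∧ F e' T) ↔ F e T := by
      intro F
      constructor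
      · rintro ⟨T', e', he', hF⟩
        obtain ⟨rfl, rfl⟩ := h₂ _ _ _ _ he he'
        exact hF
      · exact fun hF => ⟨T, e, he, hF⟩
    have hiff : ∀ p : t.Choice D, CTerm.Holds I ⟨t.A, t.B ⊕ Σ j, Fin (t.ar j), t.J, t.ar, ψ⟩ p ↔
        t.Holds I p ∧ p ≠ p₀ := by
      rintro ⟨x, X⟩
      have hy : ∀ y : (t.B ⊕ Σ j, Fin (t.ar j)) → D, ψ.Sat I X (Sum.elim x y) ↔
          t.ψ.Sat I X (Sum.elim x (y ∘ .inl)) ∧ ((∃ i, x i ≠ e (.inl i)) ∨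
            ∃ j, ¬ ((fun i => y (.inr ⟨j, i⟩)) ∈ X j ↔
              (fun i => y (.inr ⟨j, i⟩)) ∈ atomRel T e j)) := by
        intro y
        rw [hψ]
        beta_reduce
        have : Sum.elim x y ∘ Sum.map id .inl = Sum.elim x (y ∘ .inl) := by
          funext z; cases z <;> rfl
        rw [this]
        refine and_congr Iff.rfl (or_congr (exists_congr fun i => not_congr ?_)
          (exists_congr fun j => not_congr (iff_congr Iff.rfl ?_)))
        · exact huniq fun e' _ => x i = e' (.inl i)
        · exact huniq fun e' T => ∃ u, (⟨j, u⟩ : Σ j, Fin (t.ar j) → t.A ⊕ t.B) ∈ T ∧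
            ∀ i, y (.inr ⟨j, i⟩) = e' (u i)
      constructor
      · rintro ⟨y, h⟩
        obtain ⟨h, h'⟩ := (hy y).1 h
        refine ⟨⟨_, h⟩, ?_⟩
        rintro heq
        obtain ⟨rfl, rfl⟩ := Prod.ext_iff.1 heq
        rcases h' with ⟨i, hi⟩ | ⟨j, hj⟩
        · exact hi rfl
        · exact hj Iff.rfl
      · rintro ⟨⟨y, h⟩, hne⟩
        by_cases hx : x = e ∘ .inl
        · have hX : X ≠ atomRel T e := fun hX => hne (Prod.ext hx hX)
          obtain ⟨j, hj⟩ := Function.ne_iff.1 hX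
          obtain ⟨u, hu⟩ := not_forall.1 (mt Set.ext hj)
          classical
          let y' : (t.B ⊕ Σ j, Fin (t.ar j)) → D := Sum.elim y fun a =>
            if h : a.1 = j then u (Fin.cast (by rw [h]) a.2) else Classical.arbitrary D
          have hy' : (fun i => y' (.inr ⟨j, i⟩)) = u := by
            funext i
            simp [y']
          refine ⟨y', (hy y').2 ⟨h, .inr ⟨j, ?_⟩⟩⟩
          rw [hy']
          exact hu
        · obtain ⟨i, hi⟩ := Function.ne_iff.1 hx
          exact ⟨Sum.elim y fun _ => Classical.arbitrary D, (hy _).2 ⟨h, .inl ⟨i, hi⟩⟩⟩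
    have : {p : t.Choice D | t.Holds I p ∧ p ≠ p₀} = {p | t.Holds I p} \ {p₀} := by
      ext p; simp
    calc _ = Nat.card {p : t.Choice D // t.Holds I p ∧ p ≠ p₀} :=
          Nat.card_congr (Equiv.subtypeEquivRight hiff)
      _ = ({p | t.Holds I p} \ {p₀}).ncard := by rw [← this]; rfl
      _ = _ := by rw [Set.ncard_sdiff_singleton_of_mem (show p₀ ∈ {p | t.Holds I p} from hp₀)]; rfl
  · have h0 : t.val I = 0 := not_not.1 (mt (fun h => hex.2 (hval.1 h)) hT)
    rw [h0, val]
    have : ∀ p : t.Choice D,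
        ¬ CTerm.Holds I ⟨t.A, t.B ⊕ Σ j, Fin (t.ar j), t.J, t.ar, ψ⟩ p := by
      rintro ⟨x, X⟩ ⟨y, hy⟩
      refine hT (hex.2 ⟨(x, X), y ∘ .inl, ?_⟩)
      have : Sum.elim x y ∘ Sum.map id .inl = Sum.elim x (y ∘ .inl) := by
        funext z; cases z <;> rfl
      have h := ((hψ D I X _).1 hy).1
      rw [this] at h
      exact h
    rw [Nat.card_eq_zero]
    exact .inl ⟨fun p => this p.1 p.2⟩

/-- Multiply a term by the truth value of a sentence. -/
theorem exists_guard (t : CTerm R) (φ : FO R Empty) : ∃ t' : CTerm R,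
    ∀ (D : Type) [LinearOrder D] (I : Interp R D),
      (φ.Sat I Empty.elim → t'.val I = t.val I) ∧ (¬ φ.Sat I Empty.elim → t'.val I = 0) := by
  refine ⟨⟨t.A, t.B, t.J, t.ar, t.ψ.and (.fo (φ.map Empty.elim))⟩, fun D _ I => ?_⟩
  have h : ∀ p : t.Choice D, CTerm.Holds I
      ⟨t.A, t.B, t.J, t.ar, t.ψ.and (.fo (φ.map Empty.elim))⟩ p ↔
      t.Holds I p ∧ φ.Sat I Empty.elim := by
    rintro ⟨x, X⟩
    have : ∀ y : t.B → D, (t.ψ.and (.fo (φ.map Empty.elim))).Sat I X (Sum.elim x y) ↔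
        t.ψ.Sat I X (Sum.elim x y) ∧ φ.Sat I Empty.elim := by
      intro y
      refine (QF.sat_and _ _ _ _ _).trans (and_congr Iff.rfl ((φ.sat_map I _ _).trans ?_))
      rw [Subsingleton.elim (Sum.elim x y ∘ Empty.elim) Empty.elim]
    exact (exists_congr this).trans exists_and_right
  constructor
  · intro hφ
    exact Nat.card_congr (Equiv.subtypeEquivRight fun p => (h p).trans (and_iff_left hφ))
  · intro hφ
    rw [val, Nat.card_eq_zero]
    exact .inl ⟨fun p => hφ ((h p.1).1 p.2).2⟩

/-- The product counts pairs of solutions, with disjoint variables. -/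
theorem exists_mul (t₁ t₂ : CTerm R) : ∃ t' : CTerm R,
    ∀ (D : Type) [LinearOrder D] (I : Interp R D), t'.val I = t₁.val I * t₂.val I := by
  let ψ : QF R ((t₁.A ⊕ t₂.A) ⊕ (t₁.B ⊕ t₂.B)) (Sum.elim t₁.ar t₂.ar) :=
    (t₁.ψ.map (Sum.map .inl .inl) Sum.inl fun _ => rfl).and
      (t₂.ψ.map (Sum.map .inr .inr) Sum.inr fun _ => rfl)
  refine ⟨⟨t₁.A ⊕ t₂.A, t₁.B ⊕ t₂.B, t₁.J ⊕ t₂.J, Sum.elim t₁.ar t₂.ar, ψ⟩, fun D _ I => ?_⟩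
  have key : ∀ (x : t₁.A ⊕ t₂.A → D) (y : t₁.B ⊕ t₂.B → D) (X : SOAsg (Sum.elim t₁.ar t₂.ar) D),
      ψ.Sat I X (Sum.elim x y) ↔
        t₁.ψ.Sat I (fun j => X (.inl j)) (Sum.elim (x ∘ .inl) (y ∘ .inl)) ∧
        t₂.ψ.Sat I (fun j => X (.inr j)) (Sum.elim (x ∘ .inr) (y ∘ .inr)) := by
    intro x y X
    refine (QF.sat_and _ _ _ _ _).trans (and_congr ?_ ?_)
    · refine (QF.sat_map I (fun j => X (.inl j)) X _ _ _ (fun _ _ => Iff.rfl) _ _).trans ?_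
      have : Sum.elim x y ∘ Sum.map .inl .inl = Sum.elim (x ∘ .inl) (y ∘ .inl) := by
        funext z; cases z <;> rfl
      rw [this]
    · refine (QF.sat_map I (fun j => X (.inr j)) X _ _ _ (fun _ _ => Iff.rfl) _ _).trans ?_
      have : Sum.elim x y ∘ Sum.map .inr .inr = Sum.elim (x ∘ .inr) (y ∘ .inr) := by
        funext z; cases z <;> rfl
      rw [this]
  simp only [val]
  rw [← Nat.card_prod]
  refine Nat.card_congr
    { toFun := fun p => (⟨(p.1.1 ∘ .inl, fun j => p.1.2 (.inl j)), ?_⟩,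
        ⟨(p.1.1 ∘ .inr, fun j => p.1.2 (.inr j)), ?_⟩)
      invFun := fun p => ⟨(Sum.elim p.1.1.1 p.2.1.1, soElim p.1.1.2 p.2.1.2), ?_⟩
      left_inv := ?_
      right_inv := fun p => rfl }
  · obtain ⟨⟨x, X⟩, y, hy⟩ := p
    exact ⟨y ∘ .inl, ((key x y X).1 hy).1⟩
  · obtain ⟨⟨x, X⟩, y, hy⟩ := p
    exact ⟨y ∘ .inr, ((key x y X).1 hy).2⟩
  · obtain ⟨⟨⟨x₁, X₁⟩, y₁, h₁⟩, ⟨⟨x₂, X₂⟩, y₂, h₂⟩⟩ := p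
    exact ⟨Sum.elim y₁ y₂, (key _ (Sum.elim y₁ y₂) _).2 ⟨h₁, h₂⟩⟩
  · rintro ⟨⟨x, X⟩, h⟩
    refine Subtype.ext (Prod.ext (Sum.elim_comp_inl_inr x) ?_)
    funext j
    cases j <;> rfl

end CTerm

section Closure

variable {R : Signature} {f g : OrdStruct R → ℕ}

theorem add_mem_sigmaQSOClass (hf : f ∈ SigmaQSOClass R) (hg : g ∈ SigmaQSOClass R) :
    (fun S => f S + g S) ∈ SigmaQSOClass R := by
  obtain ⟨l, hl⟩ := mem_sigmaQSOClass_iff.1 hf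
  obtain ⟨l', hl'⟩ := mem_sigmaQSOClass_iff.1 hg
  exact mem_sigmaQSOClass_iff.2 ⟨l ++ l', fun S => by simp [hl, hl']⟩

theorem mul_mem_sigmaQSOClass (hf : f ∈ SigmaQSOClass R) (hg : g ∈ SigmaQSOClass R) :
    (fun S => f S * g S) ∈ SigmaQSOClass R := by
  obtain ⟨l, hl⟩ := mem_sigmaQSOClass_iff.1 hf
  obtain ⟨l', hl'⟩ := mem_sigmaQSOClass_iff.1 hg
  choose m hm using fun t₁ t₂ : CTerm R => t₁.exists_mul t₂
  have h₁ : ∀ (S : OrdStruct R) (t : CTerm R), ((l'.map (m t)).map fun t => t.val S.rel).sum =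
      t.val S.rel * g S := by
    intro S t
    rw [hl' S, List.map_map, ← List.sum_map_mul_left]
    exact congrArg List.sum (List.map_congr_left fun t' _ => hm t t' S.Dom S.rel)
  refine mem_sigmaQSOClass_iff.2 ⟨l.flatMap fun t => l'.map (m t), fun S => ?_⟩
  rw [hl S]
  clear hl
  induction l with
  | nil => simp
  | cons t l ih =>
    rw [List.flatMap_cons, List.map_append, List.sum_append, h₁, ← ih, List.map_cons,
      List.sum_cons, add_mul]

theorem pred_mem_sigmaQSOClass (hf : f ∈ SigmaQSOClass R) :
    (fun S => f S - 1) ∈ SigmaQSOClass R := by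
  obtain ⟨l, hl⟩ := mem_sigmaQSOClass_iff.1 hf
  refine mem_sigmaQSOClass_iff.2 ?_
  simp only [hl]
  clear hl
  induction l with
  | nil => exact ⟨[], fun S => by simp⟩
  | cons t l ih =>
    obtain ⟨l', hl'⟩ := ih
    obtain ⟨φ, t', h⟩ := t.exists_pred
    choose m hm using fun (φ : FO R Empty) (t : CTerm R) => t.exists_guard φ
    have h₁ : ∀ (S : OrdStruct R) (φ : FO R Empty) (l : List (CTerm R)),
        φ.Sat S.rel Empty.elim → ((l.map (m φ)).map fun t => t.val S.rel).sum =
          (l.map fun t => t.val S.rel).sum := by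
      intro S φ l hφ
      rw [List.map_map]
      exact congrArg List.sum (List.map_congr_left fun t _ => (hm φ t S.Dom S.rel).1 hφ)
    have h₀ : ∀ (S : OrdStruct R) (φ : FO R Empty) (l : List (CTerm R)),
        ¬ φ.Sat S.rel Empty.elim → ((l.map (m φ)).map fun t => t.val S.rel).sum = 0 := by
      intro S φ l hφ
      rw [List.sum_eq_zero_iff]
      simp only [List.map_map, List.mem_map]
      rintro _ ⟨t, -, rfl⟩
      exact (hm φ t S.Dom S.rel).2 hφ
    -- `(a + b) - 1` is `(a - 1) + b` for `a > 0`, and `b - 1` for `a = 0`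
    refine ⟨t' :: (l.map (m φ) ++ l'.map (m (.neg φ))), fun S => ?_⟩
    obtain ⟨hφ, ht'⟩ := h S.Dom S.rel
    simp only [List.map_cons, List.map_append, List.sum_cons, List.sum_append, ht']
    by_cases hS : φ.Sat S.rel Empty.elim
    · rw [h₁ S φ l hS, h₀ S (.neg φ) l' (fun h => h hS)]
      have := hφ.1 hS
      omega
    · rw [h₀ S φ l hS, h₁ S (.neg φ) l' hS, ← hl']
      have := not_not.1 (mt hφ.2 hS)
      omega

end Closure

end QuantLogic

namespace QuantLogic

/-! ### Programs that evaluate formulae -/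

/-- The tapes and registers of the programs. -/
inductive Tp : Type where
  | inp | len | out
  /-- The size `n` of the domain. -/
  | size
  /-- The number `n ^ d`. -/
  | pow (d : ℕ)
  /-- A copy of `n ^ d`, for loops over the cells of a relation. -/
  | cells (d : ℕ)
  /-- The address of the first bit of the `i`-th relation on the input tape. -/
  | off (i : ℕ)
  | var (i : ℕ)
  /-- The partial relation that is the value of the `j`-th second-order variable. -/
  | so (j : ℕ)
  /-- Scratch tape for comparisons. -/
  | cmp
  /-- The accuracy `m = ⌈1 / ε⌉`, the least power `2 ^ l ≥ m` (twice), and the tape that marks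
  it. -/
  | acc | pow2 | pow2' | mark
  /-- The number of samples and its binary logarithm. -/
  | samples | shift
  /-- A binary counter and a bound on its number of digits. -/
  | sum | width
deriving DecidableEq

/-- The flags of the programs. -/
inductive Fg : Type where
  | ex (d : ℕ) | coin | done | phase | phase' | carry
deriving DecidableEq

/-- The registers that are changed only by loops, once they are set up. -/
def Tp.IsReg : Tp → Prop
  | inp | out | so _ | cmp | mark | sum => False
  | _ => True

/-- The programs over these tapes and flags. -/
abbrev Prog : Type := Cmd Tp Fg
/-- The states of such programs. -/
abbrev St : Type := State Tp Fg

namespace Cmd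

section Generic

variable {K Fl : Type} [DecidableEq K] [DecidableEq Fl]

theorem den_seq_of_leaf {c₁ : Cmd K Fl} {s s' : State K Fl} (h : c₁.den s = .leaf s')
    (c₂ : Cmd K Fl) : (c₁ ;; c₂).den s = c₂.den s' := by
  rw [den, h]; rfl

theorem den_seq_assoc (a b c : Cmd K Fl) (s : State K Fl) :
    (a ;; b ;; c).den s = ((a ;; b) ;; c).den s := by
  simp only [den, Tree.bind_assoc]

/-- A loop whose rounds are deterministic. -/
theorem den_loop_of_leaf {k : K} {c : Cmd K Fl} {s : State K Fl} (f : ℕ → State K Fl)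
    (h0 : f 0 = s) (hk : ∀ i, (f i).head k = s.head k)
    (h : ∀ i < s.head k, c.den ((f i).setHead k i) = .leaf ((f (i + 1)).setHead k i)) :
    (loop k c).den s = .leaf (f (s.head k)) := by
  rw [den]
  suffices H : ∀ j ≤ s.head k, loopM (fun i s' => (c.den (s'.setHead k i)).map
      (State.setHead k (s.head k))) j s = .leaf (f j) from H _ le_rfl
  intro j hj
  induction j with
  | zero => rw [loopM, h0]
  | succ j ih =>
    rw [loopM, ih (by omega)]
    show (c.den ((f j).setHead k j)).map _ = _
    rw [h j (by omega)]
    show Tree.leaf _ = _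
    rw [State.setHead_setHead, State.setHead_self (hk _)]

theorem den_loop_right {k k' : K} (hk : k ≠ k') (s : State K Fl) :
    (loop k (right k')).den s = .leaf (s.setHead k' (s.head k' + s.head k)) := by
  refine (den_loop_of_leaf (fun i => s.setHead k' (s.head k' + i)) ?_ ?_ ?_)
  · exact State.setHead_self rfl
  · intro i; simp [hk]
  · intro i _
    rw [den, State.setHead_comm hk.symm, State.setHead_setHead, State.setHead_comm hk.symm]
    simp [add_assoc]

theorem den_loop_loop_right {k k₁ k' : K} (hk : k ≠ k') (hk₁ : k₁ ≠ k') (hkk : k ≠ k₁)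
    (s : State K Fl) : (loop k (loop k₁ (right k'))).den s =
      .leaf (s.setHead k' (s.head k' + s.head k * s.head k₁)) := by
  refine (den_loop_of_leaf (fun i => s.setHead k' (s.head k' + i * s.head k₁)) ?_ ?_ ?_)
  · exact State.setHead_self (by simp)
  · intro i; simp [hk]
  · intro i _
    rw [den_loop_right hk₁, State.setHead_comm hk.symm, State.setHead_setHead,
      State.setHead_comm hk.symm]
    simp [hk₁, hkk.symm, add_assoc, add_mul]

/-- Go to a cell with `g`, and branch according to the symbol in it. -/
def test (k : K) (o : Option Bool) (g c₁ c₂ : Cmd K Fl) : Cmd K Fl :=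
  g ;; iteSym k o (reset k ;; c₁) (reset k ;; c₂)

/-- Go to a cell with `g`, and write a symbol. -/
def put (k : K) (o : Option Bool) (g : Cmd K Fl) : Cmd K Fl := g ;; write k o ;; reset k

theorem den_test {k : K} {o : Option Bool} {g c₁ c₂ : Cmd K Fl} {s : State K Fl} {p : ℕ}
    (hg : g.den s = .leaf (s.setHead k p)) (hk : s.head k = 0) :
    (test k o g c₁ c₂).den s = if s.cont k p = o then c₁.den s else c₂.den s := by
  have h : ∀ c : Cmd K Fl, (reset k ;; c).den (s.setHead k p) = c.den s := fun c => by
    refine den_seq_of_leaf ?_ c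
    rw [den, State.setHead_setHead, State.setHead_self hk]
  rw [test, den_seq_of_leaf hg, den, h, h]
  simp

theorem den_put {k : K} {o : Option Bool} {g : Cmd K Fl} {s : State K Fl} {p : ℕ}
    (hg : g.den s = .leaf (s.setHead k p)) (hk : s.head k = 0) :
    (put k o g).den s = .leaf (s.setCell k p o) := by
  rw [put, den_seq_of_leaf hg, den_seq_of_leaf (s' := (s.setCell k p o).setHead k p), den]
  · rw [State.setHead_setHead, State.setHead_self]
    exact hk
  · simp [den, State.setCell_setHead]

theorem WF.test {L : K → Prop} {k : K} {o : Option Bool} {g c₁ c₂ : Cmd K Fl} (hk : ¬ L k)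
    (hg : g.WF L) (h₁ : c₁.WF L) (h₂ : c₂.WF L) : (Cmd.test k o g c₁ c₂).WF L :=
  ⟨hg, ⟨hk, h₁⟩, hk, h₂⟩

theorem WF.put {L : K → Prop} {k : K} {o : Option Bool} {g : Cmd K Fl} (hk : ¬ L k)
    (hg : g.WF L) : (Cmd.put k o g).WF L :=
  ⟨hg, trivial, hk⟩

end Generic

end Cmd

/-! #### Addresses of tuples -/

/-- The position of a tuple in the lexicographic order. -/
def tupleIdx {n : ℕ} : (r : ℕ) → (Fin r → Fin n) → ℕ
  | 0, _ => 0
  | r + 1, t => t 0 * n ^ r + tupleIdx r (Fin.tail t)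

theorem tupleIdx_lt {n : ℕ} (r : ℕ) (t : Fin r → Fin n) : tupleIdx r t < n ^ r := by
  induction r with
  | zero => simp [tupleIdx]
  | succ r ih =>
    have h₁ := ih (Fin.tail t)
    have h₂ : (t 0 + 1) * n ^ r ≤ n * n ^ r := Nat.mul_le_mul_right _ (t 0).2
    rw [tupleIdx, pow_succ']
    linarith

theorem tupleIdx_injective {n : ℕ} (r : ℕ) : Function.Injective (tupleIdx (n := n) r) := by
  induction r with
  | zero => exact fun _ _ _ => Subsingleton.elim _ _
  | succ r ih =>
    intro t t' h
    have h₁ := tupleIdx_lt r (Fin.tail t)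
    have h₂ := tupleIdx_lt r (Fin.tail t')
    simp only [tupleIdx] at h
    have hd : ∀ a b : ℕ, b < n ^ r → (a * n ^ r + b) / n ^ r = a ∧ (a * n ^ r + b) % n ^ r = b := by
      intro a b hb
      rw [mul_comm, Nat.mul_add_div (by omega), Nat.div_eq_of_lt hb, Nat.mul_add_mod,
        Nat.mod_eq_of_lt hb]
      simp
    have e₁ := (hd _ _ h₁).1.symm.trans ((congrArg (· / n ^ r) h).trans (hd _ _ h₂).1)
    have e₂ := (hd _ _ h₁).2.symm.trans ((congrArg (· % n ^ r) h).trans (hd _ _ h₂).2)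
    rw [← Fin.cons_self_tail t, ← Fin.cons_self_tail t', Fin.ext e₁, ih e₂]

theorem exists_tupleIdx {n : ℕ} (r : ℕ) {p : ℕ} (hp : p < n ^ r) :
    ∃ t : Fin r → Fin n, tupleIdx r t = p := by
  have hb : Function.Bijective fun t : Fin r → Fin n => (⟨tupleIdx r t, tupleIdx_lt r t⟩ :
      Fin (n ^ r)) :=
    (Fintype.bijective_iff_injective_and_card _).2
      ⟨fun t t' h => tupleIdx_injective r (Fin.mk.inj h), by simp⟩
  obtain ⟨t, ht⟩ := hb.2 ⟨p, hp⟩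
  exact ⟨t, congrArg Fin.val ht⟩

namespace Prog

open Cmd Tp Fg

/-- Move the head of `k` by the position of the tuple of the values of the variables `u`. -/
def addIdx (k : Tp) : (r : ℕ) → (Fin r → ℕ) → Prog
  | 0, _ => skip
  | r + 1, u => loop (var (u 0)) (loop (pow r) (right k)) ;; addIdx k r (Fin.tail u)

theorem den_addIdx {n : ℕ} {k : Tp} (hk : ¬ k.IsReg) (r : ℕ) (u : Fin r → ℕ) (t : Fin r → Fin n)
    (s : St) (hu : ∀ i, s.head (var (u i)) = t i) (hp : ∀ d < r, s.head (pow d) = n ^ d) :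
    (addIdx k r u).den s = .leaf (s.setHead k (s.head k + tupleIdx r t)) := by
  have h₁ : ∀ i, var i ≠ k := by rintro i rfl; exact hk trivial
  have h₂ : ∀ i, pow i ≠ k := by rintro i rfl; exact hk trivial
  induction r generalizing s with
  | zero =>
    rw [addIdx, den, tupleIdx, State.setHead_self]
    simp
  | succ r ih =>
    rw [addIdx, den_seq_of_leaf (den_loop_loop_right (h₁ _) (h₂ _) (by simp) s),
      ih (Fin.tail u) (Fin.tail t)]
    · rw [State.setHead_setHead, hu, hp r (by omega)]
      simp [tupleIdx, add_assoc]
    · intro i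
      rw [State.setHead_head, Function.update_of_ne (h₁ _)]
      exact hu i.succ
    · intro d hd
      simpa [h₂] using hp d (by omega)

theorem wf_addIdx {k : Tp} (hk : ¬ k.IsReg) (r : ℕ) (u : Fin r → ℕ) :
    (addIdx k r u).WF IsReg := by
  induction r with
  | zero => trivial
  | succ r ih => exact ⟨⟨trivial, trivial, hk⟩, ih _⟩

/-- Branch according to whether the value of `x` is less than that of `y`: mark the first cells of
the tape `cmp`, as many as the value of `y`, and inspect the cell with the number `x`. -/
def ltK (x y : ℕ) (c₁ c₂ : Prog) : Prog :=
  loop (var y) (write cmp (some true) ;; right cmp) ;; reset cmp ;; loop (var x) (right cmp) ;;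
  iteSym cmp (some true)
    (reset cmp ;; loop (var y) (write cmp none ;; right cmp) ;; reset cmp ;; c₁)
    (reset cmp ;; loop (var y) (write cmp none ;; right cmp) ;; reset cmp ;; c₂)

theorem wf_ltK {x y : ℕ} {c₁ c₂ : Prog} (h₁ : c₁.WF IsReg) (h₂ : c₂.WF IsReg) :
    (ltK x y c₁ c₂).WF IsReg := by
  refine ⟨⟨trivial, trivial, id⟩, id, ⟨trivial, id⟩, ⟨id, ⟨trivial, trivial, id⟩, id, h₁⟩,
    id, ⟨trivial, trivial, id⟩, id, h₂⟩

/-- Overwrite the first `N` cells of the tape `k`. -/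
def _root_.QuantLogic.State.fill (k : Tp) (N : ℕ) (o : Option Bool) (s : St) : St :=
  { s with cont := Function.update s.cont k fun i => if i < N then o else s.cont k i }

theorem den_fill {k x : Tp} (hk : k ≠ x) (o : Option Bool) (s : St) (h0 : s.head k = 0) :
    (loop x (write k o ;; right k) ;; reset k).den s = .leaf (s.fill k (s.head x) o) := by
  have h := den_loop_of_leaf (k := x) (c := write k o ;; right k) (s := s)
    (fun i => (s.fill k i o).setHead k i) ?_ ?_ ?_
  · rw [den_seq_of_leaf h, den, State.setHead_setHead, State.setHead_self]
    exact h0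
  · have : s.fill k 0 o = s := by ext <;> simp [State.fill]
    rw [this, State.setHead_self h0]
  · intro i; simp [hk.symm, State.fill]
  · intro i _
    rw [den, den]
    refine congrArg Tree.leaf (State.ext ?_ ?_ ?_)
    · simp only [State.setHead_cont, State.setCell_cont, State.fill]
      rw [Function.update_idem]
      congr 1
      funext j
      by_cases hj : j = i
      · subst hj; simp [hk]
      · have : j < i + 1 ↔ j < i := by omega
        simp [hk, hj, this]
    · simp only [State.setHead_head, State.setCell_head, State.fill]
      funext z
      by_cases hz : z = k
      · subst hz; simp [hk]
      · by_cases hz' : z = x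
        · subst hz'; simp [hk.symm]
        · simp [hz, hz']
    · rfl

theorem den_ltK {x y : ℕ} {c₁ c₂ : Prog} {s : St} (h0 : s.head cmp = 0)
    (hc : ∀ i, s.cont cmp i = none) :
    (ltK x y c₁ c₂).den s =
      if s.head (var x) < s.head (var y) then c₁.den s else c₂.den s := by
  have h₁ := den_fill (k := cmp) (x := var y) (by simp) (some true) s h0
  have h₂ := den_loop_right (k := var x) (k' := cmp) (by simp) (s.fill cmp (s.head (var y))
    (some true))
  have h₃ : ∀ c : Prog, (reset cmp ;; loop (var y) (write cmp none ;; right cmp) ;; reset cmp ;;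
      c).den ((s.fill cmp (s.head (var y)) (some true)).setHead cmp
        ((s.fill cmp (s.head (var y)) (some true)).head cmp +
          (s.fill cmp (s.head (var y)) (some true)).head (var x))) = c.den s := by
    intro c
    rw [den_seq_of_leaf rfl, den_seq_assoc, den_seq_of_leaf (den_fill (by simp) _ _ (by simp))]
    congr 1
    ext
    · rename_i k i b
      by_cases hk : k = cmp
      · subst hk
        simp only [State.fill, State.setHead_cont, State.setHead_head, Function.update_self, hc]
        split_ifs <;> simp_all
      · simp [State.fill, hk]
    · rename_i k
      by_cases hk : k = cmp
      · subst hk; simp [State.fill, h0]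
      · simp [State.fill, hk]
    · simp [State.fill]
  rw [ltK, den_seq_assoc, den_seq_of_leaf h₁, den_seq_of_leaf h₂, den, h₃, h₃]
  congr 1
  simp [State.fill, h0, hc]

/-- Loop over the values of a variable, and branch according to whether the inner test is positive
for one of them. -/
def exK (d : ℕ) (body : Prog → Prog → Prog) (c₁ c₂ : Prog) : Prog :=
  loop (var d) (body (setF (ex d) true) skip) ;; iteF (ex d) (setF (ex d) false ;; c₁) c₂

theorem wf_exK {d : ℕ} {body : Prog → Prog → Prog} {c₁ c₂ : Prog}
    (h : ∀ k₁ k₂, k₁.WF IsReg → k₂.WF IsReg → (body k₁ k₂).WF IsReg) (h₁ : c₁.WF IsReg)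
    (h₂ : c₂.WF IsReg) : (exK d body c₁ c₂).WF IsReg :=
  ⟨⟨trivial, h _ _ trivial trivial⟩, ⟨trivial, h₁⟩, h₂⟩

open Classical in
theorem den_exK {n d : ℕ} {body : Prog → Prog → Prog} {c₁ c₂ : Prog} {s : St} {P : Fin n → Prop}
    (hf : s.flag (ex d) = false) (hn : s.head (var d) = n)
    (h : ∀ (a : Fin n) (b : Bool) (k₁ k₂ : Prog),
      (body k₁ k₂).den ((s.setFlag (ex d) b).setHead (var d) a) =
        if P a then k₁.den ((s.setFlag (ex d) b).setHead (var d) a)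
        else k₂.den ((s.setFlag (ex d) b).setHead (var d) a)) :
    (exK d body c₁ c₂).den s = if ∃ a, P a then c₁.den s else c₂.den s := by
  have hl := den_loop_of_leaf (k := var d) (c := body (setF (ex d) true) skip) (s := s)
    (fun i => s.setFlag (ex d) (decide (∃ a : Fin n, a.val < i ∧ P a))) ?_ ?_ ?_
  · rw [exK, den_seq_of_leaf hl, den, hn]
    simp only [Fin.is_lt, true_and, State.setFlag_flag, Function.update_self, decide_eq_true_eq]
    split_ifs with hP
    · rw [den_seq_of_leaf rfl, State.setFlag_setFlag, State.setFlag_self hf]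
    · rw [State.setFlag_self]
      simp [hf, hP]
  · rw [State.setFlag_self]
    simp [hf]
  · intro i; rfl
  · intro i hi
    rw [hn] at hi
    have key : (∃ a : Fin n, a.val < i + 1 ∧ P a) ↔
        (∃ a : Fin n, a.val < i ∧ P a) ∨ P ⟨i, hi⟩ := by
      constructor
      · rintro ⟨a, ha, hP⟩
        rcases Nat.lt_succ_iff_lt_or_eq.1 ha with h | h
        · exact .inl ⟨a, h, hP⟩
        · have : a = ⟨i, hi⟩ := Fin.ext h
          exact .inr (this ▸ hP)
      · rintro (⟨a, ha, hP⟩ | hP)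
        · exact ⟨a, ha.trans (Nat.lt_succ_self i), hP⟩
        · exact ⟨_, Nat.lt_succ_self i, hP⟩
    have := h ⟨i, hi⟩ (decide (∃ a : Fin n, a.val < i ∧ P a)) (setF (ex d) true) skip
    refine this.trans ?_
    by_cases hP : P ⟨i, hi⟩
    · rw [if_pos hP, den, State.setFlag_setHead, State.setFlag_setFlag]
      simp only [key, hP, or_true, decide_true]
    · rw [if_neg hP, den]
      simp only [key, hP, or_false]

end Prog

end QuantLogic

namespace QuantLogic

/-- The nesting depth of quantifiers. -/
def FO.rank {R : Signature} : {A : Type} → FO R A → ℕ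
  | _, neg φ => φ.rank
  | _, or φ ψ => max φ.rank ψ.rank
  | _, ex φ => φ.rank + 1
  | _, _ => 0

namespace QF

variable {R : Signature} {A : Type} {q : ℕ} {ar : Fin q → ℕ}

/-- The nesting depth of quantifiers. -/
def rank : QF R A ar → ℕ
  | so _ _ => 0
  | fo φ => φ.rank
  | neg ψ => ψ.rank
  | or ψ₁ ψ₂ => max ψ₁.rank ψ₂.rank

/-- The second-order atoms. -/
def atoms : QF R A ar → List (Σ j : Fin q, Fin (ar j) → A)
  | so j u => [⟨j, u⟩]
  | fo _ => []
  | neg ψ => ψ.atoms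
  | or ψ₁ ψ₂ => ψ₁.atoms ++ ψ₂.atoms

theorem sat_congr {D : Type} [LT D] {I : Interp R D} {X X' : SOAsg ar D} {e : A → D} (ψ : QF R A ar)
    (h : ∀ a ∈ ψ.atoms, (fun i => e (a.2 i)) ∈ X a.1 ↔ (fun i => e (a.2 i)) ∈ X' a.1) :
    ψ.Sat I X e ↔ ψ.Sat I X' e := by
  induction ψ with
  | so j u => exact h ⟨j, u⟩ (by simp [atoms])
  | fo φ => exact Iff.rfl
  | neg ψ ih => exact not_congr (ih h)
  | or ψ₁ ψ₂ h₁ h₂ =>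
    exact or_congr (h₁ fun a ha => h a (List.mem_append_left _ ha))
      (h₂ fun a ha => h a (List.mem_append_right _ ha))

end QF

open Cmd Tp Fg

/-- The state of the memory is set up for structures with domain `Fin n` and relations `I`: heads
of tapes are at `0`, the relations are found on the input tape, and registers hold the powers
`n ^ d` with `d ≤ E`. -/
structure Ready {R : Signature} {n : ℕ} (I : Interp R (Fin n)) (E : ℕ) (s : St) : Prop where
  inp0 : s.head inp = 0
  rel : ∀ (i : Fin R.numRel) (t : Fin (R.arity i) → Fin n),
    s.cont inp (s.head (off i) + tupleIdx _ t) = some true ↔ t ∈ I i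
  arity_le : ∀ i, R.arity i ≤ E
  cmp0 : s.head Tp.cmp = 0
  cmp_blank : ∀ i, s.cont Tp.cmp i = none
  pow_eq : ∀ d ≤ E, s.head (pow d) = n ^ d
  so0 : ∀ j, s.head (so j) = 0

/-- The variables from number `d` up to number `D - 1` are free for use in loops. -/
def FreeVars (n d D : ℕ) (s : St) : Prop :=
  ∀ i, d ≤ i → i < D → s.flag (ex i) = false ∧ s.head (var i) = n

/-- The heads that matter for `Ready`. -/
def _root_.QuantLogic.Tp.IsFixed : Tp → Prop
  | inp | Tp.cmp | off _ | pow _ | so _ => True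
  | _ => False

section Eval

variable {R : Signature} {n : ℕ} {I : Interp R (Fin n)} {E d D : ℕ} {s s' : St}

theorem Ready.congr (h : Ready I E s) (h₁ : s'.cont inp = s.cont inp)
    (h₂ : s'.cont Tp.cmp = s.cont Tp.cmp)
    (h₃ : ∀ k : Tp, k.IsFixed → s'.head k = s.head k) : Ready I E s' where
  inp0 := (h₃ inp trivial).trans h.inp0
  rel i t := by rw [h₁, h₃ (off i) trivial]; exact h.rel i t
  arity_le := h.arity_le
  cmp0 := (h₃ Tp.cmp trivial).trans h.cmp0
  cmp_blank i := by rw [h₂]; exact h.cmp_blank i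
  pow_eq d hd := (h₃ (pow d) trivial).trans (h.pow_eq d hd)
  so0 j := (h₃ (so j) trivial).trans (h.so0 j)

theorem Ready.setVar (h : Ready I E s) (i a : ℕ) : Ready I E (s.setHead (var i) a) :=
  h.congr rfl rfl fun k hk => by
    cases k <;> first | exact False.elim hk | simp

theorem Ready.setFlag (h : Ready I E s) (f : Fg) (b : Bool) : Ready I E (s.setFlag f b) :=
  h.congr rfl rfl fun _ _ => rfl

theorem Ready.setSO (h : Ready I E s) (j i : ℕ) (o : Option Bool) :
    Ready I E (s.setCell (so j) i o) :=
  h.congr (by simp) (by simp) fun _ _ => rfl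

theorem FreeVars.mono {d' : ℕ} (h : FreeVars n d D s) (hd : d ≤ d') : FreeVars n d' D s :=
  fun i hi hi' => h i (hd.trans hi) hi'

theorem FreeVars.congr (h : FreeVars n d D s)
    (h' : ∀ i, d ≤ i → s'.flag (ex i) = s.flag (ex i) ∧ s'.head (var i) = s.head (var i)) :
    FreeVars n d D s' := fun i hi hi' => by
  rw [(h' i hi).1, (h' i hi).2]
  exact h i hi hi'

theorem FreeVars.bind (h : FreeVars n d D s) (b : Bool) (a : ℕ) :
    FreeVars n (d + 1) D ((s.setFlag (ex d) b).setHead (var d) a) :=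
  (h.mono (Nat.le_succ d)).congr fun i hi => by
    have : i ≠ d := by omega
    simp [this]

namespace Prog

/-- Branch according to the truth of a first-order formula. The free variable `a` has the number
`ρ a`; variables from number `d` on are used for quantifiers. -/
def evalFO : {A : Type} → FO R A → (A → ℕ) → ℕ → Prog → Prog → Prog
  | _, .eq x y, ρ, _, c₁, c₂ => ltK (ρ x) (ρ y) c₂ (ltK (ρ y) (ρ x) c₂ c₁)
  | _, .lt x y, ρ, _, c₁, c₂ => ltK (ρ x) (ρ y) c₁ c₂
  | _, .rel i u, ρ, _, c₁, c₂ =>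
    test inp (some true) (loop (off i) (right inp) ;; addIdx inp _ fun j => ρ (u j)) c₁ c₂
  | _, .top, _, _, c₁, _ => c₁
  | _, .neg φ, ρ, d, c₁, c₂ => evalFO φ ρ d c₂ c₁
  | _, .or φ ψ, ρ, d, c₁, c₂ => evalFO φ ρ d c₁ (evalFO ψ ρ d c₁ c₂)
  | _, .ex φ, ρ, d, c₁, c₂ => exK d (evalFO φ (fun o => o.elim d ρ) (d + 1)) c₁ c₂

theorem wf_evalFO {A : Type} (φ : FO R A) (ρ : A → ℕ) (d : ℕ) {c₁ c₂ : Prog}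
    (h₁ : c₁.WF IsReg) (h₂ : c₂.WF IsReg) : (evalFO φ ρ d c₁ c₂).WF IsReg := by
  induction φ generalizing d c₁ c₂ with
  | eq x y => exact wf_ltK h₂ (wf_ltK h₂ h₁)
  | lt x y => exact wf_ltK h₁ h₂
  | rel i u => exact WF.test id ⟨⟨trivial, id⟩, wf_addIdx id _ _⟩ h₁ h₂
  | top => exact h₁
  | neg φ ih => exact ih _ _ h₂ h₁
  | or φ ψ ih₁ ih₂ => exact ih₁ _ _ h₁ (ih₂ _ _ h₁ h₂)
  | ex φ ih => exact wf_exK (fun k₁ k₂ hk₁ hk₂ => ih _ _ hk₁ hk₂) h₁ h₂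

open Classical in
theorem den_evalFO {A : Type} (φ : FO R A) (ρ : A → ℕ) (hρ : ∀ a, ρ a < d) (hd : d + φ.rank ≤ D)
    (hs : Ready I E s) (hf : FreeVars n d D s) (e : A → Fin n)
    (he : ∀ a, s.head (var (ρ a)) = e a) (c₁ c₂ : Prog) :
    (evalFO φ ρ d c₁ c₂).den s = if φ.Sat I e then c₁.den s else c₂.den s := by
  induction φ generalizing d s c₁ c₂ with
  | eq x y =>
    rw [evalFO, den_ltK hs.cmp0 hs.cmp_blank, den_ltK hs.cmp0 hs.cmp_blank, he, he]
    rcases lt_trichotomy (e x) (e y) with h | h | h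
    · rw [if_pos (Fin.lt_def.1 h), if_neg]
      exact h.ne
    · rw [h, if_neg (lt_irrefl _), if_neg (lt_irrefl _), if_pos]
      exact h
    · rw [if_neg (not_lt.2 (Fin.lt_def.1 h).le), if_pos (Fin.lt_def.1 h), if_neg]
      exact h.ne'
  | lt x y =>
    rw [evalFO, den_ltK hs.cmp0 hs.cmp_blank, he, he]
    exact if_congr Iff.rfl rfl rfl
  | rel i u =>
    rw [evalFO, den_test (p := s.head (off i) + tupleIdx _ fun j => e (u j)) ?_ hs.inp0]
    · exact if_congr (hs.rel i _) rfl rfl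
    · rw [den_seq_of_leaf (den_loop_right (by simp) s), den_addIdx (t := fun j => e (u j)) id]
      · rw [State.setHead_setHead]
        simp [hs.inp0]
      · intro j; simpa using he _
      · intro d hd
        simpa using hs.pow_eq d (hd.le.trans (hs.arity_le i))
  | top => exact (if_pos trivial).symm
  | neg φ ih =>
    rw [evalFO, ih ρ hρ hd hs hf e he]
    by_cases hφ : φ.Sat I e <;> simp [FO.Sat, hφ]
  | or φ ψ h₁ h₂ =>
    have hm : φ.rank ≤ max φ.rank ψ.rank ∧ ψ.rank ≤ max φ.rank ψ.rank := by simp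
    rw [FO.rank] at hd
    rw [evalFO, h₁ ρ hρ (by omega) hs hf e he, h₂ ρ hρ (by omega) hs hf e he]
    simp only [FO.Sat]
    by_cases hφ : φ.Sat I e <;> simp [hφ]
  | ex φ ih =>
    rw [FO.rank] at hd
    obtain ⟨hfl, hn⟩ := hf d le_rfl (by omega)
    refine (den_exK hfl hn fun a b k₁ k₂ => (ih _ ?_ (by omega) ((hs.setFlag _ _).setVar _ _)
      (hf.bind b a) (optCons a e) ?_ k₁ k₂).trans (if_congr Iff.rfl rfl rfl)).trans
      (if_congr Iff.rfl rfl rfl)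
    · rintro (_ | x)
      · exact Nat.lt_succ_self d
      · exact (hρ x).trans (Nat.lt_succ_self d)
    · rintro (_ | x)
      · simp [optCons]
      · simp [optCons, (hρ x).ne, he]

variable {A : Type} {q : ℕ} {ar : Fin q → ℕ}

/-- The second-order assignment on the tapes. -/
def soVal (ar : Fin q → ℕ) (n : ℕ) (s : St) : SOAsg ar (Fin n) :=
  fun j => {t | s.cont (so j) (tupleIdx _ t) = some true}

/-- Branch according to the truth of a formula under the relations on the tapes. -/
def evalQF (ρ : A → ℕ) (d : ℕ) : QF R A ar → Prog → Prog → Prog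
  | .so j u, c₁, c₂ => test (so j) (some true) (addIdx (so j) _ fun i => ρ (u i)) c₁ c₂
  | .fo φ, c₁, c₂ => evalFO φ ρ d c₁ c₂
  | .neg ψ, c₁, c₂ => evalQF ρ d ψ c₂ c₁
  | .or ψ₁ ψ₂, c₁, c₂ => evalQF ρ d ψ₁ c₁ (evalQF ρ d ψ₂ c₁ c₂)

theorem wf_evalQF (ρ : A → ℕ) (d : ℕ) (ψ : QF R A ar) {c₁ c₂ : Prog}
    (h₁ : c₁.WF IsReg) (h₂ : c₂.WF IsReg) : (evalQF ρ d ψ c₁ c₂).WF IsReg := by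
  induction ψ generalizing c₁ c₂ with
  | so j u => exact WF.test id (wf_addIdx id _ _) h₁ h₂
  | fo φ => exact wf_evalFO φ ρ d h₁ h₂
  | neg ψ ih => exact ih h₂ h₁
  | or ψ₁ ψ₂ ih₁ ih₂ => exact ih₁ h₁ (ih₂ h₁ h₂)

theorem den_goto_so (hs : Ready I E s) {j : ℕ} {r : ℕ} (hr : r ≤ E) (ρ : A → ℕ) (u : Fin r → A)
    (e : A → Fin n) (he : ∀ a, s.head (var (ρ a)) = e a) :
    (addIdx (so j) r fun i => ρ (u i)).den s =
      .leaf (s.setHead (so j) (tupleIdx r fun i => e (u i))) := by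
  rw [den_addIdx (t := fun i => e (u i)) id _ _ _ (fun i => he _)
    fun d hd => hs.pow_eq d (hd.le.trans hr), hs.so0, Nat.zero_add]

open Classical in
theorem den_evalQF (ψ : QF R A ar) (ρ : A → ℕ) (hρ : ∀ a, ρ a < d) (hd : d + ψ.rank ≤ D)
    (har : ∀ j, ar j ≤ E) (hs : Ready I E s) (hf : FreeVars n d D s) (e : A → Fin n)
    (he : ∀ a, s.head (var (ρ a)) = e a) (c₁ c₂ : Prog) :
    (evalQF ρ d ψ c₁ c₂).den s = if ψ.Sat I (soVal ar n s) e then c₁.den s else c₂.den s := by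
  induction ψ generalizing c₁ c₂ with
  | so j u =>
    rw [evalQF, den_test (den_goto_so hs (har j) ρ u e he) (hs.so0 j)]
    exact if_congr Iff.rfl rfl rfl
  | fo φ => exact den_evalFO φ ρ hρ hd hs hf e he c₁ c₂
  | neg ψ ih =>
    rw [evalQF, ih hd]
    by_cases hψ : ψ.Sat I (soVal ar n s) e <;> simp [QF.Sat, hψ]
  | or φ ψ h₁ h₂ =>
    have hm : φ.rank ≤ max φ.rank ψ.rank ∧ ψ.rank ≤ max φ.rank ψ.rank := by simp
    rw [QF.rank] at hd
    rw [evalQF, h₁ (by omega), h₂ (by omega)]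
    simp only [QF.Sat]
    by_cases hφ : φ.Sat I (soVal ar n s) e <;> simp [hφ]

/-- The second-order assignment `X` extends the partial one on the tapes. -/
def Compat (s : St) (X : SOAsg ar (Fin n)) : Prop :=
  ∀ (j : Fin q) (t : Fin (ar j) → Fin n) (b : Bool),
    s.cont (so j) (tupleIdx _ t) = some b → (t ∈ X j ↔ b = true)

theorem compat_soVal : Compat s (soVal ar n s) := by
  intro j t b h
  rw [soVal, Set.mem_ofPred_eq, h, Option.some_inj]

theorem compat_setCell {j : Fin q} {t : Fin (ar j) → Fin n}
    (h : s.cont (so j) (tupleIdx _ t) = none) (b : Bool) (X : SOAsg ar (Fin n)) :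
    Compat (s.setCell (so j) (tupleIdx _ t) (some b)) X ↔ Compat s X ∧ (t ∈ X j ↔ b = true) := by
  have hne : ∀ (j' : Fin q) (t' : Fin (ar j') → Fin n),
      (⟨j', t'⟩ : Σ j, Fin (ar j) → Fin n) ≠ ⟨j, t⟩ →
      (s.setCell (so j) (tupleIdx _ t) (some b)).cont (so j') (tupleIdx _ t') =
        s.cont (so j') (tupleIdx _ t') := by
    intro j' t' hne
    by_cases hj : j' = j
    · subst hj
      have ht : tupleIdx _ t' ≠ tupleIdx _ t := by
        intro h
        rw [tupleIdx_injective _ h] at hne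
        exact hne rfl
      simp [ht]
    · have : so (j' : ℕ) ≠ so j := by simpa [Fin.ext_iff] using hj
      simp [this]
  constructor
  · intro hc
    refine ⟨fun j' t' b' h' => ?_, hc j t b (by simp)⟩
    by_cases he : (⟨j', t'⟩ : Σ j, Fin (ar j) → Fin n) = ⟨j, t⟩
    · obtain ⟨rfl, h₂⟩ := Sigma.mk.inj he
      rw [eq_of_heq h₂, h] at h'
      exact absurd h' (by simp)
    · exact hc j' t' b' (by rw [hne j' t' he, h'])
  · rintro ⟨hc, hb⟩ j' t' b' h'
    by_cases he : (⟨j', t'⟩ : Σ j, Fin (ar j) → Fin n) = ⟨j, t⟩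
    · obtain ⟨rfl, h₂⟩ := Sigma.mk.inj he
      rw [eq_of_heq h₂] at h' ⊢
      have : b = b' := by simpa using h'
      rw [← this]
      exact hb
    · rw [hne j' t' he] at h'
      exact hc j' t' b' h'

/-- Branch according to whether some extension of the relations on the tapes satisfies `ψ`: only
the atoms of `ψ` matter, and both values are tried for those that are not yet determined. -/
def satRec (ρ : A → ℕ) (d : ℕ) (ψ : QF R A ar) :
    List (Σ j : Fin q, Fin (ar j) → A) → Prog → Prog → Prog
  | [], c₁, c₂ => evalQF ρ d ψ c₁ c₂
  | a :: l, c₁, c₂ =>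
    test (so a.1) none (addIdx (so a.1) _ fun i => ρ (a.2 i))
      (put (so a.1) (some true) (addIdx (so a.1) _ fun i => ρ (a.2 i)) ;;
        satRec ρ d ψ l (put (so a.1) none (addIdx (so a.1) _ fun i => ρ (a.2 i)) ;; c₁)
          (put (so a.1) (some false) (addIdx (so a.1) _ fun i => ρ (a.2 i)) ;;
            satRec ρ d ψ l (put (so a.1) none (addIdx (so a.1) _ fun i => ρ (a.2 i)) ;; c₁)
              (put (so a.1) none (addIdx (so a.1) _ fun i => ρ (a.2 i)) ;; c₂)))
      (satRec ρ d ψ l c₁ c₂)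

theorem wf_satRec (ρ : A → ℕ) (d : ℕ) (ψ : QF R A ar) (l : List (Σ j : Fin q, Fin (ar j) → A))
    {c₁ c₂ : Prog} (h₁ : c₁.WF IsReg) (h₂ : c₂.WF IsReg) : (satRec ρ d ψ l c₁ c₂).WF IsReg := by
  induction l generalizing c₁ c₂ with
  | nil => exact wf_evalQF ρ d ψ h₁ h₂
  | cons a l ih =>
    have hp : ∀ o, (put (so a.1) o (addIdx (so a.1) _ fun i => ρ (a.2 i))).WF IsReg :=
      fun o => WF.put id (wf_addIdx id _ _)
    exact WF.test id (wf_addIdx id _ _)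
      ⟨hp _, ih ⟨hp _, h₁⟩ ⟨hp _, ih ⟨hp _, h₁⟩ ⟨hp _, h₂⟩⟩⟩ (ih h₁ h₂)

theorem ite_or_eq {α : Type*} (p q : Prop) [Decidable p] [Decidable q] [Decidable (p ∨ q)]
    (a b : α) : (if p ∨ q then a else b) = if p then a else if q then a else b := by
  by_cases hp : p <;> by_cases hq : q <;> simp [hp, hq]

open Classical in
theorem den_satRec (ψ : QF R A ar) (ρ : A → ℕ) (hρ : ∀ a, ρ a < d) (hd : d + ψ.rank ≤ D)
    (har : ∀ j, ar j ≤ E) (e : A → Fin n) (l : List (Σ j : Fin q, Fin (ar j) → A))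
    (hs : Ready I E s) (hf : FreeVars n d D s) (he : ∀ a, s.head (var (ρ a)) = e a)
    (hl : ∀ a ∈ ψ.atoms, a ∈ l ∨ s.cont (so a.1) (tupleIdx _ fun i => e (a.2 i)) ≠ none)
    (c₁ c₂ : Prog) :
    (satRec ρ d ψ l c₁ c₂).den s =
      if ∃ X : SOAsg ar (Fin n), Compat s X ∧ ψ.Sat I X e then c₁.den s else c₂.den s := by
  induction l generalizing s c₁ c₂ with
  | nil =>
    rw [satRec, den_evalQF ψ ρ hρ hd har hs hf e he]
    refine if_congr ⟨fun h => ⟨_, compat_soVal, h⟩, ?_⟩ rfl rfl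
    rintro ⟨X, hX, h⟩
    refine (ψ.sat_congr fun a ha => ?_).1 h
    obtain ⟨b, hb⟩ := Option.ne_none_iff_exists'.1 ((hl a ha).resolve_left (by simp))
    exact (hX _ _ _ hb).trans (compat_soVal _ _ _ hb).symm
  | cons a l ih =>
    set t := fun i => e (a.2 i) with ht
    have hg : ∀ s' : St, Ready I E s' → (∀ a, s'.head (var (ρ a)) = e a) → _ := fun s' h₁ h₂ =>
      den_goto_so (j := a.1) h₁ (har a.1) ρ a.2 e h₂
    have hput : ∀ (s' : St) (o : Option Bool) (c : Prog), Ready I E s' →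
        (∀ a, s'.head (var (ρ a)) = e a) →
        (put (so a.1) o (addIdx (so a.1) _ fun i => ρ (a.2 i)) ;; c).den s' =
          c.den (s'.setCell (so a.1) (tupleIdx _ t) o) := fun s' o c h₁ h₂ =>
      den_seq_of_leaf (den_put (hg s' h₁ h₂) (h₁.so0 _)) c
    have hset : ∀ b, Ready I E (s.setCell (so a.1) (tupleIdx _ t) (some b)) ∧
        FreeVars n d D (s.setCell (so a.1) (tupleIdx _ t) (some b)) := fun b =>
      ⟨hs.setSO a.1 _ _, hf⟩
    have hl' : ∀ b, ∀ a' ∈ ψ.atoms, a' ∈ l ∨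
        (s.setCell (so a.1) (tupleIdx _ t) (some b)).cont (so a'.1)
          (tupleIdx _ fun i => e (a'.2 i)) ≠ none := by
      intro b a' ha'
      rcases hl a' ha' with h | h
      · rcases List.mem_cons.1 h with rfl | h
        · exact .inr (by simp [ht])
        · exact .inl h
      · refine .inr ?_
        rw [State.setCell_cont]
        by_cases h₁ : so (a'.1 : ℕ) = so a.1
        · rw [h₁, Function.update_self]
          rw [h₁] at h
          by_cases h₂ : tupleIdx _ (fun i => e (a'.2 i)) = tupleIdx _ t
          · rw [h₂, Function.update_self]; simp
          · rwa [Function.update_of_ne h₂]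
        · rwa [Function.update_of_ne h₁]
    rw [satRec, den_test (hg s hs he) (hs.so0 _)]
    by_cases h0 : s.cont (so a.1) (tupleIdx _ t) = none
    · have hback : ∀ (b : Bool), (s.setCell (so a.1) (tupleIdx _ t) (some b)).setCell
          (so a.1) (tupleIdx _ t) none = s := fun b => by
        rw [State.setCell_setCell, State.setCell_self h0]
      rw [if_pos h0, hput s _ _ hs he, ih (hset true).1 (hset true).2 he (hl' true),
        hput _ _ _ (hset true).1 he, hput _ _ _ (hset true).1 he, hback, State.setCell_setCell,
        ih (hset false).1 (hset false).2 he (hl' false), hput _ _ _ (hset false).1 he,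
        hput _ _ _ (hset false).1 he, hback]
      have key : (∃ X : SOAsg ar (Fin n), Compat s X ∧ ψ.Sat I X e) ↔
          (∃ X : SOAsg ar (Fin n), Compat (s.setCell (so a.1) (tupleIdx _ t) (some true)) X ∧
            ψ.Sat I X e) ∨
          ∃ X : SOAsg ar (Fin n), Compat (s.setCell (so a.1) (tupleIdx _ t) (some false)) X ∧
            ψ.Sat I X e := by
        simp only [compat_setCell h0]
        constructor
        · rintro ⟨X, hX, h⟩
          by_cases hm : t ∈ X a.1
          · exact .inl ⟨X, ⟨hX, by simpa using hm⟩, h⟩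
          · exact .inr ⟨X, ⟨hX, by simpa using hm⟩, h⟩
        · rintro (⟨X, ⟨hX, -⟩, h⟩ | ⟨X, ⟨hX, -⟩, h⟩) <;> exact ⟨X, hX, h⟩
      rw [if_congr key rfl rfl, ite_or_eq]
    · rw [if_neg h0, ih hs hf he fun a' ha' => ?_]
      rcases hl a' ha' with h | h
      · rcases List.mem_cons.1 h with rfl | h
        · exact .inr h0
        · exact .inl h
      · exact .inr h

/-- Branch according to whether values of `m` variables, from number `k` on, pass a test. -/
def exsK (body : Prog → Prog → Prog) : ℕ → ℕ → Prog → Prog → Prog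
  | _, 0, c₁, c₂ => body c₁ c₂
  | k, m + 1, c₁, c₂ => exK k (exsK body (k + 1) m) c₁ c₂

theorem wf_exsK {body : Prog → Prog → Prog}
    (h : ∀ k₁ k₂, k₁.WF IsReg → k₂.WF IsReg → (body k₁ k₂).WF IsReg) (k m : ℕ) {c₁ c₂ : Prog}
    (h₁ : c₁.WF IsReg) (h₂ : c₂.WF IsReg) : (exsK body k m c₁ c₂).WF IsReg := by
  induction m generalizing k c₁ c₂ with
  | zero => exact h _ _ h₁ h₂
  | succ m ih => exact wf_exK (fun k₁ k₂ hk₁ hk₂ => ih _ hk₁ hk₂) h₁ h₂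

open Classical in
theorem den_exsK {body : Prog → Prog → Prog} {k m : ℕ} {P : (Fin m → Fin n) → Prop}
    (hs : Ready I E s) (hf : FreeVars n k D s) (hD : k + m ≤ D)
    (h : ∀ (y : Fin m → Fin n) (s' : St), s'.cont = s.cont → Ready I E s' →
      FreeVars n (k + m) D s' → (∀ i < k, s'.head (var i) = s.head (var i)) →
      (∀ i : Fin m, s'.head (var (k + i)) = y i) → ∀ k₁ k₂ : Prog,
        (body k₁ k₂).den s' = if P y then k₁.den s' else k₂.den s')
    (c₁ c₂ : Prog) :
    (exsK body k m c₁ c₂).den s = if ∃ y, P y then c₁.den s else c₂.den s := by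
  induction m generalizing k s c₁ c₂ with
  | zero =>
    have : (∃ y, P y) ↔ P Fin.elim0 :=
      ⟨fun ⟨y, hy⟩ => by rwa [Subsingleton.elim Fin.elim0 y], fun hy => ⟨_, hy⟩⟩
    simp only [this]
    exact h Fin.elim0 s rfl hs hf (fun _ _ => rfl) (fun i => i.elim0) _ _
  | succ m ih =>
    obtain ⟨hfl, hn⟩ := hf k le_rfl (by omega)
    have : (∃ y, P y) ↔ ∃ a, ∃ y : Fin m → Fin n, P (Fin.cons a y) := Fin.exists_fin_succ_pi
    simp only [this]
    refine (den_exK (P := fun a => ∃ y : Fin m → Fin n, P (Fin.cons a y)) hfl hn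
      fun a b k₁ k₂ => ?_).trans (by congr)
    refine (ih (P := fun y => P (Fin.cons a y)) ((hs.setFlag _ _).setVar _ _) (hf.bind b a)
      (by omega) ?_ _ _).trans (by congr)
    intro y s' h₁ h₂ h₃ h₄ h₅
    refine h (Fin.cons a y) s' h₁ h₂ (by rwa [Nat.add_right_comm] at h₃) (fun i hi => ?_)
      fun i => ?_
    · rw [h₄ i (by omega)]
      simp [hi.ne]
    · refine Fin.cases ?_ (fun i => ?_) i
      · rw [Fin.cons_zero, Fin.val_zero, add_zero, h₄ k (by omega)]
        simp
      · rw [Fin.cons_succ, ← h₅ i, Fin.val_succ]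
        congr 2
        omega

end Prog

end Eval

end QuantLogic

namespace QuantLogic

/-! ### Counting and sampling the relations on the tapes -/

namespace Tree

variable {α β : Type*}

/-- The sum of `f` over the leaves, with a factor `c` for every coin above the leaf. -/
noncomputable def fold (c : ℝ) (f : α → ℝ) : Tree α → ℝ
  | leaf a => f a
  | coin t₀ t₁ => c * (fold c f t₀ + fold c f t₁)

theorem fold_bind (c : ℝ) (f : β → ℝ) (t : Tree α) (u : α → Tree β) :
    fold c f (t.bind u) = fold c (fun a => fold c f (u a)) t := by
  induction t with
  | leaf a => rfl
  | coin t₀ t₁ h₀ h₁ => simp only [coin_bind, fold, h₀, h₁]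

theorem fold_map (c : ℝ) (f : β → ℝ) (t : Tree α) (g : α → β) :
    fold c f (t.map g) = fold c (fun a => f (g a)) t := fold_bind c f t _

theorem fold_congr {c : ℝ} {f g : α → ℝ} {t : Tree α} (h : t.All fun a => f a = g a) :
    fold c f t = fold c g t := by
  induction t with
  | leaf a => exact h
  | coin t₀ t₁ h₀ h₁ => rw [fold, fold, h₀ h.1, h₁ h.2]

theorem fold_mul (c r : ℝ) (f : α → ℝ) (t : Tree α) :
    fold c (fun a => r * f a) t = r * fold c f t := by
  induction t with
  | leaf a => rfl
  | coin t₀ t₁ h₀ h₁ => rw [fold, fold, h₀, h₁]; ring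

theorem fold_add (c : ℝ) (f g : α → ℝ) (t : Tree α) :
    fold c (fun a => f a + g a) t = fold c f t + fold c g t := by
  induction t with
  | leaf a => rfl
  | coin t₀ t₁ h₀ h₁ => simp only [fold, h₀, h₁]; ring

theorem mean_eq_fold (f : α → ℝ) (t : Tree α) : t.mean f = fold (1 / 2) f t := by
  induction t with
  | leaf a => rfl
  | coin t₀ t₁ h₀ h₁ => rw [mean, fold, h₀, h₁]; ring

theorem leaves_eq_fold (t : Tree α) : (t.leaves : ℝ) = fold 1 (fun _ => 1) t := by
  induction t with
  | leaf a => simp [leaves, fold]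
  | coin t₀ t₁ h₀ h₁ => rw [leaves, fold, ← h₀, ← h₁]; push_cast; ring

end Tree

namespace Cmd

variable {K Fl : Type} [DecidableEq K] [DecidableEq Fl]

/-- A weight that is multiplied by `κ` in every round is multiplied by `κ ^ N` in the loop. -/
theorem fold_loop {k : K} {c : Cmd K Fl} {s : State K Fl} (P : ℕ → State K Fl → Prop)
    (w : State K Fl → ℝ) (r κ : ℝ) (h0 : P 0 s)
    (h : ∀ i < s.head k, ∀ a, P i a →
      ((c.den (a.setHead k i)).All fun b => P (i + 1) (b.setHead k (s.head k))) ∧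
      Tree.fold r (fun b => w (b.setHead k (s.head k))) (c.den (a.setHead k i)) = κ * w a) :
    ((loop k c).den s).All (P (s.head k)) ∧
      Tree.fold r w ((loop k c).den s) = κ ^ s.head k * w s := by
  rw [den]
  suffices H : ∀ j ≤ s.head k, (loopM (fun i s' => (c.den (s'.setHead k i)).map
      (State.setHead k (s.head k))) j s).All (P j) ∧ Tree.fold r w (loopM (fun i s' =>
        (c.den (s'.setHead k i)).map (State.setHead k (s.head k))) j s) = κ ^ j * w s from
    H _ le_rfl
  intro j hj
  induction j with
  | zero => exact ⟨h0, by simp [loopM, Tree.fold]⟩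
  | succ j ih =>
    obtain ⟨h₁, h₂⟩ := ih (by omega)
    rw [loopM, Tree.all_bind, Tree.fold_bind]
    have h₃ := h₁.mono fun a ha => h j (by omega) a ha
    refine ⟨h₃.mono fun a ha => Tree.all_map.2 ha.1, ?_⟩
    rw [Tree.fold_congr (g := fun a => κ * w a), Tree.fold_mul, h₂]
    · ring
    · refine h₃.mono fun a ha => ?_
      rw [Tree.fold_map]
      exact ha.2

end Cmd

open Cmd Tp Fg Prog

/-- `s'` is obtained from `s` by filling the cells `i` of the relations `j` with `(j, i) ∈ C`; the
other cells of all relations are blank. -/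
structure FilledOn (C : Set (ℕ × ℕ)) (s s' : St) : Prop where
  head : s'.head = s.head
  flag : s'.flag = s.flag
  cont : ∀ k, (∀ j, k ≠ so j) → s'.cont k = s.cont k
  fill : ∀ j i, (j, i) ∈ C → s'.cont (so j) i ≠ none
  blank : ∀ j i, (j, i) ∉ C → s'.cont (so j) i = none

theorem FilledOn.insert {C C' : Set (ℕ × ℕ)} {s s' : St} (h : FilledOn C s s') {j i : ℕ} (b : Bool)
    (hC : ∀ p, p ∈ C' ↔ p = (j, i) ∨ p ∈ C) :
    FilledOn C' s (s'.setCell (so j) i (some b)) where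
  head := h.head
  flag := h.flag
  cont k hk := by
    rw [State.setCell_cont, Function.update_of_ne (hk j)]
    exact h.cont k hk
  fill j' i' hp := by
    rw [State.setCell_cont]
    by_cases hj : j' = j
    · subst hj
      by_cases hi : i' = i
      · subst hi; simp
      · simpa [hi] using h.fill j' i' (((hC _).1 hp).resolve_left (by simp [hi]))
    · simpa [hj] using h.fill j' i' (((hC _).1 hp).resolve_left (by simp [hj]))
  blank j' i' hp := by
    rw [hC, not_or, Prod.mk.injEq, not_and] at hp
    rw [State.setCell_cont]
    by_cases hj : j' = j
    · subst hj
      simpa [hp.1 rfl] using h.blank j' i' hp.2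
    · simpa [hj] using h.blank j' i' hp.2

section Count

variable {R : Signature} {n : ℕ} {I : Interp R (Fin n)} {E D : ℕ}

theorem FilledOn.ready {C : Set (ℕ × ℕ)} {s s' : St} (h : FilledOn C s s') (hs : Ready I E s) :
    Ready I E s' :=
  hs.congr (h.cont inp (by simp)) (h.cont Tp.cmp (by simp)) fun k _ => congrFun h.head k

theorem FilledOn.freeVars {C : Set (ℕ × ℕ)} {s s' : St} (h : FilledOn C s s') {d : ℕ}
    (hs : FreeVars n d D s) : FreeVars n d D s' :=
  hs.congr fun _ _ => ⟨congrFun h.flag _, congrFun h.head _⟩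

namespace NTerm

variable (t : NTerm R)

/-- Branch according to whether the relations on the tapes can be extended to a solution. -/
def satK : Prog → Prog → Prog :=
  exsK (satRec t.names (t.k + t.m) t.ψ t.ψ.atoms) t.k t.m

theorem wf_satK {c₁ c₂ : Prog} (h₁ : c₁.WF IsReg) (h₂ : c₂.WF IsReg) :
    (t.satK c₁ c₂).WF IsReg :=
  wf_exsK (fun _ _ hk₁ hk₂ => wf_satRec _ _ _ _ hk₁ hk₂) _ _ h₁ h₂

/-- A choice of `x̄` and `X̄` that satisfies the formula. -/
def Sol {n : ℕ} (I : Interp R (Fin n)) (x : Fin t.k → Fin n) (X : SOAsg t.ar (Fin n)) : Prop :=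
  ∃ y : Fin t.m → Fin n, t.ψ.Sat I X (Sum.elim x y)

/-- The number of solutions that extend the relations on the tapes. -/
noncomputable def count {n : ℕ} (I : Interp R (Fin n)) (x : Fin t.k → Fin n) (s : St) : ℕ :=
  Nat.card {X : SOAsg t.ar (Fin n) // Compat s X ∧ t.Sol I x X}

variable {t}

theorem count_ne_zero {x : Fin t.k → Fin n} {s : St} :
    t.count I x s ≠ 0 ↔ ∃ X : SOAsg t.ar (Fin n), Compat s X ∧ t.Sol I x X := by
  rw [count, Nat.card_ne_zero, nonempty_subtype]
  exact and_iff_left inferInstance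

theorem count_setHead {x : Fin t.k → Fin n} {s : St} (k : Tp) (i : ℕ) :
    t.count I x (s.setHead k i) = t.count I x s := rfl

/-- The registers for `x̄` hold the values `x`, and all other variables are free. -/
structure At (I : Interp R (Fin n)) (E D : ℕ) (t : NTerm R) (x : Fin t.k → Fin n) (s : St) :
    Prop where
  ready : Ready I E s
  arity_le : ∀ j, t.ar j ≤ E
  rank_le : t.k + t.m + t.ψ.rank ≤ D
  freeVars : FreeVars n t.k D s
  var_eq : ∀ i : Fin t.k, s.head (var i) = x i

variable {x : Fin t.k → Fin n} {s : St}

theorem At.setCell (h : t.At I E D x s) (j i : ℕ) (o : Option Bool) :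
    t.At I E D x (s.setCell (so j) i o) :=
  ⟨h.ready.setSO j i o, h.arity_le, h.rank_le, h.freeVars, h.var_eq⟩

theorem At.setCells (h : t.At I E D x s) (d i : ℕ) : t.At I E D x (s.setHead (cells d) i) :=
  ⟨h.ready.congr rfl rfl fun k hk => by cases k <;> first | exact False.elim hk | rfl, h.arity_le,
    h.rank_le, h.freeVars, h.var_eq⟩

theorem At.filled (h : t.At I E D x s) {C : Set (ℕ × ℕ)} {s' : St} (hs : FilledOn C s s') :
    t.At I E D x s' :=
  ⟨hs.ready h.ready, h.arity_le, h.rank_le, hs.freeVars h.freeVars,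
    fun i => (congrFun hs.head _).trans (h.var_eq i)⟩

open Classical in
theorem den_satK (h : t.At I E D x s) (c₁ c₂ : Prog) :
    (t.satK c₁ c₂).den s = if t.count I x s ≠ 0 then c₁.den s else c₂.den s := by
  have hP : (∃ y, ∃ X : SOAsg t.ar (Fin n), Compat s X ∧ t.ψ.Sat I X (Sum.elim x y)) ↔
      t.count I x s ≠ 0 :=
    Iff.trans ⟨fun ⟨y, X, h₁, h₂⟩ => ⟨X, h₁, y, h₂⟩, fun ⟨X, h₁, y, h₂⟩ => ⟨y, X, h₁, h₂⟩⟩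
      count_ne_zero.symm
  simp only [← hP]
  refine (den_exsK (P := fun y => ∃ X : SOAsg t.ar (Fin n), Compat s X ∧
    t.ψ.Sat I X (Sum.elim x y)) h.ready h.freeVars (le_trans (Nat.le_add_right _ _) h.rank_le)
    ?_ c₁ c₂).trans (by congr)
  intro y s' h₁ h₂ h₃ h₄ h₅ k₁ k₂
  have hc : ∀ X : SOAsg t.ar (Fin n), Compat s' X ↔ Compat s X := fun X => by
    simp only [Compat, h₁]
  simp only [← hc]
  refine (den_satRec t.ψ t.names ?_ h.rank_le h.arity_le (Sum.elim x y) _ h₂ h₃ ?_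
    (fun a ha => .inl ha) k₁ k₂).trans (by congr)
  · rintro (i | i)
    · exact lt_of_lt_of_le i.2 (Nat.le_add_right _ _)
    · exact Nat.add_lt_add_left i.2 _
  · rintro (i | i)
    · exact (h₄ i i.2).trans (h.var_eq i)
    · exact h₅ i

theorem count_split {j : Fin t.q} {u : Fin (t.ar j) → Fin n}
    (h : s.cont (so j) (tupleIdx _ u) = none) :
    t.count I x s = t.count I x (s.setCell (so j) (tupleIdx _ u) (some false)) +
      t.count I x (s.setCell (so j) (tupleIdx _ u) (some true)) := by
  classical
  rw [count, count, count, ← Nat.card_sum]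
  refine Nat.card_congr ((Equiv.sumCompl fun X :
    {X : SOAsg t.ar (Fin n) // Compat s X ∧ t.Sol I x X} => u ∉ X.1 j).symm.trans
      (Equiv.sumCongr ?_ ?_))
  · refine (Equiv.subtypeSubtypeEquivSubtypeInter
      (fun X : SOAsg t.ar (Fin n) => Compat s X ∧ t.Sol I x X) fun X => u ∉ X j).trans
      (Equiv.subtypeEquivRight fun X => ?_)
    rw [compat_setCell h]
    simp only [Bool.false_eq_true, iff_false]
    tauto
  · refine (Equiv.subtypeSubtypeEquivSubtypeInter
      (fun X : SOAsg t.ar (Fin n) => Compat s X ∧ t.Sol I x X) fun X => ¬ u ∉ X j).trans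
      (Equiv.subtypeEquivRight fun X => ?_)
    rw [compat_setCell h]
    simp only [iff_true, not_not]
    tauto

/-- All cells of the relations. -/
def allCells (t : NTerm R) (n : ℕ) : Set (ℕ × ℕ) := {p | ∃ j : Fin t.q, p.1 = j ∧ p.2 < n ^ t.ar j}

/-- Without blank cells there is at most one extension. -/
theorem count_filled {s₀ : St} (h : FilledOn (t.allCells n) s₀ s) (hc : t.count I x s ≠ 0) :
    t.count I x s = 1 := by
  rw [count_ne_zero] at hc
  obtain ⟨X, h₁, h₂⟩ := hc
  rw [count, Nat.card_eq_one_iff_unique]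
  refine ⟨⟨fun Y Z => Subtype.ext (funext fun j => Set.ext fun u => ?_)⟩, ⟨X, h₁, h₂⟩⟩
  obtain ⟨b, hb⟩ := Option.ne_none_iff_exists'.1 (h.fill j _ ⟨j, rfl, tupleIdx_lt _ u⟩)
  exact (Y.2.1 j u b hb).trans (Z.2.1 j u b hb).symm

/-- Move to the cell whose number is the current value of the loop register. -/
def goCell (t : NTerm R) (j : Fin t.q) : Prog := loop (cells (t.ar j)) (right (so j))

/-- Run a program for every cell of every relation. -/
def forCells (t : NTerm R) (step : Fin t.q → Prog) : Prog :=
  seqs ((List.finRange t.q).map fun j => loop (cells (t.ar j)) (step j))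

theorem wf_forCells {step : Fin t.q → Prog} (h : ∀ j, (step j).WF IsReg) :
    (t.forCells step).WF IsReg := by
  refine WF.seqs fun c hc => ?_
  obtain ⟨j, -, rfl⟩ := List.mem_map.1 hc
  exact ⟨trivial, h j⟩

/-- The number of cells of all relations. -/
def numCells (t : NTerm R) (n : ℕ) : ℕ := ∑ j, n ^ t.ar j

theorem den_putCell (h : t.At I E D x s) (j : Fin t.q) (o : Option Bool) :
    (put (so j) o (t.goCell j)).den s =
      .leaf (s.setCell (so j) (s.head (cells (t.ar j))) o) := by
  refine den_put ?_ (h.ready.so0 j)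
  rw [goCell, den_loop_right (by simp), h.ready.so0, Nat.zero_add]

/-- If every step fills its cell, keeps `Q`, and multiplies the number of extensions by `κ`, then
all cells are filled, and the number of extensions is multiplied by `κ` once for every cell. -/
theorem fold_forCells {step : Fin t.q → Prog} {Q : St → Prop} {r κ : ℝ} (h : t.At I E D x s)
    (hcells : ∀ j, s.head (cells (t.ar j)) = n ^ t.ar j) (hQ : Q s) (h0 : FilledOn ∅ s s)
    (hstep : ∀ (j : Fin t.q) (u : Fin (t.ar j) → Fin n) (s' : St), t.At I E D x s' → Q s' →
      s'.flag = s.flag → s'.head = s.head → s'.cont (so j) (tupleIdx _ u) = none →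
      ((step j).den (s'.setHead (cells (t.ar j)) (tupleIdx _ u))).All (fun a => ∃ b,
        a = (s'.setCell (so j) (tupleIdx _ u) (some b)).setHead (cells (t.ar j)) (tupleIdx _ u) ∧
        Q (s'.setCell (so j) (tupleIdx _ u) (some b))) ∧
      Tree.fold r (fun a => t.count I x a)
        ((step j).den (s'.setHead (cells (t.ar j)) (tupleIdx _ u))) = κ * t.count I x s') :
    ((t.forCells step).den s).All (fun a => FilledOn (t.allCells n) s a ∧ Q a) ∧
      Tree.fold r (fun a => t.count I x a) ((t.forCells step).den s) =
        κ ^ t.numCells n * t.count I x s := by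
  have hloop : ∀ (j : Fin t.q) (C C' : Set (ℕ × ℕ)), (∀ i, ((j : ℕ), i) ∉ C) →
      (∀ p, p ∈ C' ↔ (p.1 = j ∧ p.2 < n ^ t.ar j) ∨ p ∈ C) → ∀ s', FilledOn C s s' → Q s' →
      ((loop (cells (t.ar j)) (step j)).den s').All (fun a => FilledOn C' s a ∧ Q a) ∧
      Tree.fold r (fun a => t.count I x a) ((loop (cells (t.ar j)) (step j)).den s') =
        κ ^ n ^ t.ar j * t.count I x s' := by
    intro j C C' hC hC' s' hs' hQ'
    have hN : s'.head (cells (t.ar j)) = n ^ t.ar j := (congrFun hs'.head _).trans (hcells j)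
    have := fold_loop (k := cells (t.ar j)) (c := step j) (s := s')
      (fun i a => FilledOn ({p | p.1 = j ∧ p.2 < i} ∪ C) s a ∧ Q a) (fun a => t.count I x a) r κ
      ⟨by simpa using hs', hQ'⟩ ?_
    · rw [hN] at this
      refine ⟨this.1.mono fun a ha => ⟨?_, ha.2⟩, this.2⟩
      convert ha.1 using 1
      ext p
      exact hC' p
    · intro i hi a ⟨ha, hQa⟩
      rw [hN] at hi
      obtain ⟨u, rfl⟩ := exists_tupleIdx _ hi
      obtain ⟨h₁, h₂⟩ := hstep j u a (h.filled ha) hQa ha.flag ha.head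
        (ha.blank _ _ (by simp [hC]))
      refine ⟨h₁.mono ?_, ?_⟩
      · rintro _ ⟨b, rfl, hb⟩
        have hNa : a.head (cells (t.ar j)) = n ^ t.ar j := (congrFun ha.head _).trans (hcells j)
        rw [State.setHead_setHead, hN, State.setHead_self (by exact hNa)]
        refine ⟨ha.insert b fun p => ?_, hb⟩
        obtain ⟨p₁, p₂⟩ := p
        simp only [Set.mem_union, Set.mem_ofPred_eq, Prod.mk.injEq, Nat.lt_succ_iff_lt_or_eq]
        tauto
      · simp only [count_setHead]
        exact h₂
  have hlist : ∀ (l : List (Fin t.q)) (C C' : Set (ℕ × ℕ)), l.Nodup →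
      (∀ j ∈ l, ∀ i, ((j : ℕ), i) ∉ C) →
      (∀ p, p ∈ C' ↔ (∃ j ∈ l, p.1 = j ∧ p.2 < n ^ t.ar j) ∨ p ∈ C) →
      ∀ s', FilledOn C s s' → Q s' →
      ((seqs (l.map fun j => loop (cells (t.ar j)) (step j))).den s').All
        (fun a => FilledOn C' s a ∧ Q a) ∧
      Tree.fold r (fun a => t.count I x a)
        ((seqs (l.map fun j => loop (cells (t.ar j)) (step j))).den s') =
        κ ^ (l.map fun j => n ^ t.ar j).sum * t.count I x s' := by
    intro l
    induction l with
    | nil =>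
      intro C C' _ _ hC' s' hs' hQ'
      have : C' = C := by ext p; simp [hC']
      subst this
      exact ⟨⟨hs', hQ'⟩, by simp [seqs, den, Tree.fold]⟩
    | cons j l ih =>
      intro C C' hl hC hC' s' hs' hQ'
      obtain ⟨hj, hl⟩ := List.nodup_cons.1 hl
      obtain ⟨h₁, h₂⟩ := hloop j C ({p | p.1 = j ∧ p.2 < n ^ t.ar j} ∪ C) (hC j (by simp))
        (fun p => Iff.rfl) s' hs' hQ'
      have h₃ := h₁.mono fun a ha => ih _ C' hl (fun j' hj' i => by
          have : (j' : ℕ) ≠ j := fun e => hj (Fin.ext e ▸ hj')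
          simp [this, hC j' (by simp [hj'])])
        (fun p => by
          rw [hC']
          simp only [List.mem_cons, exists_eq_or_imp, Set.mem_union, Set.mem_ofPred_eq]
          rw [or_assoc, or_left_comm]) a ha.1 ha.2
      show (((loop (cells (t.ar j)) (step j)).den s').bind _).All _ ∧
        Tree.fold r _ (((loop (cells (t.ar j)) (step j)).den s').bind _) = _
      rw [Tree.all_bind, Tree.fold_bind]
      refine ⟨h₃.mono fun a ha => ha.1, ?_⟩
      refine (Tree.fold_congr (h₃.mono fun a ha => ha.2)).trans ?_
      rw [Tree.fold_mul, h₂, List.map_cons, List.sum_cons, pow_add]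
      ring
  have := hlist (List.finRange t.q) ∅ (t.allCells n) (List.nodup_finRange _) (by simp)
    (fun p => by simp [allCells]) s h0 hQ
  rw [numCells, ← List.sum_ofFn, List.ofFn_eq_map]
  exact this

end NTerm

end Count

end QuantLogic

namespace QuantLogic

open Cmd Tp Fg Prog

/-! ### Loops over all values of the first-order variables -/

/-- A specification of programs by elements of `M`, such as the number of runs, which adds up when
programs with the property `Ok` run one after the other. -/
structure AddSpec {M : Type} [AddCommMonoid M] (Ok : Prog → Prop)
    (Sp : Prog → St → M → Prop) : Prop where
  ok_skip : Ok skip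
  ok_seq : ∀ c₁ c₂, Ok c₁ → Ok c₂ → Ok (c₁ ;; c₂)
  ok_loop : ∀ k c, Ok c → Ok (loop k c)
  skip : ∀ s, Sp skip s 0
  seq : ∀ c₁ c₂ s N₁ N₂, Ok c₂ → Sp c₁ s N₁ → Sp c₂ s N₂ → Sp (c₁ ;; c₂) s (N₁ + N₂)
  loop : ∀ (k : Tp) c s (n : ℕ) (N : Fin n → M), k.IsReg → Ok c → s.head k = n →
    (∀ a : Fin n, Sp c (s.setHead k a) (N a)) → Sp (loop k c) s (∑ a, N a)

namespace Prog

/-- Run a program for all values of `m` variables, from number `k` on. -/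
def forVars : ℕ → ℕ → Prog → Prog
  | _, 0, c => c
  | k, m + 1, c => loop (var k) (forVars (k + 1) m c)

theorem wf_forVars (k m : ℕ) {c : Prog} (h : c.WF IsReg) : (forVars k m c).WF IsReg := by
  induction m generalizing k with
  | zero => exact h
  | succ m ih => exact ⟨trivial, ih _⟩

theorem _root_.QuantLogic.AddSpec.ok_forVars {M : Type} [AddCommMonoid M]
    {Ok : Prog → Prop} {Sp : Prog → St → M → Prop} (hSp : AddSpec Ok Sp) (k m : ℕ) {c : Prog}
    (hc : Ok c) : Ok (forVars k m c) := by
  induction m generalizing k with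
  | zero => exact hc
  | succ m ih => exact hSp.ok_loop _ _ (ih _)

theorem _root_.QuantLogic.AddSpec.forVars {M : Type} [AddCommMonoid M] {n : ℕ}
    {Ok : Prog → Prop}
    {Sp : Prog → St → M → Prop} (hSp : AddSpec Ok Sp) {k m : ℕ} {c : Prog} {s : St}
    (hc : Ok c) (N : (Fin m → Fin n) → M) (hv : ∀ i, k ≤ i → i < k + m → s.head (var i) = n)
    (h : ∀ (x : Fin m → Fin n) (s' : St), s'.cont = s.cont → s'.flag = s.flag →
      (∀ k', (∀ i, k ≤ i → i < k + m → k' ≠ var i) → s'.head k' = s.head k') →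
      (∀ i : Fin m, s'.head (var (k + i)) = x i) → Sp c s' (N x)) :
    Sp (forVars k m c) s (∑ x, N x) := by
  induction m generalizing k s with
  | zero =>
    rw [Fintype.sum_unique]
    exact h _ s rfl rfl (fun _ _ => rfl) fun i => i.elim0
  | succ m ih =>
    have hsum : ∑ x, N x = ∑ a, ∑ x : Fin m → Fin n, N (Fin.cons a x) := by
      rw [← Fintype.sum_prod_type' fun a x => N (Fin.cons a x : Fin (m + 1) → Fin n)]
      exact (Fintype.sum_equiv (Fin.consEquiv fun _ => Fin n) _ _ fun p => rfl).symm
    rw [hsum]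
    refine hSp.loop (var k) _ s n _ trivial (hSp.ok_forVars _ _ hc) (hv k le_rfl (by omega))
      fun a => ?_
    refine ih _ (fun i hi hi' => ?_) fun x s' h₁ h₂ h₃ h₄ => ?_
    · rw [State.setHead_head, Function.update_of_ne (by simp; omega)]
      exact hv i (by omega) (by omega)
    · refine h _ s' h₁ h₂ (fun k' hk' => ?_) fun i => ?_
      · rw [h₃ k' fun i hi hi' => hk' i (by omega) (by omega), State.setHead_head,
          Function.update_of_ne (hk' k le_rfl (by omega))]
      · refine Fin.cases ?_ (fun i => ?_) i
        · rw [Fin.cons_zero, Fin.val_zero, add_zero, h₃ _ fun i hi hi' => by simp; omega]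
          simp
        · rw [Fin.cons_succ, ← h₄ i, Fin.val_succ]
          congr 2
          omega

theorem _root_.QuantLogic.AddSpec.seqs {M : Type} [AddCommMonoid M]
    {Ok : Prog → Prop}
    {Sp : Prog → St → M → Prop} (hSp : AddSpec Ok Sp) {ι : Type*} (l : List ι) {c : ι → Prog}
    {s : St} {N : ι → M} (hc : ∀ t, Ok (c t)) (h : ∀ t ∈ l, Sp (c t) s (N t)) :
    Ok (Cmd.seqs (l.map c)) ∧ Sp (Cmd.seqs (l.map c)) s (l.map N).sum := by
  induction l with
  | nil => exact ⟨hSp.ok_skip, hSp.skip s⟩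
  | cons t l ih =>
    obtain ⟨h₁, h₂⟩ := ih fun t' ht' => h t' (by simp [ht'])
    exact ⟨hSp.ok_seq _ _ (hc t) h₁, hSp.seq _ _ _ _ _ h₁ (h t (by simp)) h₂⟩

end Prog

/-- The memory before the first-order variables are assigned: it is set up for the structure, all
variables are free, and all relations are blank. -/
structure Base {R : Signature} {n : ℕ} (I : Interp R (Fin n)) (E D : ℕ) (s : St) : Prop where
  ready : Ready I E s
  freeVars : FreeVars n 0 D s
  cells_eq : ∀ d ≤ E, s.head (cells d) = n ^ d
  blank : ∀ j i, s.cont (so j) i = none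
  coin_eq : s.flag coin = false

namespace NTerm

variable {R : Signature} {n : ℕ} {I : Interp R (Fin n)} {E D : ℕ} {t : NTerm R}
  {x : Fin t.k → Fin n} {s : St}

/-- The registers suffice for the term. -/
def Fits (t : NTerm R) (E D : ℕ) : Prop :=
  (∀ j, t.ar j ≤ E) ∧ t.k ≤ E ∧ t.k + t.m + t.ψ.rank ≤ D

theorem exists_fits (R : Signature) (l : List (NTerm R)) :
    ∃ E D, (∀ i, R.arity i ≤ E) ∧ ∀ t ∈ l, t.Fits E D := by
  induction l with
  | nil => exact ⟨∑ i, R.arity i, 0, fun i => Finset.single_le_sum_of_canonicallyOrdered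
      (Finset.mem_univ i), by simp⟩
  | cons t l ih =>
    obtain ⟨E, D, h₁, h₂⟩ := ih
    refine ⟨E + ((∑ j, t.ar j) + t.k), D + (t.k + t.m + t.ψ.rank),
      fun i => (h₁ i).trans (by omega), fun t' ht' => ?_⟩
    rcases List.mem_cons.1 ht' with rfl | ht'
    · refine ⟨fun j => ?_, by omega, by omega⟩
      have := Finset.single_le_sum_of_canonicallyOrdered (f := t'.ar) (Finset.mem_univ j)
      omega
    · obtain ⟨h₃, h₄, h₅⟩ := h₂ t' ht'
      exact ⟨fun j => (h₃ j).trans (by omega), by omega, by omega⟩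

theorem Fits.at (ht : t.Fits E D) (hs : Base I E D s) {s' : St} (h₁ : s'.cont = s.cont)
    (h₂ : s'.flag = s.flag)
    (h₃ : ∀ k', (∀ i, 0 ≤ i → i < 0 + t.k → k' ≠ var i) → s'.head k' = s.head k')
    (h₄ : ∀ i : Fin t.k, s'.head (var (0 + i)) = x i) : t.At I E D x s' where
  ready := hs.ready.congr (by rw [h₁]) (by rw [h₁]) fun k hk => h₃ k fun i _ _ e => by
    subst e; exact hk
  arity_le := ht.1
  rank_le := ht.2.2
  freeVars i hi hi' := by
    rw [h₂, h₃ (var i) fun i' _ hi'' e => by have := Tp.var.inj e; omega]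
    exact hs.freeVars i (Nat.zero_le _) hi'
  var_eq i := by simpa using h₄ i

theorem sum_count_eq_val (hs : ∀ j i, s.cont (so j) i = none) :
    ∑ x, t.count I x s = t.toCTerm.val I := by
  have hc : ∀ X : SOAsg t.ar (Fin n), Compat s X := fun X j u b h => by
    rw [hs] at h
    exact absurd h (by simp)
  have h₁ : ∀ x, t.count I x s = Nat.card {X : SOAsg t.ar (Fin n) // t.Sol I x X} := fun x =>
    Nat.card_congr (Equiv.subtypeEquivRight fun X => and_iff_right (hc X))
  simp only [h₁]
  rw [← Nat.card_sigma]
  exact Nat.card_congr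
    { toFun := fun p => ⟨(p.1, p.2.1), p.2.2⟩
      invFun := fun p => ⟨p.1.1, p.1.2, p.2⟩
      left_inv := fun p => rfl
      right_inv := fun p => rfl }

end NTerm

/-! ### A program with as many runs as there are solutions -/

/-- The tree has one leaf without the flag `done`, which carries the state `s`, and `N` leaves
with this flag. -/
structure Emits (T : Tree St) (s : St) (N : ℕ) : Prop where
  all : T.All fun a => a.flag Fg.done = true ∨ (a = s ∧ a.flag Fg.done = false)
  sum_done : T.fold 1 (fun a => if a.flag Fg.done = true then 1 else 0) = N
  sum_not_done : T.fold 1 (fun a => if a.flag Fg.done = true then 0 else 1) = 1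

/-- When the rest of the program leaves the finished runs alone, the numbers of emitted runs
add up, since there is only one unfinished leaf to go on from. -/
theorem Emits.bind {T : Tree St} {s s' : St} {N₁ N₂ : ℕ} (h : Emits T s N₁) {u : St → Tree St}
    (hu : ∀ a : St, a.flag Fg.done = true → ∃ b : St, u a = .leaf b ∧ b.flag Fg.done = true)
    (h' : Emits (u s) s' N₂) : Emits (T.bind u) s' (N₁ + N₂) where
  all := by
    rw [Tree.all_bind]
    refine h.all.mono fun a ha => ?_
    rcases ha with ha | ⟨rfl, -⟩
    · obtain ⟨b, hb, hb'⟩ := hu a ha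
      rw [hb]
      exact .inl hb'
    · exact h'.all
  sum_done := by
    have : T.All fun a => Tree.fold 1 (fun a : St => if a.flag Fg.done = true then (1 : ℝ) else 0)
        (u a) = (if a.flag Fg.done = true then 1 else 0) +
          N₂ * (if a.flag Fg.done = true then 0 else 1) := by
      refine h.all.mono fun a ha => ?_
      rcases ha with ha | ⟨rfl, ha⟩
      · obtain ⟨b, hb, hb'⟩ := hu a ha
        simp [hb, Tree.fold, ha, hb']
      · simp [ha, h'.sum_done]
    rw [Tree.fold_bind, Tree.fold_congr this, Tree.fold_add, Tree.fold_mul, h.sum_done,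
      h.sum_not_done]
    push_cast; ring
  sum_not_done := by
    have : T.All fun a => Tree.fold 1 (fun a : St => if a.flag Fg.done = true then (0 : ℝ) else 1)
        (u a) = if a.flag Fg.done = true then 0 else 1 := by
      refine h.all.mono fun a ha => ?_
      rcases ha with ha | ⟨rfl, ha⟩
      · obtain ⟨b, hb, hb'⟩ := hu a ha
        simp [hb, Tree.fold, ha, hb']
      · rw [h'.sum_not_done]; simp [ha]
    rw [Tree.fold_bind, Tree.fold_congr this, h.sum_not_done]

theorem Emits.leaf {s : St} (hs : s.flag Fg.done = false) : Emits (.leaf s) s 0 where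
  all := .inr ⟨rfl, hs⟩
  sum_done := by simp [Tree.fold, hs]
  sum_not_done := by simp [Tree.fold, hs]

theorem Emits.leaves {T : Tree St} {s : St} {N : ℕ} (h : Emits T s N) : T.leaves = N + 1 := by
  have : T.All fun a => (1 : ℝ) = (if a.flag Fg.done = true then 1 else 0) +
      (if a.flag Fg.done = true then 0 else 1) :=
    Tree.all_of_forall (fun a => by split_ifs <;> norm_num) T
  have h' := Tree.leaves_eq_fold T
  rw [Tree.fold_congr this, Tree.fold_add, h.sum_done, h.sum_not_done] at h'
  exact_mod_cast h'

/-- The program does nothing of interest when the flag `done` is set. -/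
def Inert (c : Prog) : Prop :=
  ∀ a : St, a.flag done = true → ∃ b : St, c.den a = .leaf b ∧ b.flag done = true

/-- The program emits `N` runs, unless the flag `done` is set. -/
def RunSpec (c : Prog) (s : St) (N : ℕ) : Prop := s.flag done = false → Emits (c.den s) s N

theorem Emits.map_setHead {T : Tree St} {s : St} {N : ℕ} (h : Emits T s N) (k : Tp) (i : ℕ) :
    Emits (T.map (State.setHead k i)) (s.setHead k i) N where
  all := Tree.all_map.2 (h.all.mono fun a ha => ha.imp id fun ha => ⟨by rw [ha.1], ha.2⟩)
  sum_done := by rw [Tree.fold_map]; exact h.sum_done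
  sum_not_done := by rw [Tree.fold_map]; exact h.sum_not_done

theorem addSpec_runSpec : AddSpec Inert RunSpec where
  ok_skip a ha := ⟨a, rfl, ha⟩
  ok_seq c₁ c₂ h₁ h₂ a ha := by
    obtain ⟨b, hb, hb'⟩ := h₁ a ha
    rw [den_seq_of_leaf hb]
    exact h₂ b hb'
  ok_loop k c h a ha := by
    rw [den]
    generalize a.head k = N
    suffices H : ∀ j : ℕ, ∃ b : St, loopM (fun i' s' => (c.den (s'.setHead k i')).map
        (State.setHead k N)) j a = .leaf b ∧ b.flag done = true from H N
    intro j
    induction j with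
    | zero => exact ⟨a, rfl, ha⟩
    | succ j ih =>
      obtain ⟨b, hb, hb'⟩ := ih
      obtain ⟨d, hd, hd'⟩ := h (b.setHead k j) hb'
      refine ⟨d.setHead k N, ?_, hd'⟩
      rw [loopM, hb]
      show (c.den _).map _ = _
      rw [hd]
      rfl
  skip s hs := Emits.leaf hs
  seq c₁ c₂ s N₁ N₂ hc h₁ h₂ hs := (h₁ hs).bind hc (h₂ hs)
  loop k c s n N _ hc hn h hs := by
    rw [den, hn]
    suffices H : ∀ j (hj : j ≤ n), Emits (loopM (fun i' s' =>
        (c.den (s'.setHead k i')).map (State.setHead k n)) j s) s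
          (∑ a : Fin j, N (Fin.castLE hj a)) from H n le_rfl
    intro j hj
    induction j with
    | zero => exact Emits.leaf hs
    | succ j ih =>
      rw [Fin.sum_univ_castSucc, loopM]
      refine (ih (by omega)).bind (fun a ha => ?_) ?_
      · obtain ⟨b, hb, hb'⟩ := hc (a.setHead k j) ha
        exact ⟨b.setHead k n, by rw [hb]; rfl, hb'⟩
      · have := (h ⟨j, hj⟩ hs).map_setHead k n
        rw [State.setHead_setHead, State.setHead_self hn] at this
        exact this

namespace NTerm

variable {R : Signature} {n : ℕ} {I : Interp R (Fin n)} {E D : ℕ} (t : NTerm R)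

/-- Fill a cell with a value for which there is a solution; choose one if both will do. -/
def runStep (j : Fin t.q) : Prog :=
  put (so j) (some false) (t.goCell j) ;;
  t.satK
    (put (so j) (some true) (t.goCell j) ;;
      t.satK
        (toss coin ;; iteF coin (setF coin false) (put (so j) (some false) (t.goCell j)))
        (put (so j) (some false) (t.goCell j)))
    (put (so j) (some true) (t.goCell j))

/-- If there is a solution, choose whether to go on or to produce one of the solutions. -/
def runBody : Prog :=
  iteF done skip (t.satK
    (toss coin ;; iteF coin (setF coin false ;; t.forCells t.runStep ;; setF done true) skip) skip)

theorem wf_runBody : t.runBody.WF IsReg := by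
  have hp : ∀ (j : Fin t.q) (o : Option Bool), (put (so j) o (t.goCell j)).WF IsReg :=
    fun j o => WF.put id ⟨trivial, id⟩
  refine ⟨trivial, t.wf_satK ⟨trivial, ⟨trivial, ?_, trivial⟩, trivial⟩ trivial⟩
  refine wf_forCells fun j => ⟨hp _ _, ?_⟩
  exact t.wf_satK ⟨hp _ _, t.wf_satK ⟨trivial, trivial, hp _ _⟩ (hp _ _)⟩ (hp _ _)

theorem inert_runBody : Inert t.runBody := fun a ha => ⟨a, by rw [runBody, den, if_pos ha]; rfl, ha⟩

variable {t} {x : Fin t.k → Fin n} {s : St}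

theorem den_putAt (h : t.At I E D x s) (j : Fin t.q) (p : ℕ) (o : Option Bool) :
    (put (so j) o (t.goCell j)).den (s.setHead (cells (t.ar j)) p) =
      .leaf ((s.setCell (so j) p o).setHead (cells (t.ar j)) p) := by
  rw [den_putCell (h.setCells _ _)]
  simp [State.setCell_setHead]

open Classical in
theorem den_runStep (h : t.At I E D x s) (hc : s.flag coin = false) (j : Fin t.q) (p : ℕ) :
    (t.runStep j).den (s.setHead (cells (t.ar j)) p) =
      if t.count I x (s.setCell (so j) p (some false)) ≠ 0 then
        if t.count I x (s.setCell (so j) p (some true)) ≠ 0 then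
          .coin (.leaf ((s.setCell (so j) p (some false)).setHead (cells (t.ar j)) p))
            (.leaf ((s.setCell (so j) p (some true)).setHead (cells (t.ar j)) p))
        else .leaf ((s.setCell (so j) p (some false)).setHead (cells (t.ar j)) p)
      else .leaf ((s.setCell (so j) p (some true)).setHead (cells (t.ar j)) p) := by
  have h₁ : ∀ b, t.At I E D x (s.setCell (so j) p (some b)) := fun b => h.setCell _ _ _
  rw [runStep, den_seq_of_leaf (den_putAt h j p _), den_satK ((h₁ _).setCells _ _), count_setHead]
  refine if_congr Iff.rfl ?_ ?_
  · rw [den_seq_of_leaf (den_putAt (h₁ _) j p _), State.setCell_setCell,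
      den_satK ((h₁ _).setCells _ _), count_setHead]
    refine if_congr Iff.rfl ?_ ?_
    · have e : ∀ b, (((s.setCell (so j) p (some true)).setHead (cells (t.ar j)) p).setFlag coin b) =
          ((s.setCell (so j) p (some true)).setFlag coin b).setHead (cells (t.ar j)) p :=
        fun b => rfl
      have hs : (s.setCell (so j) p (some true)).setFlag coin false =
          s.setCell (so j) p (some true) := State.setFlag_self hc
      show Tree.coin (Cmd.den _ _) (Cmd.den _ _) = _
      congr 1
      · rw [den, if_neg (by simp), e, hs, den_putAt (h₁ _), State.setCell_setCell]
      · rw [den, if_pos (by simp), den, State.setFlag_setFlag, e, hs]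
    · rw [den_putAt (h₁ _), State.setCell_setCell]
  · rw [den_putAt (h₁ _), State.setCell_setCell]

/-- Besides the run that goes on, the body has one run for each solution: the number of extensions
of the partial relations is the sum of the numbers for both values of the next cell, and branches
without extensions are not entered. -/
theorem runSpec_runBody (h : t.At I E D x s)
    (hcells : ∀ j, s.head (cells (t.ar j)) = n ^ t.ar j) (hb : ∀ j i, s.cont (so j) i = none)
    (hcoin : s.flag coin = false) : RunSpec t.runBody s (t.count I x s) := by
  classical
  intro hd
  rw [runBody, den, if_neg (by simp [hd]), den_satK h]
  split_ifs with hc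
  · have h0 : FilledOn ∅ s s := ⟨rfl, rfl, fun _ _ => rfl, by simp, fun j i _ => hb j i⟩
    obtain ⟨h₁, h₂⟩ := fold_forCells (r := 1) (κ := 1) (step := t.runStep)
      (Q := fun a => t.count I x a ≠ 0) h hcells hc h0 fun j u s' hs' hQ hf hh hn => by
        have hsplit := count_split (I := I) (x := x) hn
        rw [den_runStep hs' (by rw [hf, hcoin])]
        split_ifs with h₁ h₂
        · refine ⟨⟨⟨_, rfl, h₁⟩, ⟨_, rfl, h₂⟩⟩, ?_⟩
          simp only [Tree.fold, count_setHead, hsplit]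
          push_cast; ring
        · refine ⟨⟨_, rfl, h₁⟩, ?_⟩
          simp only [Tree.fold, count_setHead, hsplit, not_not.1 h₂]
          push_cast; ring
        · have h₂ : t.count I x (s'.setCell (so j) (tupleIdx _ u) (some true)) ≠ 0 := by
            rw [hsplit, not_not.1 h₁, zero_add] at hQ
            exact hQ
          refine ⟨⟨_, rfl, h₂⟩, ?_⟩
          simp only [Tree.fold, count_setHead, hsplit, not_not.1 h₁]
          push_cast; ring
    have hsum : Tree.fold 1 (fun _ => (1 : ℝ)) ((t.forCells t.runStep).den s) = t.count I x s := by
      rw [one_pow, one_mul] at h₂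
      rw [← h₂]
      refine Tree.fold_congr (h₁.mono fun a ha => ?_)
      rw [count_filled ha.1 ha.2, Nat.cast_one]
    have hden : (toss coin ;; iteF coin (setF coin false ;; t.forCells t.runStep ;; setF done true)
        skip).den s = .coin (.leaf s)
          (((t.forCells t.runStep).den s).map (State.setFlag done true)) := by
      show Tree.coin (Cmd.den _ _) (Cmd.den _ _) = _
      congr 1
      · rw [den, if_neg (by simp), den, State.setFlag_self hcoin]
      · rw [den, if_pos (by simp), den_seq_of_leaf rfl, State.setFlag_setFlag,
          State.setFlag_self hcoin]
        rfl
    rw [hden]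
    refine ⟨⟨.inr ⟨rfl, hd⟩, ?_⟩, ?_, ?_⟩
    · exact Tree.all_map.2 (Tree.all_of_forall (fun a => .inl (by simp)) _)
    · rw [Tree.fold, Tree.fold_map]
      simp [Tree.fold, hd, hsum]
    · have hz : Tree.fold 1 (fun _ => (0 : ℝ)) ((t.forCells t.runStep).den s) = 0 := by
        have := Tree.fold_mul 1 0 (fun _ => (1 : ℝ)) ((t.forCells t.runStep).den s)
        simpa using this
      rw [Tree.fold, Tree.fold_map]
      simp [Tree.fold, hd, hz]
  · rw [not_not.1 hc]
    exact Emits.leaf hd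

end NTerm

/-- A program with one run more than the sum of the values of the terms. -/
def runProg {R : Signature} (l : List (NTerm R)) : Prog :=
  seqs (l.map fun t => forVars 0 t.k t.runBody)

theorem wf_runProg {R : Signature} (l : List (NTerm R)) : (runProg l).WF IsReg := by
  refine WF.seqs fun c hc => ?_
  obtain ⟨t, -, rfl⟩ := List.mem_map.1 hc
  exact wf_forVars _ _ t.wf_runBody

/-- The extra run is the one that never chooses to produce a solution. -/
theorem leaves_runProg {R : Signature} {n : ℕ} {I : Interp R (Fin n)} {E D : ℕ} {s : St}
    {l : List (NTerm R)} (hl : ∀ t ∈ l, t.Fits E D) (hs : Base I E D s)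
    (hd : s.flag done = false) :
    ((runProg l).den s).leaves = (l.map fun t => t.toCTerm.val I).sum + 1 := by
  have hSp := addSpec_runSpec
  refine Emits.leaves (s := s) ((hSp.seqs l (c := fun t => forVars 0 t.k t.runBody)
    (fun t => hSp.ok_forVars _ _ t.inert_runBody) fun t ht => ?_).2 hd)
  rw [← NTerm.sum_count_eq_val hs.blank]
  refine hSp.forVars t.inert_runBody _ (fun i _ hi => ?_) fun x s' h₁ h₂ h₃ h₄ => ?_
  · exact (hs.freeVars i (Nat.zero_le _) (by have := (hl t ht).2.2; omega)).2
  · have hAt := (hl t ht).at hs h₁ h₂ h₃ h₄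
    have hb : ∀ j i, s'.cont (so j) i = none := by rw [h₁]; exact hs.blank
    have : t.count I x s = t.count I x s' := by
      simp only [NTerm.count, Compat, h₁]
    rw [this]
    refine NTerm.runSpec_runBody hAt (fun j => ?_) hb (by rw [h₂, hs.coin_eq])
    rw [h₃ _ (by simp), hs.cells_eq _ ((hl t ht).1 j)]

end QuantLogic

namespace QuantLogic

/-! ### Reading the structure from the input tape -/

/-- The size of the structure described by a word: the number of leading zeros. -/
def zeros (w : List Bool) : ℕ := (w.takeWhile fun b => !b).length

theorem zeros_le (w : List Bool) : zeros w ≤ w.length := (List.takeWhile_prefix _).length_le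

theorem getElem?_of_lt_zeros {w : List Bool} {i : ℕ} (h : i < zeros w) : w[i]? = some false := by
  induction w generalizing i with
  | nil => exact absurd h (by simp [zeros])
  | cons b w ih =>
    cases b with
    | true => exact absurd h (by simp [zeros])
    | false =>
      cases i with
      | zero => rfl
      | succ i =>
        rw [List.getElem?_cons_succ]
        exact ih (by simpa [zeros] using h)

theorem getElem?_zeros (w : List Bool) : w[zeros w]? ≠ some false := by
  induction w with
  | nil => simp
  | cons b w ih =>
    cases b with
    | true => simp [zeros]
    | false => simpa [zeros] using ih

/-- The address of the first bit of the `i`-th relation of a structure of size `n`. -/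
def relAddr (R : Signature) (n : ℕ) (i : Fin R.numRel) : ℕ :=
  n + 1 + (((List.finRange R.numRel).filter (· < i)).map fun j : Fin R.numRel => n ^ R.arity j).sum

/-- The relations described by a word. -/
def wordInterp (R : Signature) (w : List Bool) : Interp R (Fin (zeros w)) :=
  fun i => {t | w[relAddr R (zeros w) i + tupleIdx _ t]? = some true}

/-- Advance all heads, by the given numbers of cells. -/
def State.addHeads {K Fl : Type} (f : K → ℕ) (s : State K Fl) : State K Fl :=
  { s with head := fun k => s.head k + f k }

open Cmd Tp Fg

namespace Prog

/-- Advance the listed heads. -/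
def rights (l : List Tp) : Prog := seqs (l.map right)

theorem den_rights (l : List Tp) (s : St) :
    (rights l).den s = .leaf (s.addHeads fun k => l.count k) := by
  induction l generalizing s with
  | nil => rfl
  | cons k l ih =>
    refine (den_seq_of_leaf rfl _).trans ((ih _).trans (congrArg Tree.leaf ?_))
    refine State.ext rfl (funext fun k' => ?_) rfl
    by_cases h : k' = k
    · subst h; simp [State.addHeads]; omega
    · simp [State.addHeads, h, Ne.symm h]

theorem wf_rights {L : Tp → Prop} {l : List Tp} (h : ∀ k ∈ l, ¬ L k) : (rights l).WF L :=
  WF.seqs fun c hc => by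
    obtain ⟨k, hk, rfl⟩ := List.mem_map.1 hc
    exact h k hk

theorem den_loop_rights {k : Tp} {l : List Tp} (hk : k ∉ l) (s : St) :
    (loop k (rights l)).den s = .leaf (s.addHeads fun k' => s.head k * l.count k') := by
  refine den_loop_of_leaf (fun i => s.addHeads fun k' => i * l.count k') ?_ ?_ ?_
  · simp [State.addHeads]
  · intro i; simp [State.addHeads, List.count_eq_zero.2 hk]
  · intro i _
    rw [den_rights]
    refine congrArg Tree.leaf (State.ext rfl (funext fun k' => ?_) rfl)
    by_cases h : k' = k
    · subst h; simp [State.addHeads, List.count_eq_zero.2 hk]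
    · simp [State.addHeads, h]; ring

theorem den_loop_loop_rights {k k₁ : Tp} {l : List Tp} (hk : k ∉ l) (hk₁ : k₁ ∉ l) (hkk : k ≠ k₁)
    (s : St) : (loop k (loop k₁ (rights l))).den s =
      .leaf (s.addHeads fun k' => s.head k * s.head k₁ * l.count k') := by
  refine den_loop_of_leaf (fun i => s.addHeads fun k' => i * s.head k₁ * l.count k') ?_ ?_ ?_
  · simp [State.addHeads]
  · intro i; simp [State.addHeads, List.count_eq_zero.2 hk]
  · intro i _
    rw [den_loop_rights hk₁]
    refine congrArg Tree.leaf (State.ext rfl (funext fun k' => ?_) rfl)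
    by_cases h : k' = k
    · subst h; simp [State.addHeads, List.count_eq_zero.2 hk]
    · simp [State.addHeads, h, hkk.symm, List.count_eq_zero.2 hk₁]; ring

/-- Advance the heads in `l`, among them that of the input tape, while the input symbol is `b`. -/
def scan (b : Bool) (ph : Fg) (l : List Tp) : Prog :=
  loop len (iteF ph skip (iteSym inp (some b) (rights l) (setF ph true)))

theorem den_scan {b : Bool} {ph : Fg} {l : List Tp} {s : St} {n : ℕ} (hl : len ∉ l)
    (hi : l.count inp = 1) (hf : s.flag ph = false) (hn : n ≤ s.head len)
    (h₁ : ∀ i < n, s.cont inp (s.head inp + i) = some b)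
    (h₂ : s.cont inp (s.head inp + n) ≠ some b) :
    (scan b ph l).den s = .leaf ((s.addHeads fun k => n * l.count k).setFlag ph
      (decide (n < s.head len))) := by
  have h := den_loop_of_leaf (k := len) (s := s)
    (c := iteF ph skip (iteSym inp (some b) (rights l) (setF ph true)))
    (fun i => (s.addHeads fun k => min i n * l.count k).setFlag ph (decide (n < i))) ?_ ?_ ?_
  · rw [min_eq_right hn] at h
    exact h
  · rw [State.setFlag_self] <;> simp [State.addHeads, hf]
  · intro i; simp [State.addHeads, List.count_eq_zero.2 hl]
  · intro i _
    rw [den]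
    by_cases hin : n < i
    · have e₁ : min i n = n := by omega
      have e₂ : min (i + 1) n = n := by omega
      have e₃ : n < i + 1 := by omega
      rw [if_pos (by simp [hin]), den, e₁, e₂, decide_eq_true hin, decide_eq_true e₃]
    · have e₁ : min i n = i := by omega
      rw [if_neg (by simp [hin]), den]
      have ec : (((s.addHeads fun k => min i n * l.count k).setFlag ph
          (decide (n < i))).setHead len i).cont inp ((((s.addHeads fun k =>
            min i n * l.count k).setFlag ph (decide (n < i))).setHead len i).head inp) =
          s.cont inp (s.head inp + i) := by
        simp [State.addHeads, hi, e₁]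
      rw [ec]
      by_cases hin' : i < n
      · have e₂ : min (i + 1) n = i + 1 := by omega
        have e₃ : ¬ n < i + 1 := by omega
        rw [if_pos (h₁ i hin'), den_rights, e₁, e₂, decide_eq_false hin, decide_eq_false e₃]
        refine congrArg Tree.leaf (State.ext rfl (funext fun k' => ?_) rfl)
        by_cases h : k' = len
        · subst h; simp [State.addHeads, List.count_eq_zero.2 hl]
        · simp [State.addHeads, h]; ring
      · have e : i = n := by omega
        subst e
        rw [if_neg h₂, den]
        simp [State.setFlag_setHead]

theorem wf_scan {b : Bool} {ph : Fg} {l : List Tp} (h : len ∉ l) :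
    (scan b ph l).WF fun k => k = len :=
  ⟨rfl, trivial, wf_rights fun _ hk e => h (e ▸ hk), trivial⟩

/-- Compute the powers `n ^ d` with `d ≤ E`. -/
def powers : ℕ → Prog
  | 0 => rights [pow 0, cells 0]
  | e + 1 => powers e ;; loop size (loop (pow e) (rights [pow (e + 1), cells (e + 1)]))

theorem polyBdd_powers (E : ℕ) : (powers E).PolyBdd := by
  induction E with
  | zero => exact (wf_rights (L := fun _ => False) fun _ _ => id).polyBdd
  | succ e ih =>
    refine ih.seq (WF.polyBdd (L := fun k => k = size ∨ k = pow e) ⟨.inl rfl, .inr rfl,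
      wf_rights fun k hk => ?_⟩)
    rcases List.mem_pair.1 hk with rfl | rfl <;> simp

theorem den_powers (E : ℕ) (s : St) {n : ℕ} (hn : s.head size = n)
    (h0 : ∀ d, s.head (pow d) = 0 ∧ s.head (cells d) = 0) :
    ∃ s', (powers E).den s = .leaf s' ∧ s'.cont = s.cont ∧ s'.flag = s.flag ∧
      (∀ d ≤ E, s'.head (pow d) = n ^ d ∧ s'.head (cells d) = n ^ d) ∧
      (∀ d > E, s'.head (pow d) = 0 ∧ s'.head (cells d) = 0) ∧
      ∀ k, (∀ d, k ≠ pow d ∧ k ≠ cells d) → s'.head k = s.head k := by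
  induction E with
  | zero =>
    refine ⟨_, den_rights _ s, rfl, rfl, fun d hd => ?_, fun d hd => ?_, fun k hk => ?_⟩
    · obtain rfl : d = 0 := by omega
      simp [State.addHeads, h0]
    · have : 0 ≠ d := by omega
      simp [State.addHeads, h0, this]
    · have := hk 0
      simp [State.addHeads, List.count_cons, this.1.symm, this.2.symm]
  | succ e ih =>
    obtain ⟨s', h₁, h₂, h₃, h₄, h₅, h₆⟩ := ih
    have hl : (loop size (loop (pow e) (rights [pow (e + 1), cells (e + 1)]))).den s' =
        .leaf (s'.addHeads fun k => n * n ^ e * [pow (e + 1), cells (e + 1)].count k) := by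
      have hs : s'.head size = n := (h₆ size (by simp)).trans hn
      rw [den_loop_loop_rights (by simp) (by simp) (by simp), hs, (h₄ e le_rfl).1]
    refine ⟨_, (den_seq_of_leaf h₁ _).trans hl, h₂, h₃, fun d hd => ?_, fun d hd => ?_,
      fun k hk => ?_⟩
    · rcases Nat.lt_or_ge d (e + 1) with hd' | hd'
      · have : e + 1 ≠ d := by omega
        simp [State.addHeads, h₄ d (by omega), List.count_cons, this]
      · obtain rfl : d = e + 1 := by omega
        simp [State.addHeads, h₅ (e + 1) (by omega), List.count_cons, pow_succ']
    · have : e + 1 ≠ d := by omega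
      simp [State.addHeads, h₅ d (by omega), List.count_cons, this]
    · have := hk (e + 1)
      simp [State.addHeads, h₆ k hk, List.count_cons, this.1.symm, this.2.symm]

/-- Advance the head of `k` by the sum of the powers with the exponents in `l`. -/
def addPowers (k : Tp) (l : List ℕ) : Prog := seqs (l.map fun d => loop (pow d) (right k))

theorem wf_addPowers {k : Tp} (l : List ℕ) (hk : ∀ d, k ≠ pow d) :
    (addPowers k l).WF fun k => ∃ d, k = pow d :=
  WF.seqs fun c hc => by
    obtain ⟨d, -, rfl⟩ := List.mem_map.1 hc
    exact ⟨⟨d, rfl⟩, fun ⟨d, e⟩ => hk d e⟩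

theorem den_addPowers {k : Tp} (hk : ∀ d, k ≠ pow d) (l : List ℕ) {n : ℕ} (s : St)
    (h : ∀ d ∈ l, s.head (pow d) = n ^ d) :
    (addPowers k l).den s = .leaf (s.setHead k (s.head k + (l.map fun d => n ^ d).sum)) := by
  induction l generalizing s with
  | nil =>
    refine congrArg Tree.leaf (State.setHead_self ?_).symm
    simp
  | cons d l ih =>
    refine (den_seq_of_leaf (den_loop_right (hk d).symm s) _).trans ((ih _ fun e he => ?_).trans ?_)
    · simpa [(hk e).symm] using h e (by simp [he])
    · simp [h d, add_assoc]

/-- Compute the addresses of the relations, provided that the registers hold the end of the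
leading zeros. -/
def offsets (R : Signature) : Prog :=
  seqs ((List.finRange R.numRel).map fun i : Fin R.numRel => addPowers (off i)
    (((List.finRange R.numRel).filter (· < i)).map R.arity))

theorem wf_offsets (R : Signature) : (offsets R).WF fun k => ∃ d, k = pow d :=
  WF.seqs fun c hc => by
    obtain ⟨i, -, rfl⟩ := List.mem_map.1 hc
    exact wf_addPowers _ (by simp)

theorem den_offsets (R : Signature) {n : ℕ} (s : St)
    (h : ∀ i, s.head (pow (R.arity i)) = n ^ R.arity i) :
    ∃ s', (offsets R).den s = .leaf s' ∧ s'.cont = s.cont ∧ s'.flag = s.flag ∧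
      (∀ i : Fin R.numRel, s'.head (off i) = s.head (off i) +
        (((List.finRange R.numRel).filter (· < i)).map fun j : Fin R.numRel => n ^ R.arity j).sum) ∧
      ∀ k, (∀ i, k ≠ off i) → s'.head k = s.head k := by
  suffices H : ∀ (l : List (Fin R.numRel)) (s : St), l.Nodup →
      (∀ i, s.head (pow (R.arity i)) = n ^ R.arity i) →
      ∃ s', (seqs (l.map fun i : Fin R.numRel => addPowers (off i) (((List.finRange R.numRel).filter
        (· < i)).map R.arity))).den s = .leaf s' ∧ s'.cont = s.cont ∧ s'.flag = s.flag ∧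
      (∀ i ∈ l, s'.head (off i) = s.head (off i) +
        (((List.finRange R.numRel).filter (· < i)).map fun j : Fin R.numRel => n ^ R.arity j).sum) ∧
      ∀ k, (∀ i ∈ l, k ≠ off i) → s'.head k = s.head k by
    obtain ⟨s', h₁, h₂, h₃, h₄, h₅⟩ := H _ s (List.nodup_finRange _) h
    exact ⟨s', h₁, h₂, h₃, fun i => h₄ i (List.mem_finRange i), fun k hk => h₅ k fun i _ => hk i⟩
  intro l
  induction l with
  | nil => exact fun s _ _ => ⟨s, rfl, rfl, rfl, by simp, fun _ _ => rfl⟩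
  | cons i l ih =>
    intro s hl h
    obtain ⟨hi, hl⟩ := List.nodup_cons.1 hl
    have hd := den_addPowers (k := off i) (by simp) (((List.finRange R.numRel).filter
      (· < i)).map R.arity) (n := n) s fun d hd => by
        obtain ⟨j, -, rfl⟩ := List.mem_map.1 hd
        exact h j
    obtain ⟨s', h₁, h₂, h₃, h₄, h₅⟩ := ih (s.setHead (off i) (s.head (off i) +
      ((((List.finRange R.numRel).filter (· < i)).map R.arity).map fun d => n ^ d).sum)) hl
      fun j => by simpa using h j
    refine ⟨s', (den_seq_of_leaf hd _).trans h₁, h₂, h₃, fun j hj => ?_, fun k hk => ?_⟩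
    · rcases List.mem_cons.1 hj with rfl | hj
      · rw [h₅ _ fun j' hj' e => hi (by
          have := Fin.ext (Tp.off.inj e)
          rwa [this])]
        simp [Function.comp_def]
      · have : (j : ℕ) ≠ i := fun e => hi (Fin.ext e ▸ hj)
        simp [h₄ j hj, this]
    · rw [h₅ k fun j hj => hk j (by simp [hj])]
      simp [hk i]

/-- The registers that move along with the head of the input tape up to the relations. -/
def offs (R : Signature) : List Tp := (List.finRange R.numRel).map fun i : Fin R.numRel => off i

theorem count_offs (R : Signature) (i : Fin R.numRel) : (offs R).count (off i) = 1 := by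
  rw [offs, List.count_eq_one_of_mem]
  · refine (List.nodup_map_iff fun i j e => ?_).2 (List.nodup_finRange _)
    exact Fin.ext (Tp.off.inj e)
  · exact List.mem_map.2 ⟨i, List.mem_finRange i, rfl⟩

theorem count_offs_of_ne (R : Signature) (k : Tp) (hk : ∀ i : ℕ, k ≠ off i) :
    (offs R).count k = 0 := by
  rw [List.count_eq_zero]
  intro h
  obtain ⟨i, -, e⟩ := List.mem_map.1 h
  exact hk _ e.symm

/-- Read the structure that starts at the head of the input tape. -/
def setup (R : Signature) (E D : ℕ) : Prog :=
  scan false phase' (inp :: size :: ((List.range D).map var ++ offs R)) ;;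
  rights (inp :: offs R) ;; powers E ;; offsets R ;; reset inp

theorem polyBdd_setup (R : Signature) (E D : ℕ) : (setup R E D).PolyBdd := by
  refine (wf_scan ?_).polyBdd.seq ((wf_rights (L := fun _ => False) fun _ _ => id).polyBdd.seq
    ((polyBdd_powers E).seq ((wf_offsets R).polyBdd.seq (WF.polyBdd (L := fun _ => False) id))))
  simp [offs]

/-- The word `w` is found from the head of the input tape on, and everything else is in the initial
state. -/
structure Fresh (R : Signature) (w : List Bool) (s : St) : Prop where
  cont : ∀ i, s.cont inp (s.head inp + i) = w[i]?
  len_le : w.length ≤ s.head len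
  off_eq : ∀ i : Fin R.numRel, s.head (off i) = s.head inp
  head : ∀ k : Tp, k ≠ inp → k ≠ len → (∀ i, k ≠ off i) → k ≠ acc → s.head k = 0
  blank : ∀ k, k ≠ inp → ∀ i, s.cont k i = none
  flag : ∀ f, f ≠ phase → s.flag f = false

/-- The registers that are changed when the structure is read. -/
def _root_.QuantLogic.Tp.IsSetup : Tp → Prop
  | inp | size | pow _ | cells _ | off _ | var _ => True
  | _ => False

theorem den_setup {R : Signature} {E : ℕ} (D : ℕ) (hE : ∀ i, R.arity i ≤ E) {w : List Bool} {s : St}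
    (hs : Fresh R w s) :
    ∃ s', (setup R E D).den s = .leaf s' ∧ Base (wordInterp R w) E D s' ∧ s'.cont = s.cont ∧
      (∀ f, f ≠ phase' → s'.flag f = s.flag f) ∧
      ∀ k : Tp, ¬ k.IsSetup → s'.head k = s.head k := by
  have hcount := count_offs R
  have hcount0 := count_offs_of_ne R
  have hvar : ∀ i, i < D → ((List.range D).map var).count (var i) = 1 := fun i hi => by
    rw [List.count_eq_one_of_mem]
    · exact (List.nodup_map_iff fun i j e => Tp.var.inj e).2 List.nodup_range
    · exact List.mem_map.2 ⟨i, List.mem_range.2 hi, rfl⟩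
  have hvar0 : ∀ k, (∀ i, k ≠ var i) → ((List.range D).map var).count k = 0 := fun k hk => by
    rw [List.count_eq_zero]
    intro h
    obtain ⟨i, -, e⟩ := List.mem_map.1 h
    exact hk _ e.symm
  have h₁ := den_scan (b := false) (ph := phase')
    (l := inp :: size :: ((List.range D).map var ++ offs R)) (s := s) (n := zeros w)
    (by simp [offs]) (by simp [hcount0, hvar0]) (hs.flag _ (by simp))
    ((zeros_le w).trans hs.len_le) (fun i hi => by rw [hs.cont, getElem?_of_lt_zeros hi])
    (by rw [hs.cont]; exact getElem?_zeros w)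
  set s₁ := (s.addHeads fun k => zeros w * (inp :: size :: ((List.range D).map var ++ offs R)).count
    k).setFlag phase' (decide (zeros w < s.head len)) with hs₁
  set s₂ := s₁.addHeads fun k => (inp :: offs R).count k with hs₂
  have hz : ∀ k : Tp, k ≠ inp → k ≠ len → (∀ i, k ≠ off i) → k ≠ acc → s.head k = 0 := hs.head
  obtain ⟨s₃, h₃, c₃, f₃, p₃, -, k₃⟩ := den_powers E s₂ (n := zeros w)
    (by simp [hs₂, hs₁, State.addHeads, hcount0, hvar0, hz])
    (fun d => by simp [hs₂, hs₁, State.addHeads, hcount0, hvar0, hz])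
  obtain ⟨s₄, h₄, c₄, f₄, o₄, k₄⟩ := den_offsets R (n := zeros w) s₃ fun i => (p₃ _ (hE i)).1
  have hoff : ∀ i : Fin R.numRel,
      s₄.head (off i) = s.head inp + relAddr R (zeros w) i := fun i => by
    rw [o₄, k₃ _ (by simp)]
    simp [hs₂, hs₁, State.addHeads, hcount, hvar0, hs.off_eq, relAddr]
    ring
  have hcont : s₄.cont = s.cont := by rw [c₄, c₃]; rfl
  have hflag : ∀ f, f ≠ phase' → s₄.flag f = s.flag f := fun f hf => by
    rw [f₄, f₃]
    simp [hs₂, hs₁, State.addHeads, hf]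
  have hkeep : ∀ k : Tp, ¬ k.IsSetup → s₄.head k = s.head k := fun k hk => by
    have e : ∀ k', k'.IsSetup → k ≠ k' := fun k' h' h => hk (h ▸ h')
    rw [k₄ k fun i => e _ trivial, k₃ k fun d => ⟨e _ trivial, e _ trivial⟩]
    simp only [hs₂, hs₁, State.addHeads, State.setFlag_head]
    rw [List.count_cons_of_ne (e inp trivial).symm, List.count_cons_of_ne (e inp trivial).symm,
      List.count_cons_of_ne (e size trivial).symm, List.count_append,
      hcount0 k fun i => e _ trivial, hvar0 k fun i => e _ trivial]
    simp
  refine ⟨s₄.setHead inp 0, ?_, ?_, hcont, hflag, fun k hk => ?_⟩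
  · rw [setup, den_seq_of_leaf h₁, den_seq_of_leaf (den_rights _ s₁), den_seq_of_leaf h₃,
      den_seq_of_leaf h₄, den]
  · refine ⟨⟨by simp, fun i t => ?_, hE, ?_, ?_, ?_, ?_⟩, fun i _ hi => ⟨?_, ?_⟩, ?_, ?_, ?_⟩
    · simp only [State.setHead_cont, State.setHead_head, hcont]
      rw [Function.update_of_ne (by simp), hoff, add_assoc, hs.cont]
      exact Iff.rfl
    · rw [State.setHead_head, Function.update_of_ne (by simp), hkeep _ id]
      exact hz _ (by simp) (by simp) (by simp) (by simp)
    · intro i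
      rw [State.setHead_cont, hcont]
      exact hs.blank _ (by simp) i
    · intro d hd
      rw [State.setHead_head, Function.update_of_ne (by simp), k₄ _ (by simp)]
      exact (p₃ d hd).1
    · intro j
      rw [State.setHead_head, Function.update_of_ne (by simp), hkeep _ id]
      exact hz _ (by simp) (by simp) (by simp) (by simp)
    · rw [State.setHead_flag, hflag _ (by simp)]
      exact hs.flag _ (by simp)
    · rw [State.setHead_head, Function.update_of_ne (by simp), k₄ _ (by simp), k₃ _ (by simp)]
      simp [hs₂, hs₁, State.addHeads, hcount0, hvar i hi, hz]
    · intro d hd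
      rw [State.setHead_head, Function.update_of_ne (by simp), k₄ _ (by simp)]
      exact (p₃ d hd).2
    · intro j i
      rw [State.setHead_cont, hcont]
      exact hs.blank _ (by simp) i
    · rw [State.setHead_flag, hflag _ (by simp)]
      exact hs.flag _ (by simp)
  · rw [State.setHead_head, Function.update_of_ne (fun h => hk (by rw [h]; trivial)), hkeep k hk]

end Prog

theorem fresh_start (R : Signature) (w : List Bool) : Prog.Fresh R w (State.start inp len w) where
  cont i := by simp [State.start]
  len_le := by simp [State.start]
  off_eq i := by simp [State.start]
  head k _ h _ _ := by simp [State.start, h]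
  blank k h i := by simp [State.start, h]
  flag f _ := rfl

/-- The sum of the values of the terms in the structure that a word describes. -/
noncomputable def wordVal {R : Signature} (l : List (NTerm R)) (w : List Bool) : ℕ :=
  (l.map fun t => t.toCTerm.val (wordInterp R w)).sum

/-- The runs are those of the program that has one run for each solution, and one more. -/
theorem wordVal_mem_totP {R : Signature} (l : List (NTerm R)) : wordVal l ∈ TotP := by
  obtain ⟨E, D, hE, hl⟩ := NTerm.exists_fits R l
  have hc : (Prog.setup R E D ;; runProg l).PolyBdd :=
    (Prog.polyBdd_setup R E D).seq (wf_runProg l).polyBdd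
  obtain ⟨M, g, p, h₁, -, h₃⟩ := hc.exists_machine out (inp := inp) (len := len) (by simp)
  have ht : ∀ w, (((Prog.setup R E D ;; runProg l).den (State.start inp len w)).map g).All
      M.Halted := fun w => Tree.all_map.2 (Tree.all_of_forall h₁ _)
  refine ⟨M, M.polyTime_of_reach h₃ ht, fun w => ?_⟩
  rw [M.totalRuns_of_reach (h₃ w) (ht w), Tree.leaves_map]
  obtain ⟨s', hd, hb, -, hf, -⟩ := Prog.den_setup D hE (fresh_start R w)
  rw [den_seq_of_leaf hd, leaves_runProg hl hb (by rw [hf _ (by simp)]; rfl)]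
  rfl

end QuantLogic

namespace QuantLogic

/-! ### The structure described by an encoding -/

theorem getElem?_flatMap_of_length_eq {α β : Type} (f : α → List β) {m : ℕ} (l : List α)
    (hf : ∀ a ∈ l, (f a).length = m) {i p : ℕ} (hp : p < m) :
    (l.flatMap f)[i * m + p]? = l[i]?.bind fun a => (f a)[p]? := by
  induction l generalizing i with
  | nil => simp
  | cons a l ih =>
    have ha := hf a (by simp)
    cases i with
    | zero => simp [List.getElem?_append_left, ha, hp]
    | succ i =>
      rw [List.flatMap_cons, List.getElem?_append_right (by rw [ha, add_mul]; omega), ha,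
        List.getElem?_cons_succ, ← ih fun a ha => hf a (by simp [ha])]
      congr 1
      rw [add_mul]; omega

theorem length_lexTuples {D : Type} (l : List D) (r : ℕ) :
    (lexTuples l r).length = l.length ^ r := by
  induction r with
  | zero => rfl
  | succ r ih => simp [lexTuples, List.length_flatMap, ih, pow_succ']

theorem lexTuples_getElem? {D : Type} {l : List D} {n : ℕ} {e : Fin n → D} (hl : l.length = n)
    (he : ∀ i : Fin n, l[(i : ℕ)]? = some (e i)) (r : ℕ) (t : Fin r → Fin n) :
    (lexTuples l r)[tupleIdx r t]? = some fun i => e (t i) := by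
  induction r with
  | zero =>
    refine congrArg some (funext fun i => i.elim0)
  | succ r ih =>
    rw [lexTuples, tupleIdx, getElem?_flatMap_of_length_eq (m := n ^ r) _ _
      (fun a _ => by rw [List.length_map, length_lexTuples, hl]) (tupleIdx_lt r _), he,
      Option.bind_some, List.getElem?_map, ih]
    refine congrArg some (funext fun i => ?_)
    refine Fin.cases rfl (fun i => rfl) i

/-- The position of a block in a concatenation. -/
theorem getElem?_flatMap_of_pairwise {k : ℕ} {β : Type} (f : Fin k → List β) {l : List (Fin k)}
    (hl : l.Pairwise (· < ·)) {i : Fin k} (hi : i ∈ l) {p : ℕ} (hp : p < (f i).length) :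
    (l.flatMap f)[((l.filter (· < i)).map fun j => (f j).length).sum + p]? = (f i)[p]? := by
  induction l with
  | nil => simp at hi
  | cons j l ih =>
    obtain ⟨hj, hl⟩ := List.pairwise_cons.1 hl
    rcases List.mem_cons.1 hi with rfl | hi
    · have : (i :: l).filter (· < i) = [] := by
        rw [List.filter_eq_nil_iff]
        intro a ha
        rcases List.mem_cons.1 ha with rfl | ha
        · simp
        · simpa using (hj a ha).le
      rw [this, List.flatMap_cons, List.getElem?_append_left (by simpa using hp)]
      simp
    · rw [List.filter_cons_of_pos (by simpa using hj i hi), List.flatMap_cons, List.map_cons,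
        List.sum_cons, add_assoc, List.getElem?_append_right (by omega), ← ih hl hi]
      congr 1; omega

variable {R : Signature} (S : OrdStruct R)

theorem zeros_enc : zeros S.enc = Fintype.card S.Dom := by
  simp [zeros, OrdStruct.enc]

theorem length_encRel (i : Fin R.numRel) :
    (S.encRel i).length = Fintype.card S.Dom ^ R.arity i := by
  rw [OrdStruct.encRel, List.length_map, length_lexTuples, OrdStruct.domList, Finset.length_sort,
    Finset.card_univ]

theorem mem_wordInterp_enc (e : Fin (zeros S.enc) ≃o S.Dom)
    (he : ∀ i : Fin (zeros S.enc), S.domList[(i : ℕ)]? = some (e i)) (i : Fin R.numRel)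
    (t : Fin (R.arity i) → Fin (zeros S.enc)) :
    t ∈ wordInterp R S.enc i ↔ (fun j => e (t j)) ∈ S.rel i := by
  have hlen : S.domList.length = zeros S.enc := by
    rw [zeros_enc, OrdStruct.domList, Finset.length_sort, Finset.card_univ]
  have hlex := lexTuples_getElem? hlen he _ t
  have hlt : tupleIdx _ t < (S.encRel i).length := by
    rw [length_encRel, ← zeros_enc]; exact tupleIdx_lt _ t
  have h : S.enc[relAddr R (zeros S.enc) i + tupleIdx _ t]? =
      ((List.finRange R.numRel).flatMap fun i => S.encRel i)[(((List.finRange R.numRel).filter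
        (· < i)).map fun j => (S.encRel j).length).sum + tupleIdx _ t]? := by
    have hadd : relAddr R (zeros S.enc) i + tupleIdx _ t = (List.replicate (Fintype.card S.Dom)
        false).length + ((((List.finRange R.numRel).filter (· < i)).map fun j =>
          (S.encRel j).length).sum + tupleIdx _ t + 1) := by
      simp only [length_encRel, relAddr, zeros_enc, List.length_replicate]; omega
    rw [hadd]
    refine (List.getElem?_append_right (Nat.le_add_right _ _)).trans ?_
    rw [Nat.add_sub_cancel_left, List.getElem?_cons_succ]
  show S.enc[_]? = some true ↔ _
  rw [h, getElem?_flatMap_of_pairwise _ (List.pairwise_lt_finRange _) (List.mem_finRange i) hlt,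
    OrdStruct.encRel, List.getElem?_map, hlex]
  simp

/-- On the encoding of a structure, terms have the value that they have in the structure. -/
theorem val_enc (t : CTerm R) : t.val (wordInterp R S.enc) = t.val S.rel := by
  have hc : Fintype.card S.Dom = zeros S.enc := (zeros_enc S).symm
  refine CTerm.val_iso (Fintype.orderIsoFinOfCardEq S.Dom hc)
    (fun i t => mem_wordInterp_enc S _ (fun i : Fin (zeros S.enc) => ?_) i t) t
  have : (Fintype.orderIsoFinOfCardEq S.Dom hc i) = S.domList[(i : ℕ)]'(by
      rw [OrdStruct.domList, Finset.length_sort, Finset.card_univ, hc]; exact i.2) := rfl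
  rw [this, List.getElem?_eq_getElem]

/-- A function of the class extends to all words. -/
theorem exists_wordVal {f : OrdStruct R → ℕ} (hf : f ∈ SigmaQSOClass R) :
    ∃ l : List (NTerm R), ∀ S : OrdStruct R, wordVal l S.enc = f S := by
  obtain ⟨l, hl⟩ := exists_cTerms hf
  choose g hg using fun t : CTerm R => t.exists_nTerm
  refine ⟨l.map g, fun S => ?_⟩
  rw [hl, wordVal, List.map_map]
  exact congrArg List.sum (List.map_congr_left fun t _ => (hg t _ _).trans (val_enc S t))

end QuantLogic

namespace QuantLogic

/-! ### A binary counter -/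

/-- The `i`-th binary digit of `v`, and `none` beyond the leading digit. -/
def digit (v i : ℕ) : Option Bool := v.bits[i]?

theorem digit_zero_left (i : ℕ) : digit 0 i = none := by simp [digit]

theorem digit_zero_of_odd {v : ℕ} (h : v % 2 = 1) : digit v 0 = some true := by
  rw [digit, show v = 2 * (v / 2) + 1 by omega, Nat.bit1_bits]
  rfl

theorem digit_zero_of_even {v : ℕ} (h : v % 2 = 0) (hv : v ≠ 0) : digit v 0 = some false := by
  rw [digit, show v = 2 * (v / 2) by omega, Nat.bit0_bits _ (by omega)]
  rfl

theorem digit_succ (v i : ℕ) : digit v (i + 1) = digit (v / 2) i := by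
  rcases Nat.eq_zero_or_pos v with rfl | hv
  · simp [digit]
  · rcases Nat.mod_two_eq_zero_or_one v with h | h
    · conv_lhs => rw [digit, show v = 2 * (v / 2) by omega, Nat.bit0_bits _ (by omega)]
      rfl
    · conv_lhs => rw [digit, show v = 2 * (v / 2) + 1 by omega, Nat.bit1_bits]
      rfl

theorem digit_add (v i j : ℕ) : digit v (i + j) = digit (v / 2 ^ i) j := by
  induction i generalizing v with
  | zero => simp
  | succ i ih =>
    rw [show i + 1 + j = i + j + 1 by omega, digit_succ, ih, Nat.div_div_eq_div_mul, ← pow_succ']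

theorem digit_eq (v i : ℕ) : digit v i = digit (v / 2 ^ i) 0 := digit_add v i 0

theorem digit_eq_none_of_lt {v i : ℕ} (h : v < 2 ^ i) : digit v i = none := by
  rw [digit_eq, Nat.div_eq_of_lt h, digit_zero_left]

theorem digit_two_pow (r : ℕ) : digit (2 ^ r) r = some true := by
  rw [digit_eq, Nat.div_self (by positivity)]
  exact digit_zero_of_odd rfl

theorem digit_two_pow_of_lt {r i : ℕ} (h : i < r) : digit (2 ^ r) i = some false := by
  obtain ⟨k, rfl⟩ : ∃ k, r = i + (k + 1) := ⟨r - i - 1, by omega⟩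
  rw [digit_eq, pow_add, Nat.mul_div_cancel_left _ (by positivity)]
  exact digit_zero_of_even (by omega) (by positivity)

/-- Below the position of the digit that is added, the digits do not change, except that the
counter becomes longer. -/
theorem digit_add_two_pow_of_lt (v : ℕ) {N p : ℕ} (hp : p < N) :
    digit (v + 2 ^ N) p = if digit v p = none then some false else digit v p := by
  obtain ⟨k, rfl⟩ : ∃ k, N = p + (k + 1) := ⟨N - p - 1, by omega⟩
  have h : (v + 2 ^ (p + (k + 1))) / 2 ^ p = v / 2 ^ p + 2 * 2 ^ k := by
    rw [pow_add, Nat.add_mul_div_left _ _ (by positivity), pow_succ']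
  have hk : 0 < 2 ^ k := by positivity
  rw [digit_eq, h, digit_eq v]
  generalize v / 2 ^ p = u
  rcases Nat.mod_two_eq_zero_or_one u with hu | hu
  · rw [digit_zero_of_even (by omega) (by omega)]
    rcases eq_or_ne u 0 with rfl | hu0
    · rw [digit_zero_left, if_pos rfl]
    · rw [digit_zero_of_even hu hu0]; simp
  · rw [digit_zero_of_odd (by omega), digit_zero_of_odd hu]; simp

theorem digit_of_carry {v V p : ℕ} (h : V / 2 ^ p = v / 2 ^ p + 1) :
    (digit v p = some true → digit V p = some false ∧ V / 2 ^ (p + 1) = v / 2 ^ (p + 1) + 1) ∧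
      (digit v p ≠ some true → digit V p = some true ∧ V / 2 ^ (p + 1) = v / 2 ^ (p + 1)) := by
  rw [digit_eq, digit_eq V, pow_succ, ← Nat.div_div_eq_div_mul, ← Nat.div_div_eq_div_mul, h]
  generalize v / 2 ^ p = u
  rcases Nat.mod_two_eq_zero_or_one u with hu | hu
  · have h₀ : digit u 0 ≠ some true := by
      rcases eq_or_ne u 0 with rfl | hu0
      · simp [digit_zero_left]
      · simp [digit_zero_of_even hu hu0]
    exact ⟨fun h => absurd h h₀, fun _ => ⟨digit_zero_of_odd (by omega), by omega⟩⟩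
  · exact ⟨fun _ => ⟨digit_zero_of_even (by omega) (by omega), by omega⟩,
      fun h => absurd (digit_zero_of_odd hu) h⟩

/-- Replace the contents of a tape. -/
def State.setTape {K Fl : Type} [DecidableEq K] (k : K) (f : ℕ → Option Bool) (s : State K Fl) :
    State K Fl :=
  { s with cont := Function.update s.cont k f }

open Cmd Tp Fg

namespace Prog

/-- The counter while its digits are replaced by those of `V`, up to the head. -/
def partSum (v V p : ℕ) (s : St) : St :=
  (s.setTape sum fun i => if i < p then digit V i else digit v i).setHead sum p

/-- Write a digit. -/
theorem partSum_write {v V p : ℕ} (s : St) :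
    ((partSum v V p s).setCell sum p (digit V p)).setHead sum (p + 1) = partSum v V (p + 1) s := by
  refine State.ext ?_ ?_ rfl
  · simp only [partSum, State.setTape, State.setHead_cont, State.setCell_cont,
      Function.update_self, Function.update_idem]
    congr 1
    funext i
    rcases eq_or_ne i p with rfl | hi
    · simp
    · have : i < p + 1 ↔ i < p := by omega
      simp [hi, this]
  · simp [partSum, State.setTape]

/-- Leave a digit unchanged. -/
theorem partSum_keep {v V p : ℕ} (s : St) (h : digit V p = digit v p) :
    (partSum v V p s).setHead sum (p + 1) = partSum v V (p + 1) s := by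
  rw [← partSum_write, h, State.setCell_self]
  simp [partSum, State.setTape]

theorem partSum_cont (v V p : ℕ) (s : St) : (partSum v V p s).cont sum p = digit v p := by
  simp [partSum, State.setTape]

theorem partSum_head (v V p : ℕ) (s : St) : (partSum v V p s).head sum = p := by
  simp [partSum]

theorem partSum_setHead (v V p : ℕ) {k : Tp} (hk : k ≠ sum) (i : ℕ) (s : St) :
    (partSum v V p s).setHead k i = partSum v V p (s.setHead k i) := by
  simp only [partSum]
  rw [State.setHead_comm hk.symm]
  rfl

/-- Make sure that the counter has digits in the next cells, as many as `k` says. -/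
def padLoop (k : Tp) : Prog :=
  loop k (iteSym sum none (write sum (some false)) skip ;; right sum)

theorem den_padLoop {k : Tp} (hk : k ≠ sum) {v N p : ℕ} (s : St) (hp : p + s.head k ≤ N) :
    (padLoop k).den (partSum v (v + 2 ^ N) p s) =
      .leaf (partSum v (v + 2 ^ N) (p + s.head k) s) := by
  have hh : ∀ p, (partSum v (v + 2 ^ N) p s).head k = s.head k := fun p => by
    simp [partSum, hk, State.setTape]
  have h := den_loop_of_leaf (k := k) (s := partSum v (v + 2 ^ N) p s)
    (c := iteSym sum none (write sum (some false)) skip ;; right sum)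
    (fun i => partSum v (v + 2 ^ N) (p + i) s) rfl (fun i => by rw [hh, hh]) fun i hi => by
      rw [hh] at hi
      have hd := digit_add_two_pow_of_lt v (show p + i < N by omega)
      rw [partSum_setHead _ _ _ hk, partSum_setHead _ _ _ hk, ← add_assoc]
      split_ifs at hd with h₀
      · rw [← partSum_write, hd]
        rw [den, den, partSum_head, partSum_cont, if_pos h₀, den, partSum_head, Tree.leaf_bind,
          den, State.setCell_head, partSum_head]
      · rw [← partSum_keep _ hd, den, den, partSum_head, partSum_cont, if_neg h₀, den,
          Tree.leaf_bind, den, partSum_head]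
  rw [padLoop, h, hh]

/-- Add `1` to the counter, from the position of its head on. -/
def addCarry : Prog :=
  setF carry true ;;
  loop width (iteF carry (iteSym sum (some true) (write sum (some false))
    (write sum (some true) ;; setF carry false)) skip ;; right sum) ;; reset sum

theorem den_addCarry {v N : ℕ} (s : St) (hv : v + 2 ^ N < 2 ^ s.head width)
    (hc : s.flag carry = false) (h0 : s.head sum = 0) :
    addCarry.den (partSum v (v + 2 ^ N) N s) = .leaf (s.setTape sum (digit (v + 2 ^ N))) := by
  set V := v + 2 ^ N with hV
  have hN : V / 2 ^ N = v / 2 ^ N + 1 := by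
    rw [hV, Nat.add_div_right _ (by positivity)]
  -- Beyond the carry, the quotients agree.
  have hq : ∀ i, V / 2 ^ (N + i) = v / 2 ^ (N + i) + 1 ∨ V / 2 ^ (N + i) = v / 2 ^ (N + i) := by
    intro i
    induction i with
    | zero => exact .inl hN
    | succ i ih =>
      rw [← add_assoc, pow_succ, ← Nat.div_div_eq_div_mul, ← Nat.div_div_eq_div_mul]
      omega
  let f : ℕ → St := fun i => partSum v V (N + i)
    (s.setFlag carry (decide (V / 2 ^ (N + i) = v / 2 ^ (N + i) + 1)))
  have hh : ∀ i, (f i).head width = s.head width := fun i => by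
    simp [f, partSum, State.setTape]
  have h := den_loop_of_leaf (k := width) (s := f 0) (c := iteF carry (iteSym sum (some true)
    (write sum (some false)) (write sum (some true) ;; setF carry false)) skip ;; right sum)
    f rfl (fun i => by rw [hh, hh]) fun i _ => by
      have hn : width ≠ sum := by simp
      show Cmd.den _ ((partSum v V (N + i) _).setHead width i) = _
      have hf : (f (i + 1)).setHead width i = partSum v V (N + i + 1) ((s.setFlag carry
          (decide (V / 2 ^ (N + i + 1) = v / 2 ^ (N + i + 1) + 1))).setHead width i) :=
        partSum_setHead _ _ _ hn _ _
      rw [hf, partSum_setHead _ _ _ hn, den, den]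
      by_cases hi : V / 2 ^ (N + i) = v / 2 ^ (N + i) + 1
      · obtain ⟨h₁, h₂⟩ := digit_of_carry hi
        rw [if_pos (by simp [partSum, State.setTape, hi]), den, partSum_head, partSum_cont]
        split_ifs with hd
        · obtain ⟨h₃, h₄⟩ := h₁ hd
          rw [← partSum_write, h₃, decide_eq_true h₄, decide_eq_true hi, den, partSum_head,
            Tree.leaf_bind, den, State.setCell_head, partSum_head]
        · obtain ⟨h₃, h₄⟩ := h₂ hd
          rw [← partSum_write, h₃, h₄, decide_eq_true hi, decide_eq_false (by omega), den, den,
            partSum_head, Tree.leaf_bind, den, Tree.leaf_bind, den]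
          refine congrArg Tree.leaf (State.ext rfl ?_ ?_)
          · simp [partSum, State.setTape]
          · simp [partSum, State.setTape, State.setFlag]
      · have hi' := (hq i).resolve_left hi
        have h₄ : V / 2 ^ (N + i + 1) = v / 2 ^ (N + i + 1) := by
          rw [pow_succ, ← Nat.div_div_eq_div_mul, ← Nat.div_div_eq_div_mul, hi']
        rw [if_neg (by simp [partSum, State.setTape, hi]), den, Tree.leaf_bind, den, partSum_head,
          ← partSum_keep _ (by rw [digit_eq, hi', ← digit_eq]), decide_eq_false hi,
          decide_eq_false (by omega)]
  have hf0 : (partSum v V N s).setFlag carry true = f 0 := by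
    simp only [f, add_zero, hN, decide_true]
    rfl
  rw [addCarry, den_seq_of_leaf (s' := f 0) (by rw [den, hf0]), den_seq_of_leaf h, hh, den]
  have hlt : V < 2 ^ (N + s.head width) :=
    hv.trans_le (Nat.pow_le_pow_right (by norm_num) (by omega))
  refine congrArg Tree.leaf (State.ext ?_ ?_ ?_)
  · simp only [f, partSum, State.setTape, State.setHead_cont, State.setFlag_cont]
    congr 1
    funext i
    split_ifs with hi
    · rfl
    · have h₁ : V < 2 ^ i := hlt.trans_le (Nat.pow_le_pow_right (by norm_num) (by omega))
      rw [digit_eq_none_of_lt h₁, digit_eq_none_of_lt ((Nat.le_add_right _ _).trans_lt h₁)]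
  · simp [f, partSum, State.setTape, h0]
  · have : ¬ V / 2 ^ (N + s.head width) = v / 2 ^ (N + s.head width) + 1 := by
      rw [Nat.div_eq_of_lt hlt]; exact (Nat.succ_ne_zero _).symm
    simp [f, partSum, State.setTape, this, hc]

/-- Add to the counter the power of two whose exponent is the sum of the registers `l`. -/
def addPow (l : List Tp) : Prog := seqs (l.map padLoop) ;; addCarry

theorem den_addPow {l : List Tp} (hl : sum ∉ l) (v : ℕ) (s : St)
    (hv : v + 2 ^ (l.map s.head).sum < 2 ^ s.head width) (hc : s.flag carry = false)
    (h0 : s.head sum = 0) :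
    (addPow l).den (s.setTape sum (digit v)) =
      .leaf (s.setTape sum (digit (v + 2 ^ (l.map s.head).sum))) := by
  have hstart : s.setTape sum (digit v) = partSum v (v + 2 ^ (l.map s.head).sum) 0 s := by
    rw [partSum, State.setHead_self (by exact h0)]
    simp
  have key : ∀ (N p : ℕ) (l : List Tp), sum ∉ l → p + (l.map s.head).sum ≤ N →
      (seqs (l.map padLoop)).den (partSum v (v + 2 ^ N) p s) =
        .leaf (partSum v (v + 2 ^ N) (p + (l.map s.head).sum) s) := by
    intro N p l
    induction l generalizing p with
    | nil => intro _ _; rfl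
    | cons k l ih =>
      intro hl hp
      rw [List.map_cons, List.sum_cons] at hp
      rw [List.mem_cons, not_or] at hl
      refine (den_seq_of_leaf (den_padLoop (Ne.symm hl.1) s (by omega)) _).trans ?_
      refine (ih _ hl.2 (by omega)).trans ?_
      rw [List.map_cons, List.sum_cons, add_assoc]
  rw [hstart, addPow, den_seq_of_leaf (key _ 0 l hl (by omega)), zero_add]
  exact den_addCarry s hv hc h0

theorem wf_addPow {l : List Tp} (hl : ∀ k ∈ l, k.IsReg) : (addPow l).WF IsReg := by
  refine ⟨WF.seqs fun c hc => ?_, trivial, ⟨trivial, ⟨⟨trivial, trivial, trivial⟩,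
    trivial⟩, id⟩, id⟩
  obtain ⟨k, hk, rfl⟩ := List.mem_map.1 hc
  exact ⟨hl k hk, ⟨trivial, trivial⟩, id⟩

end Prog

end QuantLogic

namespace QuantLogic

open Cmd Tp Fg Prog

/-! ### Sampling -/

theorem Tree.fold_half_const {α : Type*} (r : ℝ) (t : Tree α) :
    Tree.fold (1 / 2) (fun _ => r) t = r := by
  induction t with
  | leaf a => rfl
  | coin t₀ t₁ h₀ h₁ => rw [fold, h₀, h₁]; ring

/-- A random process that changes nothing but the counter, as long as the counter stays below
`2 ^ W`, and adds to it a random number with mean `N.1`, variance `N.2.1` and maximum `N.2.2`.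
Mean and variance are given by the second moments about all points `a`. -/
def Samples (W : ℕ) (F : St → Tree St) (s : St) (N : ℝ × ℝ × ℕ) : Prop :=
  ∃ T : ℕ → Tree ℕ, ∀ v, v + N.2.2 < 2 ^ W →
    F (s.setTape sum (digit v)) = (T v).map (fun u => s.setTape sum (digit u)) ∧
    ((T v).All fun u => u ≤ v + N.2.2) ∧
    ∀ a : ℝ, Tree.fold (1 / 2) (fun u : ℕ => ((u : ℝ) - a) ^ 2) (T v) = (v + N.1 - a) ^ 2 + N.2.1

theorem Samples.leaf (W : ℕ) (s : St) : Samples W Tree.leaf s 0 :=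
  ⟨Tree.leaf, fun v _ => ⟨rfl, le_rfl, fun a => by simp [Tree.fold]⟩⟩

theorem Samples.bind {W : ℕ} {F₁ F₂ : St → Tree St} {s : St} {N₁ N₂ : ℝ × ℝ × ℕ}
    (h₁ : Samples W F₁ s N₁) (h₂ : Samples W F₂ s N₂) :
    Samples W (fun s => (F₁ s).bind F₂) s (N₁ + N₂) := by
  obtain ⟨T₁, h₁⟩ := h₁
  obtain ⟨T₂, h₂⟩ := h₂
  refine ⟨fun v => (T₁ v).bind T₂, fun v hv => ?_⟩
  simp only [Prod.snd_add, Prod.fst_add] at hv ⊢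
  obtain ⟨a₁, b₁, c₁⟩ := h₁ v (by omega)
  have h₃ := b₁.mono fun u hu => h₂ u (by omega)
  refine ⟨?_, ?_, fun a => ?_⟩
  · rw [a₁, Tree.bind_map, Tree.map_bind]
    exact Tree.bind_congr (h₃.mono fun u hu => hu.1)
  · rw [Tree.all_bind]
    exact (b₁.and h₃).mono fun u hu => hu.2.2.1.mono fun u' hu' => by omega
  · rw [Tree.fold_bind, Tree.fold_congr (g := fun u : ℕ => ((u : ℝ) - (a - N₂.1)) ^ 2 + N₂.2.1)
      (h₃.mono fun u hu => by rw [hu.2.2 a]; ring), Tree.fold_add, Tree.fold_half_const, c₁]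
    ring

/-- The program is such a process. -/
def SampleSpec (W : ℕ) (c : Prog) : St → ℝ × ℝ × ℕ → Prop := Samples W c.den

theorem addSpec_sampleSpec (W : ℕ) : AddSpec (fun _ => True) (SampleSpec W) where
  ok_skip := trivial
  ok_seq _ _ _ _ := trivial
  ok_loop _ _ _ := trivial
  skip s := Samples.leaf W s
  seq c₁ c₂ s N₁ N₂ _ h₁ h₂ := h₁.bind h₂
  loop k c s n N _ _ hn h := by
    have e : (loop k c).den = fun s => loopM (fun i' s' =>
        (c.den (s'.setHead k i')).map (State.setHead k (s.head k))) (s.head k) s :=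
      funext fun s => by rw [den]
    suffices H : ∀ j (hj : j ≤ n), Samples W (loopM (fun i' s' =>
        (c.den (s'.setHead k i')).map (State.setHead k n)) j) s
          (∑ a : Fin j, N (Fin.castLE hj a)) by
      obtain ⟨T, hT⟩ := H n le_rfl
      refine ⟨T, fun v hv => ?_⟩
      have hh : (s.setTape sum (digit v)).head k = n := hn
      rw [e]
      simp only [hh]
      exact hT v hv
    intro j hj
    induction j with
    | zero => exact Samples.leaf W s
    | succ j ih =>
      rw [Fin.sum_univ_castSucc]
      refine (ih (by omega)).bind ?_
      obtain ⟨T, hT⟩ := h ⟨j, hj⟩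
      refine ⟨T, fun v hv => ?_⟩
      obtain ⟨h₁, h₂, h₃⟩ := hT v hv
      refine ⟨?_, h₂, h₃⟩
      show (c.den ((s.setHead k j).setTape sum (digit v))).map _ = _
      rw [h₁, Tree.map_map]
      congr 1
      funext u
      show (State.setHead k n ((s.setTape sum (digit u)).setHead k j)) = _
      rw [State.setHead_setHead, State.setHead_self]
      exact hn

namespace NTerm

variable {R : Signature} {n : ℕ} {I : Interp R (Fin n)} {E D : ℕ} (t : NTerm R)

/-- Fill a cell with a random bit. -/
def tossStep (j : Fin t.q) : Prog :=
  toss coin ;; iteF coin (setF coin false ;; put (so j) (some true) (t.goCell j))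
    (put (so j) (some false) (t.goCell j))

/-- Make all cells blank. -/
def clear : Prog :=
  seqs ((List.finRange t.q).map fun j =>
    loop (cells (t.ar j)) (write (so j) none ;; right (so j)) ;; reset (so j))

/-- Choose the relations at random, and add their number to the counter in case of a solution. -/
def sampleBody : Prog :=
  t.forCells t.tossStep ;;
  t.satK (addPow ((List.finRange t.q).map fun j => cells (t.ar j))) skip ;; t.clear

theorem wf_sampleBody : t.sampleBody.WF IsReg := by
  have hp : ∀ (j : Fin t.q) (o : Option Bool), (put (so j) o (t.goCell j)).WF IsReg :=
    fun j o => WF.put id ⟨trivial, id⟩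
  refine ⟨wf_forCells fun j => ⟨trivial, ⟨trivial, hp _ _⟩, hp _ _⟩,
    t.wf_satK (wf_addPow fun k hk => ?_) trivial, WF.seqs fun c hc => ?_⟩
  · obtain ⟨j, -, rfl⟩ := List.mem_map.1 hk
    trivial
  · obtain ⟨j, -, rfl⟩ := List.mem_map.1 hc
    exact ⟨⟨trivial, trivial, id⟩, id⟩

variable {t} {x : Fin t.k → Fin n} {s : St}

theorem count_setTape_sum (f : ℕ → Option Bool) :
    t.count I x (s.setTape sum f) = t.count I x s := by
  simp [count, Compat, State.setTape]

theorem At.setTape_sum (h : t.At I E D x s) (f : ℕ → Option Bool) :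
    t.At I E D x (s.setTape sum f) :=
  ⟨h.ready.congr (by simp [State.setTape]) (by simp [State.setTape]) fun _ _ => rfl, h.arity_le,
    h.rank_le, h.freeVars, h.var_eq⟩

theorem den_clear (hcells : ∀ j, s.head (cells (t.ar j)) = n ^ t.ar j)
    (hso : ∀ j, s.head (so j) = 0) (hb : ∀ j i, s.cont (so j) i = none) {b : St}
    (h : FilledOn (t.allCells n) s b) : t.clear.den b = .leaf s := by
  suffices H : ∀ (l : List (Fin t.q)) (C : Set (ℕ × ℕ)) (b : St),
      (∀ p ∈ C, ∃ j ∈ l, p.1 = j ∧ p.2 < n ^ t.ar j) → FilledOn C s b →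
      (seqs (l.map fun j => loop (cells (t.ar j)) (write (so j) none ;; right (so j)) ;;
        reset (so j))).den b = .leaf s from
    H _ _ b (fun p hp => Exists.elim (show ∃ j : Fin t.q, p.1 = j ∧ p.2 < n ^ t.ar j from hp)
      fun j hj => ⟨j, List.mem_finRange j, hj⟩) h
  intro l
  induction l with
  | nil =>
    intro C b hC hb'
    refine congrArg Tree.leaf (State.ext (funext fun k => ?_) hb'.head hb'.flag)
    by_cases hk : ∃ j, k = so j
    · obtain ⟨j, rfl⟩ := hk
      funext i
      rw [hb j i, hb'.blank j i fun hp => by simpa using hC _ hp]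
    · exact hb'.cont k fun j e => hk ⟨j, e⟩
  | cons j l ih =>
    intro C b hC hb'
    have hd := den_fill (k := so j) (x := cells (t.ar j)) (by simp) none b
      (by rw [hb'.head]; exact hso j)
    refine (den_seq_of_leaf hd _).trans (ih {p ∈ C | p.1 ≠ j} _ ?_ ?_)
    · rintro p ⟨hp, hpj⟩
      obtain ⟨j', hj', h₁, h₂⟩ := hC p hp
      rcases List.mem_cons.1 hj' with rfl | hj'
      · exact absurd h₁ hpj
      · exact ⟨j', hj', h₁, h₂⟩
    · refine ⟨hb'.head, hb'.flag, fun k hk => ?_, fun j' i hp => ?_, fun j' i hp => ?_⟩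
      · simp only [State.fill]
        rw [Function.update_of_ne (hk j)]
        exact hb'.cont k hk
      · simp only [State.fill]
        rw [Function.update_of_ne (by simpa using hp.2)]
        exact hb'.fill j' i hp.1
      · simp only [State.fill]
        by_cases hj : j' = j
        · subst hj
          rw [Function.update_self]
          split_ifs with hi
          · rfl
          · refine hb'.blank _ i fun hp' => ?_
            obtain ⟨j₂, -, h₁, h₂⟩ := hC _ hp'
            obtain rfl := Fin.ext h₁
            rw [hb'.head, hcells] at hi
            exact hi h₂
        · rw [Function.update_of_ne (by simpa using hj)]
          exact hb'.blank j' i fun hp' => hp ⟨hp', hj⟩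

/-- One sample adds `2 ^ N` with the probability `p = count / 2 ^ N`, where `N` is the number of
cells: the mean is `count`, and the variance `2 ^ (2 * N) * p * (1 - p)`. -/
theorem sampleSpec_sampleBody (h : t.At I E D x s)
    (hcells : ∀ j, s.head (cells (t.ar j)) = n ^ t.ar j) (hb : ∀ j i, s.cont (so j) i = none)
    (hcoin : s.flag coin = false) (hcarry : s.flag carry = false) (hsum : s.head sum = 0) :
    SampleSpec (s.head width) t.sampleBody s (t.count I x s,
      t.count I x s * 2 ^ t.numCells n - (t.count I x s : ℝ) ^ 2, 2 ^ t.numCells n) := by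
  classical
  set N := t.numCells n with hN
  have hregs : (((List.finRange t.q).map fun j => cells (t.ar j)).map s.head).sum = N := by
    rw [List.map_map, hN, numCells, ← List.sum_ofFn, List.ofFn_eq_map]
    exact congrArg List.sum (List.map_congr_left fun j _ => hcells j)
  refine ⟨fun v => ((t.forCells t.tossStep).den (s.setTape sum (digit v))).map fun a =>
    if t.count I x a ≠ 0 then v + 2 ^ N else v, fun v hv => ?_⟩
  simp only at hv ⊢
  have h0 : FilledOn ∅ (s.setTape sum (digit v)) (s.setTape sum (digit v)) :=
    ⟨rfl, rfl, fun _ _ => rfl, by simp, fun j i _ => by simpa [State.setTape] using hb j i⟩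
  obtain ⟨h₁, h₂⟩ := fold_forCells (r := 1 / 2) (κ := 1 / 2) (step := t.tossStep)
    (Q := fun _ => True) (h.setTape_sum (digit v)) hcells trivial h0
    fun j u s' hs' _ hf _ hn => by
      have hc : s'.flag coin = false := by rw [hf]; exact hcoin
      have hden : (t.tossStep j).den (s'.setHead (cells (t.ar j)) (tupleIdx _ u)) = .coin
          (.leaf ((s'.setCell (so j) (tupleIdx _ u) (some false)).setHead (cells (t.ar j))
            (tupleIdx _ u)))
          (.leaf ((s'.setCell (so j) (tupleIdx _ u) (some true)).setHead (cells (t.ar j))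
            (tupleIdx _ u))) := by
        show Tree.coin (Cmd.den _ _) (Cmd.den _ _) = _
        congr 1
        · rw [den, if_neg (by simp), State.setFlag_setHead, State.setFlag_self hc, den_putAt hs']
        · rw [den, if_pos (by simp), den, den, Tree.leaf_bind, State.setFlag_setFlag,
            State.setFlag_setHead, State.setFlag_self hc, den_putAt hs']
      rw [hden]
      refine ⟨⟨⟨_, rfl, trivial⟩, ⟨_, rfl, trivial⟩⟩, ?_⟩
      simp only [Tree.fold, count_setHead, count_split (I := I) (x := x) hn]
      push_cast; ring
  rw [count_setTape_sum] at h₂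
  refine ⟨?_, ?_, fun a => ?_⟩
  · rw [sampleBody, den, Tree.map_map]
    refine Tree.bind_congr (h₁.mono fun a ⟨ha, _⟩ => ?_)
    have hclear : ∀ u, t.clear.den (a.setTape sum (digit u)) = .leaf (s.setTape sum (digit u)) := by
      intro u
      refine den_clear (n := n) (s := s.setTape sum (digit u)) hcells h.ready.so0
        (fun j i => by simpa [State.setTape] using hb j i)
        ⟨ha.head, ha.flag, fun k hk => ?_, fun j i hp => ?_, fun j i hp => ?_⟩
      · by_cases hks : k = sum
        · subst hks; simp [State.setTape]
        · simpa [State.setTape, hks] using ha.cont k hk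
      · simpa [State.setTape] using ha.fill j i hp
      · simpa [State.setTape] using ha.blank j i hp
    have ha' : a = a.setTape sum (digit v) := by
      have := ha.cont sum (by simp)
      simp only [State.setTape, Function.update_self] at this
      simp [State.setTape, ← this]
    have hadd := den_addPow (l := (List.finRange t.q).map fun j => cells (t.ar j))
      (by simp) v a
      (by rw [ha.head]; show _ + 2 ^ List.sum (List.map s.head _) < _; rw [hregs]; exact hv)
      (by rw [ha.flag]; exact hcarry) (by rw [ha.head]; exact hsum)
    rw [den, den_satK ((h.setTape_sum _).filled ha)]
    split_ifs with hc
    · rw [ha', hadd, Tree.leaf_bind, hclear, ha.head]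
      have hc' : t.count I x (a.setTape sum (digit v)) ≠ 0 := by rwa [count_setTape_sum]
      show Tree.leaf (s.setTape sum (digit (v + 2 ^ List.sum (List.map s.head _)))) = _
      rw [hregs]
      exact congrArg (fun u => Tree.leaf (s.setTape sum (digit u))) (if_pos hc').symm
    · have hc' : ¬ t.count I x (a.setTape sum (digit v)) ≠ 0 := by rwa [count_setTape_sum]
      rw [den, Tree.leaf_bind, ha', hclear]
      exact congrArg (fun u => Tree.leaf (s.setTape sum (digit u))) (if_neg hc').symm
  · refine Tree.all_map.2 (Tree.all_of_forall (fun a => ?_) _)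
    split_ifs
    · exact le_rfl
    · exact Nat.le_add_right _ _
  · have hcount : ((t.forCells t.tossStep).den (s.setTape sum (digit v))).All fun b =>
        (((if t.count I x b ≠ 0 then v + 2 ^ N else v : ℕ) : ℝ) - a) ^ 2 =
          (v - a) ^ 2 + ((v + 2 ^ N - a) ^ 2 - (v - a) ^ 2) * t.count I x b := by
      refine h₁.mono fun b hb => ?_
      by_cases hc : t.count I x b = 0
      · simp [hc]
      · rw [if_pos hc, count_filled hb.1 hc]; push_cast; ring
    rw [Tree.fold_map, Tree.fold_congr hcount, Tree.fold_add, Tree.fold_half_const, Tree.fold_mul,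
      h₂]
    have h2 : (1 / 2 : ℝ) ^ N * 2 ^ N = 1 := by rw [← mul_pow]; norm_num
    -- The expected number of solutions at a leaf is `count / 2 ^ N`.
    linear_combination (2 * (v - a) * t.count I x s + 2 ^ N * t.count I x s) * h2

/-- Fixing the values of the second-order atoms leaves a fixed share of all choices, so that a
random choice is a solution with a probability that is bounded from below. -/
theorem two_pow_numCells_le (hb : ∀ j i, s.cont (so j) i = none) (hc : t.count I x s ≠ 0) :
    2 ^ t.numCells n ≤ 2 ^ t.ψ.atoms.length * t.count I x s := by
  classical
  obtain ⟨X, -, y, hX⟩ := count_ne_zero.1 hc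
  set e := Sum.elim x y
  let at' : Fin t.ψ.atoms.length → Σ j : Fin t.q, Fin (t.ar j) → Fin n := fun i =>
    ⟨(t.ψ.atoms.get i).1, fun l => e ((t.ψ.atoms.get i).2 l)⟩
  let P : (Σ j : Fin t.q, Fin (t.ar j) → Fin n) → Prop := fun p => ∃ i, at' i = p
  -- `g Y` agrees with the solution `X` on the atoms, and with `Y` elsewhere. With the values of `Y`
  -- on the atoms it determines `Y`.
  let g : SOAsg t.ar (Fin n) → SOAsg t.ar (Fin n) := fun Y j =>
    {u | (P ⟨j, u⟩ ∧ u ∈ X j) ∨ (¬ P ⟨j, u⟩ ∧ u ∈ Y j)}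
  have hg : ∀ Y, Compat s (g Y) ∧ t.Sol I x (g Y) := fun Y => by
    refine ⟨fun j u b h => absurd h (by simp [hb]), y, (QF.sat_congr t.ψ fun a ha => ?_).1 hX⟩
    obtain ⟨i, hi⟩ := List.get_of_mem ha
    have : P ⟨a.1, fun l => e (a.2 l)⟩ := ⟨i, by rw [← hi]⟩
    show _ ↔ (P ⟨a.1, fun l => e (a.2 l)⟩ ∧ _) ∨ (¬ P ⟨a.1, fun l => e (a.2 l)⟩ ∧ _)
    simp only [this, true_and, not_true_eq_false, false_and, or_false]
  have hinj : Function.Injective fun Y : SOAsg t.ar (Fin n) =>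
      ((fun i => (at' i).2 ∈ Y (at' i).1 : Fin t.ψ.atoms.length → Prop),
        (⟨g Y, hg Y⟩ : {X : SOAsg t.ar (Fin n) // Compat s X ∧ t.Sol I x X})) := by
    intro Y Z hYZ
    obtain ⟨h₁, h₂⟩ := Prod.mk.inj hYZ
    have h₂ : g Y = g Z := congrArg Subtype.val h₂
    funext j
    ext u
    by_cases hP : P ⟨j, u⟩
    · obtain ⟨i, hi⟩ := hP
      have := iff_of_eq (congrFun h₁ i)
      rw [hi] at this
      exact this
    · have : u ∈ g Y j ↔ u ∈ g Z j := by rw [h₂]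
      simpa [g, hP] using this
  have hcard := Nat.card_le_card_of_injective _ hinj
  have hSO : Nat.card (SOAsg t.ar (Fin n)) = 2 ^ t.numCells n := by
    simp only [SOAsg, Nat.card_eq_fintype_card]
    rw [Fintype.card_pi]
    simp [numCells, Finset.prod_pow_eq_pow_sum]
  rw [Nat.card_prod, hSO] at hcard
  simpa [count] using hcard

end NTerm

end QuantLogic

namespace QuantLogic

open Cmd Tp Fg Prog

/-- The contributions to the counter whose variance is at most `2 ^ c` times the square of the
mean. -/
def boundedVariance (c : ℕ) : AddSubmonoid (ℝ × ℝ × ℕ) where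
  carrier := {N | 0 ≤ N.1 ∧ N.2.1 ≤ 2 ^ c * N.1 ^ 2}
  zero_mem' := by simp
  add_mem' := by
    rintro N N' ⟨h₁, h₂⟩ ⟨h₃, h₄⟩
    refine ⟨add_nonneg h₁ h₃, ?_⟩
    have := mul_nonneg (pow_nonneg (zero_le_two (α := ℝ)) c) (mul_nonneg h₁ h₃)
    simp only [Prod.fst_add, Prod.snd_add]
    nlinarith

/-- Take samples, as many as the register `samples` says, for all terms and all values of their
first-order variables. -/
def sampleProg {R : Signature} (l : List (NTerm R)) : Prog :=
  loop samples (seqs (l.map fun t => forVars 0 t.k t.sampleBody))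

theorem wf_sampleProg {R : Signature} (l : List (NTerm R)) : (sampleProg l).WF IsReg := by
  refine ⟨trivial, WF.seqs fun c hc => ?_⟩
  obtain ⟨t, -, rfl⟩ := List.mem_map.1 hc
  exact wf_forVars _ _ t.wf_sampleBody

/-- The sum of the values of these powers of the size bounds the number of digits of the counter
after one sample. -/
def widthExps {R : Signature} (l : List (NTerm R)) : List ℕ :=
  l.flatMap fun t => t.k :: List.ofFn t.ar

/-- Contributions are independent, so means and variances add up. For a nonzero count `N`, the
variance is at most `N * 2 ^ numCells ≤ 2 ^ c * N ^ 2`, and such bounds are kept by sums. -/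
theorem sampleSpec_sampleProg {R : Signature} {n : ℕ} {I : Interp R (Fin n)} {E D c : ℕ} {s : St}
    {l : List (NTerm R)} (hl : ∀ t ∈ l, t.Fits E D) (hc : ∀ t ∈ l, t.ψ.atoms.length ≤ c)
    (hs : Base I E D s) (hcarry : s.flag carry = false) (hsum : s.head sum = 0) :
    ∃ (V : ℝ) (B : ℕ), V ≤ 2 ^ c * (((l.map fun t => t.toCTerm.val I).sum : ℕ) : ℝ) ^ 2 ∧
      B < 2 ^ ((widthExps l).map fun d => n ^ d).sum ∧
      SampleSpec (s.head width) (sampleProg l) s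
        (s.head samples * ((l.map fun t => t.toCTerm.val I).sum : ℕ), s.head samples * V,
          s.head samples * B) := by
  let N₀ : (t : NTerm R) → (Fin t.k → Fin n) → ℝ × ℝ × ℕ := fun t x =>
    (t.count I x s, t.count I x s * 2 ^ t.numCells n - (t.count I x s : ℝ) ^ 2, 2 ^ t.numCells n)
  let N : NTerm R → ℝ × ℝ × ℕ := fun t => ∑ x, N₀ t x
  have hSp := addSpec_sampleSpec (s.head width)
  have hspec : SampleSpec (s.head width) (sampleProg l) s
      (∑ _a : Fin (s.head samples), (l.map N).sum) := by
    refine hSp.loop samples _ s _ _ trivial trivial rfl fun a => ?_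
    refine (hSp.seqs l (c := fun t => forVars 0 t.k t.sampleBody) (fun _ => trivial)
      fun t ht => ?_).2
    refine hSp.forVars trivial _ (fun i _ hi => ?_) fun x s' h₁ h₂ h₃ h₄ => ?_
    · exact (hs.freeVars i (Nat.zero_le _) (by have := (hl t ht).2.2; omega)).2
    · have h₃' : ∀ k', k' ≠ samples → (∀ i, 0 ≤ i → i < 0 + t.k → k' ≠ var i) →
          s'.head k' = s.head k' := fun k' hk hk' => by
        rw [h₃ k' hk', State.setHead_head, Function.update_of_ne hk]
      have hb : Base I E D (s.setHead samples a) := ⟨hs.ready.congr rfl rfl fun k hk => by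
        cases k <;> first | exact False.elim hk | rfl, hs.freeVars, hs.cells_eq, hs.blank,
          hs.coin_eq⟩
      have hAt := (hl t ht).at hb h₁ h₂ h₃ h₄
      have hcount : t.count I x s = t.count I x s' := by
        simp only [NTerm.count, Compat, h₁]
        rfl
      have hw : s'.head width = s.head width := h₃' width (by simp) (by simp)
      simp only [N₀, hcount]
      rw [← hw]
      refine NTerm.sampleSpec_sampleBody hAt (fun j => ?_) (by rw [h₁]; exact hs.blank)
        (by rw [h₂]; exact hs.coin_eq) (by rw [h₂]; exact hcarry)
        ((h₃' sum (by simp) (by simp)).trans hsum)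
      rw [h₃' _ (by simp) (by simp), hs.cells_eq _ ((hl t ht).1 j)]
  have hmem : (l.map N).sum ∈ boundedVariance c := by
    refine list_sum_mem fun y hy => ?_
    obtain ⟨t, ht, rfl⟩ := List.mem_map.1 hy
    refine sum_mem fun x _ => ⟨Nat.cast_nonneg _, ?_⟩
    simp only [N₀]
    rcases eq_or_ne (t.count I x s) 0 with h0 | h0
    · simp [h0]
    · have h₁ : (2 ^ t.numCells n : ℝ) ≤ 2 ^ t.ψ.atoms.length * t.count I x s := by
        exact_mod_cast NTerm.two_pow_numCells_le hs.blank h0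
      have h₂ : (2 ^ t.ψ.atoms.length : ℝ) ≤ 2 ^ c := pow_le_pow_right₀ (by norm_num) (hc t ht)
      have h₃ : (0 : ℝ) ≤ t.count I x s := Nat.cast_nonneg _
      nlinarith [mul_le_mul_of_nonneg_right h₂ h₃]
  have hmean : (l.map N).sum.1 = ((l.map fun t => t.toCTerm.val I).sum : ℕ) := by
    have : ∀ t, (N t).1 = (t.toCTerm.val I : ℕ) := fun t => by
      rw [← NTerm.sum_count_eq_val hs.blank]
      simp [N, N₀, Prod.fst_sum]
    clear hmem hspec hc hl
    induction l with
    | nil => simp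
    | cons t l ih => simp [ih, this]
  have hB : (l.map N).sum.2.2 < 2 ^ ((widthExps l).map fun d => n ^ d).sum := by
    have : ∀ t, (N t).2.2 = n ^ t.k * 2 ^ t.numCells n := fun t => by
      simp [N, N₀, Prod.snd_sum]
    clear hmem hspec hc hl hmean
    induction l with
    | nil => simp [widthExps]
    | cons t l ih =>
      have e : ((widthExps (t :: l)).map fun d => n ^ d).sum =
          n ^ t.k + t.numCells n + ((widthExps l).map fun d => n ^ d).sum := by
        simp [widthExps, NTerm.numCells, List.map_ofFn, List.sum_ofFn, add_assoc]
      rw [e, List.map_cons, List.sum_cons]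
      simp only [Prod.snd_add, this]
      generalize ((widthExps l).map fun d => n ^ d).sum = w at ih ⊢
      have h₁ : n ^ t.k + 1 ≤ 2 ^ n ^ t.k := Nat.lt_two_pow_self
      have h₂ : 1 ≤ 2 ^ t.numCells n := Nat.one_le_two_pow
      rw [pow_add, pow_add]
      generalize 2 ^ n ^ t.k = a at *
      generalize 2 ^ t.numCells n = b at *
      generalize 2 ^ w = d at *
      have h₃ : (n ^ t.k + 1) * b ≤ a * b := Nat.mul_le_mul_right _ h₁
      rw [add_mul, one_mul] at h₃
      obtain ⟨p, hp⟩ : ∃ p, a * b = p + 1 := ⟨a * b - 1, by omega⟩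
      obtain ⟨q, rfl⟩ : ∃ q, d = q + 1 := ⟨d - 1, by omega⟩
      have h₄ : (p + 1) * (q + 1) = p * q + p + q + 1 := by ring
      rw [hp, h₄]
      omega
  refine ⟨(l.map N).sum.2.1, (l.map N).sum.2.2, by rw [← hmean]; exact hmem.2, hB, ?_⟩
  have e : ∑ _a : Fin (s.head samples), (l.map N).sum = (s.head samples *
      (((l.map fun t => t.toCTerm.val I).sum : ℕ) : ℝ), s.head samples * (l.map N).sum.2.1,
        s.head samples * (l.map N).sum.2.2) := by
    rw [← hmean]
    simp [Prod.ext_iff]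
  rw [← e]
  exact hspec

/-! ### The number of samples -/

/-- A loop of deterministic rounds, with an invariant. -/
theorem _root_.QuantLogic.Cmd.den_loop_invariant {k : Tp} {c : Prog} {s : St} (P : ℕ → St → Prop)
    (h0 : P 0 s) (h : ∀ i < s.head k, ∀ a, P i a →
      ∃ b, c.den (a.setHead k i) = .leaf b ∧ P (i + 1) (b.setHead k (s.head k))) :
    ∃ b, (loop k c).den s = .leaf b ∧ P (s.head k) b := by
  rw [den]
  suffices H : ∀ j ≤ s.head k, ∃ b, loopM (fun i s' => (c.den (s'.setHead k i)).map
      (State.setHead k (s.head k))) j s = .leaf b ∧ P j b from H _ le_rfl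
  intro j hj
  induction j with
  | zero => exact ⟨s, rfl, h0⟩
  | succ j ih =>
    obtain ⟨a, ha, hPa⟩ := ih (by omega)
    obtain ⟨b, hb, hPb⟩ := h j (by omega) a hPa
    refine ⟨_, ?_, hPb⟩
    rw [loopM, ha, Tree.leaf_bind, hb]
    rfl

namespace Prog

/-- If the number of the round is marked, then mark its double, and increase `shift` by `2`. -/
def doubleStep : Prog :=
  test mark (some true) (loop acc (right mark))
    (rights [shift, shift] ;; reset pow2 ;; reset pow2' ;;
      loop acc (rights [pow2, pow2, pow2', pow2']) ;;
      put mark (some true) (loop acc (rights [mark, mark]))) skip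

/-- Compute the least power of two that is not less than the accuracy. The start value of `shift` is
chosen such that the number of samples will be `2 ^ (shift + 1)`. -/
def doubling (c : ℕ) : Prog :=
  rights (pow2 :: pow2' :: List.replicate (2 * c + 3) shift) ;;
  put mark (some true) (right mark) ;; loop acc doubleStep

theorem polyBdd_doubling (c : ℕ) : (doubling c).PolyBdd := by
  refine (wf_rights (L := fun _ => False) fun _ _ => id).polyBdd.seq ((WF.polyBdd
    (L := fun _ => False) (WF.put id id)).seq (WF.polyBdd (L := fun k => k = acc) ⟨rfl, ?_⟩))
  refine WF.test (by simp) ⟨rfl, by simp [WF]⟩ ⟨wf_rights (by simp), by simp [WF], by simp [WF],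
    ⟨rfl, wf_rights (by simp)⟩, WF.put (by simp) ⟨rfl, wf_rights (by simp)⟩⟩ trivial

/-- The registers and tapes that serve the approximation only. -/
def _root_.QuantLogic.Tp.IsAux : Tp → Prop
  | len | out | acc | pow2 | pow2' | mark | samples | shift | sum | width => True
  | _ => False

/-- The states agree, except on the tapes and registers in `C`. -/
structure Agree (C : Tp → Prop) (s s' : St) : Prop where
  cont : ∀ k, ¬ C k → s'.cont k = s.cont k
  head : ∀ k, ¬ C k → s'.head k = s.head k
  flag : s'.flag = s.flag

theorem _root_.QuantLogic.Base.congr {R : Signature} {n : ℕ} {I : Interp R (Fin n)} {E D : ℕ}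
    {s s' : St} (h : Base I E D s) (h' : Agree IsAux s s') : Base I E D s' where
  ready := h.ready.congr (h'.cont _ id) (h'.cont _ id) fun k hk => h'.head k fun hk' => by
    cases k <;> first | exact hk | exact hk'
  freeVars := h.freeVars.congr fun i _ => ⟨by rw [h'.flag], h'.head _ id⟩
  cells_eq d hd := (h'.head _ id).trans (h.cells_eq d hd)
  blank j i := by rw [h'.cont _ id]; exact h.blank j i
  coin_eq := by rw [h'.flag]; exact h.coin_eq

/-- The tapes and registers that are used to double. -/
def _root_.QuantLogic.Tp.IsDouble : Tp → Prop
  | pow2 | pow2' | mark | shift => True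
  | _ => False

theorem den_doubling (c : ℕ) {s : St} (hp : s.head pow2 = 0) (hp' : s.head pow2' = 0)
    (hs : s.head shift = 0) (hm : s.head mark = 0) (hb : ∀ i, s.cont mark i = none) :
    ∃ s' l, (doubling c).den s = .leaf s' ∧ s.head acc ≤ 2 ^ l ∧ s'.head pow2 = 2 ^ l ∧
      s'.head pow2' = 2 ^ l ∧ s'.head shift = 2 * l + (2 * c + 3) ∧ Agree IsDouble s s' := by
  set s₁ := s.addHeads fun k => (pow2 :: pow2' :: List.replicate (2 * c + 3) shift).count k
    with hs₁
  have hput : (put mark (some true) (right mark)).den s₁ =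
      .leaf (s₁.setCell mark 1 (some true)) := by
    have hm₁ : s₁.head mark = 0 := by simp [hs₁, State.addHeads, List.count_replicate, hm]
    exact den_put (p := 1) (by rw [den, hm₁]) hm₁
  let P : ℕ → St → Prop := fun i a => ∃ l, i ≤ 2 ^ l ∧
    (∀ j, i ≤ j → (a.cont mark j = some true ↔ j = 2 ^ l)) ∧ a.head pow2 = 2 ^ l ∧
    a.head pow2' = 2 ^ l ∧ a.head shift = 2 * l + (2 * c + 3) ∧ a.head mark = 0 ∧
    Agree IsDouble s a
  have hloop := den_loop_invariant (k := acc) (c := doubleStep)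
    (s := s₁.setCell mark 1 (some true)) P ?_ ?_
  · obtain ⟨b, h, l, h₁, -, h₃, h₄, h₅, -, h₇⟩ := hloop
    refine ⟨b, l, ?_, ?_, h₃, h₄, h₅, h₇⟩
    · rw [doubling, den_seq_of_leaf (den_rights _ s), den_seq_of_leaf hput, h]
    · simpa [hs₁, State.addHeads, List.count_replicate] using h₁
  · refine ⟨0, Nat.zero_le _, fun j _ => ?_, ?_, ?_, ?_, ?_, fun k hk => ?_, fun k hk => ?_, rfl⟩
    · rcases eq_or_ne j 1 with rfl | hj
      · simp
      · simp [hs₁, State.addHeads, hj, hb]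
    · simp [hs₁, State.addHeads, List.count_replicate, hp]
    · simp [hs₁, State.addHeads, List.count_replicate, hp']
    · simp [hs₁, State.addHeads, hs]
    · simp [hs₁, State.addHeads, List.count_replicate, hm]
    · have : k ≠ mark := by rintro rfl; exact hk trivial
      simp [hs₁, State.addHeads, this]
    · have e : ∀ k', k'.IsDouble → k ≠ k' := fun k' h' h => hk (h ▸ h')
      simp [hs₁, State.addHeads, List.count_cons, (e pow2 trivial).symm, (e pow2' trivial).symm,
        List.count_replicate, (e shift trivial).symm]
  · rintro i - a ⟨l, h₁, h₂, h₃, h₄, h₅, h₆, h₇⟩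
    have hacc : s₁.head acc = a.head acc := by
      rw [h₇.head acc id]
      simp [hs₁, State.addHeads, List.count_replicate]
    show ∃ b : St, _ ∧ P (i + 1) (b.setHead acc (s₁.head acc))
    rw [hacc]
    have hg : (loop acc (right mark)).den (a.setHead acc i) =
        .leaf ((a.setHead acc i).setHead mark i) := by
      rw [den_loop_right (by simp)]
      simp [h₆]
    rw [doubleStep, den_test hg h₆]
    simp only [State.setHead_cont, h₂ i le_rfl]
    by_cases hi : i = 2 ^ l
    · rw [if_pos hi]
      have hd : (rights [shift, shift] ;; reset pow2 ;; reset pow2' ;;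
          loop acc (rights [pow2, pow2, pow2', pow2']) ;;
          put mark (some true) (loop acc (rights [mark, mark]))).den (a.setHead acc i) =
          .leaf (((((a.setHead acc i).setHead shift (2 * (l + 1) + (2 * c + 3))).setHead pow2
            (2 * i)).setHead pow2' (2 * i)).setCell mark (2 * i) (some true)) := by
        have e₁ : ((a.setHead acc i).addHeads fun k => [shift, shift].count k) =
            (a.setHead acc i).setHead shift (2 * (l + 1) + (2 * c + 3)) := by
          refine State.ext rfl (funext fun k => ?_) rfl
          rcases eq_or_ne k shift with rfl | hk
          · simp [State.addHeads, h₅]; omega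
          · simp [State.addHeads, hk, List.count_cons, hk.symm]
        set a₁ := (a.setHead acc i).setHead shift (2 * (l + 1) + (2 * c + 3)) with ha₁
        have e₂ : (((a₁.setHead pow2 0).setHead pow2' 0).addHeads fun k =>
            ((a₁.setHead pow2 0).setHead pow2' 0).head acc * [pow2, pow2, pow2', pow2'].count k) =
            (a₁.setHead pow2 (2 * i)).setHead pow2' (2 * i) := by
          refine State.ext rfl (funext fun k => ?_) rfl
          have hia : a₁.head acc = i := by simp [ha₁]
          rcases eq_or_ne k pow2 with rfl | hk
          · simp [State.addHeads, hia, List.count_cons, mul_comm]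
          · rcases eq_or_ne k pow2' with rfl | hk'
            · simp [State.addHeads, hia, List.count_cons, mul_comm]
            · simp [State.addHeads, List.count_cons, hk, hk', hk.symm, hk'.symm]
        rw [den_seq_of_leaf (den_rights _ _), e₁, den_seq_of_leaf rfl, den_seq_of_leaf rfl,
          den_seq_of_leaf (den_loop_rights (by simp) _), e₂]
        refine den_put ?_ (by simp [ha₁, h₆])
        rw [den_loop_rights (by simp)]
        refine congrArg Tree.leaf (State.ext rfl (funext fun k => ?_) rfl)
        rcases eq_or_ne k mark with rfl | hk
        · simp [State.addHeads, ha₁, h₆, mul_comm]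
        · simp [State.addHeads, hk, List.count_cons, hk.symm]
      refine ⟨_, hd, l + 1, ?_, fun j hj => ?_, ?_, ?_, ?_, ?_, fun k hk => ?_, fun k hk => ?_,
        h₇.flag⟩
      · rw [pow_succ, ← hi]
        have : 0 < 2 ^ l := by positivity
        omega
      · rw [pow_succ', ← hi]
        rcases eq_or_ne j (2 * i) with rfl | hj'
        · simp
        · have := h₂ j (by omega)
          rw [← hi] at this
          have hne : j ≠ i := by omega
          simpa [hj', hne] using this
      · simp [pow_succ', hi]
      · simp [pow_succ', hi]
      · simp
      · simp [h₆]
      · have : k ≠ mark := by rintro rfl; exact hk trivial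
        simpa [this] using h₇.cont k hk
      · have e : ∀ k', k'.IsDouble → k ≠ k' := fun k' h' h => hk (h ▸ h')
        have := h₇.head k hk
        by_cases hka : k = acc
        · subst hka; simpa using this
        · simpa [e pow2 trivial, e pow2' trivial, e shift trivial, hka] using this
    · rw [if_neg hi]
      refine ⟨_, rfl, l, by omega, fun j hj => h₂ j (by omega), ?_⟩
      rw [State.setHead_setHead, State.setHead_self rfl]
      exact ⟨h₃, h₄, h₅, h₆, h₇⟩

end Prog

end QuantLogic

namespace QuantLogic

open Cmd Tp Fg Prog

namespace Prog

/-- Compute the number of samples and the registers for the counter, and start the counter with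
half of the number of samples, so that the final division rounds to the nearest number. -/
def prepare (c : ℕ) (exps : List ℕ) : Prog :=
  doubling c ;;
  loop pow2 (loop pow2' (rights (List.replicate (4 ^ (c + 2)) samples))) ;;
  loop shift (right width) ;; right width ;; addPowers width exps ;;
  (loop shift (write sum (some false) ;; right sum) ;; reset sum) ;;
  put sum (some true) (loop shift (right sum))

theorem polyBdd_prepare (c : ℕ) (exps : List ℕ) : (prepare c exps).PolyBdd := by
  refine (polyBdd_doubling c).seq (PolyBdd.seq ?_ (PolyBdd.seq ?_ (PolyBdd.seq ?_
    ((wf_addPowers exps (by simp)).polyBdd.seq (PolyBdd.seq ?_ ?_)))))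
  · refine WF.polyBdd (L := fun k => k = pow2 ∨ k = pow2') ⟨.inl rfl, .inr rfl,
      wf_rights fun k hk => ?_⟩
    obtain rfl := List.eq_of_mem_replicate hk
    simp
  · exact WF.polyBdd (L := fun k => k = shift) ⟨rfl, by simp [WF]⟩
  · exact WF.polyBdd (L := fun _ => False) id
  · exact WF.polyBdd (L := fun k => k = shift) ⟨⟨rfl, trivial, by simp [WF]⟩, by simp [WF]⟩
  · exact WF.polyBdd (L := fun k => k = shift) (WF.put (by simp) ⟨rfl, by simp [WF]⟩)

/-- For the least power `2 ^ l ≥ m`, the number of samples is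
`2 ^ (r + 1) = 4 ^ (c + 2) * 2 ^ l * 2 ^ l ≥ 16 * 2 ^ c * m ^ 2`, and the counter starts at
`2 ^ r`. -/
theorem den_prepare {R : Signature} {n : ℕ} {I : Interp R (Fin n)} {E D : ℕ} (c : ℕ)
    {exps : List ℕ} (hexps : ∀ d ∈ exps, d ≤ E) {s : St} (hs : Base I E D s)
    (h0 : ∀ k : Tp, k.IsAux → k ≠ len → k ≠ acc → s.head k = 0)
    (hb : ∀ k : Tp, k.IsAux → ∀ i, s.cont k i = none) :
    ∃ s' r, (prepare c exps).den s = .leaf s' ∧ Base I E D s' ∧ s'.flag = s.flag ∧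
      s'.cont out = s.cont out ∧ s'.head out = 0 ∧ s'.cont sum = digit (2 ^ r) ∧ s'.head sum = 0 ∧
      s'.head shift = r ∧ s'.head samples = 2 ^ (r + 1) ∧
      s'.head width = r + 1 + (exps.map fun d => n ^ d).sum ∧
      16 * 2 ^ c * s.head acc ^ 2 ≤ 2 ^ (r + 1) := by
  obtain ⟨s₁, l, h₁, hacc, hp, hp', hsh, hA⟩ := den_doubling c (h0 pow2 trivial (by simp) (by simp))
    (h0 pow2' trivial (by simp) (by simp)) (h0 shift trivial (by simp) (by simp))
    (h0 mark trivial (by simp) (by simp)) (hb mark trivial)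
  have hmono : ∀ k : Tp, ¬ k.IsAux → ¬ k.IsDouble := fun k hk hk' => by
    cases k <;> first | exact hk' | exact hk trivial
  have hs₁ : Base I E D s₁ := hs.congr ⟨fun k hk => hA.cont k (hmono k hk),
    fun k hk => hA.head k (hmono k hk), hA.flag⟩
  set r := 2 * l + (2 * c + 3) with hr
  have hN : 2 ^ l * 2 ^ l * 4 ^ (c + 2) = 2 ^ (r + 1) := by
    rw [hr, show 4 = 2 ^ 2 by norm_num, ← pow_mul, ← pow_add, ← pow_add]
    congr 1; ring
  have h₂ : (loop pow2 (loop pow2' (rights (List.replicate (4 ^ (c + 2)) samples)))).den s₁ =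
      .leaf (s₁.setHead samples (2 ^ (r + 1))) := by
    rw [den_loop_loop_rights (by simp) (by simp) (by simp), hp, hp']
    refine congrArg Tree.leaf (State.ext rfl (funext fun k => ?_) rfl)
    rcases eq_or_ne k samples with rfl | hk
    · have := (hA.head samples id).trans (h0 samples trivial (by simp) (by simp))
      simp [State.addHeads, this, hN]
    · simp [State.addHeads, hk, List.count_replicate, hk.symm]
  have hw : s₁.head width = 0 := (hA.head width id).trans (h0 width trivial (by simp) (by simp))
  have h₃ : (loop shift (right width)).den (s₁.setHead samples (2 ^ (r + 1))) =
      .leaf ((s₁.setHead samples (2 ^ (r + 1))).setHead width r) := by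
    rw [den_loop_right (by simp)]
    simp [hw, hsh]
  set s₅ := (s₁.setHead samples (2 ^ (r + 1))).setHead width
    (r + 1 + (exps.map fun d => n ^ d).sum) with hs₅
  have h₅ : (right width ;; addPowers width exps).den
      ((s₁.setHead samples (2 ^ (r + 1))).setHead width r) = .leaf s₅ := by
    rw [den_seq_of_leaf rfl, den_addPowers (n := n) (by simp)]
    · simp [hs₅]
    · intro d hd
      simpa using hs₁.ready.pow_eq d (hexps d hd)
  have hsum : s₅.head sum = 0 := by
    simpa [hs₅, hA.head sum id] using h0 sum trivial (by simp) (by simp)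
  have hsh₅ : s₅.head shift = r := by simpa [hs₅] using hsh
  have h₆ := den_fill (k := sum) (x := shift) (by simp) (some false) s₅ hsum
  rw [hsh₅] at h₆
  have h₇ : (put sum (some true) (loop shift (right sum))).den (s₅.fill sum r (some false)) =
      .leaf ((s₅.fill sum r (some false)).setCell sum r (some true)) := by
    refine den_put ?_ hsum
    rw [den_loop_right (by simp)]
    simp only [State.fill, hsum, hsh₅, zero_add]
  refine ⟨(s₅.fill sum r (some false)).setCell sum r (some true), r, ?_,
    hs₁.congr ⟨fun k hk => ?_, fun k hk => ?_, ?_⟩, hA.flag, ?_, ?_, ?_, hsum, hsh₅,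
    ?_, ?_, ?_⟩
  · rw [prepare, den_seq_of_leaf h₁, den_seq_of_leaf h₂, den_seq_of_leaf h₃, den_seq_assoc,
      den_seq_of_leaf h₅, den_seq_of_leaf h₆, h₇]
  · have : k ≠ sum := by rintro rfl; exact hk trivial
    simp [State.fill, this, hs₅]
  · have e₁ : k ≠ width := by rintro rfl; exact hk trivial
    have e₂ : k ≠ samples := by rintro rfl; exact hk trivial
    simp [State.fill, e₁, e₂, hs₅]
  · rfl
  · simp [State.fill, hs₅, hA.cont out id]
  · simp [State.fill, hs₅, hA.head out id, h0 out trivial]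
  · funext i
    have hbs : s₁.cont sum i = none := by rw [hA.cont sum id]; exact hb sum trivial i
    rcases lt_trichotomy i r with hi | rfl | hi
    · simp [State.fill, hs₅, hi, hi.ne, digit_two_pow_of_lt hi]
    · simp [State.fill, digit_two_pow]
    · rw [digit_eq_none_of_lt (Nat.pow_lt_pow_right (by norm_num) hi)]
      simp [State.fill, hs₅, hi.ne', hi.not_gt, hbs]
  · simp [State.fill, hs₅]
  · simp [State.fill, hs₅]
  · have h4 : (4 : ℕ) ^ (c + 2) = 16 * (2 ^ c * 2 ^ c) := by
      rw [← mul_pow, pow_add]; norm_num [mul_comm]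
    rw [← hN, h4]
    have h₁ : s.head acc ^ 2 ≤ 2 ^ l * 2 ^ l := by
      rw [sq]; exact Nat.mul_le_mul hacc hacc
    calc 16 * 2 ^ c * s.head acc ^ 2 ≤ 16 * 2 ^ c * (2 ^ l * 2 ^ l) := Nat.mul_le_mul_left _ h₁
      _ ≤ 16 * (2 ^ c * 2 ^ c) * (2 ^ l * 2 ^ l) := Nat.mul_le_mul_right _
          (Nat.mul_le_mul_left _ (Nat.le_mul_of_pos_right _ (by positivity)))
      _ = _ := by ring

/-- Write the quotient of the counter by the number of samples to the output tape. -/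
def output : Prog :=
  loop shift (right sum) ;; right sum ;;
  loop width (iteSym sum (some true) (write out (some true))
    (iteSym sum (some false) (write out (some false)) skip) ;; right sum ;; right out)

theorem polyBdd_output : output.PolyBdd :=
  WF.polyBdd (L := fun k => k = shift ∨ k = width) ⟨⟨.inl rfl, by simp [WF]⟩, by simp [WF],
    .inr rfl, ⟨trivial, trivial, trivial⟩, by simp [WF], by simp [WF]⟩

theorem den_output {s : St} {v r : ℕ} (hsum : s.cont sum = digit v) (hs0 : s.head sum = 0)
    (hr : s.head shift = r) (hv : v < 2 ^ s.head width) (ho : s.head out = 0)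
    (hb : ∀ i, s.cont out i = none) :
    ∃ s', output.den s = .leaf s' ∧ s'.cont out = digit (v / 2 ^ (r + 1)) := by
  have h₁ : (loop shift (right sum) ;; right sum).den s = .leaf (s.setHead sum (r + 1)) := by
    rw [den_seq_of_leaf (den_loop_right (by simp) s), den]
    simp [hs0, hr]
  let P : ℕ → St → Prop := fun i a => a.head sum = r + 1 + i ∧ a.head out = i ∧
    a.cont sum = digit v ∧ ∀ j, a.cont out j = if j < i then digit v (r + 1 + j) else none
  have hloop := den_loop_invariant (k := width) (c := iteSym sum (some true)
    (write out (some true)) (iteSym sum (some false) (write out (some false)) skip) ;; right sum ;;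
      right out) (s := s.setHead sum (r + 1)) P ?_ ?_
  · obtain ⟨b, h₂, -, -, -, h₃⟩ := hloop
    refine ⟨b, ?_, funext fun j => ?_⟩
    · rw [output, den_seq_assoc, den_seq_of_leaf h₁, h₂]
    · rw [h₃, ← digit_add]
      split_ifs with hj
      · rfl
      · refine (digit_eq_none_of_lt (hv.trans_le (Nat.pow_le_pow_right (by norm_num) ?_))).symm
        simp only [State.setHead_head] at hj
        rw [Function.update_of_ne (by simp)] at hj
        omega
  · exact ⟨by simp, by simpa using ho, hsum, fun j => by simp [hb]⟩
  · rintro i - a ⟨a₁, a₂, a₃, a₄⟩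
    have hw : (iteSym sum (some true) (write out (some true)) (iteSym sum (some false)
        (write out (some false)) skip) : Prog).den (a.setHead width i) =
        .leaf ((a.setHead width i).setCell out i (digit v (r + 1 + i))) := by
      have e₁ : (a.setHead width i).cont sum ((a.setHead width i).head sum) =
          digit v (r + 1 + i) := by simp [a₁, a₃]
      have e₂ : (a.setHead width i).head out = i := by simp [a₂]
      simp only [den]
      rw [e₁, e₂]
      split_ifs with h h'
      · rw [h]
      · rw [h']
      · rw [State.setCell_self]
        have : (a.setHead width i).cont out i = none := by simp [a₄]
        rw [this]
        rcases hd : digit v (r + 1 + i) with _ | _ | _ <;> simp_all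
    refine ⟨_, den_seq_of_leaf hw _, ?_, ?_, ?_, fun j => ?_⟩
    · simp [a₁, add_assoc]
    · simp [a₂]
    · simpa using a₃
    · rcases eq_or_ne j i with rfl | hj
      · simp
      · have : j < i + 1 ↔ j < i := by omega
        simp [hj, this, a₄]

end Prog

end QuantLogic

namespace QuantLogic

open Cmd Tp Fg Prog

/-! ### The approximation scheme -/

/-- Read the accuracy, which stands in unary in front of the word that describes the structure. -/
def readAcc (R : Signature) : Prog :=
  scan true phase (inp :: acc :: offs R) ;; rights (inp :: offs R)

theorem polyBdd_readAcc (R : Signature) : (readAcc R).PolyBdd :=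
  (wf_scan (by simp [offs])).polyBdd.seq (wf_rights (L := fun _ => False) fun _ _ => id).polyBdd

theorem den_readAcc (R : Signature) (m : ℕ) (x : List Bool) :
    ∃ s, (readAcc R).den (State.start inp len (List.replicate m true ++ false :: x)) = .leaf s ∧
      Fresh R x s ∧ s.head acc = m := by
  set w := List.replicate m true ++ false :: x with hw
  have hlen : w.length = m + 1 + x.length := by simp [hw]; omega
  have h0 : ∀ i, (State.start inp len w : St).cont inp ((State.start inp len w : St).head inp + i) =
      w[i]? := fun i => by simp [State.start]
  have h₁ := den_scan (b := true) (ph := phase) (l := inp :: acc :: offs R)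
    (s := State.start inp len w) (n := m) (by simp [offs]) (by simp [count_offs_of_ne]) rfl
    (by simp [State.start, hlen]; omega)
    (fun i hi => by rw [h0, hw, List.getElem?_append_left (by simpa using hi)]; simp [hi])
    (by rw [h0, hw, List.getElem?_append_right (by simp)]; simp)
  refine ⟨_, (den_seq_of_leaf h₁ _).trans (den_rights _ _), ⟨fun i => ?_, ?_, fun i => ?_,
    fun k h₁ h₂ h₃ h₄ => ?_, fun k hk i => ?_, fun f hf => ?_⟩, ?_⟩
  · have : ((((State.start inp len w : St).addHeads fun k => m * (inp :: acc :: offs R).count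
        k).setFlag phase (decide (m < (State.start inp len w : St).head len))).addHeads fun k =>
          (inp :: offs R).count k).head inp = m + 1 := by
      simp [State.addHeads, State.start, count_offs_of_ne]
    rw [this]
    show (State.start inp len w : St).cont inp _ = _
    simp only [State.start, if_true, hw]
    rw [List.getElem?_append_right (by simp; omega), List.length_replicate,
      show m + 1 + i - m = i + 1 by omega, List.getElem?_cons_succ]
  · simp [State.addHeads, State.start, hlen]; omega
  · simp [State.addHeads, State.start, count_offs_of_ne, count_offs]
  · simp [State.addHeads, State.start, count_offs_of_ne R k h₃, List.count_cons, h₁.symm, h₂,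
      h₄.symm]
  · simp [State.addHeads, State.start, hk]
  · simp [State.addHeads, State.start, hf]
  · simp [State.addHeads, State.start, count_offs_of_ne]

/-- Approximate the sum of the values of the terms. -/
def approxProg (R : Signature) (l : List (NTerm R)) (E D c : ℕ) : Prog :=
  readAcc R ;; setup R E D ;; prepare c (widthExps l) ;; sampleProg l ;; output

theorem polyBdd_approxProg (R : Signature) (l : List (NTerm R)) (E D c : ℕ) :
    (approxProg R l E D c).PolyBdd :=
  (polyBdd_readAcc R).seq ((polyBdd_setup R E D).seq ((polyBdd_prepare c _).seq
    ((wf_sampleProg l).polyBdd.seq polyBdd_output)))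

/-- If the counter is close enough to its mean, then the rounded quotient is a good
approximation: either the deviation is less than half a unit, and the quotient is exact, or it is
less than half of the admissible error, and rounding does no more harm than that. -/
theorem abs_sub_div_le {F m r u : ℕ} (hm : 0 < m)
    (h : |(u : ℝ) - (2 ^ r + 2 ^ (r + 1) * F)| < 2 ^ (r + 1) * max (1 / 2) (F / (2 * m) : ℝ)) :
    |(F : ℝ) - (u / 2 ^ (r + 1) : ℕ)| ≤ F / m := by
  have hm' : (0 : ℝ) < m := by exact_mod_cast hm
  have hM : (0 : ℝ) < 2 ^ (r + 1) := by positivity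
  set M : ℝ := 2 ^ (r + 1) with hMdef
  have hr : (2 : ℝ) ^ r = M / 2 := by rw [hMdef, pow_succ]; ring
  set z : ℕ := u / 2 ^ (r + 1) with hz
  have hz₁ : (z : ℝ) * M ≤ u := by
    have := Nat.div_mul_le_self u (2 ^ (r + 1))
    rw [← hz] at this
    rw [hMdef]
    exact_mod_cast this
  have hz₂ : (u : ℝ) < (z + 1) * M := by
    have := Nat.lt_div_mul_add (a := u) (b := 2 ^ (r + 1)) (by positivity)
    rw [← hz] at this
    have h' : (u : ℝ) < z * 2 ^ (r + 1) + 2 ^ (r + 1) := by exact_mod_cast this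
    rw [hMdef]; linarith
  rw [hr, abs_lt] at h
  have hFm : (F : ℝ) / m = 2 * (F / (2 * m)) := by field_simp
  obtain ⟨h₁, h₂⟩ := h
  rcases le_total (F / (2 * m) : ℝ) (1 / 2) with hle | hle
  · rw [max_eq_left hle] at h₁ h₂
    have e₁ : (z : ℝ) < F + 1 := by
      by_contra hc
      have := mul_le_mul_of_nonneg_right (not_lt.1 hc) hM.le
      nlinarith
    have e₂ : (F : ℝ) < z + 1 := by
      by_contra hc
      have := mul_le_mul_of_nonneg_right (not_lt.1 hc) hM.le
      nlinarith
    have e : z = F := by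
      have e₁ : z < F + 1 := by exact_mod_cast e₁
      have e₂ : F < z + 1 := by exact_mod_cast e₂
      omega
    rw [e, sub_self, abs_zero]
    positivity
  · rw [max_eq_right hle] at h₁ h₂
    rw [hFm]
    generalize (F / (2 * m) : ℝ) = d at *
    rw [abs_le]
    constructor
    · by_contra hc
      have := mul_lt_mul_of_pos_right (not_le.1 hc) hM
      nlinarith [mul_le_mul_of_nonneg_right hle hM.le]
    · by_contra hc
      have := mul_lt_mul_of_pos_right (not_le.1 hc) hM
      nlinarith [mul_le_mul_of_nonneg_right hle hM.le]

/-- The number of samples is large enough for Chebyshev's inequality. -/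
theorem variance_le {F m : ℕ} {M V : ℝ} {c : ℕ} (hm : 0 < m) (hV : V ≤ 2 ^ c * (F : ℝ) ^ 2)
    (hM : 16 * 2 ^ c * (m : ℝ) ^ 2 ≤ M) :
    M * V / (M * max (1 / 2) (F / (2 * m) : ℝ)) ^ 2 ≤ 1 / 4 := by
  have hm' : (0 : ℝ) < m := by exact_mod_cast hm
  have hM0 : 0 < M := lt_of_lt_of_le (by positivity) hM
  set d : ℝ := max (1 / 2) (F / (2 * m)) with hd
  have hd0 : 0 < d := lt_of_lt_of_le (by norm_num) (le_max_left _ _)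
  have hd₁ : (F : ℝ) / (2 * m) ≤ d := le_max_right _ _
  have hd₂ : (F : ℝ) ≤ 2 * m * d := by
    rw [div_le_iff₀ (by positivity)] at hd₁
    linarith
  have hF : (F : ℝ) ^ 2 ≤ (2 * m * d) ^ 2 := pow_le_pow_left₀ (Nat.cast_nonneg _) hd₂ 2
  have h₁ : 4 * V ≤ M * d ^ 2 := by
    have h₂ := mul_le_mul_of_nonneg_right hM (sq_nonneg d)
    have h₃ := mul_le_mul_of_nonneg_left hF (pow_nonneg (zero_le_two (α := ℝ)) c)
    nlinarith
  rw [div_le_iff₀ (by positivity)]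
  nlinarith [mul_le_mul_of_nonneg_left h₁ hM0.le]

open Classical in
/-- With probability at least `3 / 4`, the output has a relative error of at most `1 / m`, by
Chebyshev's inequality. -/
theorem approxProg_spec {R : Signature} {l : List (NTerm R)} {E D c : ℕ}
    (hE : ∀ i, R.arity i ≤ E) (hl : ∀ t ∈ l, t.Fits E D) (hc : ∀ t ∈ l, t.ψ.atoms.length ≤ c)
    {m : ℕ} (hm : 0 < m) (x : List Bool) :
    (((approxProg R l E D c).den (State.start inp len (List.replicate m true ++ false :: x))).All
      fun a : St => ∃ z, a.cont out = digit z) ∧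
    3 / 4 ≤ ((approxProg R l E D c).den
      (State.start inp len (List.replicate m true ++ false :: x))).mean fun a : St =>
        if ∃ z, a.cont out = digit z ∧ |(wordVal l x : ℝ) - z| ≤ wordVal l x / m then 1 else 0 := by
  obtain ⟨s₁, h₁, hf, hacc⟩ := den_readAcc R m x
  obtain ⟨s₂, h₂, hb, hcont, hflag, hhead⟩ := den_setup D hE hf
  have hset : ∀ k : Tp, k.IsAux → ¬ k.IsSetup := fun k hk hk' => by
    cases k <;> first | exact hk | exact hk'
  have haux : ∀ k : Tp, k.IsAux → k ≠ inp := fun k hk h => by subst h; exact hk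
  have hexps : ∀ d ∈ widthExps l, d ≤ E := fun d hd => by
    obtain ⟨t, ht, hd⟩ := List.mem_flatMap.1 hd
    rcases List.mem_cons.1 hd with rfl | hd
    · exact (hl t ht).2.1
    · obtain ⟨j, rfl⟩ := List.mem_ofFn.1 hd
      exact (hl t ht).1 j
  obtain ⟨s, r, h₃, hs, hfl, hout, hout0, hsum, hsum0, hsh, hsamp, hw, hM⟩ :=
    den_prepare c hexps hb (fun k hk hk₁ hk₂ => by
      rw [hhead k (hset k hk)]
      exact hf.head k (haux k hk) hk₁ (fun i h => by subst h; exact hk) hk₂)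
      (fun k hk i => by rw [hcont]; exact hf.blank k (haux k hk) i)
  have hden : (approxProg R l E D c).den (State.start inp len (List.replicate m true ++ false :: x))
      = (sampleProg l ;; output).den s := by
    rw [approxProg, den_seq_of_leaf h₁, den_seq_of_leaf h₂, den_seq_of_leaf h₃]
  obtain ⟨V, B, hV, hB, T, hT⟩ := sampleSpec_sampleProg hl hc hs
    (by rw [hfl, hflag _ (by simp)]; exact hf.flag _ (by simp)) hsum0
  rw [hsamp] at hT
  -- The counter does not overflow.
  have hle : 2 ^ r + 2 ^ (r + 1) * B < 2 ^ s.head width := by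
    rw [hw, pow_add 2 (r + 1)]
    have : 2 ^ (r + 1) * (B + 1) ≤ 2 ^ (r + 1) * 2 ^ ((widthExps l).map fun d => zeros x ^ d).sum :=
      Nat.mul_le_mul_left _ hB
    have h2 : 2 ^ (r + 1) = 2 * 2 ^ r := pow_succ' 2 r
    have h0 : 0 < 2 ^ r := by positivity
    rw [mul_add, mul_one] at this
    refine lt_of_lt_of_le ?_ this
    omega
  obtain ⟨hT₁, hT₂, hT₃⟩ := hT (2 ^ r) hle
  have hself : s.setTape sum (digit (2 ^ r)) = s := by
    rw [← hsum]; simp [State.setTape]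
  rw [hself] at hT₁
  have hfin : (T (2 ^ r)).All fun u => ∃ b, output.den (s.setTape sum (digit u)) = .leaf b ∧
      b.cont out = digit (u / 2 ^ (r + 1)) := hT₂.mono fun u hu => by
    refine den_output (by simp [State.setTape]) hsum0 hsh (hu.trans_lt hle) hout0 fun i => ?_
    have : (s.setTape sum (digit u)).cont out = s.cont out := by simp [State.setTape]
    rw [this, hout, hcont]
    exact hf.blank _ (by simp) i
  rw [hden, den, hT₁, Tree.bind_map]
  refine ⟨?_, ?_⟩
  · rw [Tree.all_bind]
    refine hfin.mono fun u ⟨b, hb, hb'⟩ => ?_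
    rw [hb]
    exact ⟨_, hb'⟩
  · set F := wordVal l x with hF
    set K : ℝ := (2 ^ (r + 1) * max (1 / 2) (F / (2 * m) : ℝ)) ^ 2 with hK
    have hpos : (0 : ℝ) < 2 ^ (r + 1) * max (1 / 2) (F / (2 * m) : ℝ) :=
      mul_pos (by positivity) (lt_of_lt_of_le (by norm_num) (le_max_left _ _))
    have hmean : (T (2 ^ r)).mean (fun u : ℕ => 1 + -(1 / K) *
        ((u : ℝ) - (2 ^ r + 2 ^ (r + 1) * F)) ^ 2) = 1 - 2 ^ (r + 1) * V / K := by
      rw [Tree.mean_eq_fold, Tree.fold_add, Tree.fold_half_const, Tree.fold_mul, hT₃]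
      have : (((2 ^ r : ℕ) : ℝ) + ((2 ^ (r + 1) : ℕ) : ℝ) * (F : ℕ) -
          (2 ^ r + 2 ^ (r + 1) * F)) = 0 := by
        push_cast; ring
      simp only [hF, wordVal] at this ⊢
      rw [this]
      push_cast; ring
    have hvar : 2 ^ (r + 1) * V / K ≤ 1 / 4 := by
      refine variance_le hm hV ?_
      have : 16 * 2 ^ c * m ^ 2 ≤ 2 ^ (r + 1) := by
        rw [hhead acc id, hacc] at hM
        exact hM
      exact_mod_cast this
    -- Chebyshev: `1 - (u - mean) ^ 2 / K` is at most the indicator of a good output.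
    have hmono : (T (2 ^ r)).mean (fun u : ℕ => 1 + -(1 / K) *
        ((u : ℝ) - (2 ^ r + 2 ^ (r + 1) * F)) ^ 2) ≤ (T (2 ^ r)).mean fun u =>
          (output.den (s.setTape sum (digit u))).mean fun a : St =>
            if ∃ z, a.cont out = digit z ∧ |(F : ℝ) - z| ≤ F / m then 1 else 0 := by
      refine Tree.mean_mono (hfin.mono fun u ⟨b, hb, hb'⟩ => ?_)
      rw [hb]
      show _ ≤ if ∃ z, b.cont out = digit z ∧ |(F : ℝ) - z| ≤ F / m then (1 : ℝ) else 0
      have hK0 : 0 < K := by positivity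
      split_ifs with h
      · have : 0 ≤ 1 / K * ((u : ℝ) - (2 ^ r + 2 ^ (r + 1) * F)) ^ 2 := by positivity
        linarith
      · have h' : 2 ^ (r + 1) * max (1 / 2) (F / (2 * m) : ℝ) ≤
            |(u : ℝ) - (2 ^ r + 2 ^ (r + 1) * F)| := by
          by_contra hlt
          exact h ⟨_, hb', abs_sub_div_le hm (not_le.1 hlt)⟩
        have h'' : K ≤ ((u : ℝ) - (2 ^ r + 2 ^ (r + 1) * F)) ^ 2 := by
          rw [← sq_abs ((u : ℝ) - _)]
          exact pow_le_pow_left₀ hpos.le h' 2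
        have : 1 ≤ 1 / K * ((u : ℝ) - (2 ^ r + 2 ^ (r + 1) * F)) ^ 2 := by
          rw [one_div, ← div_eq_inv_mul, le_div_iff₀ hK0]
          linarith
        linarith
    rw [Tree.mean_bind]
    linarith

/-- The length of the coin sequences is the time bound of the machine, so that they are never used
up before the machine halts. -/
theorem hasFPRAS_wordVal {R : Signature} (l : List (NTerm R)) : HasFPRAS (wordVal l) := by
  classical
  obtain ⟨E, D, hE, hl⟩ := NTerm.exists_fits R l
  set c := (l.map fun t => t.ψ.atoms.length).sum
  have hc : ∀ t ∈ l, t.ψ.atoms.length ≤ c := fun t ht =>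
    List.single_le_sum (fun _ _ => Nat.zero_le _) _ (List.mem_map_of_mem ht)
  obtain ⟨M, g, p, hg, ho, hr⟩ := (polyBdd_approxProg R l E D c).exists_machine out
    (inp := inp) (len := len) (by simp)
  refine ⟨M, p.comp (Polynomial.X + 1), fun x ε hε _ => ?_⟩
  intro m T final
  have hm : 0 < m := Nat.ceil_pos.2 (by positivity)
  have hmε : 1 / (m : ℝ) ≤ ε := by
    rw [one_div_le (by exact_mod_cast hm) hε]
    exact Nat.le_ceil _
  set w := List.replicate m true ++ false :: x with hw
  have hT : p.eval w.length = T := by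
    simp only [T, Polynomial.eval_comp, Polynomial.eval_add, Polynomial.eval_X, Polynomial.eval_one]
    congr 1
    simp [hw]; omega
  have hreach := hr w
  rw [hT] at hreach
  obtain ⟨hall, hmean⟩ := approxProg_spec hE hl hc hm x
  have hhalt : (((approxProg R l E D c).den (State.start inp len w)).map g).All M.Halted :=
    Tree.all_map.2 (Tree.all_of_forall hg _)
  have hout : ∀ (a : St) z, a.cont out = digit z → M.Outputs (g a) z := fun a z h i => by
    rw [ho, h]; rfl
  refine ⟨fun ω => ?_, ?_⟩
  · refine M.runCoins_of_reach (p := fun a => M.Halted a ∧ ∃ n, M.Outputs a n) hreach ?_ hhalt _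
      (by simp)
    exact Tree.all_map.2 (hall.mono fun a ⟨z, hz⟩ => ⟨hg a, z, hout a z hz⟩)
  · have hsum := M.sum_runCoins_of_reach hreach hhalt (fun a => if ∃ n : ℕ, M.Outputs a n ∧
      |(wordVal l x : ℝ) - n| ≤ ε * wordVal l x then 1 else 0) le_rfl
    have hcard : (Nat.card {ω : Fin T → Bool // ∃ n : ℕ, M.Outputs (final ω) n ∧
        |(wordVal l x : ℝ) - n| ≤ ε * wordVal l x} : ℝ) = ∑ ω : Fin T → Bool,
          if ∃ n : ℕ, M.Outputs (final ω) n ∧ |(wordVal l x : ℝ) - n| ≤ ε * wordVal l x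
          then 1 else 0 := by
      rw [Nat.card_eq_fintype_card, Fintype.card_subtype, Finset.sum_boole]
    rw [hcard, hsum, mul_div_cancel_left₀ _ (by positivity), Tree.mean_map]
    refine hmean.trans (Tree.mean_mono (Tree.all_of_forall (fun a => ?_) _))
    split_ifs with h₁ h₂ h₂
    · exact le_rfl
    · obtain ⟨z, hz, hz'⟩ := h₁
      refine absurd ⟨z, hout a z hz, hz'.trans ?_⟩ h₂
      rw [div_eq_mul_one_div, mul_comm]
      exact mul_le_mul_of_nonneg_right hmε (Nat.cast_nonneg _)
    · exact zero_le_one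
    · exact le_rfl

end QuantLogic

theorem mainTheorem1 (R : QuantLogic.Signature) :
    (∀ f ∈ QuantLogic.SigmaQSOClass R, ∀ g ∈ QuantLogic.SigmaQSOClass R,
      (fun S => f S + g S) ∈ QuantLogic.SigmaQSOClass R) ∧
    (∀ f ∈ QuantLogic.SigmaQSOClass R, ∀ g ∈ QuantLogic.SigmaQSOClass R,
      (fun S => f S * g S) ∈ QuantLogic.SigmaQSOClass R) ∧
    (∀ f ∈ QuantLogic.SigmaQSOClass R,
      (fun S => f S - 1) ∈ QuantLogic.SigmaQSOClass R) ∧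
    (∀ f ∈ QuantLogic.SigmaQSOClass R, ∃ F ∈ QuantLogic.TotP,
      ∀ S : QuantLogic.OrdStruct R, F S.enc = f S) ∧
    (∀ f ∈ QuantLogic.SigmaQSOClass R, ∃ F : List Bool → ℕ, QuantLogic.HasFPRAS F ∧
      ∀ S : QuantLogic.OrdStruct R, F S.enc = f S) := by
  refine ⟨fun f hf g hg => QuantLogic.add_mem_sigmaQSOClass hf hg,
    fun f hf g hg => QuantLogic.mul_mem_sigmaQSOClass hf hg,
    fun f hf => QuantLogic.pred_mem_sigmaQSOClass hf, fun f hf => ?_, fun f hf => ?_⟩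
  · obtain ⟨l, hl⟩ := QuantLogic.exists_wordVal hf
    exact ⟨_, QuantLogic.wordVal_mem_totP l, hl⟩
  · obtain ⟨l, hl⟩ := QuantLogic.exists_wordVal hf
    exact ⟨_, QuantLogic.hasFPRAS_wordVal l, hl⟩
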